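/- **Setting.** Let $d\ge 1$ and let $\mathbb T^d=\mathbb R^d/\mathbb Z^d$ carry its Haar probability measure $dx$. For $1\le p<\infty$ and $0<\alpha<1$, $W^{\alpha,p}(\mathbb T^d)$ is the set of $f\in L^p(\mathbb T^d)$ with $$\int_{(0,1]^d}\int_{\mathbb T^d}\frac{|f(x+h)-f(x)|^p}{|h|^{d+p\alpha}}\,dx\,dh<\infty ,$$ and $W^{1,p}(\mathbb T^d)$ is the usual Sobolev space of $f\in L^p$ with distributional gradient $\nabla f\in L^p$. Let $T>0$, let $b\in L^1([0,T]\times\mathbb T^d;\mathbb R^d)$ with $b_t\in W^{1,1}(\mathbb T^d;\mathbb R^d)$ for every $t\in[0,T]$ and with jointly measurable spatial distributional gradient $\nabla b$, and suppose that for some $\beta>0$ $$\sup_{t\in[0,T]}\int_{\mathbb T^d}\exp\{\beta|\nabla b_t(x)|\}\,dx=K<\infty,\qquad \|\operatorname{div} b\|_{L^\infty([0,T]\times\mathbb T^d)}=L<\infty ,$$ where $|\nabla b_t|$ is the Euclidean (Frobenius) norm. For $u_0\in L^\infty(\mathbb T^d)$, a solution in $L^\infty([0,T]\times\mathbb T^d)$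 of $$\partial_t u+b\cdot\nabla u=0,\qquad u(0,\cdot)=u_0,\tag{Tr}$$ is a function $u\in L^\infty([0,T]\times\mathbb T^d)$ given by a bounded, weakly-$*$ continuous curve $t\mapsto u_t\in L^\infty(\mathbb T^d)$ with $$\int_{\mathbb T^d}u_t\phi\,dx-\int_{\mathbb T^d}u_0\phi\,dx=\int_0^t\int_{\mathbb T^d}u_s\,(b_s\cdot\nabla\phi+(\operatorname{div}b_s)\,\phi)\,dx\,ds$$ for all $t\in[0,T]$ and $\phi\in C^\infty(\mathbb T^d)$. **Corollary 1.3.** There are constants $C_1>0$ and $C_2>2$ depending only on $d$, and for each $p$ a constant $C_{d,p}$ depending only on $d$ and $p$, such that for all $T,\beta,K,L,b$ as above, all $0<\alpha\le1$, $p\ge1$ and all $u_0\in L^\infty(\mathbb T^d)\cap W^{\alpha,p}(\mathbb T^d)$, problem (Tr) has a solution $u\in L^\infty([0,T]\times\mathbb T^d)$, this solution is unique (any other one agrees with it almost everywhere on $\mathbb T^d$ at each time $t\in[0,T]$), and: 1. for every $t\in[0,T]$, $u_t\in W^{\alpha_t,p}(\mathbb T^d)$ with $\alpha_t:=\dfrac{\alpha}{1+2\beta^{-1}\alpha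 pC_1t}$; 2. if $p>1$, then for all $1\le p'<p$ and $0<\alpha'<\alpha$, $u_t\in W^{\alpha',p'}(\mathbb T^d)$ for every $t\in[0,T]$ with $t<\left(\frac1{p'}-\frac1p\right)\frac{\beta}{\alpha C_1}$; 3. if $\alpha=1$, then for all $1\le p'<p$ and every $t\in[0,T]$ with $t<\left(\frac1{p'}-\frac1p\right)\frac{\beta}{C_1}$, $u_t\in W^{1,p'}(\mathbb T^d)$ and $$\|\nabla u_t\|_{L^{p'}}\le C_{d,p}\,\|\nabla u_0\|_{L^p}\,\bigl(e^{Lt}C_2K\bigr)^{\frac{1+\beta^{-1}pC_1t}{p}} .$$ -/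

import Mathlib

open MeasureTheory Set

/-- A smooth function `φ : 𝕋^d → ℝ` on the flat torus `𝕋^d = ℝ^d / ℤ^d`: its periodic lift to `ℝ^d`
is of class `C^∞`. -/
def IsSmoothOnTorus {d : ℕ} (φ : UnitAddTorus (Fin d) → ℝ) : Prop :=
  ContDiff ℝ ((⊤ : ℕ∞) : WithTop ℕ∞)
    (fun y : EuclideanSpace ℝ (Fin d) => φ (fun i => (y i : UnitAddCircle)))

/-- The `i`-th partial derivative of a function on the torus. -/
noncomputable def torusPartial {d : ℕ} (φ : UnitAddTorus (Fin d) → ℝ) (i : Fin d)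
    (x : UnitAddTorus (Fin d)) : ℝ :=
  deriv (fun s : ℝ => φ (x + Pi.single i (s : UnitAddCircle))) 0

/-- The integrable vector field `g` is the distributional gradient of the integrable function `f`
on the torus. -/
structure IsWeakGrad {d : ℕ} (f : UnitAddTorus (Fin d) → ℝ)
    (g : UnitAddTorus (Fin d) → EuclideanSpace ℝ (Fin d)) : Prop where
  integrable_fun : Integrable f
  integrable_grad : Integrable g
  integral_eq : ∀ φ : UnitAddTorus (Fin d) → ℝ, IsSmoothOnTorus φ → ∀ i : Fin d,
    ∫ x, f x * torusPartial φ i x = - ∫ x, g x i * φ x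

/-- The `p`-th power of the Gagliardo seminorm,
`∫_{(0,1]^d} ∫_{𝕋^d} |f(x+h) - f(x)|^p / |h|^{d + p α} dx dh`. -/
noncomputable def gagliardoPow {d : ℕ} (α p : ℝ) (f : UnitAddTorus (Fin d) → ℝ) : ENNReal :=
  ∫⁻ h in {h : EuclideanSpace ℝ (Fin d) | ∀ i, h i ∈ Ioc (0 : ℝ) 1},
    ∫⁻ x : UnitAddTorus (Fin d),
      ENNReal.ofReal
        (|f (x + fun i => (h i : UnitAddCircle)) - f x| ^ p / ‖h‖ ^ ((d : ℝ) + p * α))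

/-- `f ∈ W^{α,p}(𝕋^d)` for `0 < α ≤ 1` and `1 ≤ p < ∞`: the fractional Sobolev space if `α < 1`, and
the classical first order Sobolev space if `α = 1`. -/
def MemSobolev {d : ℕ} (α p : ℝ) (f : UnitAddTorus (Fin d) → ℝ) : Prop :=
  MemLp f (ENNReal.ofReal p) volume ∧
    ((α < 1 ∧ gagliardoPow α p f < ⊤) ∨
      (α = 1 ∧ ∃ g, IsWeakGrad f g ∧ MemLp g (ENNReal.ofReal p) volume))

/-- The measure `dt ⊗ dx` on `[0,T] × 𝕋^d`. -/
noncomputable def spaceTimeMeasure (d : ℕ) (T : ℝ) : Measure (ℝ × UnitAddTorus (Fin d)) :=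
  (volume.restrict (Icc 0 T)).prod volume

/-- The Euclidean (Frobenius) norm of a `d × d` matrix given by its rows. -/
noncomputable def frobNorm {d : ℕ} (A : Fin d → EuclideanSpace ℝ (Fin d)) : ℝ :=
  Real.sqrt (∑ i, ‖A i‖ ^ 2)

/-- The trace of a `d × d` matrix given by its rows. -/
def rowTrace {d : ℕ} (A : Fin d → EuclideanSpace ℝ (Fin d)) : ℝ := ∑ i, A i i

/-- The standing assumptions on the drift `b : [0,T] × 𝕋^d → ℝ^d`. The row `Db t x i` is the value at
`x` of the distributional gradient of the `i`-th component of `b t`, so that `frobNorm (Db t x)` is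
`|∇b_t(x)|` and `rowTrace (Db t x)` is `div b_t(x)`. -/
structure IsExpDrift {d : ℕ} (T β K L : ℝ)
    (b : ℝ → UnitAddTorus (Fin d) → EuclideanSpace ℝ (Fin d))
    (Db : ℝ → UnitAddTorus (Fin d) → Fin d → EuclideanSpace ℝ (Fin d)) : Prop where
  integrable_drift : Integrable (Function.uncurry b) (spaceTimeMeasure d T)
  aestronglyMeasurable_grad : AEStronglyMeasurable (Function.uncurry Db) (spaceTimeMeasure d T)
  isWeakGrad : ∀ t ∈ Icc 0 T, ∀ i : Fin d, IsWeakGrad (fun x => b t x i) (fun x => Db t x i)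
  exp_bound : (⨆ t ∈ Icc 0 T, ∫⁻ x, ENNReal.ofReal (Real.exp (β * frobNorm (Db t x))))
    = ENNReal.ofReal K
  div_bound : eLpNorm (fun z : ℝ × UnitAddTorus (Fin d) => rowTrace (Db z.1 z.2)) ⊤
    (spaceTimeMeasure d T) = ENNReal.ofReal L

/-- `u ∈ L^∞([0,T] × 𝕋^d)` is a distributional solution of `∂_t u + b · ∇u = 0`, `u(0,·) = u₀`: a
bounded, weakly-* continuous curve `t ↦ u t` in `L^∞(𝕋^d)` with
`∫ u_t φ - ∫ u₀ φ = ∫_0^t ∫ u_s (b_s · ∇φ + (div b_s) φ)` for all `t ∈ [0,T]`, `φ ∈ C^∞(𝕋^d)`. -/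
structure IsBoundedTransportSolution {d : ℕ} (T : ℝ)
    (b : ℝ → UnitAddTorus (Fin d) → EuclideanSpace ℝ (Fin d))
    (Db : ℝ → UnitAddTorus (Fin d) → Fin d → EuclideanSpace ℝ (Fin d))
    (u₀ : UnitAddTorus (Fin d) → ℝ) (u : ℝ → UnitAddTorus (Fin d) → ℝ) : Prop where
  aestronglyMeasurable : AEStronglyMeasurable (Function.uncurry u) (spaceTimeMeasure d T)
  aestronglyMeasurable_slice : ∀ t ∈ Icc 0 T, AEStronglyMeasurable (u t) volume
  bounded : ∃ M : ℝ, ∀ t ∈ Icc 0 T, ∀ᵐ x, |u t x| ≤ M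
  weak_continuous : ∀ ψ : UnitAddTorus (Fin d) → ℝ, Integrable ψ →
    ContinuousOn (fun t => ∫ x, u t x * ψ x) (Icc 0 T)
  weak_eq : ∀ t ∈ Icc 0 T, ∀ φ : UnitAddTorus (Fin d) → ℝ, IsSmoothOnTorus φ →
    (∫ x, u t x * φ x) - ∫ x, u₀ x * φ x =
      ∫ s in (0 : ℝ)..t, ∫ x,
        u s x * ((∑ i, b s x i * torusPartial φ i x) + rowTrace (Db s x) * φ x)

/-! Formally `u_t = u₀ ∘ X_t`, where `X_t` is the flow of `b` traced backwards, so the regularity of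
`u_t` is decided by how much `X_t` stretches. The stretching is at most the exponential of the
integral of `|∇b|` along trajectories, and exponential integrability of `∇b` makes that exponential
integrable to a power of order `β / t`. All estimates are proved for a discrete flow, uniformly in
the discretisation, and then passed to a weak limit.

Discrete flow. On each time slab of length `τ` the drift is integrated in time, mollified in space
and used, with a minus sign, as a small displacement of the torus; `approx` is the mollified datum
composed with these displacements. Two facts are uniform. First, a displacement of divergence at
most `Lτ` compresses volume by a factor `exp (Lτ + quadratic error)`, so with small steps the whole
composition costs at most `exp (L t + 1)` (`exists_isScheme`); this extra `1` is where `C₂ = e`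
comes from. Second, by convexity of the exponential in time and in space, if `E` is the sum of the
gradients of the displacements along a trajectory, then `∫ exp (s E) ≤ exp (L t + 1) K` as soon as
`s t ≤ β` (`lintegral_exp_accum_le`).

First order regularity. The chain rule gives `|∇u_t| ≤ exp E · |∇u₀| ∘ X_t`, and Hölder's inequality
with `1/r = 1/s + 1/p` bounds `∇u_t` in `L^r` (`IsScheme.lintegral_grad_approx_le`).

Fractional regularity. Here two trajectories are compared. The gradient is replaced by its maximal
function, which still has exponential moments at half the rate (`lintegral_exp_realMax_le`) and
controls difference quotients at pairs of points (`dist_displace_le`). A Hajłasz type inequality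
`|u₀ x - u₀ y| ≤ C |x - y|^α (g x + g y)`, with `g` in `L^p` whenever the Gagliardo seminorm is
finite, then bounds increments of `u_t` in `L^q`, where `1/q = 1/s + 1/p`
(`exists_lintegral_increment_approx_le`). Keeping `q` gives the loss of integrability; interpolating
with the bound on `u` raises `q` to `p` and gives the loss of order. Decay of increments with a
slightly larger exponent makes the Gagliardo integral converge (`gagliardoPow_lt_top_of_decay`).

Existence. The schemes satisfy the weak equation up to an error that tends to zero, provided the
time step is chosen after the mollification parameter (`IsDrift.exists_scheme_weak_eq`). They are
bounded, so weak compactness yields a solution, every slice of which is a weak limit of schemes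
(`IsDrift.exists_solution`); the estimates are lower semicontinuous.

Uniqueness. No commutator estimate is needed, because existence already provides, for smooth data
and short times, solutions `W` with square integrable gradient (`IsDrift.exists_sobolev_solution`).
Against such a `W` any bounded solution `U` satisfies `d/dt ∫ U W = ∫ U W div b`, since all
derivatives can be put on `W`. If `U` vanishes at the end of a short interval and `W` starts near
the sign of `U` at its beginning, the `L¹` norm of `U` is at most half of its supremum over the
interval, hence zero (`IsWeakSolution.ae_eq_zero_of_short`); time reversal turns this into
uniqueness for the initial value problem. -/

namespace TorusTransport

/-- The flat torus. -/
abbrev Torus (d : ℕ) := UnitAddTorus (Fin d)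

/-- Euclidean space. -/
abbrev Euc (d : ℕ) := EuclideanSpace ℝ (Fin d)

/-! ### The torus as a quotient of Euclidean space -/

variable {d : ℕ}

/-- The quotient map from Euclidean space to the torus. -/
def proj (v : Euc d) : Torus d := fun i => (v i : UnitAddCircle)

@[simp] lemma proj_apply (v : Euc d) (i : Fin d) : proj v i = (v i : UnitAddCircle) := rfl

@[simp] lemma proj_zero : proj (0 : Euc d) = 0 := by ext i; simp

lemma proj_add (v w : Euc d) : proj (v + w) = proj v + proj w := by
  ext i; simp

lemma proj_sub (v w : Euc d) : proj (v - w) = proj v - proj w := by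
  ext i; simp

lemma proj_single (i : Fin d) (s : ℝ) :
    proj (EuclideanSpace.single i s) = Pi.single i (s : UnitAddCircle) := by
  ext j
  by_cases h : j = i
  · subst h; simp
  · simp [h]

@[fun_prop] lemma continuous_proj : Continuous (proj : Euc d → Torus d) := by
  refine continuous_pi fun i => ?_
  exact (AddCircle.continuous_mk' 1).comp (by fun_prop)

@[fun_prop] lemma measurable_proj : Measurable (proj : Euc d → Torus d) :=
  continuous_proj.measurable

lemma proj_surjective : Function.Surjective (proj : Euc d → Torus d) := by
  intro x
  have h : ∀ i, ∃ r : ℝ, (r : UnitAddCircle) = x i := fun i => QuotientAddGroup.mk_surjective (x i)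
  choose r hr using h
  exact ⟨WithLp.toLp 2 r, by ext i; simp [hr]⟩

/-- Being a quotient map, the projection lets continuity on the torus be checked on periodic lifts,
where smoothness is defined. -/
lemma isOpenQuotientMap_proj : IsOpenQuotientMap (proj : Euc d → Torus d) := by
  have h : IsOpenQuotientMap (fun (v : Fin d → ℝ) i => (v i : UnitAddCircle)) :=
    IsOpenQuotientMap.piMap fun i => QuotientAddGroup.isOpenQuotientMap_mk
  exact h.comp (PiLp.homeomorph 2 (fun _ : Fin d => ℝ)).isOpenQuotientMap

lemma continuous_iff_lift {X : Type*} [TopologicalSpace X] {u : Torus d → X} :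
    Continuous u ↔ Continuous fun y => u (proj y) :=
  isOpenQuotientMap_proj.isQuotientMap.continuous_iff

lemma proj_eq_proj_iff {v w : Euc d} :
    proj v = proj w ↔ ∃ k : Fin d → ℤ, ∀ i, v i = w i + k i := by
  constructor
  · intro h
    have h1 : ∀ i, ∃ k : ℤ, v i = w i + k := fun i => by
      have h2 : (v i : UnitAddCircle) = w i := congrFun h i
      have h3 : ((v i - w i : ℝ) : UnitAddCircle) = 0 := by
        rw [AddCircle.coe_sub, h2, sub_self]
      obtain ⟨k, hk⟩ := (AddCircle.coe_eq_zero_iff (1 : ℝ)).1 h3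
      refine ⟨k, ?_⟩
      simp only [zsmul_eq_mul, mul_one] at hk
      linarith
    choose k hk using h1
    exact ⟨k, hk⟩
  · rintro ⟨k, hk⟩
    ext i
    simp [hk i]

instance : IsProbabilityMeasure (volume : Measure UnitAddCircle) := ⟨UnitAddCircle.measure_univ⟩

/-! ### Smooth functions -/

section Smooth

variable {u v φ : Torus d → ℝ}

lemma isSmooth_const (c : ℝ) : IsSmoothOnTorus (fun _ : Torus d => c) := contDiff_const

lemma _root_.IsSmoothOnTorus.mul (hu : IsSmoothOnTorus u) (hv : IsSmoothOnTorus v) :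
    IsSmoothOnTorus (fun x => u x * v x) := ContDiff.mul hu hv

lemma _root_.IsSmoothOnTorus.const_mul (c : ℝ) (hu : IsSmoothOnTorus u) : IsSmoothOnTorus (fun x => c * u x) :=
  IsSmoothOnTorus.mul (isSmooth_const c) hu

lemma _root_.IsSmoothOnTorus.sum {ι : Type*} (s : Finset ι) {f : ι → Torus d → ℝ}
    (hf : ∀ j ∈ s, IsSmoothOnTorus (f j)) : IsSmoothOnTorus (fun x => ∑ j ∈ s, f j x) :=
  ContDiff.sum hf

/-- A vector field on the torus is smooth if its components are. -/
def IsSmoothField (V : Torus d → Euc d) : Prop := ∀ i, IsSmoothOnTorus (fun x => V x i)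

lemma IsSmoothField.contDiff {V : Torus d → Euc d} (hV : IsSmoothField V) :
    ContDiff ℝ ((⊤ : ℕ∞) : WithTop ℕ∞) (fun y => V (proj y)) :=
  contDiff_euclidean.2 hV

/-- Displacement of the torus along a vector field. -/
def displace (V : Torus d → Euc d) (x : Torus d) : Torus d := x + proj (V x)

lemma displace_proj (V : Torus d → Euc d) (y : Euc d) :
    displace V (proj y) = proj (y + V (proj y)) := by simp [displace, proj_add]

/-- A displacement lifts to the smooth map `y ↦ y + V (proj y)` of Euclidean space, so the
composition can be differentiated upstairs. -/
lemma _root_.IsSmoothOnTorus.comp_displace (hu : IsSmoothOnTorus u) {V : Torus d → Euc d}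
    (hV : IsSmoothField V) : IsSmoothOnTorus (fun x => u (displace V x)) := by
  have h : (fun y : Euc d => u (displace V (proj y))) =
      (fun y => u (proj y)) ∘ fun y => y + V (proj y) := by
    funext y; simp [displace_proj]
  show ContDiff ℝ _ (fun y : Euc d => u (displace V (proj y)))
  rw [h]
  exact ContDiff.comp hu (contDiff_id.add hV.contDiff)

lemma _root_.IsSmoothOnTorus.comp_add (hu : IsSmoothOnTorus u) (a : Torus d) :
    IsSmoothOnTorus (fun x => u (x + a)) := by
  obtain ⟨w, rfl⟩ := proj_surjective a
  exact IsSmoothOnTorus.comp_displace (V := fun _ => w) hu (fun i => isSmooth_const _)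

lemma _root_.IsSmoothOnTorus.continuous (hu : IsSmoothOnTorus u) : Continuous u :=
  continuous_iff_lift.2 (ContDiff.continuous hu)

lemma IsSmoothField.continuous {V : Torus d → Euc d} (hV : IsSmoothField V) : Continuous V :=
  continuous_iff_lift.2 hV.contDiff.continuous

lemma continuous_displace {V : Torus d → Euc d} (hV : Continuous V) :
    Continuous (displace V) := continuous_id.add (continuous_proj.comp hV)

lemma _root_.IsSmoothOnTorus.hasFDerivAt (hu : IsSmoothOnTorus u) (y : Euc d) :
    HasFDerivAt (fun y => u (proj y)) (fderiv ℝ (fun y => u (proj y)) y) y :=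
  (ContDiff.differentiable hu (by simp) y).hasFDerivAt

lemma torusPartial_proj (hu : IsSmoothOnTorus u) (i : Fin d) (y : Euc d) :
    torusPartial u i (proj y) =
      fderiv ℝ (fun y => u (proj y)) y (EuclideanSpace.single i 1) := by
  have h : (fun s : ℝ => u (proj y + Pi.single i (s : UnitAddCircle))) =
      fun s : ℝ => (fun y => u (proj y)) (y + s • EuclideanSpace.single i (1 : ℝ)) := by
    funext s
    have h2 : s • EuclideanSpace.single i (1 : ℝ) = EuclideanSpace.single i s := by
      ext j; by_cases hj : j = i
      · subst hj; simp
      · simp [hj]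
    simp only [proj_add, h2, proj_single]
  rw [torusPartial, h]
  have h3 : HasDerivAt (fun s : ℝ => y + s • EuclideanSpace.single i (1 : ℝ))
      (EuclideanSpace.single i (1 : ℝ)) 0 := by
    simpa using ((hasDerivAt_id (0 : ℝ)).smul_const (EuclideanSpace.single i (1 : ℝ))).const_add y
  have h4 := IsSmoothOnTorus.hasFDerivAt hu (y + (0 : ℝ) • EuclideanSpace.single i (1 : ℝ))
  have h5 := h4.comp_hasDerivAt (0 : ℝ) h3
  simpa [Function.comp_def] using h5.deriv

lemma _root_.IsSmoothOnTorus.smooth_torusPartial (hu : IsSmoothOnTorus u) (i : Fin d) :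
    IsSmoothOnTorus (torusPartial u i) := by
  have h : (fun y : Euc d => torusPartial u i (proj y)) =
      fun y => fderiv ℝ (fun y => u (proj y)) y (EuclideanSpace.single i 1) :=
    funext fun y => torusPartial_proj hu i y
  show ContDiff ℝ _ (fun y : Euc d => torusPartial u i (proj y))
  rw [h]
  exact (ContDiff.fderiv_right hu (by simp)).clm_apply contDiff_const

/-- The gradient of a function on the torus. -/
noncomputable def grad (u : Torus d → ℝ) (x : Torus d) : Euc d :=
  WithLp.toLp 2 fun i => torusPartial u i x

@[simp] lemma grad_apply (u : Torus d → ℝ) (x : Torus d) (i : Fin d) :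
    grad u x i = torusPartial u i x := rfl

lemma isSmoothField_grad (hu : IsSmoothOnTorus u) : IsSmoothField (grad u) :=
  fun i => IsSmoothOnTorus.smooth_torusPartial hu i

lemma fderiv_lift (hu : IsSmoothOnTorus u) (y w : Euc d) :
    fderiv ℝ (fun y => u (proj y)) y w = ∑ i, w i * torusPartial u i (proj y) := by
  have hw : w = ∑ i, w i • EuclideanSpace.single i (1 : ℝ) := by
    ext j
    simp [Finset.sum_apply, Pi.single_apply]
  conv_lhs => rw [hw]
  rw [map_sum]
  refine Finset.sum_congr rfl fun i _ => ?_
  rw [map_smul, torusPartial_proj hu, smul_eq_mul]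

lemma sum_mul_torusPartial (u : Torus d → ℝ) (x : Torus d) (w : Euc d) :
    ∑ i, w i * torusPartial u i x = inner ℝ w (grad u x) := by
  simp [PiLp.inner_apply, mul_comm]

lemma abs_inner_grad_le (u : Torus d → ℝ) (x : Torus d) (w : Euc d) :
    |∑ i, w i * torusPartial u i x| ≤ ‖w‖ * ‖grad u x‖ := by
  rw [sum_mul_torusPartial]; exact abs_real_inner_le_norm _ _

lemma hasDerivAt_line (hu : IsSmoothOnTorus u) (x : Torus d) (w : Euc d) (s : ℝ) :
    HasDerivAt (fun s : ℝ => u (x + proj (s • w)))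
      (∑ i, w i * torusPartial u i (x + proj (s • w))) s := by
  obtain ⟨y, rfl⟩ := proj_surjective x
  have h3 : HasDerivAt (fun s : ℝ => y + s • w) w s := by
    simpa using ((hasDerivAt_id s).smul_const w).const_add y
  have h5 := (IsSmoothOnTorus.hasFDerivAt hu (y + s • w)).comp_hasDerivAt s h3
  rw [fderiv_lift hu, proj_add] at h5
  refine h5.congr_of_eventuallyEq (Filter.Eventually.of_forall fun s => ?_)
  simp [proj_add]

lemma hasDerivAt_torusPartial (hu : IsSmoothOnTorus u) (i : Fin d) (x : Torus d) :
    HasDerivAt (fun s : ℝ => u (x + Pi.single i (s : UnitAddCircle))) (torusPartial u i x) 0 := by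
  have h := hasDerivAt_line hu x (EuclideanSpace.single i 1) 0
  have h2 : ∀ s : ℝ, s • EuclideanSpace.single i (1 : ℝ) = EuclideanSpace.single i s := by
    intro s; ext j; by_cases hj : j = i
    · subst hj; simp
    · simp [hj]
  simp only [h2, proj_single] at h
  have h3 := h.differentiableAt.hasDerivAt
  exact h3

lemma torusPartial_mul (hu : IsSmoothOnTorus u) (hv : IsSmoothOnTorus v) (i : Fin d)
    (x : Torus d) : torusPartial (fun x => u x * v x) i x =
      torusPartial u i x * v x + u x * torusPartial v i x := by
  have h := (hasDerivAt_torusPartial hu i x).fun_mul (hasDerivAt_torusPartial hv i x)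
  have := h.deriv
  simpa [torusPartial] using this

lemma torusPartial_sum {ι : Type*} (s : Finset ι) {f : ι → Torus d → ℝ}
    (hf : ∀ j ∈ s, IsSmoothOnTorus (f j)) (i : Fin d) (x : Torus d) :
    torusPartial (fun x => ∑ j ∈ s, f j x) i x = ∑ j ∈ s, torusPartial (f j) i x := by
  have h := HasDerivAt.fun_sum fun j hj => hasDerivAt_torusPartial (hf j hj) i x
  exact h.deriv

lemma torusPartial_const_mul (hu : IsSmoothOnTorus u) (c : ℝ) (i : Fin d)
    (x : Torus d) : torusPartial (fun x => c * u x) i x = c * torusPartial u i x :=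
  ((hasDerivAt_torusPartial hu i x).const_mul c).deriv

/-- The matrix of partial derivatives of a vector field, by rows. -/
noncomputable def jac (V : Torus d → Euc d) (x : Torus d) (i : Fin d) : Euc d :=
  grad (fun x => V x i) x

/-- The lifted displacement has derivative `I + DV`; the gradient is multiplied by its transpose,
which is why the rows of `jac V` appear as vectors. -/
lemma grad_comp_displace (hu : IsSmoothOnTorus u) {V : Torus d → Euc d}
    (hV : IsSmoothField V) (x : Torus d) :
    grad (fun x => u (displace V x)) x =
      grad u (displace V x) + ∑ j, torusPartial u j (displace V x) • jac V x j := by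
  obtain ⟨y, rfl⟩ := proj_surjective x
  ext i
  rw [grad_apply, torusPartial_proj (IsSmoothOnTorus.comp_displace hu hV)]
  have hc : (fun y : Euc d => u (displace V (proj y))) =
      (fun y => u (proj y)) ∘ fun y => y + V (proj y) := by
    funext y; simp [displace_proj]
  rw [hc]
  have hVd : DifferentiableAt ℝ (fun y => V (proj y)) y :=
    hV.contDiff.differentiable (by simp) y
  have h1 : HasFDerivAt (fun y => y + V (proj y))
      (ContinuousLinearMap.id ℝ (Euc d) + fderiv ℝ (fun y => V (proj y)) y) y :=
    (hasFDerivAt_id y).add hVd.hasFDerivAt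
  have h2 := (IsSmoothOnTorus.hasFDerivAt hu (y + V (proj y))).comp y h1
  rw [h2.fderiv, ContinuousLinearMap.comp_apply, fderiv_lift hu]
  have h3 : ∀ j, (fderiv ℝ (fun y => V (proj y)) y (EuclideanSpace.single i 1)) j =
      torusPartial (fun x => V x j) i (proj y) := by
    intro j
    rw [torusPartial_proj (hV j)]
    have h4 : HasFDerivAt (fun y => V (proj y) j) _ y :=
      (EuclideanSpace.proj (𝕜 := ℝ) j).hasFDerivAt.comp y hVd.hasFDerivAt
    rw [h4.fderiv]
    rfl
  have hs : ∀ j, (EuclideanSpace.single i (1 : ℝ) : Euc d) j = if j = i then 1 else 0 := by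
    simp
  simp only [_root_.add_apply, ContinuousLinearMap.id_apply, PiLp.add_apply, h3,
    add_mul, Finset.sum_add_distrib, hs, displace_proj, ite_mul, one_mul, zero_mul,
    Finset.sum_ite_eq', Finset.mem_univ, if_true, grad_apply, jac]
  congr 1
  simp [mul_comm]

lemma norm_sum_smul_rows_le (c : Euc d) (A : Fin d → Euc d) :
    ‖∑ j, c j • A j‖ ≤ ‖c‖ * frobNorm A := by
  calc ‖∑ j, c j • A j‖ ≤ ∑ j, ‖c j • A j‖ := norm_sum_le _ _
    _ = ∑ j, |c j| * ‖A j‖ := by simp [norm_smul]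
    _ ≤ √(∑ j, |c j| ^ 2) * √(∑ j, ‖A j‖ ^ 2) := Real.sum_mul_le_sqrt_mul_sqrt _ _ _
    _ = ‖c‖ * frobNorm A := by simp [EuclideanSpace.norm_eq, frobNorm]

lemma norm_grad_comp_displace_le (hu : IsSmoothOnTorus u) {V : Torus d → Euc d}
    (hV : IsSmoothField V) (x : Torus d) :
    ‖grad (fun x => u (displace V x)) x‖ ≤
      (1 + frobNorm (jac V x)) * ‖grad u (displace V x)‖ := by
  rw [grad_comp_displace hu hV]
  refine (norm_add_le _ _).trans ?_
  have := norm_sum_smul_rows_le (grad u (displace V x)) (jac V x)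
  simp only [grad_apply] at this
  linarith

end Smooth

/-! ### Integration by parts and second order bounds for smooth functions -/

variable {u v φ : Torus d → ℝ}

lemma exists_bound_of_continuous {X : Type*} [NormedAddCommGroup X] {f : Torus d → X}
    (hf : Continuous f) : ∃ C : ℝ, 0 ≤ C ∧ ∀ x, ‖f x‖ ≤ C := by
  obtain ⟨C, hC⟩ := isCompact_univ.exists_bound_of_continuousOn hf.continuousOn
  exact ⟨max C 0, le_max_right _ _, fun x => (hC x (mem_univ x)).trans (le_max_left _ _)⟩

lemma integrable_of_continuous {X : Type*} [NormedAddCommGroup X] {f : Torus d → X}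
    (hf : Continuous f) : Integrable f := by
  obtain ⟨C, -, hC⟩ := exists_bound_of_continuous hf
  exact Integrable.of_bound hf.aestronglyMeasurable_of_compactSpace C
    (Filter.Eventually.of_forall hC)

lemma Continuous.integrable_mul {f g : Torus d → ℝ} (hf : Integrable f) (hg : Continuous g) :
    Integrable fun x => f x * g x := by
  obtain ⟨C, -, hC⟩ := exists_bound_of_continuous hg
  exact hf.mul_bdd hg.aestronglyMeasurable (Filter.Eventually.of_forall hC)

lemma abs_torusPartial_le (u : Torus d → ℝ) (i : Fin d) (x : Torus d) :
    |torusPartial u i x| ≤ ‖grad u x‖ := by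
  have := PiLp.norm_apply_le (grad u x) i
  simpa using this

lemma hasDerivAt_coord_line (hu : IsSmoothOnTorus u) (i : Fin d) (x : Torus d) (s : ℝ) :
    HasDerivAt (fun s : ℝ => u (x + proj (s • EuclideanSpace.single i (1 : ℝ))))
      (torusPartial u i (x + proj (s • EuclideanSpace.single i (1 : ℝ)))) s := by
  have h := hasDerivAt_line hu x (EuclideanSpace.single i 1) s
  convert h using 1
  simp

/-- The derivative of a smooth function has zero mean. -/
lemma integral_torusPartial (hu : IsSmoothOnTorus u) (i : Fin d) :
    ∫ x, torusPartial u i x = 0 := by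
  obtain ⟨C, hC0, hC⟩ := exists_bound_of_continuous (hu.smooth_torusPartial i).continuous
  set e : ℝ → Torus d := fun s => proj (s • EuclideanSpace.single i (1 : ℝ)) with he
  have hc : ∀ s : ℝ, Continuous fun x : Torus d => u (x + e s) :=
    fun s => hu.continuous.comp (continuous_id.add continuous_const)
  have hc' : Continuous fun x : Torus d => torusPartial u i (x + e 0) :=
    (hu.smooth_torusPartial i).continuous.comp (continuous_id.add continuous_const)
  -- By translation invariance the function of `s` differentiated here is constant, so its
  -- derivative, the mean of the partial derivative, vanishes.
  have h : HasDerivAt (fun s => ∫ x, u (x + e s)) (∫ x, torusPartial u i (x + e 0)) 0 :=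
    (hasDerivAt_integral_of_dominated_loc_of_deriv_le (μ := (volume : Measure (Torus d)))
      (F := fun (s : ℝ) x => u (x + e s)) (F' := fun s x => torusPartial u i (x + e s))
      (x₀ := 0) (s := univ) (bound := fun _ => C) Filter.univ_mem
      (Filter.Eventually.of_forall fun s => (hc s).aestronglyMeasurable)
      (integrable_of_continuous (hc 0)) hc'.aestronglyMeasurable
      (Filter.Eventually.of_forall fun x s _ => hC _) (integrable_const C)
      (Filter.Eventually.of_forall fun x s _ => hasDerivAt_coord_line hu i x s)).2
  have hconst : ∀ s : ℝ, ∫ x, u (x + e s) = ∫ x, u x :=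
    fun s => integral_add_right_eq_self u (e s)
  simp only [hconst, integral_add_right_eq_self (torusPartial u i) (e 0)] at h
  exact h.unique (hasDerivAt_const _ _)

lemma integral_mul_torusPartial (hu : IsSmoothOnTorus u) (hv : IsSmoothOnTorus v) (i : Fin d) :
    ∫ x, u x * torusPartial v i x = - ∫ x, torusPartial u i x * v x := by
  have h := integral_torusPartial (hu.mul hv) i
  simp_rw [torusPartial_mul hu hv] at h
  rw [integral_add] at h
  · linarith
  · exact integrable_of_continuous ((hu.smooth_torusPartial i).continuous.mul hv.continuous)
  · exact integrable_of_continuous (hu.continuous.mul (hv.smooth_torusPartial i).continuous)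

lemma isWeakGrad_grad (hu : IsSmoothOnTorus u) : IsWeakGrad u (grad u) where
  integrable_fun := integrable_of_continuous hu.continuous
  integrable_grad := integrable_of_continuous (isSmoothField_grad hu).continuous
  integral_eq φ hφ i := by simpa using integral_mul_torusPartial hu hφ i

/-- Bounds for the gradient of a function on the torus and for the modulus of continuity of the
gradient. -/
structure HasC2Bound (u : Torus d → ℝ) (g ℓ : ℝ) : Prop where
  grad_le : ∀ x, ‖grad u x‖ ≤ g
  lip : ∀ x w, ‖grad u (x + proj w) - grad u x‖ ≤ ℓ * ‖w‖

lemma HasC2Bound.nonneg {g ℓ : ℝ} (h : HasC2Bound u g ℓ) : 0 ≤ g :=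
  (norm_nonneg _).trans (h.grad_le 0)

lemma HasC2Bound.mono {g ℓ g' ℓ' : ℝ} (h : HasC2Bound u g ℓ) (hg : g ≤ g') (hl : ℓ ≤ ℓ') :
    HasC2Bound u g' ℓ' :=
  ⟨fun x => (h.grad_le x).trans hg, fun x w => (h.lip x w).trans (by gcongr)⟩

lemma abs_sub_le_of_grad_le {g : ℝ} (hu : IsSmoothOnTorus u) (hg : ∀ x, ‖grad u x‖ ≤ g)
    (x : Torus d) (w : Euc d) : |u (x + proj w) - u x| ≤ g * ‖w‖ := by
  have h := Convex.norm_image_sub_le_of_norm_hasDerivWithin_le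
    (f := fun s : ℝ => u (x + proj (s • w))) (s := univ) (C := g * ‖w‖) (x := 0) (y := 1)
    (fun s _ => (hasDerivAt_line hu x w s).hasDerivWithinAt)
    (fun s _ => by
      rw [Real.norm_eq_abs, mul_comm]
      exact (abs_inner_grad_le u _ w).trans (by gcongr; exact hg _))
    convex_univ (mem_univ _) (mem_univ _)
  simpa using h

lemma exists_hasC2Bound (hu : IsSmoothOnTorus u) : ∃ g ℓ, 0 ≤ ℓ ∧ HasC2Bound u g ℓ := by
  obtain ⟨g, -, hg⟩ := exists_bound_of_continuous (isSmoothField_grad hu).continuous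
  have h : ∀ i, ∃ C : ℝ, 0 ≤ C ∧ ∀ x, ‖grad (torusPartial u i) x‖ ≤ C := fun i =>
    exists_bound_of_continuous (isSmoothField_grad (hu.smooth_torusPartial i)).continuous
  choose C hC0 hC using h
  refine ⟨g, ∑ i, C i, Finset.sum_nonneg fun i _ => hC0 i, hg, fun x w => ?_⟩
  have h1 : ∀ z : Euc d, ‖z‖ ≤ ∑ i, |z i| := fun z => by
    rw [EuclideanSpace.norm_eq]
    refine Real.sqrt_le_iff.2 ⟨Finset.sum_nonneg fun i _ => abs_nonneg _, ?_⟩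
    exact Finset.sum_sq_le_sq_sum_of_nonneg fun i _ => norm_nonneg _
  refine (h1 _).trans ?_
  rw [Finset.sum_mul]
  exact Finset.sum_le_sum fun i _ => abs_sub_le_of_grad_le (hu.smooth_torusPartial i) (hC i) x w

/-- First order Taylor expansion on the torus. -/
lemma HasC2Bound.taylor {g ℓ : ℝ} (h : HasC2Bound u g ℓ) (hl : 0 ≤ ℓ) (hu : IsSmoothOnTorus u)
    (x : Torus d) (w : Euc d) :
    |u (x + proj w) - u x - ∑ i, w i * torusPartial u i x| ≤ ℓ * ‖w‖ ^ 2 := by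
  -- Mean value inequality for the Taylor remainder along the segment: its derivative is `w` paired
  -- with the increment of the gradient. The factor `1/2` of the sharp remainder is not needed.
  have h := Convex.norm_image_sub_le_of_norm_hasDerivWithin_le
    (f := fun s : ℝ => u (x + proj (s • w)) - s * ∑ i, w i * torusPartial u i x) (s := Icc 0 1)
    (C := ℓ * ‖w‖ ^ 2) (x := 0) (y := 1)
    (fun s _ => ((hasDerivAt_line hu x w s).sub
      (hasDerivAt_mul_const (∑ i, w i * torusPartial u i x))).hasDerivWithinAt)
    (fun s hs => by
      rw [Real.norm_eq_abs, sum_mul_torusPartial, sum_mul_torusPartial, ← inner_sub_right]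
      refine (abs_real_inner_le_norm _ _).trans ?_
      have h2 := h.lip x (s • w)
      rw [norm_smul, Real.norm_eq_abs, abs_of_nonneg hs.1] at h2
      have h3 : ℓ * (s * ‖w‖) ≤ ℓ * ‖w‖ := by
        gcongr; exact mul_le_of_le_one_left (norm_nonneg _) hs.2
      calc _ ≤ ‖w‖ * (ℓ * ‖w‖) := by gcongr; exact h2.trans h3
        _ = _ := by ring)
    (convex_Icc 0 1) (by simp) (by simp)
  simpa [sub_right_comm] using h

/-! ### The Haar measure of the torus and periodic integration -/

/-- The half-open cube `(0, ρ]^d`. -/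
def cube (d : ℕ) (ρ : ℝ) : Set (Euc d) := {h | ∀ i, h i ∈ Ioc (0 : ℝ) ρ}

lemma cube_eq_preimage (ρ : ℝ) :
    cube d ρ = WithLp.ofLp ⁻¹' (Set.pi univ fun _ : Fin d => Ioc (0 : ℝ) ρ) := by
  ext h; simp [cube]

lemma measurableSet_cube (ρ : ℝ) : MeasurableSet (cube d ρ) := by
  rw [cube_eq_preimage]
  exact (PiLp.volume_preserving_ofLp (Fin d)).measurable
    (MeasurableSet.univ_pi fun _ => measurableSet_Ioc)

lemma volume_cube (ρ : ℝ) : volume (cube d ρ) = ENNReal.ofReal ρ ^ d := by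
  rw [cube_eq_preimage, (PiLp.volume_preserving_ofLp (Fin d)).measure_preimage
    (MeasurableSet.univ_pi fun _ => measurableSet_Ioc).nullMeasurableSet, volume_pi_pi]
  simp

/-- Every integral over the torus can thus be computed on the half-open unit cube, which is also the
domain of `h` in the Gagliardo seminorm. -/
lemma measurePreserving_proj :
    MeasurePreserving (proj : Euc d → Torus d) (volume.restrict (cube d 1)) volume := by
  have h1 := (PiLp.volume_preserving_ofLp (Fin d)).restrict_preimage
    (MeasurableSet.univ_pi fun _ : Fin d => (measurableSet_Ioc : MeasurableSet (Ioc (0 : ℝ) 1)))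
  rw [← cube_eq_preimage] at h1
  have h2 : MeasurePreserving (fun (v : Fin d → ℝ) i => (v i : UnitAddCircle))
      (Measure.pi fun _ : Fin d => (volume : Measure ℝ).restrict (Ioc 0 1))
      (Measure.pi fun _ => volume) :=
    measurePreserving_pi _ _ fun i => by
      have := UnitAddCircle.measurePreserving_mk 0
      rwa [zero_add] at this
  rw [volume_pi, Measure.restrict_pi_pi] at h1
  exact h2.comp h1

lemma lintegral_torus_eq {F : Torus d → ENNReal} (hF : Measurable F) :
    ∫⁻ x, F x = ∫⁻ h in cube d 1, F (proj h) :=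
  (measurePreserving_proj.lintegral_comp hF).symm

/-- Integer vectors. -/
def intVec (k : Fin d → ℤ) : Euc d := WithLp.toLp 2 fun i => (k i : ℝ)

@[simp] lemma intVec_apply (k : Fin d → ℤ) (i : Fin d) : intVec k i = k i := rfl

lemma proj_intVec (k : Fin d → ℤ) : proj (intVec k) = 0 := by
  ext i
  simp

lemma proj_add_intVec (y : Euc d) (k : Fin d → ℤ) : proj (y + intVec k) = proj y := by
  rw [proj_add, proj_intVec, add_zero]

lemma exists_eq_add_intVec {v w : Euc d} (h : proj v = proj w) : ∃ k, v = w + intVec k := by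
  obtain ⟨k, hk⟩ := proj_eq_proj_iff.1 h
  exact ⟨k, by ext i; simp [hk i]⟩

lemma intVec_eq_of_mem_cube {y : Euc d} {k l : Fin d → ℤ} (hk : y - intVec k ∈ cube d 1)
    (hl : y - intVec l ∈ cube d 1) : k = l := by
  funext i
  have h1 := hk i
  have h2 := hl i
  simp only [PiLp.sub_apply, intVec_apply, mem_Ioc] at h1 h2
  have h3 : (k i : ℝ) < l i + 1 := by linarith
  have h4 : (l i : ℝ) < k i + 1 := by linarith
  have h5 : k i < l i + 1 := by exact_mod_cast h3
  have h6 : l i < k i + 1 := by exact_mod_cast h4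
  omega

lemma exists_sub_intVec_mem_cube (y : Euc d) : ∃ k, y - intVec k ∈ cube d 1 := by
  refine ⟨fun i => ⌈y i⌉ - 1, fun i => ?_⟩
  have h1 := Int.le_ceil (y i)
  have h2 := Int.ceil_lt_add_one (y i)
  simp only [PiLp.sub_apply, intVec_apply, mem_Ioc]
  push_cast
  constructor <;> linarith

lemma eq_of_proj_eq_of_mem_cube {y z : Euc d} (hy : y ∈ cube d 1) (hz : z ∈ cube d 1)
    (h : proj y = proj z) : y = z := by
  obtain ⟨k, hk⟩ := exists_eq_add_intVec h
  have h0 : k = 0 := intVec_eq_of_mem_cube (y := y) (by rw [hk]; simpa using hz)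
    (by have : intVec (0 : Fin d → ℤ) = 0 := by ext i; simp
        rw [this]; simpa using hy)
  rw [hk, h0]; ext i; simp

/-- A set on which the projection to the torus is injective carries at most the mass of the
torus. -/
lemma setLIntegral_proj_le {A : Set (Euc d)} (hA : MeasurableSet A) (hinj : InjOn proj A)
    {F : Torus d → ENNReal} (hF : Measurable F) :
    ∫⁻ y in A, F (proj y) ≤ ∫⁻ x, F x := by
  have hsh : ∀ k : Fin d → ℤ, Measurable fun y : Euc d => y + intVec k := fun k => by fun_prop
  have hsh' : ∀ k : Fin d → ℤ, Measurable fun y : Euc d => y - intVec k := fun k => by fun_prop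
  have hQ : ∀ k : Fin d → ℤ, MeasurableSet {y : Euc d | y - intVec k ∈ cube d 1} := fun k =>
    hsh' k (measurableSet_cube 1)
  -- `A` is cut along the integer translates of the unit cube. Moved back into the cube, the pieces
  -- stay disjoint exactly because the projection is injective on `A`.
  set S : (Fin d → ℤ) → Set (Euc d) := fun k => A ∩ {y | y - intVec k ∈ cube d 1} with hS
  set B : (Fin d → ℤ) → Set (Euc d) := fun k => {y | y + intVec k ∈ A} ∩ cube d 1 with hB
  have hBm : ∀ k, MeasurableSet (B k) := fun k => (hsh k hA).inter (measurableSet_cube 1)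
  have hA' : A = ⋃ k, S k := by
    ext y
    simp only [hS, mem_iUnion, mem_inter_iff, mem_ofPred_eq, exists_and_left]
    exact ⟨fun h => ⟨h, exists_sub_intVec_mem_cube y⟩, fun h => h.1⟩
  have hdS : Pairwise (Function.onFun Disjoint S) := by
    intro k l hkl
    refine Set.disjoint_left.2 fun y h1 h2 => hkl (intVec_eq_of_mem_cube h1.2 h2.2)
  have hdB : Pairwise (Function.onFun Disjoint B) := by
    intro k l hkl
    refine Set.disjoint_left.2 fun y h1 h2 => hkl ?_
    have h3 : y + intVec k = y + intVec l := hinj h1.1 h2.1 (by simp [proj_add_intVec])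
    have h4 := add_left_cancel h3
    funext i
    have := congrArg (fun z : Euc d => z i) h4
    simpa using this
  have hSB : ∀ k, ∫⁻ y in S k, F (proj y) = ∫⁻ y in B k, F (proj y) := by
    intro k
    have h := (measurePreserving_add_right (volume : Measure (Euc d)) (intVec k)).setLIntegral_comp_preimage
      (s := S k) (hA.inter (hQ k)) (f := fun y => F (proj y)) (hF.comp measurable_proj)
    rw [← h]
    have h2 : (fun y => y + intVec k) ⁻¹' S k = B k := by
      ext y; simp [hS, hB]
    rw [h2]
    simp only [proj_add_intVec]
  calc ∫⁻ y in A, F (proj y) = ∑' k, ∫⁻ y in S k, F (proj y) := by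
        conv_lhs => rw [hA']
        exact lintegral_iUnion (fun k => hA.inter (hQ k)) hdS _
    _ = ∑' k, ∫⁻ y in B k, F (proj y) := by simp only [hSB]
    _ = ∫⁻ y in ⋃ k, B k, F (proj y) := (lintegral_iUnion hBm hdB _).symm
    _ ≤ ∫⁻ y in cube d 1, F (proj y) :=
        lintegral_mono_set (iUnion_subset fun k => inter_subset_right)
    _ = ∫⁻ x, F x := (lintegral_torus_eq hF).symm

/-! ### Jacobians -/

/-- Lower bound for the determinant of a perturbation of the identity. -/
lemma exists_det_one_add_ge (d : ℕ) : ∃ C r : ℝ, 0 ≤ C ∧ 0 < r ∧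
    ∀ (A : Matrix (Fin d) (Fin d) ℝ) (a : ℝ), (∀ i j, |A i j| ≤ a) → 0 ≤ a → a ≤ r →
      1 + A.trace - C * a ^ 2 ≤ (1 + A).det := by
  set f : (Fin d → Fin d → ℝ) → ℝ := fun A => ((1 : Matrix (Fin d) (Fin d) ℝ) + Matrix.of A).det
    with hf
  have hsm : ContDiff ℝ 2 f := by
    simp only [hf, Matrix.det_apply']
    refine ContDiff.sum fun σ _ => contDiff_const.mul (contDiff_prod fun i _ => ?_)
    simp only [Matrix.add_apply, Matrix.of_apply]
    exact contDiff_const.add (contDiff_apply_apply ℝ ℝ _ _)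
  have hsm' : ContDiff ℝ 1 (fderiv ℝ f) := hsm.fderiv_right (by norm_num)
  -- The determinant is smooth, so its derivative is Lipschitz near the identity; this makes the
  -- first order expansion error quadratic.
  obtain ⟨K, t, ht, hK⟩ := hsm'.contDiffAt.exists_lipschitzOnWith (x := 0)
  obtain ⟨r, hr, hrt⟩ := Metric.mem_nhds_iff.1 ht
  have htr : ∀ A : Fin d → Fin d → ℝ, fderiv ℝ f 0 A = (Matrix.of A).trace := by
    intro A
    have h1 : HasDerivAt (fun t : ℝ => f (t • A)) (fderiv ℝ f 0 A) 0 := by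
      have h2 : HasDerivAt (fun t : ℝ => t • A) A 0 := by
        simpa using (hasDerivAt_id (0 : ℝ)).smul_const A
      have h3 : HasFDerivAt f (fderiv ℝ f 0) ((0 : ℝ) • A) := by
        rw [zero_smul]; exact (hsm.differentiable (by norm_num) 0).hasFDerivAt
      exact h3.comp_hasDerivAt (0 : ℝ) h2
    -- The derivative at zero is read off from the polynomial expansion of `det (1 + t A)`, whose
    -- linear coefficient is the trace.
    have h4 : (fun t : ℝ => f (t • A)) = fun t => 1 + (Matrix.of A).trace * t +
        Polynomial.eval t
          (1 + (Polynomial.X : Polynomial ℝ) • (Matrix.of A).map Polynomial.C).det.divX.divX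
          * t ^ 2 := by
      funext t
      rw [← Matrix.det_one_add_smul]
      rfl
    rw [h4] at h1
    refine h1.unique ?_
    set P := (1 + (Polynomial.X : Polynomial ℝ) •
      (Matrix.of A).map Polynomial.C).det.divX.divX
    have h5 : HasDerivAt (fun t : ℝ => 1 + (Matrix.of A).trace * t + P.eval t * t ^ 2)
        ((Matrix.of A).trace * 1 + (P.derivative.eval 0 * 0 ^ 2 + P.eval 0 * (2 * 0))) 0 := by
      refine HasDerivAt.add (((hasDerivAt_id (0 : ℝ)).const_mul _).const_add 1)
        ((P.hasDerivAt 0).mul ?_)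
      simpa using hasDerivAt_pow 2 (0 : ℝ)
    simpa using h5
  -- Halving the radius keeps the closed condition `a ≤ r / 2` inside the open ball where the
  -- Lipschitz bound holds.
  refine ⟨K, r / 2, K.2, by positivity, fun A a hA ha har => ?_⟩
  have hAn : ‖(fun i j => A i j : Fin d → Fin d → ℝ)‖ ≤ a :=
    (pi_norm_le_iff_of_nonneg ha).2 fun i => (pi_norm_le_iff_of_nonneg ha).2 fun j => hA i j
  set A' : Fin d → Fin d → ℝ := fun i j => A i j
  have h := Convex.norm_image_sub_le_of_norm_hasDerivWithin_le
    (f := fun s : ℝ => f (s • A') - s * fderiv ℝ f 0 A') (s := Icc 0 1)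
    (C := K * a ^ 2) (x := 0) (y := 1)
    (fun s _ => by
      have h2 : HasDerivAt (fun t : ℝ => t • A') A' s := by
        simpa using (hasDerivAt_id s).smul_const A'
      have h3 := ((hsm.differentiable (by norm_num) (s • A')).hasFDerivAt).comp_hasDerivAt s h2
      exact (h3.sub (hasDerivAt_mul_const (fderiv ℝ f 0 A'))).hasDerivWithinAt)
    (fun s hs => by
      have hs1 : ‖s • A'‖ ≤ a := by
        rw [norm_smul, Real.norm_eq_abs, abs_of_nonneg hs.1]
        exact (mul_le_of_le_one_left (norm_nonneg _) hs.2).trans hAn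
      have h4 := hK.dist_le_mul (s • A') (hrt (by simpa using hs1.trans_lt (by linarith))) 0
        (hrt (by simpa using hr))
      rw [dist_eq_norm, dist_zero_right] at h4
      rw [← _root_.sub_apply]
      calc _ ≤ ‖fderiv ℝ f (s • A') - fderiv ℝ f 0‖ * ‖A'‖ := ContinuousLinearMap.le_opNorm _ _
        _ ≤ (K * a) * a := by gcongr; exact h4.trans (by gcongr)
        _ = _ := by ring)
    (convex_Icc 0 1) (by simp) (by simp)
  have hf0 : f 0 = 1 := by
    have : (Matrix.of (0 : Fin d → Fin d → ℝ)) = 0 := rfl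
    simp [hf, this]
  simp only [one_smul, one_mul, zero_smul, zero_mul, sub_zero, mul_one, hf0, htr,
    Real.norm_eq_abs, norm_one] at h
  have h6 := (abs_le.1 h).1
  have h7 : f A' = (1 + A).det := rfl
  have h8 : (Matrix.of A').trace = A.trace := rfl
  rw [h7, h8] at h6
  linarith

lemma fderiv_lift_field {V : Torus d → Euc d} (hV : IsSmoothField V) (y w : Euc d) (i : Fin d) :
    fderiv ℝ (fun y => V (proj y)) y w i = ∑ j, w j * jac V (proj y) i j := by
  have hVd : DifferentiableAt ℝ (fun y => V (proj y)) y :=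
    hV.contDiff.differentiable (by simp) y
  have h4 : HasFDerivAt (fun y => V (proj y) i) _ y :=
    (EuclideanSpace.proj (𝕜 := ℝ) i).hasFDerivAt.comp y hVd.hasFDerivAt
  have h5 := fderiv_lift (hV i) y w
  rw [h4.fderiv] at h5
  exact h5

lemma det_id_add_fderiv {V : Torus d → Euc d} (hV : IsSmoothField V) (y : Euc d) :
    (ContinuousLinearMap.id ℝ (Euc d) + fderiv ℝ (fun y => V (proj y)) y).det =
      (1 + Matrix.of fun i j => jac V (proj y) i j).det := by
  rw [ContinuousLinearMap.det, ← LinearMap.det_toMatrix (EuclideanSpace.basisFun (Fin d) ℝ).toBasis]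
  congr 1
  ext i j
  rw [LinearMap.toMatrix_apply]
  simp [fderiv_lift_field hV, Matrix.one_apply]

/-- Change of variables inequality for displacements of the torus. -/
lemma lintegral_comp_displace_le {V : Torus d → Euc d} (hV : IsSmoothField V) {κ c : ℝ}
    (hκ : κ < 1) (hlip : ∀ x w, ‖V (x + proj w) - V x‖ ≤ κ * ‖w‖)
    (hdet : ∀ x, c ≤ (1 + Matrix.of fun i j => jac V x i j).det)
    {F : Torus d → ENNReal} (hF : Measurable F) :
    ENNReal.ofReal c * ∫⁻ x, F (displace V x) ≤ ∫⁻ x, F x := by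
  set Ψ : Euc d → Euc d := fun y => y + V (proj y) with hΨ
  have hderiv : ∀ y, HasFDerivAt Ψ
      (ContinuousLinearMap.id ℝ (Euc d) + fderiv ℝ (fun y => V (proj y)) y) y := fun y =>
    (hasFDerivAt_id y).add (hV.contDiff.differentiable (by simp) y).hasFDerivAt
  have hΨc : Continuous Ψ := continuous_id.add hV.contDiff.continuous
  -- `Ψ` is the identity plus a contraction, hence injective.
  have hinj : Function.Injective Ψ := by
    intro y z hyz
    have h1 : ‖V (proj y) - V (proj z)‖ ≤ κ * ‖y - z‖ := by
      have := hlip (proj z) (y - z)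
      rwa [← proj_add, add_sub_cancel] at this
    have h2 : y - z = -(V (proj y) - V (proj z)) := by
      have : y + V (proj y) = z + V (proj z) := hyz
      rw [neg_sub, sub_eq_sub_iff_add_eq_add, this, add_comm]
    have h3 : ‖y - z‖ ≤ κ * ‖y - z‖ := by
      conv_lhs => rw [h2, norm_neg]
      exact h1
    have h4 : ‖y - z‖ ≤ 0 := by nlinarith [norm_nonneg (y - z)]
    exact sub_eq_zero.1 (norm_le_zero_iff.1 h4)
  -- `Ψ` commutes with integer translations, so two points of the image that agree on the torus come
  -- from points of the cube that agree on the torus, hence from the same point.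
  have hinj2 : InjOn proj (Ψ '' cube d 1) := by
    rintro _ ⟨y, hy, rfl⟩ _ ⟨z, hz, rfl⟩ h
    obtain ⟨k, hk⟩ := exists_eq_add_intVec h
    have h1 : Ψ y = Ψ (z + intVec k) := by
      rw [hk]; simp only [hΨ, proj_add_intVec]; abel
    have h2 := hinj h1
    have h3 : y = z := eq_of_proj_eq_of_mem_cube hy hz (by rw [h2, proj_add_intVec])
    rw [h3]
  have hms : MeasurableSet (Ψ '' cube d 1) :=
    (measurableSet_cube 1).image_of_measurable_injOn hΨc.measurable hinj.injOn
  calc ENNReal.ofReal c * ∫⁻ x, F (displace V x)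
      = ∫⁻ y in cube d 1, ENNReal.ofReal c * F (proj (Ψ y)) := by
        have hm : Measurable fun x => F (displace V x) :=
          hF.comp (continuous_displace hV.continuous).measurable
        have hm' : Measurable fun y => F (displace V (proj y)) := hm.comp measurable_proj
        rw [lintegral_torus_eq hm, ← lintegral_const_mul _ hm']
        simp only [displace_proj, hΨ]
    _ ≤ ∫⁻ y in cube d 1, ENNReal.ofReal
          |(ContinuousLinearMap.id ℝ (Euc d) + fderiv ℝ (fun y => V (proj y)) y).det| *
            F (proj (Ψ y)) := by
        refine lintegral_mono fun y => ?_
        gcongr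
        rw [det_id_add_fderiv hV]
        exact (hdet _).trans (le_abs_self _)
    _ = ∫⁻ y in Ψ '' cube d 1, F (proj y) :=
        (lintegral_image_eq_lintegral_abs_det_fderiv_mul volume (measurableSet_cube 1)
          (fun y _ => (hderiv y).hasFDerivWithinAt) hinj.injOn (fun y => F (proj y))).symm
    _ ≤ ∫⁻ x, F x := setLIntegral_proj_le hms hinj2 hF

/-! ### Small displacements -/

lemma frobNorm_nonneg (A : Fin d → Euc d) : 0 ≤ frobNorm A := Real.sqrt_nonneg _

lemma frobNorm_eq_norm (A : Fin d → Euc d) :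
    frobNorm A = ‖(WithLp.toLp 2 A : PiLp 2 fun _ : Fin d => Euc d)‖ := by
  rw [PiLp.norm_eq_of_L2]; rfl

lemma norm_row_le_frobNorm (A : Fin d → Euc d) (i : Fin d) : ‖A i‖ ≤ frobNorm A := by
  rw [frobNorm_eq_norm]
  exact PiLp.norm_apply_le (WithLp.toLp 2 A : PiLp 2 fun _ : Fin d => Euc d) i

lemma frobNorm_le_sum (A : Fin d → Euc d) : frobNorm A ≤ ∑ i, ‖A i‖ := by
  refine Real.sqrt_le_iff.2 ⟨Finset.sum_nonneg fun i _ => norm_nonneg _, ?_⟩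
  exact Finset.sum_sq_le_sq_sum_of_nonneg fun i _ => norm_nonneg _

lemma norm_le_sum_abs (z : Euc d) : ‖z‖ ≤ ∑ i, |z i| := by
  rw [EuclideanSpace.norm_eq]
  refine Real.sqrt_le_iff.2 ⟨Finset.sum_nonneg fun i _ => abs_nonneg _, ?_⟩
  exact Finset.sum_sq_le_sq_sum_of_nonneg fun i _ => norm_nonneg _

/-- A smooth vector field which is small, with its first derivatives and with the Lipschitz constant
of its first derivatives. -/
structure FieldBound (V : Torus d → Euc d) (a : ℝ) : Prop where
  smooth : IsSmoothField V
  norm_le : ∀ x, ‖V x‖ ≤ a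
  frob_le : ∀ x, frobNorm (jac V x) ≤ a
  lip : ∀ x w, ‖V (x + proj w) - V x‖ ≤ a * ‖w‖
  frob_lip : ∀ x w, frobNorm (jac V (x + proj w) - jac V x) ≤ a * ‖w‖

lemma FieldBound.nonneg {V : Torus d → Euc d} {a : ℝ} (h : FieldBound V a) : 0 ≤ a :=
  (norm_nonneg _).trans (h.norm_le 0)

/-- A bound on the components bounds the field. -/
lemma FieldBound.of_components {V : Torus d → Euc d} {a : ℝ} (hV : IsSmoothField V)
    (h0 : ∀ i x, |V x i| ≤ a) (h2 : ∀ i, HasC2Bound (fun x => V x i) a a) :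
    FieldBound V (d * a) where
  smooth := hV
  norm_le x := (norm_le_sum_abs _).trans <| by
    simpa using Finset.sum_le_sum fun i (_ : i ∈ Finset.univ) => h0 i x
  frob_le x := (frobNorm_le_sum _).trans <| by
    simpa [jac] using Finset.sum_le_sum fun i (_ : i ∈ Finset.univ) => (h2 i).grad_le x
  lip x w := (norm_le_sum_abs _).trans <| by
    simpa [mul_assoc] using Finset.sum_le_sum fun i (_ : i ∈ Finset.univ) =>
      abs_sub_le_of_grad_le (hV i) (h2 i).grad_le x w
  frob_lip x w := (frobNorm_le_sum _).trans <| by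
    simpa [mul_assoc, jac] using Finset.sum_le_sum fun i (_ : i ∈ Finset.univ) => (h2 i).lip x w

/-- The gradient becomes `(I + DV)ᵀ ∇u` at the displaced point. Displaced points separate by a
factor at most `1 + a`, so the variation of `∇u` contributes `ℓ (1 + a)` times the matrix factor `1
+ a`, and the variation of `DV` contributes `g a`. -/
lemma HasC2Bound.comp_displace {V : Torus d → Euc d} {a g ℓ : ℝ} (hu : IsSmoothOnTorus u)
    (h : HasC2Bound u g ℓ) (hl : 0 ≤ ℓ) (hV : FieldBound V a) :
    HasC2Bound (fun x => u (displace V x)) ((1 + a) * g) (ℓ * (1 + a) ^ 2 + g * a) := by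
  have ha := hV.nonneg
  have hg := h.nonneg
  refine ⟨fun x => (norm_grad_comp_displace_le hu hV.smooth x).trans ?_, fun x w => ?_⟩
  · have := hV.frob_le x
    have := h.grad_le (displace V x)
    gcongr
  · rw [grad_comp_displace hu hV.smooth, grad_comp_displace hu hV.smooth]
    set p := displace V (x + proj w) with hp
    set q := displace V x with hq
    have hpq : p = q + proj (w + (V (x + proj w) - V x)) := by
      simp only [hp, hq, displace, proj_add, proj_sub]; abel
    have hD : ‖w + (V (x + proj w) - V x)‖ ≤ (1 + a) * ‖w‖ := by
      refine (norm_add_le _ _).trans ?_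
      linarith [hV.lip x w]
    have h1 : ‖grad u p - grad u q‖ ≤ ℓ * ((1 + a) * ‖w‖) := by
      rw [hpq]; exact (h.lip q _).trans (by gcongr)
    have h2 : ‖∑ j, (grad u p - grad u q) j • jac V (x + proj w) j‖ ≤
        ℓ * ((1 + a) * ‖w‖) * a := by
      refine (norm_sum_smul_rows_le _ _).trans ?_
      have := hV.frob_le (x + proj w)
      have := frobNorm_nonneg (jac V (x + proj w))
      gcongr
    have h3 : ‖∑ j, (grad u q) j • (jac V (x + proj w) - jac V x) j‖ ≤ g * (a * ‖w‖) := by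
      refine (norm_sum_smul_rows_le _ _).trans ?_
      have := hV.frob_lip x w
      have := frobNorm_nonneg (jac V (x + proj w) - jac V x)
      have := h.grad_le q
      gcongr
    have h4 : grad u p + ∑ j, torusPartial u j p • jac V (x + proj w) j -
        (grad u q + ∑ j, torusPartial u j q • jac V x j) =
        (grad u p - grad u q) + (∑ j, (grad u p - grad u q) j • jac V (x + proj w) j +
          ∑ j, (grad u q) j • (jac V (x + proj w) - jac V x) j) := by
      rw [← Finset.sum_add_distrib, add_sub_add_comm, ← Finset.sum_sub_distrib]
      congr 1
      refine Finset.sum_congr rfl fun j _ => ?_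
      simp only [PiLp.sub_apply, grad_apply, Pi.sub_apply, sub_smul, smul_sub]
      abel
    rw [h4]
    refine (norm_add_le _ _).trans ((add_le_add h1 ((norm_add_le _ _).trans
      (add_le_add h2 h3))).trans (le_of_eq ?_))
    ring

/-- The constants of the Jacobian estimate. -/
lemma exists_lintegral_comp_displace_le (d : ℕ) : ∃ C r : ℝ, 0 ≤ C ∧ 0 < r ∧
    ∀ (V : Torus d → Euc d) (a δ : ℝ), FieldBound V a → a ≤ r → 0 ≤ δ → δ ≤ r →
      (∀ x, |rowTrace (jac V x)| ≤ δ) → ∀ F : Torus d → ENNReal, Measurable F →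
      ∫⁻ x, F (displace V x) ≤
        ENNReal.ofReal (Real.exp (δ + C * (a ^ 2 + δ ^ 2))) * ∫⁻ x, F x := by
  obtain ⟨C, r, hC, hr, h⟩ := exists_det_one_add_ge d
  -- The thresholds force `a ≤ 1/2` and `x = δ + C a² ≤ 1/2`; the constant absorbs `C a²` together
  -- with `x² ≤ 2 δ² + 2 C² a²`. The coefficient of `δ` in the exponent stays equal to one, which is
  -- what lets the steps multiply up to the rate `L`.
  refine ⟨C + 2 + 2 * C ^ 2, min r (min (1 / 2) (1 / (4 * (C + 1)))), by positivity, by positivity,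
    fun V a δ hV har hδ hδr htr F hF => ?_⟩
  have ha := hV.nonneg
  have h1 : a ≤ r := har.trans (min_le_left _ _)
  have h2 : a ≤ 1 / 2 := har.trans ((min_le_right _ _).trans (min_le_left _ _))
  have h4 : δ ≤ 1 / (4 * (C + 1)) := hδr.trans ((min_le_right _ _).trans (min_le_right _ _))
  have h5 : a ≤ 1 / (4 * (C + 1)) := har.trans ((min_le_right _ _).trans (min_le_right _ _))
  rw [le_div_iff₀ (by positivity)] at h4 h5
  set x := δ + C * a ^ 2 with hx
  have hx0 : 0 ≤ x := by positivity
  have hx1 : x ≤ 1 / 2 := by nlinarith [mul_nonneg hC ha, mul_nonneg hC hδ]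
  -- Turns the lower bound `1 - x` on the Jacobian into an exponential, at a quadratic cost valid on
  -- `[0, 1/2]`.
  have hexp : Real.exp (-(x + x ^ 2)) ≤ 1 - x := by
    rw [Real.exp_neg]
    have h6 : (1 - x)⁻¹ ≤ Real.exp (x + x ^ 2) := by
      rw [inv_le_comm₀ (by linarith) (Real.exp_pos _), ← Real.exp_neg]
      have h7 := Real.exp_bound_div_one_sub_of_interval hx0 (by linarith : x < 1)
      have h8 := Real.quadratic_le_exp_of_nonneg (x := x + x ^ 2) (by positivity)
      rw [Real.exp_neg, inv_le_comm₀ (Real.exp_pos _) (by linarith)]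
      refine le_trans ?_ h8
      rw [inv_le_iff_one_le_mul₀ (by linarith)]
      nlinarith [pow_nonneg hx0 2, pow_nonneg hx0 3, pow_nonneg hx0 4, pow_nonneg hx0 5]
    rw [inv_le_comm₀ (Real.exp_pos _) (by linarith)]
    exact h6
  have hdet : ∀ y, Real.exp (-(x + x ^ 2)) ≤
      (1 + Matrix.of fun i j => jac V y i j).det := by
    intro y
    refine hexp.trans ?_
    have h6 := h (Matrix.of fun i j => jac V y i j) a (fun i j => by
      have := PiLp.norm_apply_le (jac V y i) j
      exact (this.trans (norm_row_le_frobNorm _ i)).trans (hV.frob_le y)) ha h1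
    have h7 : (Matrix.of fun i j => jac V y i j).trace = rowTrace (jac V y) := rfl
    rw [h7] at h6
    have := (abs_le.1 (htr y)).1
    linarith
  have h9 := lintegral_comp_displace_le hV.smooth (by linarith : a < 1) hV.lip hdet hF
  calc ∫⁻ x, F (displace V x)
      = ENNReal.ofReal (Real.exp (x + x ^ 2)) * (ENNReal.ofReal (Real.exp (-(x + x ^ 2))) *
          ∫⁻ x, F (displace V x)) := by
        rw [← mul_assoc, ← ENNReal.ofReal_mul (Real.exp_pos _).le, ← Real.exp_add]
        simp
    _ ≤ ENNReal.ofReal (Real.exp (x + x ^ 2)) * ∫⁻ x, F x := by gcongr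
    _ ≤ _ := by
        gcongr ENNReal.ofReal (Real.exp ?_) * _
        have h10 : x ^ 2 ≤ 2 * δ ^ 2 + 2 * C ^ 2 * a ^ 2 := by
          have h11 : (C * a ^ 2) ^ 2 ≤ C ^ 2 * a ^ 2 := by
            have h12 : a ^ 2 ≤ 1 := by nlinarith
            have : (C * a ^ 2) ^ 2 = C ^ 2 * a ^ 2 * a ^ 2 := by ring
            rw [this]
            exact mul_le_of_le_one_right (by positivity) h12
          nlinarith [sq_nonneg (δ - C * a ^ 2)]
        have : 0 ≤ C * δ ^ 2 := by positivity
        have : 0 ≤ C ^ 2 * δ ^ 2 := by positivity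
        nlinarith [sq_nonneg a]

/-! ### Compositions of displacements -/

/-- Composition of the first `k` displacements. -/
noncomputable def traj (V : ℕ → Torus d → Euc d) : ℕ → Torus d → Torus d
  | 0 => id
  -- The latest displacement acts first: trajectories are followed backwards in time, down to the
  -- initial datum.
  | k + 1 => fun x => traj V k (displace (V k) x)

/-- Sum of `m` along the trajectories of `traj`. -/
noncomputable def accum (V : ℕ → Torus d → Euc d) (m : ℕ → Torus d → ℝ) : ℕ → Torus d → ℝ
  | 0 => fun _ => 0
  | k + 1 => fun x => m k x + accum V m k (displace (V k) x)

section Scheme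

variable {V : ℕ → Torus d → Euc d} {a : ℕ → ℝ}

lemma smooth_comp_traj (hV : ∀ k, IsSmoothField (V k)) (hu : IsSmoothOnTorus u) (k : ℕ) :
    IsSmoothOnTorus (fun x => u (traj V k x)) := by
  induction k with
  | zero => exact hu
  | succ k ih => exact ih.comp_displace (hV k)

lemma continuous_traj (hV : ∀ k, IsSmoothField (V k)) (k : ℕ) : Continuous (traj V k) := by
  induction k with
  | zero => exact continuous_id
  | succ k ih => exact ih.comp (continuous_displace (hV k).continuous)

lemma measurable_accum (hV : ∀ k, IsSmoothField (V k)) {m : ℕ → Torus d → ℝ}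
    (hm : ∀ k, Measurable (m k)) (k : ℕ) : Measurable (accum V m k) := by
  induction k with
  | zero => exact measurable_const
  | succ k ih =>
    exact (hm k).add (ih.comp (continuous_displace (hV k).continuous).measurable)

/-- Each step multiplies the gradient by at most `1 + |DV|`, and `1 + r ≤ exp r` turns the product
into the exponential of an accumulated sum, the only quantity whose moments have to be controlled.
-/
lemma norm_grad_comp_traj_le (hV : ∀ k, IsSmoothField (V k)) (hu : IsSmoothOnTorus u) (k : ℕ)
    (x : Torus d) : ‖grad (fun x => u (traj V k x)) x‖ ≤
      Real.exp (accum V (fun k x => frobNorm (jac (V k) x)) k x) * ‖grad u (traj V k x)‖ := by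
  induction k generalizing x with
  | zero => simp [traj, accum]
  | succ k ih =>
    refine (norm_grad_comp_displace_le (smooth_comp_traj hV hu k) (hV k) x).trans ?_
    have h1 := ih (displace (V k) x)
    have h2 : 1 + frobNorm (jac (V k) x) ≤ Real.exp (frobNorm (jac (V k) x)) := by
      linarith [Real.add_one_le_exp (frobNorm (jac (V k) x))]
    simp only [accum, traj, Real.exp_add, mul_assoc]
    gcongr

/-- A purely qualitative bound: it degenerates as the mollification is removed, and serves only to
make Taylor remainders small by shrinking the time step. -/
lemma hasC2Bound_comp_traj (hV : ∀ k, FieldBound (V k) (a k)) (hu : IsSmoothOnTorus u) {Q : ℝ}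
    (h : HasC2Bound u Q Q) (k : ℕ) :
    HasC2Bound (fun x => u (traj V k x)) (Real.exp (3 * ∑ j ∈ Finset.range k, a j) * Q)
      (Real.exp (3 * ∑ j ∈ Finset.range k, a j) * Q) := by
  have hQ := h.nonneg
  induction k with
  | zero => simpa [traj] using h
  | succ k ih =>
    have ha := (hV k).nonneg
    have h1 := ih.comp_displace (smooth_comp_traj (fun k => (hV k).smooth) hu k) (by positivity)
      (hV k)
    -- With equal bounds on the gradient and on its modulus, the composition multiplies them by `1 +
    -- a` and by `(1 + a)² + a = 1 + 3a + a²`.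
    have h2 : 1 + 3 * a k + a k ^ 2 ≤ Real.exp (3 * a k) := by
      have := Real.quadratic_le_exp_of_nonneg (x := 3 * a k) (by positivity)
      nlinarith [sq_nonneg (a k)]
    rw [Finset.sum_range_succ, mul_add, Real.exp_add]
    set P := Real.exp (3 * ∑ j ∈ Finset.range k, a j) * Q with hP
    have hP0 : 0 ≤ P := by positivity
    refine HasC2Bound.mono h1 ?_ ?_
    · nlinarith [sq_nonneg (a k)]
    · nlinarith

variable {lam : ℕ → ℝ}

/-- The one-step bound is applied to `F ∘ traj V k`, so the compression factors multiply and their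
logarithms add. -/
lemma lintegral_comp_traj_le (hV : ∀ k, IsSmoothField (V k))
    (hJ : ∀ k, ∀ F : Torus d → ENNReal, Measurable F →
      ∫⁻ x, F (displace (V k) x) ≤ ENNReal.ofReal (Real.exp (lam k)) * ∫⁻ x, F x)
    (k : ℕ) {F : Torus d → ENNReal} (hF : Measurable F) :
    ∫⁻ x, F (traj V k x) ≤
      ENNReal.ofReal (Real.exp (∑ j ∈ Finset.range k, lam j)) * ∫⁻ x, F x := by
  induction k with
  | zero => simp [traj]
  | succ k ih =>
    refine (hJ k (fun x => F (traj V k x)) (hF.comp (continuous_traj hV k).measurable)).trans ?_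
    rw [Finset.sum_range_succ, add_comm, Real.exp_add, ENNReal.ofReal_mul (Real.exp_pos _).le,
      mul_assoc]
    gcongr

/-- Exponential moments along the trajectories: Jensen's inequality in time. -/
lemma lintegral_exp_accum_le (hV : ∀ k, IsSmoothField (V k)) (hlam : ∀ k, 0 ≤ lam k)
    (hJ : ∀ k, ∀ F : Torus d → ENNReal, Measurable F →
      ∫⁻ x, F (displace (V k) x) ≤ ENNReal.ofReal (Real.exp (lam k)) * ∫⁻ x, F x)
    {m : ℕ → Torus d → ℝ} (hm : ∀ k, Measurable (m k))
    {θ : ℝ} {Z : ENNReal} (hZ : 1 ≤ Z)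
    (hmZ : ∀ k, ∀ s, 0 ≤ s → s ≤ θ → ∫⁻ x, ENNReal.ofReal (Real.exp (s * m k x)) ≤ Z)
    (k : ℕ) {s : ℝ} (hs : 0 ≤ s) (hsk : s * k ≤ θ) :
    ∫⁻ x, ENNReal.ofReal (Real.exp (s * accum V m k x)) ≤
      ENNReal.ofReal (Real.exp (∑ j ∈ Finset.range k, lam j)) * Z := by
  induction k generalizing s with
  | zero => simpa [accum] using hZ
  | succ k ih =>
    have hk1 : (0 : ℝ) < k + 1 := by positivity
    push_cast at hsk
    have hsum : 0 ≤ ∑ j ∈ Finset.range (k + 1), lam j := Finset.sum_nonneg fun j _ => hlam j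
    -- The weights `1/(k+1)` and `k/(k+1)` amount to a uniform average over the steps: every step
    -- ends up being tested with exponent `s` times the number of steps.
    set w : ℝ := 1 / (k + 1) with hw
    set w' : ℝ := k / (k + 1) with hw'
    have hw0 : 0 ≤ w := by positivity
    have hw'0 : 0 ≤ w' := by positivity
    have hww : w + w' = 1 := by rw [hw, hw']; field_simp; ring
    -- Chosen so that `s' k = s (k + 1)`, which keeps the constraint `s k ≤ θ` along the induction.
    -- For `k = 0` the division gives `s' = 0`, harmless because nothing has accumulated yet.
    set s' : ℝ := (k + 1) * s / k with hs'
    have hs'0 : 0 ≤ s' := by positivity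
    have hs'k : s' * k ≤ θ := by
      rcases Nat.eq_zero_or_pos k with rfl | hk
      · simp only [Nat.cast_zero, mul_zero] at hsk ⊢
        nlinarith
      · have : (0 : ℝ) < k := by exact_mod_cast hk
        rw [hs', div_mul_cancel₀ _ this.ne']; linarith
    have hpt : ∀ x, Real.exp (s * accum V m (k + 1) x) ≤
        w * Real.exp ((k + 1) * s * m k x) +
          w' * Real.exp (s' * accum V m k (displace (V k) x)) := by
      intro x
      have h1 := convexOn_exp.2 (mem_univ ((k + 1) * s * m k x))
        (mem_univ (s' * accum V m k (displace (V k) x))) hw0 hw'0 hww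
      simp only [smul_eq_mul] at h1
      refine le_trans (le_of_eq ?_) h1
      congr 1
      simp only [accum, hw, hw', hs']
      rcases Nat.eq_zero_or_pos k with rfl | hk
      · simp [accum]
      · have : (0 : ℝ) < k := by exact_mod_cast hk
        field_simp
    have hme : Measurable fun x => ENNReal.ofReal (Real.exp (s' * accum V m k x)) :=
      (((measurable_accum hV hm k).const_mul s').exp).ennreal_ofReal
    have hme2 : Measurable fun x =>
        ENNReal.ofReal (Real.exp (s' * accum V m k (displace (V k) x))) :=
      hme.comp (continuous_displace (hV k).continuous).measurable
    calc ∫⁻ x, ENNReal.ofReal (Real.exp (s * accum V m (k + 1) x))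
        ≤ ∫⁻ x, (ENNReal.ofReal w * ENNReal.ofReal (Real.exp ((k + 1) * s * m k x)) +
          ENNReal.ofReal w' *
            ENNReal.ofReal (Real.exp (s' * accum V m k (displace (V k) x)))) := by
          refine lintegral_mono fun x => ?_
          rw [← ENNReal.ofReal_mul hw0, ← ENNReal.ofReal_mul hw'0,
            ← ENNReal.ofReal_add (by positivity) (by positivity)]
          exact ENNReal.ofReal_le_ofReal (hpt x)
      _ = ENNReal.ofReal w * (∫⁻ x, ENNReal.ofReal (Real.exp ((k + 1) * s * m k x))) +
          ENNReal.ofReal w' *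
            ∫⁻ x, ENNReal.ofReal (Real.exp (s' * accum V m k (displace (V k) x))) := by
          rw [lintegral_add_right _ (hme2.const_mul _), lintegral_const_mul _ hme2,
            lintegral_const_mul]
          exact (((hm k).const_mul _).exp).ennreal_ofReal
      _ ≤ ENNReal.ofReal w * (ENNReal.ofReal (Real.exp (∑ j ∈ Finset.range (k + 1), lam j)) * Z) +
          ENNReal.ofReal w' *
            (ENNReal.ofReal (Real.exp (∑ j ∈ Finset.range (k + 1), lam j)) * Z) := by
          gcongr
          · refine (hmZ k ((k + 1) * s) (by positivity) (by linarith)).trans ?_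
            refine le_mul_of_one_le_left (by positivity) ?_
            rw [ENNReal.one_le_ofReal]
            exact Real.one_le_exp hsum
          · refine (hJ k _ hme).trans ?_
            rw [Finset.sum_range_succ, add_comm, Real.exp_add,
              ENNReal.ofReal_mul (Real.exp_pos _).le, mul_assoc]
            gcongr
            exact ih hs'0 hs'k
      _ = _ := by
          rw [← add_mul, ← ENNReal.ofReal_add hw0 hw'0, hww, ENNReal.ofReal_one, one_mul]

lemma dist_traj_le {m : ℕ → Torus d → ℝ}
    (hm : ∀ k x y, dist (displace (V k) x) (displace (V k) y) ≤
      Real.exp (m k x + m k y) * dist x y) (k : ℕ) (x y : Torus d) :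
    dist (traj V k x) (traj V k y) ≤ Real.exp (accum V m k x + accum V m k y) * dist x y := by
  induction k generalizing x y with
  | zero => simp [traj, accum]
  | succ k ih =>
    refine (ih _ _).trans ?_
    have h1 := hm k x y
    calc _ ≤ Real.exp (accum V m k (displace (V k) x) + accum V m k (displace (V k) y)) *
          (Real.exp (m k x + m k y) * dist x y) := by gcongr
      _ = _ := by
        rw [← mul_assoc, ← Real.exp_add]; congr 2; simp only [accum]; ring

end Scheme

/-! ### A one-sided dyadic maximal function -/

/-- The uniform probability measure on the cube `(0, 2⁻ʲ]^d`. -/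
noncomputable def cubeMeasure (d j : ℕ) : Measure (Euc d) :=
  (ENNReal.ofReal ((2 : ℝ)⁻¹ ^ j) ^ d)⁻¹ • volume.restrict (cube d ((2 : ℝ)⁻¹ ^ j))

lemma ofReal_half_pow_ne_zero (d j : ℕ) : ENNReal.ofReal ((2 : ℝ)⁻¹ ^ j) ^ d ≠ 0 := by
  exact pow_ne_zero _ (by simp)

lemma ofReal_half_pow_ne_top (d j : ℕ) : ENNReal.ofReal ((2 : ℝ)⁻¹ ^ j) ^ d ≠ ⊤ :=
  ENNReal.pow_ne_top ENNReal.ofReal_ne_top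

instance (d j : ℕ) : IsProbabilityMeasure (cubeMeasure d j) := by
  refine ⟨?_⟩
  rw [cubeMeasure, Measure.smul_apply, Measure.restrict_apply_univ, volume_cube, smul_eq_mul]
  exact ENNReal.inv_mul_cancel (ofReal_half_pow_ne_zero d j) (ofReal_half_pow_ne_top d j)

lemma lintegral_cubeMeasure (j : ℕ) (F : Euc d → ENNReal) :
    ∫⁻ h, F h ∂(cubeMeasure d j) = (ENNReal.ofReal ((2 : ℝ)⁻¹ ^ j) ^ d)⁻¹ *
      ∫⁻ h in cube d ((2 : ℝ)⁻¹ ^ j), F h := by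
  rw [cubeMeasure, lintegral_smul_measure, smul_eq_mul]

/-- The one-sided dyadic maximal function. -/
noncomputable def maxFun (F : Torus d → ENNReal) (x : Torus d) : ENNReal :=
  ⨆ j : ℕ, ∫⁻ h, F (x + proj h) ∂(cubeMeasure d j)

lemma measurable_maxFun {F : Torus d → ENNReal} (hF : Measurable F) : Measurable (maxFun F) := by
  refine Measurable.iSup fun j => ?_
  have : Measurable fun z : Torus d × Euc d => F (z.1 + proj z.2) := by fun_prop
  exact this.lintegral_prod_right'

lemma maxFun_le {F : Torus d → ENNReal} {c : ENNReal} (h : ∀ x, F x ≤ c) (x : Torus d) :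
    maxFun F x ≤ c :=
  iSup_le fun j => (lintegral_mono fun h' => h _).trans (by simp)

/-- Rounding the side up to a power of `1/2` at most doubles it, which costs the factor `2 ^ d`. -/
lemma setLIntegral_cube_le_maxFun (F : Torus d → ENNReal) (x : Torus d) {ρ : ℝ} (hρ : 0 < ρ)
    (hρ1 : ρ ≤ 1) : ∫⁻ h in cube d ρ, F (x + proj h) ≤
      2 ^ d * ENNReal.ofReal ρ ^ d * maxFun F x := by
  obtain ⟨j, hj1, hj2⟩ := exists_nat_pow_near_of_lt_one hρ hρ1 (by norm_num : (0 : ℝ) < 2⁻¹)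
    (by norm_num : (2 : ℝ)⁻¹ < 1)
  have hsub : cube d ρ ⊆ cube d ((2 : ℝ)⁻¹ ^ j) := fun h hh i => ⟨(hh i).1, (hh i).2.trans hj2⟩
  calc ∫⁻ h in cube d ρ, F (x + proj h)
      ≤ ∫⁻ h in cube d ((2 : ℝ)⁻¹ ^ j), F (x + proj h) := lintegral_mono_set hsub
    _ = ENNReal.ofReal ((2 : ℝ)⁻¹ ^ j) ^ d * ∫⁻ h, F (x + proj h) ∂(cubeMeasure d j) := by
        rw [lintegral_cubeMeasure, ← mul_assoc, ENNReal.mul_inv_cancel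
          (ofReal_half_pow_ne_zero d j) (ofReal_half_pow_ne_top d j), one_mul]
    _ ≤ ENNReal.ofReal (2 * ρ) ^ d * maxFun F x := by
        gcongr
        · rw [pow_succ] at hj1; linarith
        · exact le_iSup (fun j => ∫⁻ h, F (x + proj h) ∂(cubeMeasure d j)) j
    _ = _ := by rw [ENNReal.ofReal_mul (by norm_num), mul_pow]; simp

lemma norm_proj_le {h : Euc d} {ρ : ℝ} (hρ : 0 ≤ ρ) (hh : ∀ i, |h i| ≤ ρ) : ‖proj h‖ ≤ ρ := by
  refine (pi_norm_le_iff_of_nonneg hρ).2 fun i => ?_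
  have : ‖((h i : ℝ) : UnitAddCircle)‖ ≤ ‖h i‖ := QuotientAddGroup.norm_mk_le_norm
  exact this.trans (hh i)

lemma injOn_proj_cube {ρ : ℝ} (hρ1 : ρ ≤ 1) : InjOn proj (cube d ρ) := fun _ hy _ hz h =>
  eq_of_proj_eq_of_mem_cube (fun i => ⟨(hy i).1, (hy i).2.trans hρ1⟩)
    (fun i => ⟨(hz i).1, (hz i).2.trans hρ1⟩) h

/-- The one-sided cube sits in the sup-norm ball and injects into the torus. Passing to balls makes
Vitali's covering lemma applicable to one-sided averages. -/
lemma setLIntegral_cube_le_closedBall {F : Torus d → ENNReal} (hF : Measurable F) (x : Torus d)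
    {ρ : ℝ} (hρ : 0 ≤ ρ) (hρ1 : ρ ≤ 1) :
    ∫⁻ h in cube d ρ, F (x + proj h) ≤ ∫⁻ z in Metric.closedBall x ρ, F z := by
  set G : Torus d → ENNReal := (Metric.closedBall x ρ).indicator F with hG
  have hGm : Measurable G := hF.indicator Metric.isClosed_closedBall.measurableSet
  calc ∫⁻ h in cube d ρ, F (x + proj h) = ∫⁻ h in cube d ρ, G (x + proj h) := by
        refine setLIntegral_congr_fun (measurableSet_cube ρ) fun h hh => ?_
        have : x + proj h ∈ Metric.closedBall x ρ := by
          rw [Metric.mem_closedBall, dist_eq_norm, add_sub_cancel_left]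
          exact norm_proj_le hρ fun i => by rw [abs_of_pos (hh i).1]; exact (hh i).2
        simp [hG, this]
    _ ≤ ∫⁻ z, G (x + z) := setLIntegral_proj_le (F := fun z => G (x + z)) (measurableSet_cube ρ)
        (injOn_proj_cube hρ1) (hGm.comp (measurable_const_add x))
    _ = ∫⁻ z, G z := lintegral_add_left_eq_self G x
    _ = _ := lintegral_indicator Metric.isClosed_closedBall.measurableSet F

lemma volume_closedBall_le (x : Torus d) {r : ℝ} (hr : 0 ≤ r) :
    volume (Metric.closedBall x r) ≤ ENNReal.ofReal (2 * r) ^ d := by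
  rw [volume_pi, Measure.pi_closedBall _ _ hr]
  calc _ ≤ ∏ _i : Fin d, ENNReal.ofReal (2 * r) := by
        refine Finset.prod_le_prod' fun i _ => ?_
        rw [AddCircle.volume_closedBall]
        exact ENNReal.ofReal_le_ofReal (min_le_right _ _)
    _ = _ := by simp

/-- The weak type `(1,1)` estimate. -/
lemma volume_lt_maxFun_le {F : Torus d → ENNReal} (hF : Measurable F) {t : ENNReal} (ht : t ≠ 0)
    (ht' : t ≠ ⊤) : volume {x | t < maxFun F x} ≤ 10 ^ d * (t⁻¹ * ∫⁻ x, F x) := by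
  set S := {x | t < maxFun F x} with hS
  have h1 : ∀ x ∈ S, ∃ j : ℕ, t < ∫⁻ h, F (x + proj h) ∂(cubeMeasure d j) := fun x hx =>
    lt_iSup_iff.1 hx
  choose! j hj using h1
  set r : Torus d → ℝ := fun x => (2 : ℝ)⁻¹ ^ j x with hr
  have hr0 : ∀ x, 0 < r x := fun x => by positivity
  have hr1 : ∀ x, r x ≤ 1 := fun x => pow_le_one₀ (by norm_num) (by norm_num)
  -- The disjoint balls carry the mass of `F`, while their fivefold enlargements cover; a ball of
  -- radius `5r` has volume at most `(10 r) ^ d`, whence the constant `10 ^ d`.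
  obtain ⟨w, hwS, hdisj, hcov⟩ := Vitali.exists_disjoint_subfamily_covering_enlargement_closedBall
    S (fun x => x) r 1 (fun x _ => hr1 x) 5 (by norm_num)
  have hwc : w.Countable := hdisj.countable_of_nonempty_interior fun x _ => by
    refine ⟨x, mem_interior_iff_mem_nhds.2 (Metric.closedBall_mem_nhds x (hr0 x))⟩
  have hball : ∀ x ∈ S, ENNReal.ofReal (r x) ^ d ≤ t⁻¹ * ∫⁻ z in Metric.closedBall x (r x), F z := by
    intro x hx
    have h2 := (hj x hx).le
    rw [lintegral_cubeMeasure] at h2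
    have h3 := h2.trans (mul_le_mul_right (setLIntegral_cube_le_closedBall hF x (hr0 x).le (hr1 x))
      _)
    have h4 : t * ENNReal.ofReal (r x) ^ d ≤ ∫⁻ z in Metric.closedBall x (r x), F z := by
      rw [mul_comm, ENNReal.mul_le_iff_le_inv (ofReal_half_pow_ne_zero d _)
        (ofReal_half_pow_ne_top d _)]
      exact h3
    rwa [← ENNReal.mul_le_iff_le_inv ht ht']
  have : Countable w := hwc.to_subtype
  calc volume S ≤ volume (⋃ x : w, Metric.closedBall (x : Torus d) (5 * r x)) := by
        refine measure_mono fun x hx => ?_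
        obtain ⟨b, hb, hb2⟩ := hcov x hx
        exact mem_iUnion.2 ⟨⟨b, hb⟩, hb2 (Metric.mem_closedBall_self (hr0 x).le)⟩
    _ ≤ ∑' x : w, volume (Metric.closedBall (x : Torus d) (5 * r x)) := measure_iUnion_le _
    _ ≤ ∑' x : w, 10 ^ d * (t⁻¹ * ∫⁻ z in Metric.closedBall (x : Torus d) (r x), F z) := by
        refine ENNReal.tsum_le_tsum fun x => ?_
        refine (volume_closedBall_le _ (by have := hr0 x; positivity)).trans ?_
        have h5 : (2 : ℝ) * (5 * r x) = 10 * r x := by ring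
        rw [h5, ENNReal.ofReal_mul (by norm_num), mul_pow]
        have h6 : ENNReal.ofReal 10 = 10 := by simp
        rw [h6]
        gcongr
        exact hball x (hwS x.2)
    _ = 10 ^ d * (t⁻¹ * ∫⁻ z in ⋃ x : w, Metric.closedBall (x : Torus d) (r x), F z) := by
        rw [ENNReal.tsum_mul_left, ENNReal.tsum_mul_left, lintegral_iUnion]
        · exact fun x => Metric.isClosed_closedBall.measurableSet
        · exact fun x y hxy => hdisj x.2 y.2 (fun h => hxy (Subtype.ext h))
    _ ≤ _ := by gcongr; exact Measure.restrict_le_self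

/-- Kolmogorov's inequality for the square root of the maximal function. -/
lemma lintegral_sqrt_maxFun_le {F : Torus d → ENNReal} (hF : Measurable F) {c : ENNReal}
    (hc : c ≠ ⊤) (hFc : ∀ x, F x ≤ c) :
    ∫⁻ x, ENNReal.ofReal ((maxFun F x).toReal ^ (1 / 2 : ℝ)) ≤ 1 + 10 ^ d * ∫⁻ x, F x := by
  set g : Torus d → ℝ := fun x => (maxFun F x).toReal
  have hfin : ∀ x, maxFun F x ≠ ⊤ := fun x => ((maxFun_le hFc x).trans_lt hc.lt_top).ne
  have hgm : Measurable g := (measurable_maxFun hF).ennreal_toReal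
  rw [lintegral_rpow_eq_lintegral_meas_lt_mul volume
    (Filter.Eventually.of_forall fun x => ENNReal.toReal_nonneg) hgm.aemeasurable
    (by norm_num : (0 : ℝ) < 1 / 2)]
  have hI1 : ∫⁻ t in Ioc (0 : ℝ) 1, ENNReal.ofReal (t ^ ((1 / 2 : ℝ) - 1)) = 2 := by
    rw [← ofReal_integral_eq_lintegral_ofReal]
    · rw [← intervalIntegral.integral_of_le zero_le_one, integral_rpow (Or.inl (by norm_num))]
      norm_num
    · exact (intervalIntegrable_iff_integrableOn_Ioc_of_le zero_le_one).1
        (intervalIntegral.intervalIntegrable_rpow' (by norm_num))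
    · exact (ae_restrict_mem measurableSet_Ioc).mono fun t ht => Real.rpow_nonneg ht.1.le _
  have hI2 : ∫⁻ t in Ioi (1 : ℝ), ENNReal.ofReal (t ^ (-(3 / 2) : ℝ)) = 2 := by
    rw [← ofReal_integral_eq_lintegral_ofReal]
    · rw [integral_Ioi_rpow_of_lt (by norm_num) zero_lt_one]
      norm_num
    · exact integrableOn_Ioi_rpow_of_lt (by norm_num) zero_lt_one
    · exact (ae_restrict_mem measurableSet_Ioi).mono fun t ht =>
        Real.rpow_nonneg (zero_lt_one.trans ht).le _
  -- The layer-cake integral is split at height one: below, level sets have measure at most one;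
  -- above, the weak type bound leaves the integrable weight `t ^ (-3/2)`.
  rw [← Ioc_union_Ioi_eq_Ioi (zero_le_one' ℝ), lintegral_union measurableSet_Ioi
    (Ioc_disjoint_Ioi le_rfl), mul_add]
  have hhalf : ENNReal.ofReal (1 / 2) * 2 = 1 := by
    have : (2 : ENNReal) = ENNReal.ofReal 2 := by simp
    rw [this, ← ENNReal.ofReal_mul (by norm_num)]; norm_num
  refine add_le_add ?_ ?_
  · calc _ ≤ ENNReal.ofReal (1 / 2) * ∫⁻ t in Ioc (0 : ℝ) 1, ENNReal.ofReal (t ^ ((1 / 2 : ℝ) - 1)) := by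
          gcongr with t
          exact mul_le_of_le_one_left (by positivity) prob_le_one
      _ = 1 := by rw [hI1, hhalf]
  · calc _ ≤ ENNReal.ofReal (1 / 2) * ∫⁻ t in Ioi (1 : ℝ),
            (10 ^ d * ∫⁻ x, F x) * ENNReal.ofReal (t ^ (-(3 / 2) : ℝ)) := by
          gcongr ENNReal.ofReal (1 / 2) * ?_
          refine setLIntegral_mono' measurableSet_Ioi fun t ht => ?_
          have ht0 : 0 < t := zero_lt_one.trans ht
          have h1 : {x | t < g x} ⊆ {x | ENNReal.ofReal t < maxFun F x} := fun x hx => by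
            exact (ENNReal.ofReal_lt_iff_lt_toReal ht0.le (hfin x)).2 hx
          have h2 := (measure_mono h1).trans (volume_lt_maxFun_le hF (by simpa using ht0)
            ENNReal.ofReal_ne_top)
          calc _ ≤ 10 ^ d * ((ENNReal.ofReal t)⁻¹ * ∫⁻ x, F x) *
                ENNReal.ofReal (t ^ ((1 / 2 : ℝ) - 1)) := by gcongr
            _ = (10 ^ d * ∫⁻ x, F x) *
                ((ENNReal.ofReal t)⁻¹ * ENNReal.ofReal (t ^ ((1 / 2 : ℝ) - 1))) := by ring
            _ = _ := by
              rw [← ENNReal.ofReal_inv_of_pos ht0, ← ENNReal.ofReal_mul (by positivity),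
                ← Real.rpow_neg_one, ← Real.rpow_add ht0]
              norm_num
      _ = _ := by
          rw [lintegral_const_mul _ (by fun_prop), hI2, mul_comm, mul_assoc, mul_comm 2, hhalf,
            mul_one]

/-- The maximal function of a nonnegative continuous function, as a real number. -/
noncomputable def realMax (f : Torus d → ℝ) (x : Torus d) : ℝ :=
  (maxFun (fun x => ENNReal.ofReal (f x)) x).toReal

lemma realMax_nonneg (f : Torus d → ℝ) (x : Torus d) : 0 ≤ realMax f x := ENNReal.toReal_nonneg

lemma measurable_realMax {f : Torus d → ℝ} (hf : Continuous f) : Measurable (realMax f) :=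
  (measurable_maxFun hf.measurable.ennreal_ofReal).ennreal_toReal

lemma maxFun_ne_top {f : Torus d → ℝ} (hf : Continuous f) (x : Torus d) :
    maxFun (fun x => ENNReal.ofReal (f x)) x ≠ ⊤ := by
  obtain ⟨C, -, hC⟩ := exists_bound_of_continuous hf
  exact ((maxFun_le (c := ENNReal.ofReal C) (fun x => ENNReal.ofReal_le_ofReal
    ((le_abs_self _).trans (hC x))) x).trans_lt ENNReal.ofReal_lt_top).ne

/-- Jensen's inequality on each cube average, followed by the supremum over the cubes. -/
lemma exp_realMax_le {f : Torus d → ℝ} (hf : Continuous f) (hf0 : ∀ x, 0 ≤ f x) {θ : ℝ}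
    (hθ : 0 < θ) (x : Torus d) :
    Real.exp (θ * realMax f x) ≤ realMax (fun x => Real.exp (θ * f x)) x := by
  have hc : Continuous fun x => Real.exp (θ * f x) := by fun_prop
  set W := realMax (fun x => Real.exp (θ * f x)) x with hW
  have hint : ∀ (g : Torus d → ℝ) (hg : Continuous g) (j : ℕ),
      Integrable (fun h => g (x + proj h)) (cubeMeasure d j) := fun g hg j => by
    obtain ⟨C, -, hC⟩ := exists_bound_of_continuous hg
    exact Integrable.of_bound (hg.comp (continuous_const.add continuous_proj)).aestronglyMeasurable
      C (Filter.Eventually.of_forall fun h => hC _)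
  have hle : ∀ j, Real.exp (θ * ∫ h, f (x + proj h) ∂(cubeMeasure d j)) ≤ W := by
    intro j
    have h1 := convexOn_exp.map_integral_le (μ := cubeMeasure d j)
      (f := fun h => θ * f (x + proj h)) Real.continuous_exp.continuousOn isClosed_univ
      (Filter.Eventually.of_forall fun _ => mem_univ _) ((hint f hf j).const_mul θ)
      (hint _ hc j)
    rw [integral_const_mul] at h1
    refine h1.trans ?_
    have h2 : ∫ h, Real.exp (θ * f (x + proj h)) ∂(cubeMeasure d j) =
        (∫⁻ h, ENNReal.ofReal (Real.exp (θ * f (x + proj h))) ∂(cubeMeasure d j)).toReal :=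
      integral_eq_lintegral_of_nonneg_ae
        (Filter.Eventually.of_forall fun _ => (Real.exp_pos _).le) (hint _ hc j).1
    show ∫ h, Real.exp (θ * f (x + proj h)) ∂(cubeMeasure d j) ≤ W
    rw [h2]
    exact ENNReal.toReal_mono (maxFun_ne_top hc x)
      (le_iSup (fun j => ∫⁻ h, ENNReal.ofReal (Real.exp (θ * f (x + proj h))) ∂(cubeMeasure d j)) j)
  have hW0 : 0 < W := (Real.exp_pos _).trans_le (hle 0)
  have hlog : 0 ≤ Real.log W / θ := by
    have h3 : 0 ≤ ∫ h, f (x + proj h) ∂(cubeMeasure d 0) := integral_nonneg fun _ => hf0 _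
    have h4 := (Real.le_log_iff_exp_le hW0).2 (hle 0)
    exact div_nonneg ((mul_nonneg hθ.le h3).trans h4) hθ.le
  have hmax : realMax f x ≤ Real.log W / θ := by
    refine ENNReal.toReal_le_of_le_ofReal hlog (iSup_le fun j => ?_)
    rw [← ofReal_integral_eq_lintegral_ofReal (hint f hf j)
      (Filter.Eventually.of_forall fun _ => hf0 _)]
    refine ENNReal.ofReal_le_ofReal ?_
    rw [le_div_iff₀ hθ, mul_comm]
    exact (Real.le_log_iff_exp_le hW0).2 (hle j)
  rw [← Real.le_log_iff_exp_le hW0]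
  rw [le_div_iff₀ hθ] at hmax
  linarith

/-- Exponential integrability passes to the maximal function. -/
lemma lintegral_exp_realMax_le {f : Torus d → ℝ} (hf : Continuous f) (hf0 : ∀ x, 0 ≤ f x) {θ : ℝ}
    (hθ : 0 < θ) {s : ℝ} (hsθ : 2 * s ≤ θ) :
    ∫⁻ x, ENNReal.ofReal (Real.exp (s * realMax f x)) ≤
      1 + 10 ^ d * ∫⁻ x, ENNReal.ofReal (Real.exp (θ * f x)) := by
  have hc : Continuous fun x => Real.exp (θ * f x) := by fun_prop
  obtain ⟨C, -, hC⟩ := exists_bound_of_continuous hc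
  refine le_trans (lintegral_mono fun x => ENNReal.ofReal_le_ofReal ?_)
    (lintegral_sqrt_maxFun_le hc.measurable.ennreal_ofReal (c := ENNReal.ofReal C)
      ENNReal.ofReal_ne_top fun x => ENNReal.ofReal_le_ofReal ((le_abs_self _).trans (hC x)))
  have h1 := exp_realMax_le hf hf0 hθ x
  -- Only half of the exponent is used, because the maximal function of an `L¹` function is
  -- integrable to powers below one only. This loss is one of the two factors `2` in `C₁`.
  have h2 : Real.exp (s * realMax f x) ≤ Real.exp (θ * realMax f x) ^ (1 / 2 : ℝ) := by
    rw [← Real.exp_mul]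
    refine Real.exp_le_exp.2 ?_
    nlinarith [realMax_nonneg f x]
  exact h2.trans (Real.rpow_le_rpow (Real.exp_pos _).le h1 (by norm_num))

/-! ### Two-point estimates -/

/-- Rounding each coordinate of a lift to the nearest integer gives the representative whose entries
realise the distances on the circle. -/
lemma exists_rep (x y : Torus d) :
    ∃ w : Euc d, y = x + proj w ∧ ∀ i, |w i| ≤ dist x y := by
  obtain ⟨z, hz⟩ := proj_surjective (y - x)
  refine ⟨WithLp.toLp 2 fun i => z i - round (z i), ?_, fun i => ?_⟩
  · have h1 : proj (WithLp.toLp 2 fun i => z i - round (z i) : Euc d) = proj z :=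
      proj_eq_proj_iff.2 ⟨fun i => -round (z i), fun i => by simp [sub_eq_add_neg]⟩
    rw [h1, hz]; abel
  · have h1 : ‖((z i : ℝ) : UnitAddCircle)‖ = |z i - round (z i)| := by
      rw [AddCircle.norm_eq]; simp
    have h2 := norm_le_pi_norm (y - x) i
    rw [← hz, proj_apply, h1, hz, ← dist_eq_norm, dist_comm] at h2
    exact h2

lemma dist_torus_le_half (x y : Torus d) : dist x y ≤ 1 / 2 := by
  rw [dist_pi_le_iff (by norm_num)]
  intro i
  rw [dist_eq_norm]
  have := AddCircle.norm_le_half_period (1 : ℝ) one_ne_zero (x := x i - y i)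
  simpa using this

lemma dist_add_proj_le (x : Torus d) (w : Euc d) : dist (x + proj w) x ≤ ‖w‖ := by
  rw [dist_eq_norm, add_sub_cancel_left]
  exact norm_proj_le (norm_nonneg _) fun i => PiLp.norm_apply_le w i

/-- Averaging an inequality over the points lying in one-sided cubes at both `x` and `y`. -/
lemma mul_dist_pow_le {A B : Torus d → ENNReal} (hA : Measurable A)
    {c : ENNReal} (h : ∀ z, c ≤ A z + B z) (x y : Torus d) :
    c * ENNReal.ofReal (dist x y) ^ d ≤
      (∫⁻ h in cube d (2 * dist x y), A (x + proj h)) +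
        ∫⁻ h in cube d (2 * dist x y), B (y + proj h) := by
  obtain ⟨w, hw, hwr⟩ := exists_rep x y
  set r := dist x y
  -- The positive part of `w` is the corner from which a cube of side `r` lies inside the one-sided
  -- cubes of side `2 r` issued both from `x` and from `y`.
  set e : Euc d := WithLp.toLp 2 fun i => max 0 (w i) with he
  have hei : ∀ i, e i = max 0 (w i) := fun i => rfl
  have hcube : ∀ h ∈ cube d r, h + e ∈ cube d (2 * r) ∧ h + (e - w) ∈ cube d (2 * r) := by
    intro h hh
    refine ⟨fun i => ?_, fun i => ?_⟩
    · have h1 := hh i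
      have h2 := abs_le.1 (hwr i)
      simp only [PiLp.add_apply, hei, mem_Ioc] at h1 ⊢
      rcases max_cases 0 (w i) with h3 | h3 <;> constructor <;> linarith
    · have h1 := hh i
      have h2 := abs_le.1 (hwr i)
      simp only [PiLp.add_apply, PiLp.sub_apply, hei, mem_Ioc] at h1 ⊢
      rcases max_cases 0 (w i) with h3 | h3 <;> constructor <;> linarith
  have hshift : ∀ (G : Euc d → ENNReal) (b : Euc d), (∀ h ∈ cube d r, h + b ∈ cube d (2 * r)) →
      ∫⁻ h in cube d r, G (h + b) ≤ ∫⁻ h in cube d (2 * r), G h := by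
    intro G b hb
    rw [← lintegral_indicator (measurableSet_cube _), ← lintegral_indicator (measurableSet_cube _),
      ← lintegral_add_right_eq_self ((cube d (2 * r)).indicator G) b]
    refine lintegral_mono fun h => ?_
    by_cases hh : h ∈ cube d r
    · simp [hh, hb h hh]
    · simp [hh]
  calc c * ENNReal.ofReal r ^ d = ∫⁻ _h in cube d r, c := by
        rw [lintegral_const, Measure.restrict_apply_univ, volume_cube]
    _ ≤ ∫⁻ h in cube d r, (A (x + proj (h + e)) + B (y + proj (h + (e - w)))) := by
        refine lintegral_mono fun h' => ?_
        have h1 : y + proj (h' + (e - w)) = x + proj (h' + e) := by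
          rw [hw]; simp only [proj_add, proj_sub]; abel
        rw [h1]; exact h _
    _ = (∫⁻ h in cube d r, A (x + proj (h + e))) +
          ∫⁻ h in cube d r, B (y + proj (h + (e - w))) := lintegral_add_left (by fun_prop) _
    _ ≤ _ := add_le_add (hshift (fun h => A (x + proj h)) e fun h hh => (hcube h hh).1)
        (hshift (fun h => B (y + proj h)) (e - w) fun h hh => (hcube h hh).2)

lemma norm_le_sqrt_of_mem_cube {h : Euc d} {ρ : ℝ} (hh : h ∈ cube d ρ) : ‖h‖ ≤ √d * ρ := by
  rcases Nat.eq_zero_or_pos d with hd | hd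
  · subst hd
    have : h = 0 := Subsingleton.elim _ _
    simp [this]
  have hρ : 0 ≤ ρ := (hh ⟨0, hd⟩).1.le.trans (hh ⟨0, hd⟩).2
  rw [EuclideanSpace.norm_eq]
  calc √(∑ i, ‖h i‖ ^ 2) ≤ √(∑ _i : Fin d, ρ ^ 2) := by
        refine Real.sqrt_le_sqrt (Finset.sum_le_sum fun i _ => ?_)
        rw [Real.norm_eq_abs, abs_of_pos (hh i).1]
        exact pow_le_pow_left₀ (hh i).1.le (hh i).2 2
    _ = √d * ρ := by
        rw [Finset.sum_const, Finset.card_univ, Fintype.card_fin, nsmul_eq_mul,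
          Real.sqrt_mul (by positivity), Real.sqrt_sq hρ]

lemma cube_smul {s ρ : ℝ} (hs : 0 < s) (h : Euc d) : s • h ∈ cube d (s * ρ) ↔ h ∈ cube d ρ := by
  simp only [cube, mem_ofPred_eq, PiLp.smul_apply, smul_eq_mul, mem_Ioc]
  refine forall_congr' fun i => ?_
  rw [mul_pos_iff_of_pos_left hs, mul_le_mul_iff_right₀ hs]

/-- Scaling of cubes. -/
lemma setLIntegral_cube_smul (G : Euc d → ENNReal) {s ρ : ℝ} (hs : 0 < s) :
    ∫⁻ h in cube d ρ, G (s • h) = (ENNReal.ofReal s ^ d)⁻¹ * ∫⁻ h in cube d (s * ρ), G h := by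
  have hemb : MeasurableEmbedding fun h : Euc d => s • h :=
    (Homeomorph.smulOfNeZero s hs.ne').measurableEmbedding
  have h1 := hemb.lintegral_map (μ := volume) ((cube d (s * ρ)).indicator G)
  rw [Measure.map_addHaar_smul volume hs.ne', lintegral_smul_measure,
    lintegral_indicator (measurableSet_cube _)] at h1
  rw [← lintegral_indicator (measurableSet_cube _)]
  convert h1.symm using 1
  · refine lintegral_congr fun h => ?_
    by_cases hh : h ∈ cube d ρ
    · simp [hh, (cube_smul hs h).2 hh]
    · simp [hh, mt (cube_smul hs h).1 hh]
  · simp only [smul_eq_mul, finrank_euclideanSpace, Fintype.card_fin]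
    congr 1
    rw [abs_of_pos (by positivity), ENNReal.ofReal_inv_of_pos (by positivity),
      ENNReal.ofReal_pow hs.le]

lemma hasDerivAt_field_line {V : Torus d → Euc d} (hV : IsSmoothField V) (x : Torus d)
    (w : Euc d) (s : ℝ) : HasDerivAt (fun s : ℝ => V (x + proj (s • w)))
      (WithLp.toLp 2 fun i => ∑ j, w j * jac V (x + proj (s • w)) i j) s := by
  rw [hasDerivAt_iff_hasFDerivAt, ← hasFDerivWithinAt_univ, hasFDerivWithinAt_euclidean]
  intro i
  have h := hasDerivAt_line (hV i) x w s
  rw [hasFDerivWithinAt_univ]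
  refine h.hasFDerivAt.congr_fderiv ?_
  ext
  simp [jac]

lemma norm_toLp_rows_le (w : Euc d) (A : Fin d → Euc d) :
    ‖(WithLp.toLp 2 fun i => ∑ j, w j * A i j : Euc d)‖ ≤ ‖w‖ * frobNorm A := by
  have h1 : ∀ i, |∑ j, w j * A i j| ≤ ‖w‖ * ‖A i‖ := fun i => by
    have : ∑ j, w j * A i j = inner ℝ w (A i) := by simp [PiLp.inner_apply, mul_comm]
    rw [this]; exact abs_real_inner_le_norm _ _
  rw [EuclideanSpace.norm_eq]
  refine Real.sqrt_le_iff.2 ⟨mul_nonneg (norm_nonneg _) (frobNorm_nonneg _), ?_⟩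
  have hf : frobNorm A ^ 2 = ∑ i, ‖A i‖ ^ 2 :=
    Real.sq_sqrt (Finset.sum_nonneg fun i _ => by positivity)
  rw [mul_pow, hf, Finset.mul_sum]
  refine Finset.sum_le_sum fun i _ => ?_
  rw [← mul_pow]
  exact pow_le_pow_left₀ (norm_nonneg _) (h1 i) 2

lemma continuous_jac {V : Torus d → Euc d} (hV : IsSmoothField V) : Continuous (jac V) :=
  continuous_pi fun i => (isSmoothField_grad (hV i)).continuous

lemma continuous_frobNorm : Continuous (frobNorm : (Fin d → Euc d) → ℝ) := by
  unfold frobNorm; fun_prop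

lemma continuous_frobNorm_jac {V : Torus d → Euc d} (hV : IsSmoothField V) :
    Continuous fun x => frobNorm (jac V x) := continuous_frobNorm.comp (continuous_jac hV)

lemma norm_field_sub_le_lintegral {V : Torus d → Euc d} (hV : IsSmoothField V) (x : Torus d)
    (w : Euc d) : ENNReal.ofReal ‖V (x + proj w) - V x‖ ≤ ENNReal.ofReal ‖w‖ *
      ∫⁻ s in Ioc (0 : ℝ) 1, ENNReal.ofReal (frobNorm (jac V (x + proj (s • w)))) := by
  have hc : Continuous fun s : ℝ => x + proj (s • w) := by fun_prop
  have hc1 : Continuous fun s : ℝ => frobNorm (jac V (x + proj (s • w))) :=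
    (continuous_frobNorm_jac hV).comp hc
  have hc2 : Continuous fun s : ℝ =>
      (WithLp.toLp 2 fun i => ∑ j, w j * jac V (x + proj (s • w)) i j : Euc d) := by
    refine (PiLp.continuous_toLp 2 _).comp (continuous_pi fun i => ?_)
    have := (continuous_jac hV).comp hc
    have h2 : Continuous fun s : ℝ => jac V (x + proj (s • w)) i := (continuous_apply i).comp this
    refine continuous_finsetSum _ fun j _ => continuous_const.mul ?_
    exact (EuclideanSpace.proj (𝕜 := ℝ) j).continuous.comp h2
  have h1 := intervalIntegral.integral_eq_sub_of_hasDerivAt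
    (fun s _ => hasDerivAt_field_line hV x w s) (hc2.intervalIntegrable 0 1)
  simp only [one_smul, zero_smul, proj_zero, add_zero] at h1
  rw [← h1, ← ofReal_integral_eq_lintegral_ofReal (hc1.integrableOn_Ioc)
    (Filter.Eventually.of_forall fun _ => frobNorm_nonneg _),
    ← ENNReal.ofReal_mul (norm_nonneg _)]
  refine ENNReal.ofReal_le_ofReal ?_
  rw [← intervalIntegral.integral_of_le zero_le_one, ← intervalIntegral.integral_const_mul]
  exact intervalIntegral.norm_integral_le_of_norm_le zero_le_one
    (Filter.Eventually.of_forall fun s _ => norm_toLp_rows_le w _)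
    ((hc1.const_mul _).intervalIntegrable 0 1)

/-- Increments are integrals of the gradient along segments. After exchanging the integrals, the
dilation by `s` turns the inner one into an integral over the cube of side `s ρ`, and the powers of
`s` cancel against the volume of that cube. -/
lemma setLIntegral_cube_field_le {V : Torus d → Euc d} (hV : IsSmoothField V) (x : Torus d)
    {ρ : ℝ} (hρ : 0 < ρ) (hρ1 : ρ ≤ 1) :
    ∫⁻ h in cube d ρ, ENNReal.ofReal ‖V (x + proj h) - V x‖ ≤
      ENNReal.ofReal (√d * ρ) * (2 ^ d * ENNReal.ofReal ρ ^ d *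
        maxFun (fun x => ENNReal.ofReal (frobNorm (jac V x))) x) := by
  set F : Torus d → ENNReal := fun x => ENNReal.ofReal (frobNorm (jac V x)) with hF
  have hFm : Measurable F := (continuous_frobNorm_jac hV).measurable.ennreal_ofReal
  calc ∫⁻ h in cube d ρ, ENNReal.ofReal ‖V (x + proj h) - V x‖
      ≤ ∫⁻ h in cube d ρ, ENNReal.ofReal (√d * ρ) * ∫⁻ s in Ioc (0 : ℝ) 1, F (x + proj (s • h)) := by
        refine setLIntegral_mono' (measurableSet_cube ρ) fun h hh => ?_
        refine (norm_field_sub_le_lintegral hV x h).trans ?_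
        gcongr
        exact norm_le_sqrt_of_mem_cube hh
    _ = ENNReal.ofReal (√d * ρ) * ∫⁻ h in cube d ρ, ∫⁻ s in Ioc (0 : ℝ) 1, F (x + proj (s • h)) := by
        refine lintegral_const_mul _ ?_
        have : Measurable fun z : Euc d × ℝ => F (x + proj (z.2 • z.1)) := by fun_prop
        exact this.lintegral_prod_right'
    _ = ENNReal.ofReal (√d * ρ) * ∫⁻ s in Ioc (0 : ℝ) 1, ∫⁻ h in cube d ρ, F (x + proj (s • h)) := by
        rw [lintegral_lintegral_swap]
        have : Measurable fun z : Euc d × ℝ => F (x + proj (z.2 • z.1)) := by fun_prop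
        exact this.aemeasurable
    _ ≤ ENNReal.ofReal (√d * ρ) * ∫⁻ _s in Ioc (0 : ℝ) 1,
          (2 ^ d * ENNReal.ofReal ρ ^ d * maxFun F x) := by
        gcongr ENNReal.ofReal (√d * ρ) * ?_
        refine setLIntegral_mono' measurableSet_Ioc fun s hs => ?_
        rw [setLIntegral_cube_smul (fun h => F (x + proj h)) hs.1]
        have h1 := setLIntegral_cube_le_maxFun F x (mul_pos hs.1 hρ)
          (mul_le_one₀ hs.2 hρ.le hρ1)
        have hs0 : ENNReal.ofReal s ^ d ≠ 0 := pow_ne_zero _ (by simpa using hs.1)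
        have hs1 : ENNReal.ofReal s ^ d ≠ ⊤ := ENNReal.pow_ne_top ENNReal.ofReal_ne_top
        calc _ ≤ (ENNReal.ofReal s ^ d)⁻¹ * (2 ^ d * ENNReal.ofReal (s * ρ) ^ d * maxFun F x) := by
              gcongr
          _ = ((ENNReal.ofReal s ^ d)⁻¹ * ENNReal.ofReal s ^ d) *
                (2 ^ d * ENNReal.ofReal ρ ^ d * maxFun F x) := by
              rw [ENNReal.ofReal_mul hs.1.le, mul_pow]; ring
          _ = _ := by rw [ENNReal.inv_mul_cancel hs0 hs1, one_mul]
    _ = _ := by simp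

/-- The Lipschitz estimate of a smooth vector field by the maximal function of its gradient. -/
lemma norm_field_sub_le_realMax {V : Torus d → Euc d} (hV : IsSmoothField V) (x y : Torus d) :
    ‖V x - V y‖ ≤ √d * 2 * 4 ^ d * dist x y *
      (realMax (fun x => frobNorm (jac V x)) x + realMax (fun x => frobNorm (jac V x)) y) := by
  rcases eq_or_lt_of_le (dist_nonneg (x := x) (y := y)) with h0 | h0
  · rw [dist_eq_zero.1 h0.symm]; simp
  set r := dist x y
  set F : Torus d → ENNReal := fun x => ENNReal.ofReal (frobNorm (jac V x)) with hF
  have hfc := continuous_frobNorm_jac hV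
  -- The torus has diameter at most `1/2`, so the averaging cubes never exceed the unit cube.
  have hr1 : 2 * r ≤ 1 := by have := dist_torus_le_half x y; linarith
  have hm : Measurable fun z => ENNReal.ofReal ‖V z - V x‖ :=
    ((hV.continuous.sub continuous_const).norm).measurable.ennreal_ofReal
  -- The triangle inequality through an intermediate point, averaged over the common cube.
  have h1 := mul_dist_pow_le (A := fun z => ENNReal.ofReal ‖V z - V x‖)
    (B := fun z => ENNReal.ofReal ‖V z - V y‖) (c := ENNReal.ofReal ‖V x - V y‖) hm
    (fun z => by
      rw [← ENNReal.ofReal_add (norm_nonneg _) (norm_nonneg _)]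
      refine ENNReal.ofReal_le_ofReal ?_
      have : V x - V y = (V z - V y) - (V z - V x) := by abel
      rw [this, add_comm]
      exact norm_sub_le _ _) x y
  have h2 := h1.trans (add_le_add (setLIntegral_cube_field_le hV x (by positivity) hr1)
    (setLIntegral_cube_field_le hV y (by positivity) hr1))
  rw [← mul_add, ← mul_add] at h2
  have hx : maxFun F x = ENNReal.ofReal (realMax (fun x => frobNorm (jac V x)) x) :=
    (ENNReal.ofReal_toReal (maxFun_ne_top hfc x)).symm
  have hy : maxFun F y = ENNReal.ofReal (realMax (fun x => frobNorm (jac V x)) y) :=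
    (ENNReal.ofReal_toReal (maxFun_ne_top hfc y)).symm
  have h2' : (2 : ENNReal) ^ d = ENNReal.ofReal 2 ^ d := by simp
  rw [hx, hy, ← ENNReal.ofReal_add (realMax_nonneg _ _) (realMax_nonneg _ _), h2',
    ← ENNReal.ofReal_pow (by positivity), ← ENNReal.ofReal_pow (by positivity),
    ← ENNReal.ofReal_pow (by positivity), ← ENNReal.ofReal_mul (by positivity),
    ← ENNReal.ofReal_mul (by positivity), ← ENNReal.ofReal_mul (by positivity),
    ← ENNReal.ofReal_mul (by positivity)] at h2
  have hS : 0 ≤ realMax (fun x => frobNorm (jac V x)) x + realMax (fun x => frobNorm (jac V x)) y :=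
    add_nonneg (realMax_nonneg _ _) (realMax_nonneg _ _)
  rw [ENNReal.ofReal_le_ofReal_iff (by positivity)] at h2
  have hrd : 0 < r ^ d := by positivity
  refine le_of_mul_le_mul_right (h2.trans (le_of_eq ?_)) hrd
  rw [mul_pow, show (4 : ℝ) ^ d = 2 ^ d * 2 ^ d by rw [← mul_pow]; norm_num]
  ring

/-- Displacements are Lipschitz along the maximal function. -/
lemma dist_displace_le {V : Torus d → Euc d} (hV : IsSmoothField V) (x y : Torus d) :
    dist (displace V x) (displace V y) ≤
      Real.exp (√d * 2 * 4 ^ d * realMax (fun x => frobNorm (jac V x)) x +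
        √d * 2 * 4 ^ d * realMax (fun x => frobNorm (jac V x)) y) * dist x y := by
  set K := √d * 2 * 4 ^ d * realMax (fun x => frobNorm (jac V x)) x +
        √d * 2 * 4 ^ d * realMax (fun x => frobNorm (jac V x)) y with hK
  have h1 : dist (displace V x) (displace V y) ≤ dist x y + ‖V x - V y‖ := by
    rw [dist_eq_norm, dist_eq_norm]
    have : displace V x - displace V y = (x - y) + proj (V x - V y) := by
      simp only [displace, proj_sub]; abel
    rw [this]
    refine (norm_add_le _ _).trans (add_le_add le_rfl ?_)
    exact norm_proj_le (norm_nonneg _) fun i => PiLp.norm_apply_le (V x - V y) i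
  have h2 := norm_field_sub_le_realMax hV x y
  have h3 : dist (displace V x) (displace V y) ≤ (K + 1) * dist x y := by
    refine h1.trans ((add_le_add le_rfl h2).trans (le_of_eq ?_))
    rw [hK]; ring
  exact h3.trans (mul_le_mul_of_nonneg_right (Real.add_one_le_exp K) dist_nonneg)

/-! ### A pointwise estimate from the Gagliardo seminorm -/

/-- The pointwise Gagliardo quotient. -/
noncomputable def gagliardoAt (α p : ℝ) (f : Torus d → ℝ) (x : Torus d) : ENNReal :=
  ∫⁻ h in cube d 1, ENNReal.ofReal (|f (x + proj h) - f x| ^ p / ‖h‖ ^ ((d : ℝ) + p * α))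

lemma measurable_gagliardo_integrand (α p : ℝ) {f : Torus d → ℝ} (hf : Measurable f) :
    Measurable fun z : Torus d × Euc d =>
      ENNReal.ofReal (|f (z.1 + proj z.2) - f z.1| ^ p / ‖z.2‖ ^ ((d : ℝ) + p * α)) := by
  have h1 : Measurable fun z : Torus d × Euc d => f (z.1 + proj z.2) := by fun_prop
  have h2 : Measurable fun z : Torus d × Euc d => |f (z.1 + proj z.2) - f z.1| :=
    (h1.sub (hf.comp measurable_fst)).abs
  exact ((h2.pow_const p).div ((measurable_snd.norm).pow_const _)).ennreal_ofReal

lemma measurable_gagliardoAt (α p : ℝ) {f : Torus d → ℝ} (hf : Measurable f) :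
    Measurable (gagliardoAt α p f) :=
  (measurable_gagliardo_integrand α p hf).lintegral_prod_right'

lemma lintegral_gagliardoAt (α p : ℝ) {f : Torus d → ℝ} (hf : Measurable f) :
    ∫⁻ x, gagliardoAt α p f x = gagliardoPow α p f := by
  unfold gagliardoAt
  rw [lintegral_lintegral_swap (measurable_gagliardo_integrand α p hf).aemeasurable]
  rfl

/-- The weight `‖h‖ ^ (d/p + α)` is bounded by its size on the cube, and Hölder's inequality on the
cube bounds the remaining quotient by its `L^p` norm, which is the pointwise Gagliardo quotient. -/
lemma setLIntegral_cube_abs_sub_le {f : Torus d → ℝ} (hf : Measurable f) {α p : ℝ} (hα : 0 < α)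
    (hp : 1 ≤ p) (x : Torus d) {ρ : ℝ} (hρ : 0 < ρ) (hρ1 : ρ ≤ 1) :
    ∫⁻ h in cube d ρ, ENNReal.ofReal |f (x + proj h) - f x| ≤
      ENNReal.ofReal ((√d * ρ) ^ (d / p + α) * ρ ^ (d * (1 - 1 / p))) *
        gagliardoAt α p f x ^ (1 / p) := by
  have hp0 : 0 < p := by linarith
  set E : ℝ := d / p + α with hE
  have hE0 : 0 < E := by positivity
  set k : Euc d → ENNReal := fun h => ENNReal.ofReal (|f (x + proj h) - f x| / ‖h‖ ^ E) with hk
  have hfm : Measurable fun h : Euc d => f (x + proj h) := by fun_prop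
  have hkm : Measurable k :=
    (((hfm.sub_const _).abs).div (measurable_norm.pow_const _)).ennreal_ofReal
  have h1 : ∫⁻ h in cube d ρ, ENNReal.ofReal |f (x + proj h) - f x| ≤
      ∫⁻ h in cube d ρ, ENNReal.ofReal ((√d * ρ) ^ E) * k h := by
    refine setLIntegral_mono' (measurableSet_cube ρ) fun h hh => ?_
    rw [hk, ← ENNReal.ofReal_mul (by positivity)]
    refine ENNReal.ofReal_le_ofReal ?_
    rcases eq_or_lt_of_le (norm_nonneg h) with h0 | h0
    · have : h = 0 := norm_eq_zero.1 h0.symm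
      rw [this]; simp only [proj_zero, add_zero, sub_self, abs_zero]; positivity
    · rw [mul_div_assoc', le_div_iff₀ (by positivity), mul_comm]
      gcongr
      exact norm_le_sqrt_of_mem_cube hh
  have h2 : ∫⁻ h in cube d ρ, k h ≤
      gagliardoAt α p f x ^ (1 / p) * ENNReal.ofReal (ρ ^ (d * (1 - 1 / p))) := by
    have h3 := eLpNorm'_le_eLpNorm'_mul_rpow_measure_univ (f := k)
      (μ := volume.restrict (cube d ρ)) zero_lt_one hp hkm.aestronglyMeasurable
    simp only [eLpNorm', enorm_eq_self, ENNReal.rpow_one, div_one, Measure.restrict_apply_univ,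
      volume_cube] at h3
    refine h3.trans (mul_le_mul' ?_ ?_)
    · refine ENNReal.rpow_le_rpow ?_ (by positivity)
      have hsub : cube d ρ ⊆ cube d 1 := fun h hh i => ⟨(hh i).1, (hh i).2.trans hρ1⟩
      refine (lintegral_mono_set hsub).trans (lintegral_mono fun h => le_of_eq ?_)
      rw [hk, ENNReal.ofReal_rpow_of_nonneg (by positivity) hp0.le,
        Real.div_rpow (abs_nonneg _) (by positivity), ← Real.rpow_mul (norm_nonneg _)]
      congr 3
      rw [hE]; field_simp
    · rw [← ENNReal.ofReal_pow hρ.le, ENNReal.ofReal_rpow_of_nonneg (by positivity)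
        (by have := (div_le_one hp0).2 hp; linarith), ← Real.rpow_natCast, ← Real.rpow_mul hρ.le]
  calc _ ≤ ∫⁻ h in cube d ρ, ENNReal.ofReal ((√d * ρ) ^ E) * k h := h1
    _ = ENNReal.ofReal ((√d * ρ) ^ E) * ∫⁻ h in cube d ρ, k h := lintegral_const_mul _ hkm
    _ ≤ ENNReal.ofReal ((√d * ρ) ^ E) * (gagliardoAt α p f x ^ (1 / p) *
          ENNReal.ofReal (ρ ^ (d * (1 - 1 / p)))) := by gcongr
    _ = _ := by rw [ENNReal.ofReal_mul (by positivity)]; ring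

/-- The pointwise Hajłasz type estimate. -/
lemma exists_abs_sub_le_gagliardoAt (d : ℕ) {α p : ℝ} (hα : 0 < α) (hp : 1 ≤ p) :
    ∃ C : ℝ, 0 ≤ C ∧ ∀ f : Torus d → ℝ, Measurable f → ∀ x y : Torus d,
      ENNReal.ofReal |f x - f y| ≤ ENNReal.ofReal (C * dist x y ^ α) *
        (gagliardoAt α p f x ^ (1 / p) + gagliardoAt α p f y ^ (1 / p)) := by
  have hp0 : 0 < p := by linarith
  refine ⟨(√d * 2) ^ (d / p + α) * 2 ^ (d * (1 - 1 / p)), by positivity, fun f hf x y => ?_⟩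
  rcases eq_or_lt_of_le (dist_nonneg (x := x) (y := y)) with h0 | h0
  · rw [dist_eq_zero.1 h0.symm]; simp
  set r := dist x y
  have hr1 : 2 * r ≤ 1 := by have := dist_torus_le_half x y; linarith
  have h1 := mul_dist_pow_le (A := fun z => ENNReal.ofReal |f z - f x|)
    (B := fun z => ENNReal.ofReal |f z - f y|) (c := ENNReal.ofReal |f x - f y|)
    ((hf.sub_const _).abs.ennreal_ofReal)
    (fun z => by
      rw [← ENNReal.ofReal_add (abs_nonneg _) (abs_nonneg _)]
      refine ENNReal.ofReal_le_ofReal ?_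
      have : f x - f y = (f z - f y) - (f z - f x) := by ring
      rw [this, add_comm]
      exact abs_sub _ _) x y
  have h2 := h1.trans (add_le_add (setLIntegral_cube_abs_sub_le hf hα hp x (by positivity) hr1)
    (setLIntegral_cube_abs_sub_le hf hα hp y (by positivity) hr1))
  rw [← mul_add] at h2
  have hrd : (0 : ℝ) < r ^ d := by positivity
  have hrd0 : ENNReal.ofReal r ^ d ≠ 0 := pow_ne_zero _ (by simpa using h0)
  have hrd1 : ENNReal.ofReal r ^ d ≠ ⊤ := ENNReal.pow_ne_top ENNReal.ofReal_ne_top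
  -- Power count: the exponents `d/p + α` and `d (1 - 1/p)` add up to `α + d`, and `r ^ d` cancels
  -- against the volume of the common cube.
  have h3 : (√d * (2 * r)) ^ (d / p + α) * (2 * r) ^ (d * (1 - 1 / p)) =
      (√d * 2) ^ (d / p + α) * 2 ^ (d * (1 - 1 / p)) * r ^ α * r ^ d := by
    rw [← mul_assoc, Real.mul_rpow (by positivity) h0.le, Real.mul_rpow (by norm_num) h0.le]
    have : r ^ (d / p + α) * r ^ (d * (1 - 1 / p)) = r ^ α * r ^ d := by
      rw [← Real.rpow_natCast r d, ← Real.rpow_add h0, ← Real.rpow_add h0]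
      congr 1
      field_simp; ring
    linear_combination (√d * 2) ^ (d / p + α) * 2 ^ (d * (1 - 1 / p)) * this
  rw [h3, ENNReal.ofReal_mul (by positivity), ENNReal.ofReal_pow h0.le, mul_right_comm] at h2
  exact (ENNReal.mul_le_mul_iff_left hrd0 hrd1).1 h2

/-! ### Mollification by powers of a trigonometric bump -/

/-- The cosine on the circle. -/
noncomputable def circleCos (x : UnitAddCircle) : ℝ := (fourier 1 x : ℂ).re

/-- The sine on the circle. -/
noncomputable def circleSin (x : UnitAddCircle) : ℝ := (fourier 1 x : ℂ).im

lemma fourier_one_coe (x : ℝ) :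
    (fourier 1 (x : UnitAddCircle) : ℂ) = Complex.exp ((2 * Real.pi * x : ℝ) * Complex.I) := by
  rw [fourier_coe_apply]
  congr 1
  push_cast
  ring

lemma circleCos_coe (x : ℝ) : circleCos (x : UnitAddCircle) = Real.cos (2 * Real.pi * x) := by
  rw [circleCos, fourier_one_coe, Complex.exp_ofReal_mul_I_re]

lemma circleSin_coe (x : ℝ) : circleSin (x : UnitAddCircle) = Real.sin (2 * Real.pi * x) := by
  rw [circleSin, fourier_one_coe, Complex.exp_ofReal_mul_I_im]

lemma circleCos_sub (x y : UnitAddCircle) :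
    circleCos (x - y) = circleCos x * circleCos y + circleSin x * circleSin y := by
  induction x using QuotientAddGroup.induction_on with | _ a
  induction y using QuotientAddGroup.induction_on with | _ b
  have : ((a : UnitAddCircle) - b) = ((a - b : ℝ) : UnitAddCircle) := rfl
  show circleCos ((a : UnitAddCircle) - (b : UnitAddCircle)) = circleCos (a : UnitAddCircle) *
    circleCos (b : UnitAddCircle) + circleSin (a : UnitAddCircle) * circleSin (b : UnitAddCircle)
  rw [this, circleCos_coe, circleCos_coe, circleCos_coe, circleSin_coe, circleSin_coe, mul_sub,
    Real.cos_sub]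

lemma circleCos_le_one (x : UnitAddCircle) : circleCos x ≤ 1 := by
  induction x using QuotientAddGroup.induction_on with | _ a
  exact (circleCos_coe a).le.trans (Real.cos_le_one _)

lemma neg_one_le_circleCos (x : UnitAddCircle) : -1 ≤ circleCos x := by
  induction x using QuotientAddGroup.induction_on with | _ a
  exact (Real.neg_one_le_cos _).trans (circleCos_coe a).ge

lemma circleCos_zero : circleCos 0 = 1 := by simp [circleCos]

lemma eq_zero_of_circleCos_eq_one {x : UnitAddCircle} (h : circleCos x = 1) : x = 0 := by
  induction x using QuotientAddGroup.induction_on with | _ a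
  have h1 : Real.cos (2 * Real.pi * a) = 1 := (circleCos_coe a).symm.trans h
  obtain ⟨k, hk⟩ := (Real.cos_eq_one_iff _).1 h1
  have h2 : a = k := by
    have := Real.pi_pos
    have h3 : (k : ℝ) * (2 * Real.pi) = a * (2 * Real.pi) := by rw [hk]; ring
    exact (mul_right_cancel₀ (by positivity) h3).symm
  exact (AddCircle.coe_eq_zero_iff (1 : ℝ)).2 ⟨k, by simp [h2]⟩

/-- The trigonometric bump. -/
noncomputable def bump (x : Torus d) : ℝ := ∏ i, (1 + circleCos (x i)) / 2

lemma isSmooth_circleCos (i : Fin d) : IsSmoothOnTorus fun x : Torus d => circleCos (x i) := by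
  unfold IsSmoothOnTorus
  simp only [circleCos_coe]
  fun_prop

lemma isSmooth_circleSin (i : Fin d) : IsSmoothOnTorus fun x : Torus d => circleSin (x i) := by
  unfold IsSmoothOnTorus
  simp only [circleSin_coe]
  fun_prop

/-- Finite sums of products of smooth functions of two variables. -/
def IsSeparable (k : Torus d → Torus d → ℝ) : Prop :=
  ∃ (ι : Type) (_ : Fintype ι) (g h : ι → Torus d → ℝ), (∀ j, IsSmoothOnTorus (g j)) ∧
    (∀ j, IsSmoothOnTorus (h j)) ∧ ∀ x y, k x y = ∑ j, g j x * h j y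

lemma IsSeparable.of_mul {g h : Torus d → ℝ} (hg : IsSmoothOnTorus g) (hh : IsSmoothOnTorus h) :
    IsSeparable fun x y => g x * h y :=
  ⟨Unit, inferInstance, fun _ => g, fun _ => h, fun _ => hg, fun _ => hh, by simp⟩

lemma IsSeparable.add {k l : Torus d → Torus d → ℝ} (hk : IsSeparable k) (hl : IsSeparable l) :
    IsSeparable fun x y => k x y + l x y := by
  obtain ⟨ι, _, g, h, hg, hh, hk⟩ := hk
  obtain ⟨ι', _, g', h', hg', hh', hl⟩ := hl
  refine ⟨ι ⊕ ι', inferInstance, Sum.elim g g', Sum.elim h h', ?_, ?_, fun x y => ?_⟩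
  · rintro (j | j) <;> simp [hg, hg']
  · rintro (j | j) <;> simp [hh, hh']
  · simp [hk, hl]

lemma IsSeparable.mul {k l : Torus d → Torus d → ℝ} (hk : IsSeparable k) (hl : IsSeparable l) :
    IsSeparable fun x y => k x y * l x y := by
  obtain ⟨ι, _, g, h, hg, hh, hk⟩ := hk
  obtain ⟨ι', _, g', h', hg', hh', hl⟩ := hl
  refine ⟨ι × ι', inferInstance, fun j x => g j.1 x * g' j.2 x, fun j x => h j.1 x * h' j.2 x,
    fun j => (hg j.1).mul (hg' j.2), fun j => (hh j.1).mul (hh' j.2), fun x y => ?_⟩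
  simp only [hk, hl]
  rw [Finset.sum_mul_sum, Fintype.sum_prod_type]
  refine Finset.sum_congr rfl fun i _ => Finset.sum_congr rfl fun j _ => ?_
  ring

lemma IsSeparable.const (c : ℝ) : IsSeparable fun _ _ : Torus d => c := by
  simpa using IsSeparable.of_mul (isSmooth_const c) (isSmooth_const (d := d) 1)

lemma IsSeparable.prod {ι : Type*} (s : Finset ι) {k : ι → Torus d → Torus d → ℝ}
    (hk : ∀ j ∈ s, IsSeparable (k j)) : IsSeparable fun x y => ∏ j ∈ s, k j x y := by
  classical
  induction s using Finset.induction_on with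
  | empty => simpa using IsSeparable.const 1
  | insert a s ha ih =>
    simp only [Finset.prod_insert ha]
    exact (hk a (by simp)).mul (ih fun j hj => hk j (by simp [hj]))

lemma IsSeparable.pow {k : Torus d → Torus d → ℝ} (hk : IsSeparable k) (n : ℕ) :
    IsSeparable fun x y => k x y ^ n := by
  simpa using IsSeparable.prod (Finset.range n) (fun _ _ => hk)

/-- The addition formula for the cosine makes the kernel a finite sum of products. Mollification
therefore has finite rank, and smoothness, joint measurability and weak limits of mollifications
reduce to finitely many scalar integrals. -/
lemma isSeparable_bump : IsSeparable fun x y : Torus d => bump (x - y) := by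
  unfold bump
  refine IsSeparable.prod _ fun i _ => ?_
  simp only [Pi.sub_apply, circleCos_sub]
  have h1 := IsSeparable.of_mul (isSmooth_circleCos i) (isSmooth_circleCos i)
  have h2 := IsSeparable.of_mul (isSmooth_circleSin i) (isSmooth_circleSin i)
  have := ((IsSeparable.const (d := d) 1).add (h1.add h2)).mul (IsSeparable.const (1 / 2))
  convert this using 3
  ring

lemma bump_nonneg (x : Torus d) : 0 ≤ bump x :=
  Finset.prod_nonneg fun i _ => by have := neg_one_le_circleCos (x i); linarith

lemma bump_zero : bump (0 : Torus d) = 1 := by simp [bump, circleCos_zero]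

lemma bump_lt_one {x : Torus d} (hx : x ≠ 0) : bump x < 1 := by
  obtain ⟨i, hi⟩ := Function.ne_iff.1 hx
  have h1 : ∀ j, (1 + circleCos (x j)) / 2 ≤ 1 := fun j => by
    have := circleCos_le_one (x j); linarith
  have h0 : ∀ j, 0 ≤ (1 + circleCos (x j)) / 2 := fun j => by
    have := neg_one_le_circleCos (x j); linarith
  have h2 : circleCos (x i) < 1 :=
    lt_of_le_of_ne (circleCos_le_one _) fun h => hi (eq_zero_of_circleCos_eq_one h)
  rw [bump, ← Finset.mul_prod_erase _ _ (Finset.mem_univ i)]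
  have h3 : ∏ j ∈ Finset.univ.erase i, (1 + circleCos (x j)) / 2 ≤ 1 :=
    Finset.prod_le_one (fun j _ => h0 j) fun j _ => h1 j
  calc _ ≤ (1 + circleCos (x i)) / 2 * 1 := by gcongr; exact h0 i
    _ < 1 := by linarith

lemma isSmooth_bump : IsSmoothOnTorus (bump : Torus d → ℝ) := by
  unfold IsSmoothOnTorus bump
  simp only [circleCos_coe]
  fun_prop

lemma integral_bump_pow_pos (n : ℕ) : 0 < ∫ x : Torus d, bump x ^ n := by
  have hc : Continuous fun x : Torus d => bump x ^ n := isSmooth_bump.continuous.pow n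
  refine hc.integral_pos_of_hasCompactSupport_nonneg_nonzero (HasCompactSupport.of_compactSpace _)
    (fun x => pow_nonneg (bump_nonneg x) n) (x := 0) (by simp [bump_zero])

/-- The mollifying kernel. -/
noncomputable def kernel (n : ℕ) (x : Torus d) : ℝ := (∫ y : Torus d, bump y ^ n)⁻¹ * bump x ^ n

lemma kernel_nonneg (n : ℕ) (x : Torus d) : 0 ≤ kernel n x :=
  mul_nonneg (inv_nonneg.2 (integral_bump_pow_pos n).le) (pow_nonneg (bump_nonneg x) n)

lemma continuous_kernel (n : ℕ) : Continuous (kernel n : Torus d → ℝ) :=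
  continuous_const.mul (isSmooth_bump.continuous.pow n)

lemma integral_kernel (n : ℕ) : ∫ x : Torus d, kernel n x = 1 := by
  unfold kernel
  rw [integral_const_mul, inv_mul_cancel₀ (integral_bump_pow_pos n).ne']

lemma isSeparable_kernel (n : ℕ) : IsSeparable fun x y : Torus d => kernel n (x - y) :=
  (IsSeparable.const _).mul (isSeparable_bump.pow n)

lemma isSmooth_kernel (n : ℕ) : IsSmoothOnTorus (kernel n : Torus d → ℝ) := by
  have h : IsSmoothOnTorus fun x : Torus d => bump x ^ n := ContDiff.pow isSmooth_bump n
  exact h.const_mul _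

/-- The bump has a strict maximum at the origin, so its normalised powers concentrate there. -/
lemma tendsto_integral_kernel_mul {G : Torus d → ℝ} (hG : Continuous G) :
    Filter.Tendsto (fun n => ∫ y, kernel n y * G y) Filter.atTop (nhds (G 0)) := by
  have h := tendsto_setIntegral_pow_smul_of_unique_maximum_of_isCompact_of_continuousOn
    (μ := (volume : Measure (Torus d))) isCompact_univ (c := bump) (x₀ := 0) (g := G)
    isSmooth_bump.continuous.continuousOn (fun y _ hy => by rw [bump_zero]; exact bump_lt_one hy)
    (fun x _ => bump_nonneg x) (by simp [bump_zero]) (by simp) hG.continuousOn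
  refine h.congr fun n => ?_
  simp only [Measure.restrict_univ, smul_eq_mul, kernel]
  rw [← integral_const_mul]
  simp only [mul_assoc]

instance : (volume : Measure (Torus d)).IsNegInvariant :=
  Measure.IsAddHaarMeasure.isNegInvariant_of_regular _

section Moll

variable {X : Type*} [NormedAddCommGroup X] [NormedSpace ℝ X]

/-- Mollification. -/
noncomputable def moll (n : ℕ) (f : Torus d → X) (x : Torus d) : X := ∫ y, kernel n (x - y) • f y

lemma continuous_kernel_sub (n : ℕ) (x : Torus d) : Continuous fun y => kernel n (x - y) :=
  (continuous_kernel n).comp (continuous_const.sub continuous_id)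

lemma integrable_kernel_smul (n : ℕ) (x : Torus d) {f : Torus d → X} (hf : Integrable f) :
    Integrable fun y => kernel n (x - y) • f y := by
  obtain ⟨C, -, hC⟩ := exists_bound_of_continuous (continuous_kernel_sub n x)
  exact hf.bdd_smul C (continuous_kernel_sub n x).aestronglyMeasurable
    (Filter.Eventually.of_forall hC)

lemma integral_kernel_sub (n : ℕ) (x : Torus d) : ∫ y, kernel n (x - y) = 1 := by
  rw [integral_sub_left_eq_self (kernel n) volume x, integral_kernel]

/-- The probability measure with density `y ↦ κ_n(x - y)`. -/
noncomputable def kernelMeasure (n : ℕ) (x : Torus d) : Measure (Torus d) :=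
  volume.withDensity fun y => ENNReal.ofReal (kernel n (x - y))

lemma measurable_kernel_sub (n : ℕ) (x : Torus d) :
    Measurable fun y => ENNReal.ofReal (kernel n (x - y)) :=
  (continuous_kernel_sub n x).measurable.ennreal_ofReal

lemma lintegral_kernel_sub (n : ℕ) (x : Torus d) : ∫⁻ y, ENNReal.ofReal (kernel n (x - y)) = 1 := by
  rw [← ofReal_integral_eq_lintegral_ofReal
    (integrable_of_continuous (continuous_kernel_sub n x))
    (Filter.Eventually.of_forall fun _ => kernel_nonneg _ _), integral_kernel_sub,
    ENNReal.ofReal_one]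

lemma lintegral_kernel_sub' (n : ℕ) (y : Torus d) :
    ∫⁻ x, ENNReal.ofReal (kernel n (x - y)) = 1 := by
  rw [lintegral_sub_right_eq_self (fun x => ENNReal.ofReal (kernel n x)) y,
    ← ofReal_integral_eq_lintegral_ofReal (integrable_of_continuous (continuous_kernel n))
    (Filter.Eventually.of_forall fun _ => kernel_nonneg _ _), integral_kernel, ENNReal.ofReal_one]

instance (n : ℕ) (x : Torus d) : IsProbabilityMeasure (kernelMeasure n x) := by
  refine ⟨?_⟩
  rw [kernelMeasure, withDensity_apply _ MeasurableSet.univ, Measure.restrict_univ,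
    lintegral_kernel_sub]

lemma moll_eq_integral_kernelMeasure (n : ℕ) (f : Torus d → X) (x : Torus d) :
    moll n f x = ∫ y, f y ∂(kernelMeasure n x) := by
  rw [kernelMeasure, integral_withDensity_eq_integral_toReal_smul (measurable_kernel_sub n x)
    (Filter.Eventually.of_forall fun _ => ENNReal.ofReal_lt_top)]
  simp only [ENNReal.toReal_ofReal (kernel_nonneg _ _), moll]

lemma lintegral_kernelMeasure (n : ℕ) (x : Torus d) (F : Torus d → ENNReal) :
    ∫⁻ y, F y ∂(kernelMeasure n x) = ∫⁻ y, ENNReal.ofReal (kernel n (x - y)) * F y := by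
  rw [kernelMeasure, lintegral_withDensity_eq_lintegral_mul_non_measurable _
    (measurable_kernel_sub n x) (Filter.Eventually.of_forall fun _ => ENNReal.ofReal_lt_top)]
  rfl

lemma kernelMeasure_absolutelyContinuous (n : ℕ) (x : Torus d) :
    kernelMeasure n x ≪ volume := withDensity_absolutelyContinuous _ _

lemma integrable_kernelMeasure (n : ℕ) (x : Torus d) {f : Torus d → X} (hf : Integrable f) :
    Integrable f (kernelMeasure n x) := by
  rw [kernelMeasure, integrable_withDensity_iff_integrable_smul' (measurable_kernel_sub n x)
    (Filter.Eventually.of_forall fun _ => ENNReal.ofReal_lt_top)]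
  simpa only [ENNReal.toReal_ofReal (kernel_nonneg _ _)] using integrable_kernel_smul n x hf

/-- Averaging in `x` the kernel measures gives the Haar measure. -/
lemma lintegral_lintegral_kernelMeasure (n : ℕ) {F : Torus d → ENNReal} (hF : AEMeasurable F) :
    ∫⁻ x, ∫⁻ y, F y ∂(kernelMeasure n x) = ∫⁻ y, F y := by
  simp only [lintegral_kernelMeasure]
  rw [lintegral_lintegral_swap]
  · refine lintegral_congr fun y => ?_
    have hm : Measurable fun x => ENNReal.ofReal (kernel n (x - y)) :=
      ((continuous_kernel n).comp (continuous_id.sub continuous_const)).measurable.ennreal_ofReal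
    rw [lintegral_mul_const _ hm, lintegral_kernel_sub', one_mul]
  · have hm : Measurable fun z : Torus d × Torus d => ENNReal.ofReal (kernel n (z.1 - z.2)) :=
      ((continuous_kernel n).comp (continuous_fst.sub continuous_snd)).measurable.ennreal_ofReal
    exact hm.aemeasurable.mul (hF.comp_quasiMeasurePreserving Measure.quasiMeasurePreserving_snd)

end Moll

/-- Jensen's inequality for a convex function of the norm. -/
lemma ofReal_comp_norm_integral_le {Ω X : Type*} [MeasurableSpace Ω] [NormedAddCommGroup X]
    [NormedSpace ℝ X] {μ : Measure Ω} [IsProbabilityMeasure μ] {f : Ω → X} (hf : Integrable f μ)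
    {ψ : ℝ → ℝ} (hψ : ConvexOn ℝ (Ici 0) ψ) (hψc : Continuous ψ) (hψm : MonotoneOn ψ (Ici 0))
    (hψ0 : ∀ x, 0 ≤ x → 0 ≤ ψ x) :
    ENNReal.ofReal (ψ ‖∫ x, f x ∂μ‖) ≤ ∫⁻ x, ENNReal.ofReal (ψ ‖f x‖) ∂μ := by
  by_cases hfin : ∫⁻ x, ENNReal.ofReal (ψ ‖f x‖) ∂μ = ⊤
  · rw [hfin]; exact le_top
  have hm : AEStronglyMeasurable (fun x => ψ ‖f x‖) μ :=
    hψc.comp_aestronglyMeasurable hf.1.norm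
  have hint : Integrable (fun x => ψ ‖f x‖) μ := by
    refine ⟨hm, ?_⟩
    rw [hasFiniteIntegral_iff_ofReal (Filter.Eventually.of_forall fun x => hψ0 _ (norm_nonneg _))]
    exact lt_top_iff_ne_top.2 hfin
  rw [← ofReal_integral_eq_lintegral_ofReal hint
    (Filter.Eventually.of_forall fun x => hψ0 _ (norm_nonneg _))]
  refine ENNReal.ofReal_le_ofReal ?_
  have h1 := hψ.map_integral_le hψc.continuousOn isClosed_Ici
    (Filter.Eventually.of_forall fun x => mem_Ici.2 (norm_nonneg (f x))) hf.norm hint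
  refine le_trans (hψm (norm_nonneg _) ?_ (norm_integral_le_integral_norm f)) h1
  exact mem_Ici.2 (integral_nonneg fun x => norm_nonneg (f x))

lemma ofReal_norm_integral_rpow_le {Ω X : Type*} [MeasurableSpace Ω] [NormedAddCommGroup X]
    [NormedSpace ℝ X] {μ : Measure Ω} [IsProbabilityMeasure μ] {f : Ω → X} (hf : Integrable f μ)
    {p : ℝ} (hp : 1 ≤ p) :
    ENNReal.ofReal (‖∫ x, f x ∂μ‖ ^ p) ≤ ∫⁻ x, ENNReal.ofReal (‖f x‖ ^ p) ∂μ :=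
  ofReal_comp_norm_integral_le (ψ := fun x => x ^ p) hf (convexOn_rpow hp)
    (Real.continuous_rpow_const (by linarith))
    (fun x hx y _ hxy => Real.rpow_le_rpow hx hxy (by linarith)) fun x hx => Real.rpow_nonneg hx _

section Moll

variable {X : Type*} [NormedAddCommGroup X] [NormedSpace ℝ X]

lemma continuous_moll (n : ℕ) {f : Torus d → X} (hf : Integrable f) : Continuous (moll n f) := by
  obtain ⟨C, -, hC⟩ := exists_bound_of_continuous (continuous_kernel (d := d) n)
  refine continuous_of_dominated (bound := fun y => C * ‖f y‖)
    (fun x => (integrable_kernel_smul n x hf).1)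
    (fun x => Filter.Eventually.of_forall fun y => ?_) (hf.norm.const_mul C)
    (Filter.Eventually.of_forall fun y => ?_)
  · rw [norm_smul]; gcongr; exact hC _
  · exact ((continuous_kernel n).comp (continuous_id.sub continuous_const)).smul continuous_const

/-- Jensen's inequality for the probability measures `kernelMeasure n x`, whose average over `x` is
the Haar measure. A general convex `ψ` is allowed because both powers and exponentials are needed.
-/
lemma lintegral_moll_comp_le (n : ℕ) {f : Torus d → X} (hf : Integrable f)
    {ψ : ℝ → ℝ} (hψ : ConvexOn ℝ (Ici 0) ψ) (hψc : Continuous ψ) (hψm : MonotoneOn ψ (Ici 0))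
    (hψ0 : ∀ x, 0 ≤ x → 0 ≤ ψ x) :
    ∫⁻ x, ENNReal.ofReal (ψ ‖moll n f x‖) ≤ ∫⁻ x, ENNReal.ofReal (ψ ‖f x‖) := by
  have hm : AEMeasurable (fun x => ENNReal.ofReal (ψ ‖f x‖)) :=
    (hψc.measurable.comp_aemeasurable hf.1.norm.aemeasurable).ennreal_ofReal
  rw [← lintegral_lintegral_kernelMeasure n hm]
  refine lintegral_mono fun x => ?_
  rw [moll_eq_integral_kernelMeasure]
  exact ofReal_comp_norm_integral_le (integrable_kernelMeasure n x hf) hψ hψc hψm hψ0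

lemma lintegral_moll_rpow_le (n : ℕ) {f : Torus d → X} (hf : Integrable f) {p : ℝ} (hp : 1 ≤ p) :
    ∫⁻ x, ENNReal.ofReal (‖moll n f x‖ ^ p) ≤ ∫⁻ x, ENNReal.ofReal (‖f x‖ ^ p) :=
  lintegral_moll_comp_le (ψ := fun x => x ^ p) n hf (convexOn_rpow hp)
    (Real.continuous_rpow_const (by linarith))
    (fun x hx y _ hxy => Real.rpow_le_rpow hx hxy (by linarith)) fun x hx => Real.rpow_nonneg hx _

lemma norm_moll_le (n : ℕ) {f : Torus d → X} {M : ℝ} (hM : ∀ᵐ x, ‖f x‖ ≤ M) (x : Torus d) :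
    ‖moll n f x‖ ≤ M := by
  rw [moll_eq_integral_kernelMeasure]
  have h := norm_integral_le_of_norm_le_const (μ := kernelMeasure n x)
    ((kernelMeasure_absolutelyContinuous n x).ae_le hM)
  simpa using h

lemma moll_sub (n : ℕ) {f g : Torus d → X} (hf : Integrable f) (hg : Integrable g) (x : Torus d) :
    moll n (fun y => f y - g y) x = moll n f x - moll n g x := by
  simp only [moll, smul_sub]
  exact integral_sub (integrable_kernel_smul n x hf) (integrable_kernel_smul n x hg)

lemma moll_comp_add (n : ℕ) (f : Torus d → X) (a x : Torus d) :
    moll n (fun y => f (y + a)) x = moll n f (x + a) := by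
  simp only [moll]
  rw [← integral_add_right_eq_self (fun y => kernel n (x + a - y) • f y) a]
  simp

lemma moll_eq_integral_sub (n : ℕ) (f : Torus d → X) (x : Torus d) :
    moll n f x = ∫ y, kernel n y • f (x - y) := by
  rw [← integral_sub_left_eq_self (fun y => kernel n y • f (x - y)) volume x]
  simp [moll]

end Moll

lemma moll_apply_euc {n : ℕ} {f : Torus d → Euc d} (hf : Integrable f) (x : Torus d) (i : Fin d) :
    moll n f x i = moll n (fun y => f y i) x := by
  have := (EuclideanSpace.proj (𝕜 := ℝ) i).integral_comp_comm (integrable_kernel_smul n x hf)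
  simpa [moll] using this.symm

lemma integrable_coord {Ω : Type*} [MeasurableSpace Ω] {μ : Measure Ω} {f : Ω → Euc d}
    (hf : Integrable f μ) (i : Fin d) : Integrable (fun y => f y i) μ :=
  (EuclideanSpace.proj (𝕜 := ℝ) i).integrable_comp hf

/-- Smoothness and quantitative bounds of mollifications. -/
lemma exists_moll_eq_sum (d n : ℕ) : ∃ (ι : Type) (_ : Fintype ι) (g h : ι → Torus d → ℝ),
    (∀ j, IsSmoothOnTorus (g j)) ∧ (∀ j, IsSmoothOnTorus (h j)) ∧
    (∀ x y, kernel n (x - y) = ∑ j, g j x * h j y) ∧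
    ∀ f : Torus d → ℝ, Integrable f → moll n f = fun x => ∑ j, (∫ y, h j y * f y) * g j x := by
  obtain ⟨ι, hι, g, h, hg, hh, hk⟩ := isSeparable_kernel (d := d) n
  refine ⟨ι, hι, g, h, hg, hh, hk, fun f hf => funext fun x => ?_⟩
  simp only [moll, hk, smul_eq_mul, Finset.sum_mul]
  rw [integral_finsetSum]
  · refine Finset.sum_congr rfl fun j _ => ?_
    rw [← integral_mul_const]
    refine integral_congr_ae (Filter.Eventually.of_forall fun y => ?_)
    simp only; ring
  · intro j _
    have := (Continuous.integrable_mul hf (hh j).continuous).const_mul (g j x)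
    refine this.congr (Filter.Eventually.of_forall fun y => ?_)
    simp only; ring

lemma isSmooth_moll (n : ℕ) {f : Torus d → ℝ} (hf : Integrable f) :
    IsSmoothOnTorus (moll n f) := by
  obtain ⟨ι, _, g, h, hg, -, -, hm⟩ := exists_moll_eq_sum d n
  rw [hm f hf]
  exact IsSmoothOnTorus.sum _ fun j _ => (hg j).const_mul _

lemma isSmooth_kernel_sub_left (n : ℕ) (x : Torus d) :
    IsSmoothOnTorus fun y : Torus d => kernel n (x - y) := by
  obtain ⟨ι, _, g, h, -, hh, hk⟩ := isSeparable_kernel (d := d) n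
  simp only [hk]
  exact IsSmoothOnTorus.sum _ fun j _ => (hh j).const_mul _

lemma torusPartial_kernel_sub (n : ℕ) (i : Fin d) (x y : Torus d) :
    torusPartial (fun y => kernel n (x - y)) i y =
      - torusPartial (fun x => kernel n (x - y)) i x := by
  have hsm : IsSmoothOnTorus fun x => kernel n (x - y) := by
    simpa [sub_eq_add_neg] using (isSmooth_kernel n).comp_add (-y)
  have h1 := hasDerivAt_torusPartial hsm i x
  have h2 := hasDerivAt_neg (0 : ℝ)
  have h1' : HasDerivAt (fun s : ℝ => kernel n (x + Pi.single i (s : UnitAddCircle) - y))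
      (torusPartial (fun x => kernel n (x - y)) i x) (-0) := by simpa using h1
  have h3 := h1'.comp (0 : ℝ) h2
  have h4 := h3.deriv
  rw [mul_neg_one] at h4
  rw [← h4]
  simp only [torusPartial]
  congr 1
  funext s
  simp only [Function.comp_apply]
  congr 1
  have : (Pi.single i (((-s : ℝ)) : UnitAddCircle) : Torus d) =
      - Pi.single i (s : UnitAddCircle) := by
    rw [← Pi.single_neg]; rfl
  rw [this]
  abel

/-- Mollification commutes with weak differentiation. -/
lemma torusPartial_moll (n : ℕ) {f : Torus d → ℝ} {g : Torus d → Euc d} (hfg : IsWeakGrad f g)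
    (i : Fin d) (x : Torus d) : torusPartial (moll n f) i x = moll n (fun y => g y i) x := by
  obtain ⟨ι, _, G, H, hG, hH, hk, hm⟩ := exists_moll_eq_sum d n
  have h1 := hfg.integral_eq _ (isSmooth_kernel_sub_left n x) i
  have h2 : ∀ y, torusPartial (fun x => kernel n (x - y)) i x =
      ∑ j, H j y * torusPartial (G j) i x := by
    intro y
    have : (fun x => kernel n (x - y)) = fun x => ∑ j, H j y * G j x := by
      funext x; rw [hk]; simp only [mul_comm]
    rw [this, torusPartial_sum _ fun j _ => (hG j).const_mul _]
    exact Finset.sum_congr rfl fun j _ => torusPartial_const_mul (hG j) _ _ _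
  rw [hm f hfg.integrable_fun, torusPartial_sum _ fun j _ => (hG j).const_mul _]
  simp only [torusPartial_const_mul (hG _)]
  have h3 : ∑ j, (∫ y, H j y * f y) * torusPartial (G j) i x =
      ∫ y, f y * ∑ j, H j y * torusPartial (G j) i x := by
    simp only [Finset.mul_sum]
    rw [integral_finsetSum]
    · refine Finset.sum_congr rfl fun j _ => ?_
      rw [← integral_mul_const]
      refine integral_congr_ae (Filter.Eventually.of_forall fun y => ?_)
      simp only; ring
    · intro j _
      have := (Continuous.integrable_mul hfg.integrable_fun (hH j).continuous).mul_const
        (torusPartial (G j) i x)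
      refine this.congr (Filter.Eventually.of_forall fun y => ?_)
      simp only; ring
  rw [h3]
  simp only [← h2]
  simp only [torusPartial_kernel_sub, mul_neg, integral_neg, neg_inj] at h1
  rw [h1]
  simp only [moll, smul_eq_mul, mul_comm]

lemma grad_moll (n : ℕ) {f : Torus d → ℝ} {g : Torus d → Euc d} (hfg : IsWeakGrad f g)
    (x : Torus d) : grad (moll n f) x = moll n g x := by
  ext i
  rw [grad_apply, torusPartial_moll n hfg, moll_apply_euc hfg.integrable_grad]

/-- Quantitative smoothness of mollifications. -/
lemma exists_moll_bound (d n : ℕ) : ∃ C : ℝ, 0 ≤ C ∧ ∀ f : Torus d → ℝ, Integrable f →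
    (∀ x, |moll n f x| ≤ C * ∫ y, |f y|) ∧
      HasC2Bound (moll n f) (C * ∫ y, |f y|) (C * ∫ y, |f y|) := by
  obtain ⟨ι, _, G, H, hG, hH, -, hm⟩ := exists_moll_eq_sum d n
  have h1 := fun j => exists_bound_of_continuous (hG j).continuous
  have h2 := fun j => exists_bound_of_continuous (hH j).continuous
  have h3 := fun j => exists_hasC2Bound (hG j)
  choose A hA0 hA using h1
  choose B hB0 hB using h2
  choose g l hl0 hC2 using h3
  have hg0 := fun j => (hC2 j).nonneg
  -- Only sup bounds of the finitely many factors of the kernel enter, so the constant does not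
  -- depend on `f`.
  refine ⟨∑ j, B j * (A j + g j + l j), Finset.sum_nonneg fun j _ =>
    mul_nonneg (hB0 j) (by linarith [hA0 j, hg0 j, hl0 j]), fun f hf => ?_⟩
  have hN0 : 0 ≤ ∫ y, |f y| := integral_nonneg fun _ => abs_nonneg _
  have hc : ∀ j, |∫ y, H j y * f y| ≤ B j * ∫ y, |f y| := by
    intro j
    rw [← integral_const_mul]
    refine norm_integral_le_of_norm_le (f := fun y => H j y * f y) (hf.abs.const_mul _)
      (Filter.Eventually.of_forall fun y => ?_)
    rw [norm_mul]
    exact mul_le_mul_of_nonneg_right (hB j y) (abs_nonneg _)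
  rw [hm f hf]
  have hgrad : ∀ x, grad (fun x => ∑ j, (∫ y, H j y * f y) * G j x) x =
      ∑ j, (∫ y, H j y * f y) • grad (G j) x := by
    intro x
    ext i
    rw [grad_apply, torusPartial_sum _ fun j _ => (hG j).const_mul _]
    simp [torusPartial_const_mul (hG _)]
  rw [Finset.sum_mul]
  refine ⟨fun x => ?_, fun x => ?_, fun x w => ?_⟩
  · refine (Finset.abs_sum_le_sum_abs _ _).trans (Finset.sum_le_sum fun j _ => ?_)
    rw [abs_mul]
    calc _ ≤ (B j * ∫ y, |f y|) * A j := mul_le_mul (hc j) (hA j x) (abs_nonneg _)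
          (mul_nonneg (hB0 j) hN0)
      _ = B j * A j * ∫ y, |f y| := by ring
      _ ≤ _ := by
        gcongr
        · exact hB0 j
        · linarith [hg0 j, hl0 j]
  · rw [hgrad]
    refine (norm_sum_le _ _).trans (Finset.sum_le_sum fun j _ => ?_)
    rw [norm_smul]
    calc _ ≤ (B j * ∫ y, |f y|) * g j := mul_le_mul (hc j) ((hC2 j).grad_le x) (norm_nonneg _)
          (mul_nonneg (hB0 j) hN0)
      _ = B j * g j * ∫ y, |f y| := by ring
      _ ≤ _ := by
        gcongr
        · exact hB0 j
        · linarith [hA0 j, hl0 j]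
  · rw [hgrad, hgrad, ← Finset.sum_sub_distrib, Finset.sum_mul]
    refine (norm_sum_le _ _).trans (Finset.sum_le_sum fun j _ => ?_)
    rw [← smul_sub, norm_smul]
    calc _ ≤ (B j * ∫ y, |f y|) * (l j * ‖w‖) := mul_le_mul (hc j) ((hC2 j).lip x w)
          (norm_nonneg _) (mul_nonneg (hB0 j) hN0)
      _ = B j * l j * (∫ y, |f y|) * ‖w‖ := by ring
      _ ≤ _ := by
        gcongr
        · exact hB0 j
        · linarith [hA0 j, hg0 j]

/-- Mollifications of continuous functions converge pointwise. -/
lemma tendsto_moll_of_continuous {f : Torus d → ℝ} (hf : Continuous f) (x : Torus d) :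
    Filter.Tendsto (fun n => moll n f x) Filter.atTop (nhds (f x)) := by
  have h := tendsto_integral_kernel_mul (G := fun y => f (x - y))
    (hf.comp (continuous_const.sub continuous_id))
  simp only [sub_zero] at h
  refine h.congr fun n => ?_
  rw [moll_eq_integral_sub]
  simp

lemma tendsto_lintegral_moll_sub_of_continuous {f : Torus d → ℝ} (hf : Continuous f) :
    Filter.Tendsto (fun n => ∫⁻ x, ENNReal.ofReal |moll n f x - f x|) Filter.atTop (nhds 0) := by
  obtain ⟨C, hC0, hC⟩ := exists_bound_of_continuous hf
  have hfi := integrable_of_continuous hf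
  have h := tendsto_lintegral_of_dominated_convergence (μ := (volume : Measure (Torus d)))
    (F := fun n x => ENNReal.ofReal |moll n f x - f x|) (f := fun _ => 0)
    (fun _ => ENNReal.ofReal (2 * C))
    (fun n => ((continuous_moll n hfi).sub hf).abs.measurable.ennreal_ofReal)
    (fun n => Filter.Eventually.of_forall fun x => ENNReal.ofReal_le_ofReal (by
      have h1 := norm_moll_le n (Filter.Eventually.of_forall hC) x
      have h2 := hC x
      rw [Real.norm_eq_abs] at h1 h2
      linarith [abs_sub (moll n f x) (f x)]))
    (by simpa using ENNReal.mul_ne_top (by simp) ENNReal.ofReal_ne_top)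
    (Filter.Eventually.of_forall fun x => by
      have h1 : Filter.Tendsto (fun n => |moll n f x - f x|) Filter.atTop (nhds 0) := by
        have := (tendsto_moll_of_continuous hf x).sub_const (f x)
        simpa using this.abs
      simpa using ENNReal.tendsto_ofReal h1)
  simpa using h

/-- Mollifications converge in `L¹`. -/
lemma tendsto_lintegral_moll_sub {f : Torus d → ℝ} (hf : Integrable f) :
    Filter.Tendsto (fun n => ∫⁻ x, ENNReal.ofReal |moll n f x - f x|) Filter.atTop (nhds 0) := by
  rw [ENNReal.tendsto_nhds_zero]
  intro ε hε
  have hε3 : ε / 3 ≠ 0 := (ENNReal.div_pos hε.ne' (by simp)).ne'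
  -- Density of continuous functions; mollification contracts the `L¹` norm of the difference.
  obtain ⟨g, -, hg1, hg2, hgi⟩ := hf.exists_hasCompactSupport_lintegral_sub_le hε3
  have h1 := (ENNReal.tendsto_nhds_zero.1 (tendsto_lintegral_moll_sub_of_continuous hg2)) (ε / 3)
    (pos_iff_ne_zero.2 hε3)
  filter_upwards [h1] with n hn
  have hfg : Integrable fun x => f x - g x := hf.sub hgi
  have hA : ∫⁻ x, ENNReal.ofReal |f x - g x| ≤ ε / 3 := by
    simpa [← Real.norm_eq_abs, ofReal_norm] using hg1
  have hB : ∫⁻ x, ENNReal.ofReal |moll n (fun x => f x - g x) x| ≤ ε / 3 := by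
    have := lintegral_moll_rpow_le n hfg le_rfl
    simp only [Real.rpow_one, Real.norm_eq_abs] at this
    exact this.trans hA
  calc ∫⁻ x, ENNReal.ofReal |moll n f x - f x|
      ≤ ∫⁻ x, (ENNReal.ofReal |moll n (fun x => f x - g x) x| +
          (ENNReal.ofReal |moll n g x - g x| + ENNReal.ofReal |f x - g x|)) := by
        refine lintegral_mono fun x => ?_
        rw [← ENNReal.ofReal_add (abs_nonneg _) (abs_nonneg _),
          ← ENNReal.ofReal_add (abs_nonneg _) (by positivity)]
        refine ENNReal.ofReal_le_ofReal ?_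
        rw [moll_sub n hf hgi]
        have : moll n f x - f x = (moll n f x - moll n g x) + ((moll n g x - g x) +
          -(f x - g x)) := by ring
        rw [this]
        refine (abs_add_le _ _).trans (add_le_add le_rfl ((abs_add_le _ _).trans ?_))
        rw [abs_neg]
    _ = (∫⁻ x, ENNReal.ofReal |moll n (fun x => f x - g x) x|) +
          ((∫⁻ x, ENNReal.ofReal |moll n g x - g x|) + ∫⁻ x, ENNReal.ofReal |f x - g x|) := by
        have hm : Measurable fun x => ENNReal.ofReal |moll n g x - g x| :=
          ((continuous_moll n hgi).sub hg2).abs.measurable.ennreal_ofReal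
        rw [lintegral_add_left (continuous_moll n hfg).abs.measurable.ennreal_ofReal,
          lintegral_add_left hm]
    _ ≤ ε / 3 + (ε / 3 + ε / 3) := by gcongr
    _ = ε := by rw [← add_assoc, ENNReal.add_thirds]

/-! ### Translation estimates for weakly differentiable functions -/

lemma quasiMeasurePreserving_add (a : Torus d) :
    Measure.QuasiMeasurePreserving (fun x : Torus d => x + a) :=
  (measurePreserving_add_right volume a).quasiMeasurePreserving

/-- Along a subsequence, mollifications converge almost everywhere. -/
lemma exists_subseq_tendsto_moll {f : Torus d → ℝ} (hf : Integrable f) :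
    ∃ ns : ℕ → ℕ, StrictMono ns ∧
      ∀ᵐ x, Filter.Tendsto (fun k => moll (ns k) f x) Filter.atTop (nhds (f x)) := by
  have h : TendstoInMeasure volume (fun n => moll n f) Filter.atTop f := by
    refine tendstoInMeasure_of_tendsto_eLpNorm (p := 1) one_ne_zero
      (fun n => (continuous_moll n hf).aestronglyMeasurable) hf.1 ?_
    have := tendsto_lintegral_moll_sub hf
    simp only [eLpNorm_one_eq_lintegral_enorm, Pi.sub_apply, ← ofReal_norm, Real.norm_eq_abs]
    exact this
  exact h.exists_seq_tendsto_ae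

/-- The increment is the mean of a directional derivative over a segment; Jensen's inequality on the
segment and translation invariance give the constant one. -/
lemma lintegral_translate_le_of_smooth (hu : IsSmoothOnTorus u) {p : ℝ} (hp : 1 ≤ p) (h : Euc d) :
    ∫⁻ x, ENNReal.ofReal (|u (x + proj h) - u x| ^ p) ≤
      ENNReal.ofReal (‖h‖ ^ p) * ∫⁻ x, ENNReal.ofReal (‖grad u x‖ ^ p) := by
  have hg : Continuous fun x => ‖grad u x‖ := (isSmoothField_grad hu).continuous.norm
  have hprob : IsProbabilityMeasure (volume.restrict (Ioc (0 : ℝ) 1)) := ⟨by simp⟩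
  have hpt : ∀ x, ENNReal.ofReal (|u (x + proj h) - u x| ^ p) ≤
      ∫⁻ s in Ioc (0 : ℝ) 1, ENNReal.ofReal (‖h‖ ^ p) *
        ENNReal.ofReal (‖grad u (x + proj (s • h))‖ ^ p) := by
    intro x
    have hc : Continuous fun s : ℝ => x + proj (s • h) := by fun_prop
    have hc2 : Continuous fun s : ℝ => ∑ i, h i * torusPartial u i (x + proj (s • h)) :=
      continuous_finsetSum _ fun i _ =>
        continuous_const.mul ((hu.smooth_torusPartial i).continuous.comp hc)
    have h1 := intervalIntegral.integral_eq_sub_of_hasDerivAt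
      (fun s _ => hasDerivAt_line hu x h s) (hc2.intervalIntegrable 0 1)
    simp only [one_smul, zero_smul, proj_zero, add_zero] at h1
    rw [← h1, intervalIntegral.integral_of_le zero_le_one, ← Real.norm_eq_abs]
    refine (ofReal_norm_integral_rpow_le hc2.integrableOn_Ioc hp).trans ?_
    refine lintegral_mono fun s => ?_
    rw [← ENNReal.ofReal_mul (by positivity), ← Real.mul_rpow (norm_nonneg _) (norm_nonneg _)]
    exact ENNReal.ofReal_le_ofReal (Real.rpow_le_rpow (norm_nonneg _) (abs_inner_grad_le u _ h)
      (by linarith))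
  have hm : Measurable fun z : Torus d × ℝ => ENNReal.ofReal (‖h‖ ^ p) *
      ENNReal.ofReal (‖grad u (z.1 + proj (z.2 • h))‖ ^ p) := by
    have h1 : Continuous fun z : Torus d × ℝ => ‖grad u (z.1 + proj (z.2 • h))‖ :=
      hg.comp (by fun_prop)
    exact (h1.measurable.pow_const p).ennreal_ofReal.const_mul _
  have hgm : Measurable fun x => ENNReal.ofReal (‖grad u x‖ ^ p) :=
    (hg.measurable.pow_const p).ennreal_ofReal
  calc _ ≤ ∫⁻ x, ∫⁻ s in Ioc (0 : ℝ) 1, ENNReal.ofReal (‖h‖ ^ p) *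
        ENNReal.ofReal (‖grad u (x + proj (s • h))‖ ^ p) := lintegral_mono hpt
    _ = ∫⁻ s in Ioc (0 : ℝ) 1, ∫⁻ x, ENNReal.ofReal (‖h‖ ^ p) *
        ENNReal.ofReal (‖grad u (x + proj (s • h))‖ ^ p) := lintegral_lintegral_swap hm.aemeasurable
    _ = ∫⁻ _s in Ioc (0 : ℝ) 1, ENNReal.ofReal (‖h‖ ^ p) * ∫⁻ x, ENNReal.ofReal (‖grad u x‖ ^ p) := by
        refine lintegral_congr fun s => ?_
        rw [lintegral_add_right_eq_self (fun x => ENNReal.ofReal (‖h‖ ^ p) *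
          ENNReal.ofReal (‖grad u x‖ ^ p)), lintegral_const_mul _ hgm]
    _ = _ := by simp

/-- Translation estimate for weakly differentiable functions. -/
lemma lintegral_translate_le {f : Torus d → ℝ} {g : Torus d → Euc d} (hfg : IsWeakGrad f g) {p : ℝ}
    (hp : 1 ≤ p) (h : Euc d) :
    ∫⁻ x, ENNReal.ofReal (|f (x + proj h) - f x| ^ p) ≤
      ENNReal.ofReal (‖h‖ ^ p) * ∫⁻ x, ENNReal.ofReal (‖g x‖ ^ p) := by
  obtain ⟨ns, -, hns⟩ := exists_subseq_tendsto_moll hfg.integrable_fun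
  have hns' := (quasiMeasurePreserving_add (proj h)).ae hns
  have hc := fun n => continuous_moll n hfg.integrable_fun
  have hm : ∀ k, Measurable fun x =>
      ENNReal.ofReal (|moll (ns k) f (x + proj h) - moll (ns k) f x| ^ p) := fun k => by
    have : Continuous fun x => |moll (ns k) f (x + proj h) - moll (ns k) f x| :=
      (((hc (ns k)).comp (continuous_id.add continuous_const)).sub (hc (ns k))).abs
    exact (this.measurable.pow_const p).ennreal_ofReal
  -- Fatou's lemma along a subsequence of mollifications converging almost everywhere, at `x` and at
  -- the translated point.
  calc ∫⁻ x, ENNReal.ofReal (|f (x + proj h) - f x| ^ p)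
      ≤ ∫⁻ x, Filter.liminf (fun k =>
          ENNReal.ofReal (|moll (ns k) f (x + proj h) - moll (ns k) f x| ^ p)) Filter.atTop := by
        refine lintegral_mono_ae ?_
        filter_upwards [hns, hns'] with x h1 h2
        refine le_of_eq (Filter.Tendsto.liminf_eq ?_).symm
        refine ENNReal.tendsto_ofReal (((h2.sub h1).abs).rpow_const (Or.inr (by linarith)))
    _ ≤ Filter.liminf (fun k => ∫⁻ x,
          ENNReal.ofReal (|moll (ns k) f (x + proj h) - moll (ns k) f x| ^ p)) Filter.atTop :=
        lintegral_liminf_le hm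
    _ ≤ Filter.liminf (fun _ : ℕ => ENNReal.ofReal (‖h‖ ^ p) * ∫⁻ x, ENNReal.ofReal (‖g x‖ ^ p))
          Filter.atTop := by
        refine Filter.liminf_le_liminf (Filter.Eventually.of_forall fun k => ?_)
        refine (lintegral_translate_le_of_smooth (isSmooth_moll (ns k) hfg.integrable_fun) hp h).trans
          ?_
        gcongr ENNReal.ofReal (‖h‖ ^ p) * ?_
        simp only [grad_moll _ hfg]
        exact lintegral_moll_rpow_le _ hfg.integrable_grad hp
    _ = _ := Filter.liminf_const _

/-- The moment of the mollifying kernel. -/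
noncomputable def kernelMoment (d n : ℕ) (p : ℝ) : ℝ := ∫ y : Torus d, kernel n y * ‖y‖ ^ p

lemma kernelMoment_nonneg (d n : ℕ) (p : ℝ) : 0 ≤ kernelMoment d n p :=
  integral_nonneg fun y => mul_nonneg (kernel_nonneg n y) (by positivity)

lemma tendsto_kernelMoment (d : ℕ) {p : ℝ} (hp : 0 < p) :
    Filter.Tendsto (fun n => kernelMoment d n p) Filter.atTop (nhds 0) := by
  have h := tendsto_integral_kernel_mul (d := d) (G := fun y => ‖y‖ ^ p)
    (continuous_norm.rpow_const fun _ => Or.inr hp.le)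
  simpa [kernelMoment, Real.zero_rpow hp.ne'] using h

/-- Rate of convergence of mollifications of weakly differentiable functions. -/
lemma lintegral_moll_sub_rpow_le (n : ℕ) {f : Torus d → ℝ} {g : Torus d → Euc d}
    (hfg : IsWeakGrad f g) {p : ℝ} (hp : 1 ≤ p) :
    ∫⁻ x, ENNReal.ofReal (|moll n f x - f x| ^ p) ≤
      ENNReal.ofReal (√d ^ p * kernelMoment d n p) * ∫⁻ x, ENNReal.ofReal (‖g x‖ ^ p) := by
  have hf := hfg.integrable_fun
  have hp0 : 0 < p := by linarith
  have hpt : ∀ x, ENNReal.ofReal (|moll n f x - f x| ^ p) ≤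
      ∫⁻ y, ENNReal.ofReal (kernel n y) * ENNReal.ofReal (|f (x - y) - f x| ^ p) := by
    intro x
    have h1 : moll n f x - f x = ∫ y, (f y - f x) ∂(kernelMeasure n x) := by
      rw [integral_sub (integrable_kernelMeasure n x hf) (integrable_const _),
        ← moll_eq_integral_kernelMeasure]
      simp
    rw [h1, ← Real.norm_eq_abs]
    refine (ofReal_norm_integral_rpow_le ((integrable_kernelMeasure n x hf).sub
      (integrable_const _)) hp).trans ?_
    rw [lintegral_kernelMeasure, ← lintegral_sub_left_eq_self _ x]
    simp
  have hae : AEMeasurable (fun z : Torus d × Torus d =>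
      ENNReal.ofReal (kernel n z.2) * ENNReal.ofReal (|f (z.1 - z.2) - f z.1| ^ p))
      (volume.prod volume) := by
    have hk : Measurable fun z : Torus d × Torus d => ENNReal.ofReal (kernel n z.2) :=
      ((continuous_kernel n).comp continuous_snd).measurable.ennreal_ofReal
    have h1 : AEMeasurable (fun z : Torus d × Torus d => f z.1) (volume.prod volume) :=
      hf.aemeasurable.comp_quasiMeasurePreserving Measure.quasiMeasurePreserving_fst
    have h2 : AEMeasurable (fun z : Torus d × Torus d => f (z.1 - z.2)) (volume.prod volume) :=
      hf.aemeasurable.comp_quasiMeasurePreserving (quasiMeasurePreserving_sub_of_right_invariant _ _)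
    exact hk.aemeasurable.mul (((h2.sub h1).abs.pow_const p).ennreal_ofReal)
  calc _ ≤ ∫⁻ x, ∫⁻ y, ENNReal.ofReal (kernel n y) * ENNReal.ofReal (|f (x - y) - f x| ^ p) :=
        lintegral_mono hpt
    _ = ∫⁻ y, ∫⁻ x, ENNReal.ofReal (kernel n y) * ENNReal.ofReal (|f (x - y) - f x| ^ p) :=
        lintegral_lintegral_swap hae
    _ ≤ ∫⁻ y, ENNReal.ofReal (√d ^ p * (kernel n y * ‖y‖ ^ p)) *
          ∫⁻ x, ENNReal.ofReal (‖g x‖ ^ p) := by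
        refine lintegral_mono fun y => ?_
        rw [lintegral_const_mul' _ _ ENNReal.ofReal_ne_top]
        obtain ⟨w, hw, hwr⟩ := exists_rep 0 (-y)
        rw [zero_add] at hw
        rw [dist_zero_left, norm_neg] at hwr
        have hwn : ‖w‖ ≤ √d * ‖y‖ := by
          rw [EuclideanSpace.norm_eq]
          calc √(∑ i, ‖w i‖ ^ 2) ≤ √(∑ _i : Fin d, ‖y‖ ^ 2) :=
                Real.sqrt_le_sqrt (Finset.sum_le_sum fun i _ =>
                  pow_le_pow_left₀ (norm_nonneg _) (hwr i) 2)
            _ = √d * ‖y‖ := by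
              rw [Finset.sum_const, Finset.card_univ, Fintype.card_fin, nsmul_eq_mul,
                Real.sqrt_mul (by positivity), Real.sqrt_sq (norm_nonneg _)]
        have h1 := lintegral_translate_le hfg hp w
        rw [← hw] at h1
        simp only [← sub_eq_add_neg] at h1
        calc _ ≤ ENNReal.ofReal (kernel n y) *
              (ENNReal.ofReal (‖w‖ ^ p) * ∫⁻ x, ENNReal.ofReal (‖g x‖ ^ p)) := by gcongr
          _ ≤ ENNReal.ofReal (kernel n y) *
              (ENNReal.ofReal ((√d * ‖y‖) ^ p) * ∫⁻ x, ENNReal.ofReal (‖g x‖ ^ p)) := by gcongr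
          _ = _ := by
            rw [← mul_assoc, ← ENNReal.ofReal_mul (kernel_nonneg _ _),
              Real.mul_rpow (by positivity) (norm_nonneg _)]
            congr 2; ring
    _ = _ := by
        have hc : Continuous fun y : Torus d => kernel n y * ‖y‖ ^ p :=
          (continuous_kernel n).mul (continuous_norm.rpow_const fun _ => Or.inr hp0.le)
        have hm : Measurable fun y : Torus d =>
            ENNReal.ofReal (√(d : ℝ) ^ p * (kernel n y * ‖y‖ ^ p)) :=
          (continuous_const.mul hc).measurable.ennreal_ofReal
        rw [lintegral_mul_const _ hm]
        congr 1
        rw [kernelMoment, ← integral_const_mul, ofReal_integral_eq_lintegral_ofReal]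
        · exact integrable_of_continuous (continuous_const.mul hc)
        · exact Filter.Eventually.of_forall fun y => mul_nonneg (by positivity)
            (mul_nonneg (kernel_nonneg n y) (by positivity))

/-! ### Integration of time dependent functions in time -/

section TimeIntegral

variable {X : Type*} [NormedAddCommGroup X] [NormedSpace ℝ X] {ν : Measure ℝ} [IsFiniteMeasure ν]
  {F : ℝ → Torus d → X}

/-- The integral in time `∫ F_s ds` of a time dependent function on the torus. -/
noncomputable def timeInt (ν : Measure ℝ) (F : ℝ → Torus d → X) (y : Torus d) : X := ∫ s, F s y ∂ν

lemma integrable_timeInt (hF : Integrable (Function.uncurry F) (ν.prod volume)) :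
    Integrable (timeInt ν F) := hF.integral_prod_right

lemma integral_norm_timeInt_le (hF : Integrable (Function.uncurry F) (ν.prod volume)) :
    ∫ y, ‖timeInt ν F y‖ ≤ ∫ z, ‖F z.1 z.2‖ ∂(ν.prod volume) := by
  have h := integral_prod_symm _ hF.norm
  simp only [Function.uncurry] at h
  rw [h]
  exact integral_mono (integrable_timeInt hF).norm hF.norm.integral_prod_right
    fun y => norm_integral_le_integral_norm _

lemma integrable_smul_of_continuous {g : Torus d → ℝ} (hg : Continuous g)
    (hF : Integrable (Function.uncurry F) (ν.prod volume)) :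
    Integrable (fun z : ℝ × Torus d => g z.2 • F z.1 z.2) (ν.prod volume) := by
  obtain ⟨C, -, hC⟩ := exists_bound_of_continuous hg
  exact Integrable.bdd_smul hF C (hg.comp continuous_snd).aestronglyMeasurable
    (Filter.Eventually.of_forall fun z => hC z.2)

lemma integral_smul_timeInt {g : Torus d → ℝ} (hg : Continuous g)
    (hF : Integrable (Function.uncurry F) (ν.prod volume)) :
    ∫ y, g y • timeInt ν F y = ∫ z, g z.2 • F z.1 z.2 ∂(ν.prod volume) := by
  rw [integral_prod_symm _ (integrable_smul_of_continuous hg hF)]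
  exact integral_congr_ae (Filter.Eventually.of_forall fun y => (integral_smul _ _).symm)

lemma moll_timeInt (n : ℕ) (hF : Integrable (Function.uncurry F) (ν.prod volume)) (x : Torus d) :
    moll n (timeInt ν F) x = ∫ s, moll n (F s) x ∂ν := by
  rw [moll, integral_smul_timeInt (continuous_kernel_sub n x) hF,
    integral_prod _ (integrable_smul_of_continuous (continuous_kernel_sub n x) hF)]
  rfl

lemma isWeakGrad_timeInt {f : ℝ → Torus d → ℝ} {g : ℝ → Torus d → Euc d}
    (hf : Integrable (Function.uncurry f) (ν.prod volume))
    (hg : Integrable (Function.uncurry g) (ν.prod volume)) (hfg : ∀ᵐ s ∂ν, IsWeakGrad (f s) (g s)) :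
    IsWeakGrad (timeInt ν f) (timeInt ν g) := by
  refine ⟨integrable_timeInt hf, integrable_timeInt hg, fun φ hφ i => ?_⟩
  have hc := (hφ.smooth_torusPartial i).continuous
  have h1 := integral_smul_timeInt hc hf
  have h2 := integral_smul_timeInt (F := fun s x => g s x) hφ.continuous hg
  have hI := integrable_smul_of_continuous (F := fun s x => g s x) hφ.continuous hg
  have h3 : ∫ x, timeInt ν g x i * φ x = (∫ x, φ x • timeInt ν g x) i := by
    have := (EuclideanSpace.proj (𝕜 := ℝ) i).integral_comp_comm
      ((integrable_timeInt hg).bdd_smul (exists_bound_of_continuous hφ.continuous).choose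
        hφ.continuous.aestronglyMeasurable
        (Filter.Eventually.of_forall
          (exists_bound_of_continuous hφ.continuous).choose_spec.2))
    simp only [EuclideanSpace.coe_proj] at this
    refine Eq.trans ?_ this
    exact integral_congr_ae (Filter.Eventually.of_forall fun x => mul_comm _ _)
  have h4 : (∫ z, φ z.2 • g z.1 z.2 ∂(ν.prod volume)) i
      = ∫ z, φ z.2 * g z.1 z.2 i ∂(ν.prod volume) := by
    have := (EuclideanSpace.proj (𝕜 := ℝ) i).integral_comp_comm hI
    simp only [EuclideanSpace.coe_proj, PiLp.smul_apply, smul_eq_mul] at this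
    exact this.symm
  rw [h3, h2, h4, integral_prod _ (by simpa using integrable_coord hI i), ← integral_neg]
  simp only [smul_eq_mul] at h1
  simp_rw [mul_comm (timeInt ν f _)]
  have h5 := integral_prod _ (integrable_smul_of_continuous hc hf)
  simp only [smul_eq_mul] at h5
  rw [h1, h5]
  refine integral_congr_ae ?_
  filter_upwards [hfg] with s hs
  have := hs.integral_eq φ hφ i
  simp only [mul_comm (f s _)] at this
  rw [this]
  simp_rw [mul_comm (φ _)]

variable {f : ℝ → Torus d → ℝ}

/-- In the finite-sum form each term is a function of time times a smooth function of space, so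
joint measurability comes for free. -/
lemma integrable_moll_prod (n : ℕ) (hf : Integrable (Function.uncurry f) (ν.prod volume)) :
    Integrable (fun z : ℝ × Torus d => moll n (f z.1) z.2) (ν.prod volume) := by
  obtain ⟨ι, _, g, h, hg, hh, -, hm⟩ := exists_moll_eq_sum d n
  have hae : ∀ᵐ s ∂ν, Integrable (f s) := hf.prod_right_ae
  have hae' : (fun z : ℝ × Torus d => ∑ j, (∫ y, h j y * f z.1 y) * g j z.2)
      =ᵐ[ν.prod volume] fun z => moll n (f z.1) z.2 := by
    have := (Measure.quasiMeasurePreserving_fst (μ := ν) (ν := (volume : Measure (Torus d)))).ae hae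
    filter_upwards [this] with z hz
    rw [hm _ hz]
  refine Integrable.congr ?_ hae'
  refine integrable_finsetSum _ fun j _ => ?_
  refine Integrable.mul_prod (f := fun s => ∫ y, h j y * f s y) ?_
    (integrable_of_continuous (hg j).continuous)
  exact (integrable_smul_of_continuous (F := f) (hh j).continuous hf).integral_prod_left

/-- Slicewise `L¹` convergence, dominated in time by twice the `L¹` norm of the slice because
mollification is a contraction. -/
lemma tendsto_integral_moll_sub_prod (hf : Integrable (Function.uncurry f) (ν.prod volume)) :
    Filter.Tendsto (fun n => ∫ z, |moll n (f z.1) z.2 - f z.1 z.2| ∂(ν.prod volume))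
      Filter.atTop (nhds 0) := by
  have hI : ∀ n, Integrable (fun z : ℝ × Torus d => |moll n (f z.1) z.2 - f z.1 z.2|)
      (ν.prod volume) := fun n => ((integrable_moll_prod n hf).sub hf).abs
  simp_rw [fun n => integral_prod _ (hI n)]
  have hae : ∀ᵐ s ∂ν, Integrable (f s) := hf.prod_right_ae
  have key := tendsto_integral_filter_of_dominated_convergence (μ := ν) (l := Filter.atTop)
    (F := fun n s => ∫ x, |moll n (f s) x - f s x|) (f := fun _ => 0)
    (fun s => 2 * ∫ x, |f s x|) ?_ ?_ ?_ ?_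
  · simpa using key
  · exact Filter.Eventually.of_forall fun n => (hI n).integral_prod_left.aestronglyMeasurable
  · refine Filter.Eventually.of_forall fun n => ?_
    filter_upwards [hae] with s hs
    have hmi := integrable_of_continuous (continuous_moll n hs)
    have h1 : ∫ x, |moll n (f s) x| ≤ ∫ x, |f s x| := by
      have := lintegral_moll_rpow_le n hs (p := 1) le_rfl
      simp only [Real.rpow_one] at this
      rw [← ofReal_integral_eq_lintegral_ofReal hmi.norm
        (Filter.Eventually.of_forall fun _ => norm_nonneg _),
        ← ofReal_integral_eq_lintegral_ofReal hs.norm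
        (Filter.Eventually.of_forall fun _ => norm_nonneg _)] at this
      exact (ENNReal.ofReal_le_ofReal_iff (integral_nonneg fun _ => norm_nonneg _)).1 this
    rw [Real.norm_of_nonneg (integral_nonneg fun _ => abs_nonneg _)]
    calc ∫ x, |moll n (f s) x - f s x| ≤ ∫ x, (|moll n (f s) x| + |f s x|) :=
          integral_mono (hmi.sub hs).abs (hmi.abs.add hs.abs) fun x => abs_sub _ _
      _ = (∫ x, |moll n (f s) x|) + ∫ x, |f s x| := integral_add hmi.abs hs.abs
      _ ≤ _ := by linarith
  · exact (hf.abs.integral_prod_left).const_mul 2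
  · filter_upwards [hae] with s hs
    have := tendsto_lintegral_moll_sub hs
    have h2 := (ENNReal.tendsto_toReal ENNReal.zero_ne_top).comp this
    refine h2.congr fun n => ?_
    simp only [Function.comp_apply]
    exact (integral_eq_lintegral_of_nonneg_ae (Filter.Eventually.of_forall fun _ => abs_nonneg _)
      (((continuous_moll n hs).aestronglyMeasurable.sub hs.1).norm)).symm

lemma integral_abs_moll_timeInt_sub_le (n : ℕ)
    (hf : Integrable (Function.uncurry f) (ν.prod volume)) :
    ∫ x, |moll n (timeInt ν f) x - timeInt ν f x|
      ≤ ∫ z, |moll n (f z.1) z.2 - f z.1 z.2| ∂(ν.prod volume) := by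
  have hI := (integrable_moll_prod n hf).sub hf
  have h2 : (fun x => moll n (timeInt ν f) x - timeInt ν f x)
      =ᵐ[volume] timeInt ν (fun s x => moll n (f s) x - f s x) := by
    have h1 : ∀ᵐ x : Torus d, Integrable (fun s => f s x) ν := hf.prod_left_ae
    have h2 : ∀ᵐ x : Torus d, Integrable (fun s => moll n (f s) x) ν :=
      (integrable_moll_prod n hf).prod_left_ae
    filter_upwards [h1, h2] with x hx hx'
    rw [moll_timeInt n hf, timeInt, timeInt, integral_sub hx' hx]
  have h3 := integral_norm_timeInt_le (F := fun s x => moll n (f s) x - f s x) hI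
  refine le_trans (le_of_eq ?_) h3
  refine integral_congr_ae ?_
  filter_upwards [h2] with x hx
  rw [hx]; rfl

end TimeIntegral

/-- Drifts with exponentially integrable gradient and bounded divergence, in the form used for the
estimates; unlike `IsExpDrift` it is stable under time reversal and restriction in time. -/
structure IsDrift (T β K L : ℝ) (b : ℝ → Torus d → Euc d) (Db : ℝ → Torus d → Fin d → Euc d) :
    Prop where
  integrable_drift : Integrable (Function.uncurry b) (spaceTimeMeasure d T)
  integrable_grad : Integrable (fun z : ℝ × Torus d => WithLp.toLp 2 (Db z.1 z.2) :
    ℝ × Torus d → PiLp 2 fun _ : Fin d => Euc d) (spaceTimeMeasure d T)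
  isWeakGrad : ∀ t ∈ Icc 0 T, ∀ i : Fin d, IsWeakGrad (fun x => b t x i) (fun x => Db t x i)
  one_le : 1 ≤ K
  exp_le : ∀ t ∈ Icc 0 T,
    ∫⁻ x, ENNReal.ofReal (Real.exp (β * frobNorm (Db t x))) ≤ ENNReal.ofReal K
  div_le : ∀ᵐ z ∂(spaceTimeMeasure d T), |rowTrace (Db z.1 z.2)| ≤ L

instance (T : ℝ) : IsFiniteMeasure (spaceTimeMeasure d T) := by
  unfold spaceTimeMeasure; infer_instance

lemma _root_.IsExpDrift.isDrift {T β K L : ℝ} {b : ℝ → Torus d → Euc d}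
    {Db : ℝ → Torus d → Fin d → Euc d} (h : IsExpDrift T β K L b Db) (hT : 0 < T) (hβ : 0 < β)
    (hL : 0 ≤ L) : IsDrift T β K L b Db := by
  have hexp : ∀ t ∈ Icc 0 T,
      ∫⁻ x, ENNReal.ofReal (Real.exp (β * frobNorm (Db t x))) ≤ ENNReal.ofReal K := by
    intro t ht
    rw [← h.exp_bound]
    exact le_iSup₂ (f := fun t (_ : t ∈ Icc 0 T) =>
      ∫⁻ x, ENNReal.ofReal (Real.exp (β * frobNorm (Db t x)))) t ht
  have hm : AEStronglyMeasurable (fun z : ℝ × Torus d => (WithLp.toLp 2 (Db z.1 z.2) :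
      PiLp 2 fun _ : Fin d => Euc d)) (spaceTimeMeasure d T) :=
    (PiLp.continuous_toLp 2 _).comp_aestronglyMeasurable h.aestronglyMeasurable_grad
  refine ⟨h.integrable_drift, ⟨hm, ?_⟩, h.isWeakGrad, ?_, hexp, ?_⟩
  · rw [HasFiniteIntegral]
    -- Integrability of the gradient is not assumed; it follows from `r ≤ exp r` and the exponential
    -- bound.
    have hle : ∀ z : ℝ × Torus d, ‖(WithLp.toLp 2 (Db z.1 z.2) : PiLp 2 fun _ : Fin d => Euc d)‖ₑ
        ≤ ENNReal.ofReal β⁻¹ * ENNReal.ofReal (Real.exp (β * frobNorm (Db z.1 z.2))) := by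
      intro z
      rw [← ofReal_norm, ← frobNorm_eq_norm, ← ENNReal.ofReal_mul (by positivity)]
      refine ENNReal.ofReal_le_ofReal ?_
      rw [inv_mul_eq_div, le_div_iff₀ hβ]
      linarith [Real.add_one_le_exp (β * frobNorm (Db z.1 z.2))]
    have hem : AEMeasurable (fun z : ℝ × Torus d =>
        ENNReal.ofReal (Real.exp (β * frobNorm (Db z.1 z.2)))) (spaceTimeMeasure d T) := by
      have h1 : AEMeasurable (fun z : ℝ × Torus d => frobNorm (Db z.1 z.2)) (spaceTimeMeasure d T) :=
        (continuous_frobNorm.comp_aestronglyMeasurable h.aestronglyMeasurable_grad).aemeasurable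
      exact (Real.measurable_exp.comp_aemeasurable (h1.const_mul β)).ennreal_ofReal
    refine lt_of_le_of_lt (lintegral_mono hle) ?_
    rw [lintegral_const_mul'' _ hem]
    refine ENNReal.mul_lt_top ENNReal.ofReal_lt_top ?_
    unfold spaceTimeMeasure at hem ⊢
    rw [lintegral_prod _ hem]
    calc _ ≤ ∫⁻ t in Icc 0 T, ENNReal.ofReal K := setLIntegral_mono measurable_const hexp
      _ < ⊤ := by
        rw [setLIntegral_const]
        exact ENNReal.mul_lt_top ENNReal.ofReal_lt_top (by simp)
  · have h1 := hexp 0 ⟨le_rfl, hT.le⟩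
    have h2 : (1 : ENNReal) ≤ ENNReal.ofReal K := by
      refine le_trans ?_ h1
      calc (1 : ENNReal) = ∫⁻ x : Torus d, 1 := by simp
        _ ≤ _ := lintegral_mono fun x => by
          rw [← ENNReal.ofReal_one]
          exact ENNReal.ofReal_le_ofReal
            (Real.one_le_exp (mul_nonneg hβ.le (frobNorm_nonneg _)))
    exact ENNReal.one_le_ofReal.1 h2
  · have h1 := ae_le_eLpNormEssSup (f := fun z : ℝ × Torus d => rowTrace (Db z.1 z.2))
      (μ := spaceTimeMeasure d T)
    rw [← eLpNorm_exponent_top, h.div_bound] at h1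
    filter_upwards [h1] with z hz
    rw [← ofReal_norm, ENNReal.ofReal_le_ofReal_iff hL] at hz
    exact hz

/-! ### Time reversal and mollified time integrals of a drift -/

section Drift

variable {T β K L : ℝ} {b : ℝ → Torus d → Euc d} {Db : ℝ → Torus d → Fin d → Euc d}

lemma measurePreserving_reverse {t δ : ℝ} :
    MeasurePreserving (fun z : ℝ × Torus d => (t - z.1, z.2)) (spaceTimeMeasure d δ)
      ((volume.restrict (Icc (t - δ) t)).prod volume) := by
  have h1 : MeasurePreserving (fun s : ℝ => t - s) (volume.restrict (Icc 0 δ))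
      (volume.restrict (Icc (t - δ) t)) := by
    have h := (Measure.measurePreserving_sub_left (volume : Measure ℝ) t).restrict_preimage
      (measurableSet_Icc (a := t - δ) (b := t))
    have h2 : (fun s : ℝ => t - s) ⁻¹' Icc (t - δ) t = Icc 0 δ := by
      ext s; simp only [mem_preimage, mem_Icc]; constructor <;> rintro ⟨h1, h2⟩ <;>
        constructor <;> linarith
    rwa [h2] at h
  exact h1.prod (MeasurePreserving.id volume)

lemma restrict_prod_le_spaceTime {I : Set ℝ} (hI : I ⊆ Icc 0 T) :
    (volume.restrict I).prod (volume : Measure (Torus d)) ≤ spaceTimeMeasure d T :=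
  Measure.prod_mono (Measure.restrict_mono hI le_rfl) le_rfl

/-- Time reversal at time `t`, followed by restriction to the time interval `[0, δ]`. -/
lemma IsDrift.reverse (h : IsDrift T β K L b Db) {t δ : ℝ} (htT : t ≤ T) (hδt : δ ≤ t) :
    IsDrift δ β K L (fun s x => - b (t - s) x) (fun s x i => - Db (t - s) x i) := by
  have hsub : Icc (t - δ) t ⊆ Icc 0 T := Icc_subset_Icc (by linarith) htT
  have hmem : ∀ s ∈ Icc 0 δ, t - s ∈ Icc 0 T := fun s hs => ⟨by linarith [hs.2], by linarith [hs.1]⟩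
  have hle := restrict_prod_le_spaceTime (d := d) hsub
  have hfrob : ∀ A : Fin d → Euc d, frobNorm (fun i => - A i) = frobNorm A := by
    intro A; simp [frobNorm]
  refine ⟨?_, ?_, fun s hs i => ?_, h.one_le, fun s hs => ?_, ?_⟩
  · exact (measurePreserving_reverse.integrable_comp_of_integrable
      (h.integrable_drift.mono_measure hle)).neg
  · exact (measurePreserving_reverse.integrable_comp_of_integrable
      (h.integrable_grad.mono_measure hle)).neg
  · have h1 := h.isWeakGrad (t - s) (hmem s hs) i
    refine ⟨h1.integrable_fun.neg, h1.integrable_grad.neg, fun φ hφ j => ?_⟩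
    have := h1.integral_eq φ hφ j
    simp only [PiLp.neg_apply, neg_mul, integral_neg]
    rw [this]
  · simp only [hfrob]
    exact h.exp_le _ (hmem s hs)
  · have h1 := (measurePreserving_reverse (d := d) (t := t) (δ := δ)).quasiMeasurePreserving.ae
      (ae_mono hle h.div_le)
    filter_upwards [h1] with z hz
    simpa [rowTrace, abs_neg] using hz

/-- The matrix field `Db` with values in a Euclidean space. -/
noncomputable def rows (Db : ℝ → Torus d → Fin d → Euc d) (s : ℝ) (y : Torus d) :
    PiLp 2 fun _ : Fin d => Euc d := WithLp.toLp 2 (Db s y)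

/-- The mollified time integral of the drift, with the opposite sign. -/
noncomputable def stepField (ν : Measure ℝ) (n : ℕ) (b : ℝ → Torus d → Euc d) (x : Torus d) :
    Euc d := WithLp.toLp 2 fun i => -1 * moll n (timeInt ν fun s y => b s y i) x

/-- Used with the projections and with the trace, to identify the rows and the divergence of a
mollified time integral. -/
lemma clm_moll_timeInt {X Y : Type*} [NormedAddCommGroup X] [NormedSpace ℝ X] [CompleteSpace X]
    [NormedAddCommGroup Y] [NormedSpace ℝ Y] [CompleteSpace Y] {ν : Measure ℝ} [IsFiniteMeasure ν]
    {F : ℝ → Torus d → X} (hF : Integrable (Function.uncurry F) (ν.prod volume)) (ℓ : X →L[ℝ] Y)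
    (n : ℕ) (x : Torus d) :
    ℓ (moll n (timeInt ν F) x) = moll n (timeInt ν fun s y => ℓ (F s y)) x := by
  have hF' : Integrable (Function.uncurry fun s y => ℓ (F s y)) (ν.prod volume) :=
    ℓ.integrable_comp hF
  rw [moll, moll, integral_smul_timeInt (continuous_kernel_sub n x) hF,
    integral_smul_timeInt (continuous_kernel_sub n x) hF', ← ℓ.integral_comp_comm
      (integrable_smul_of_continuous (continuous_kernel_sub n x) hF)]
  simp

/-- The trace as a continuous linear form. -/
noncomputable def traceCLM (d : ℕ) : (PiLp 2 fun _ : Fin d => Euc d) →L[ℝ] ℝ :=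
  ∑ i, (PiLp.proj (𝕜 := ℝ) 2 (fun _ : Fin d => ℝ) i).comp
    (PiLp.proj (𝕜 := ℝ) 2 (fun _ : Fin d => Euc d) i)

lemma traceCLM_apply (A : PiLp 2 fun _ : Fin d => Euc d) : traceCLM d A = rowTrace fun i => A i := by
  simp [traceCLM, rowTrace]

section Field

variable {ν : Measure ℝ} [IsFiniteMeasure ν]

lemma prod_le_spaceTime {ν : Measure ℝ} (hν : ν ≤ volume.restrict (Icc 0 T)) :
    ν.prod (volume : Measure (Torus d)) ≤ spaceTimeMeasure d T := Measure.prod_mono hν le_rfl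

lemma IsDrift.integrable_coord_prod (h : IsDrift T β K L b Db) (hν : ν ≤ volume.restrict (Icc 0 T))
    (i : Fin d) : Integrable (Function.uncurry fun s y => b s y i) (ν.prod volume) :=
  integrable_coord (h.integrable_drift.mono_measure (prod_le_spaceTime hν)) i

lemma IsDrift.integrable_rows_prod (h : IsDrift T β K L b Db)
    (hν : ν ≤ volume.restrict (Icc 0 T)) :
    Integrable (Function.uncurry (rows Db)) (ν.prod volume) :=
  h.integrable_grad.mono_measure (prod_le_spaceTime hν)

lemma IsDrift.integrable_row_prod (h : IsDrift T β K L b Db)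
    (hν : ν ≤ volume.restrict (Icc 0 T)) (i : Fin d) :
    Integrable (Function.uncurry fun s y => Db s y i) (ν.prod volume) :=
  (PiLp.proj (𝕜 := ℝ) 2 (fun _ : Fin d => Euc d) i).integrable_comp (h.integrable_rows_prod hν)

lemma IsDrift.isWeakGrad_timeInt (h : IsDrift T β K L b Db) (hν : ν ≤ volume.restrict (Icc 0 T))
    (i : Fin d) : IsWeakGrad (timeInt ν fun s y => b s y i) (timeInt ν fun s y => Db s y i) := by
  refine TorusTransport.isWeakGrad_timeInt (h.integrable_coord_prod hν i)
    (h.integrable_row_prod hν i) ?_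
  have : ∀ᵐ s ∂(volume.restrict (Icc 0 T)), s ∈ Icc 0 T := ae_restrict_mem measurableSet_Icc
  filter_upwards [ae_mono hν this] with s hs
  exact h.isWeakGrad s hs i

lemma IsDrift.isSmoothField_stepField (h : IsDrift T β K L b Db)
    (hν : ν ≤ volume.restrict (Icc 0 T)) (n : ℕ) : IsSmoothField (stepField ν n b) := fun i =>
  (isSmooth_moll n (integrable_timeInt (h.integrable_coord_prod hν i))).const_mul _

/-- Time integration and mollification both commute with the weak gradient, so bounds on `Db` pass
to the displacement by convexity alone. -/
lemma IsDrift.jac_stepField (h : IsDrift T β K L b Db) (hν : ν ≤ volume.restrict (Icc 0 T))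
    (n : ℕ) (x : Torus d) :
    jac (stepField ν n b) x = fun i => - moll n (timeInt ν (rows Db)) x i := by
  funext i
  have h1 : jac (stepField ν n b) x i
      = - grad (moll n (timeInt ν fun s y => b s y i)) x := by
    ext j
    have := torusPartial_const_mul
      (isSmooth_moll n (integrable_timeInt (h.integrable_coord_prod hν i))) (-1) j x
    simp only [jac, grad_apply, PiLp.neg_apply]
    rw [← neg_one_mul]
    exact this
  rw [h1, grad_moll n (h.isWeakGrad_timeInt hν i)]
  have h2 := clm_moll_timeInt (h.integrable_rows_prod hν)
    (PiLp.proj (𝕜 := ℝ) 2 (fun _ : Fin d => Euc d) i) n x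
  simp only [PiLp.proj_apply] at h2
  rw [h2]
  rfl

lemma IsDrift.frobNorm_jac_stepField (h : IsDrift T β K L b Db)
    (hν : ν ≤ volume.restrict (Icc 0 T)) (n : ℕ) (x : Torus d) :
    frobNorm (jac (stepField ν n b) x) = ‖moll n (timeInt ν (rows Db)) x‖ := by
  rw [h.jac_stepField hν, frobNorm_eq_norm, ← norm_neg]
  congr 1
  ext i
  simp

lemma IsDrift.rowTrace_jac_stepField (h : IsDrift T β K L b Db)
    (hν : ν ≤ volume.restrict (Icc 0 T)) (n : ℕ) (x : Torus d) :
    rowTrace (jac (stepField ν n b) x)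
      = - moll n (timeInt ν fun s y => rowTrace (Db s y)) x := by
  have h2 := clm_moll_timeInt (h.integrable_rows_prod hν) (traceCLM d) n x
  simp only [traceCLM_apply] at h2
  rw [h.jac_stepField hν]
  have h3 : rowTrace (fun i => - moll n (timeInt ν (rows Db)) x i)
      = - rowTrace fun i => moll n (timeInt ν (rows Db)) x i := by
    simp [rowTrace]
  rw [h3, h2]
  rfl

lemma IsDrift.integrable_div_prod (h : IsDrift T β K L b Db)
    (hν : ν ≤ volume.restrict (Icc 0 T)) :
    Integrable (Function.uncurry fun s y => rowTrace (Db s y)) (ν.prod volume) := by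
  have := (traceCLM d).integrable_comp (h.integrable_rows_prod hν)
  refine this.congr (Filter.Eventually.of_forall fun z => ?_)
  simp only [traceCLM_apply]; rfl

lemma IsDrift.abs_rowTrace_jac_stepField_le (h : IsDrift T β K L b Db)
    (hν : ν ≤ volume.restrict (Icc 0 T)) (n : ℕ) (x : Torus d) :
    |rowTrace (jac (stepField ν n b) x)| ≤ L * ν.real univ := by
  rw [h.rowTrace_jac_stepField hν, abs_neg]
  refine norm_moll_le n (f := timeInt ν fun s y => rowTrace (Db s y)) ?_ x
  have h1 : ∀ᵐ z ∂(ν.prod (volume : Measure (Torus d))), |rowTrace (Db z.1 z.2)| ≤ L :=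
    ae_mono (prod_le_spaceTime hν) h.div_le
  have h2 : ∀ᵐ y : Torus d, ∀ᵐ s ∂ν, |rowTrace (Db s y)| ≤ L := by
    have h3 := (Measure.measurePreserving_swap (μ := (volume : Measure (Torus d))) (ν := ν)
      ).quasiMeasurePreserving.ae h1
    exact Measure.ae_ae_of_ae_prod h3
  filter_upwards [h2] with y hy
  exact norm_integral_le_of_norm_le_const hy

/-- Jensen's inequality twice: for the mollification in space and for the normalised time measure. A
time integral over a step of length `τ` is `τ` times an average, whence the rate `β / τ`. -/
lemma IsDrift.lintegral_exp_frobNorm_jac_stepField_le (h : IsDrift T β K L b Db)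
    (hν : ν ≤ volume.restrict (Icc 0 T)) {τ : ℝ} (hτ : 0 < τ) (hντ : ν.real univ ≤ τ) (hβ : 0 < β)
    (n : ℕ) :
    ∫⁻ x, ENNReal.ofReal (Real.exp (β / τ * frobNorm (jac (stepField ν n b) x)))
      ≤ ENNReal.ofReal K := by
  have hR := h.integrable_rows_prod hν
  simp only [h.frobNorm_jac_stepField hν]
  have hconv : ∀ s : ℝ, ConvexOn ℝ (Ici 0) fun r : ℝ => Real.exp (s * r) := fun s =>
    (convexOn_exp.comp_linearMap (LinearMap.mulLeft ℝ s : ℝ →ₗ[ℝ] ℝ)).subset (subset_univ _) (convex_Ici 0)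
  have hmono : ∀ s : ℝ, 0 ≤ s → MonotoneOn (fun r : ℝ => Real.exp (s * r)) (Ici 0) :=
    fun s hs a _ c _ hac => Real.exp_le_exp.2 (mul_le_mul_of_nonneg_left hac hs)
  refine (lintegral_moll_comp_le n (integrable_timeInt hR) (hconv (β / τ)) (by fun_prop)
    (hmono _ (by positivity)) fun r _ => (Real.exp_pos _).le).trans ?_
  -- Slabs beyond the final time carry no mass and cannot be normalised; there the bound is `1 ≤ K`.
  rcases eq_or_ne ν 0 with h0 | h0
  · subst h0
    simp only [timeInt, integral_zero_measure, norm_zero, mul_zero, Real.exp_zero]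
    simpa using ENNReal.ofReal_le_ofReal h.one_le
  have hm0 : 0 < ν.real univ := by
    rw [measureReal_def]
    exact ENNReal.toReal_pos (by simpa using h0) (measure_ne_top _ _)
  -- The measure is normalised by its actual mass; a mass smaller than `τ`, as in an incomplete
  -- slab, only improves the exponent.
  set m := ν.real univ
  set μ : Measure ℝ := (ENNReal.ofReal m)⁻¹ • ν with hμ
  have hmν : ENNReal.ofReal m = ν univ := ofReal_measureReal (measure_ne_top _ _)
  have hprob : IsProbabilityMeasure μ := by
    refine ⟨?_⟩
    rw [hμ, Measure.smul_apply, smul_eq_mul, hmν]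
    exact ENNReal.inv_mul_cancel (by simpa using h0) (measure_ne_top _ _)
  have hc : (ENNReal.ofReal m)⁻¹ ≠ ⊤ := by simpa using hm0
  have hint : ∀ᵐ y : Torus d, Integrable (fun s => rows Db s y) ν := hR.prod_left_ae
  have hpt : ∀ᵐ y : Torus d, ENNReal.ofReal (Real.exp (β / τ * ‖timeInt ν (rows Db) y‖)) ≤
      ∫⁻ s, ENNReal.ofReal (Real.exp (β * frobNorm (Db s y))) ∂μ := by
    filter_upwards [hint] with y hy
    have hJ := ofReal_comp_norm_integral_le (μ := μ) (hy.smul_measure hc) (hconv β) (by fun_prop)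
      (hmono _ hβ.le) fun r _ => (Real.exp_pos _).le
    simp only [frobNorm_eq_norm]
    refine le_trans (ENNReal.ofReal_le_ofReal (Real.exp_le_exp.2 ?_)) hJ
    rw [hμ, integral_smul_measure, norm_smul, ENNReal.toReal_inv, ENNReal.toReal_ofReal hm0.le,
      Real.norm_of_nonneg (by positivity)]
    rw [div_mul_eq_mul_div, mul_div_assoc]
    refine mul_le_mul_of_nonneg_left ?_ hβ.le
    rw [div_eq_inv_mul]
    refine mul_le_mul_of_nonneg_right ?_ (norm_nonneg _)
    exact inv_anti₀ hm0 hντ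
  refine (lintegral_mono_ae hpt).trans ?_
  have hem : AEMeasurable (fun z : ℝ × Torus d =>
      ENNReal.ofReal (Real.exp (β * frobNorm (Db z.1 z.2)))) (μ.prod volume) := by
    have h1 : AEMeasurable (fun z : ℝ × Torus d => frobNorm (Db z.1 z.2)) (ν.prod volume) := by
      simp only [frobNorm_eq_norm]
      exact hR.1.norm.aemeasurable
    have h2 : AEMeasurable (fun z : ℝ × Torus d =>
        ENNReal.ofReal (Real.exp (β * frobNorm (Db z.1 z.2)))) (ν.prod volume) :=
      (Real.measurable_exp.comp_aemeasurable (h1.const_mul β)).ennreal_ofReal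
    refine h2.mono_ac ?_
    rw [hμ, Measure.prod_smul_left]
    exact Measure.smul_absolutelyContinuous
  rw [← lintegral_lintegral_swap (f := fun s y =>
    ENNReal.ofReal (Real.exp (β * frobNorm (Db s y)))) hem]
  have hae : ∀ᵐ s ∂μ, s ∈ Icc 0 T := by
    have : ∀ᵐ s ∂(volume.restrict (Icc 0 T)), s ∈ Icc 0 T := ae_restrict_mem measurableSet_Icc
    exact Measure.ae_smul_measure (ae_mono hν this) _
  calc _ ≤ ∫⁻ s, ENNReal.ofReal K ∂μ := lintegral_mono_ae (hae.mono fun s hs => h.exp_le s hs)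
    _ = _ := by simp

/-- The constant depends on `d` and `n` only and multiplies the `L¹` mass of the drift on the slab:
these bounds have a finite sum over the slabs and are individually small for short steps. -/
lemma exists_fieldBound_stepField (d n : ℕ) : ∃ C : ℝ, 0 ≤ C ∧ ∀ (T β K L : ℝ)
    (b : ℝ → Torus d → Euc d) (Db : ℝ → Torus d → Fin d → Euc d) (ν : Measure ℝ)
    [IsFiniteMeasure ν], IsDrift T β K L b Db → ν ≤ volume.restrict (Icc 0 T) →
    FieldBound (stepField ν n b) (C * ∫ z, ‖b z.1 z.2‖ ∂(ν.prod volume)) := by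
  obtain ⟨C, hC, hb⟩ := exists_moll_bound d n
  refine ⟨d * C, by positivity, fun T β K L b Db ν _ h hν => ?_⟩
  rw [mul_assoc]
  have hle : ∀ i, ∫ y, |timeInt ν (fun s y => b s y i) y| ≤ ∫ z, ‖b z.1 z.2‖ ∂(ν.prod volume) := by
    intro i
    refine (integral_norm_timeInt_le (h.integrable_coord_prod hν i)).trans ?_
    exact integral_mono (h.integrable_coord_prod hν i).norm
      (h.integrable_drift.mono_measure (prod_le_spaceTime hν)).norm
      fun z => PiLp.norm_apply_le (b z.1 z.2) i
  have hsm := fun i => isSmooth_moll n (integrable_timeInt (h.integrable_coord_prod hν i))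
  refine FieldBound.of_components (h.isSmoothField_stepField hν n) (fun i x => ?_) fun i => ?_
  · simp only [stepField, neg_mul, one_mul, abs_neg]
    exact ((hb _ (integrable_timeInt (h.integrable_coord_prod hν i))).1 x).trans
      (mul_le_mul_of_nonneg_left (hle i) hC)
  · have h2 := ((hb _ (integrable_timeInt (h.integrable_coord_prod hν i))).2).mono
      (mul_le_mul_of_nonneg_left (hle i) hC) (mul_le_mul_of_nonneg_left (hle i) hC)
    have hg : ∀ x, grad (fun x => stepField ν n b x i) x
        = - grad (moll n (timeInt ν fun s y => b s y i)) x := by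
      intro x
      ext j
      have := torusPartial_const_mul (hsm i) (-1) j x
      simp only [grad_apply, PiLp.neg_apply]
      rw [← neg_one_mul]
      exact this
    refine ⟨fun x => ?_, fun x w => ?_⟩
    · rw [hg, norm_neg]; exact h2.grad_le x
    · rw [hg, hg, neg_sub_neg, norm_sub_rev]; exact h2.lip x w

end Field

end Drift

/-! ### Time slabs -/

/-- Lebesgue measure on the part of the time interval `(kτ, (k+1)τ]` inside `[0, T]`. -/
noncomputable def slab (T τ : ℝ) (k : ℕ) : Measure ℝ :=
  (volume.restrict (Icc 0 T)).restrict (Ioc (k * τ) ((k + 1) * τ))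

instance (T τ : ℝ) (k : ℕ) : IsFiniteMeasure (slab T τ k) := by
  unfold slab; infer_instance

lemma slab_le (T τ : ℝ) (k : ℕ) : slab T τ k ≤ volume.restrict (Icc 0 T) := Measure.restrict_le_self

lemma slab_prod (d : ℕ) (T τ : ℝ) (k : ℕ) : (slab T τ k).prod (volume : Measure (Torus d)) =
    (spaceTimeMeasure d T).restrict (Ioc (k * τ) ((k + 1) * τ) ×ˢ univ) := by
  rw [spaceTimeMeasure, ← Measure.prod_restrict, Measure.restrict_univ, slab]

lemma measurableSet_slab (d : ℕ) (s t : ℝ) :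
    MeasurableSet (Ioc s t ×ˢ univ : Set (ℝ × Torus d)) := measurableSet_Ioc.prod .univ

lemma slab_univ_le {T τ : ℝ} (hτ : 0 ≤ τ) (k : ℕ) : (slab T τ k).real univ ≤ τ := by
  rw [slab, measureReal_restrict_apply_univ]
  have h : (volume.restrict (Icc 0 T)) (Ioc ((k : ℝ) * τ) ((k + 1) * τ)) ≤ ENNReal.ofReal τ := by
    refine (Measure.restrict_le_self _).trans ?_
    rw [Real.volume_Ioc]
    exact ENNReal.ofReal_le_ofReal (by linarith)
  exact (ENNReal.toReal_mono ENNReal.ofReal_ne_top h).trans (ENNReal.toReal_ofReal hτ).le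

lemma spaceTime_slab_le {T τ : ℝ} (k : ℕ) :
    spaceTimeMeasure d T (Ioc (k * τ) ((k + 1) * τ) ×ˢ univ) ≤ ENNReal.ofReal τ := by
  rw [spaceTimeMeasure, Measure.prod_prod, measure_univ, mul_one]
  refine (Measure.restrict_le_self _).trans ?_
  rw [Real.volume_Ioc]
  exact ENNReal.ofReal_le_ofReal (by linarith)

lemma sum_integral_slab {X : Type*} [NormedAddCommGroup X] [NormedSpace ℝ X] {T τ : ℝ}
    (hτ : 0 ≤ τ) {g : ℝ × Torus d → X} (hg : Integrable g (spaceTimeMeasure d T)) (m : ℕ) :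
    ∑ k ∈ Finset.range m, ∫ z, g z ∂((slab T τ k).prod volume) =
      ∫ z in Ioc 0 (m * τ) ×ˢ univ, g z ∂(spaceTimeMeasure d T) := by
  induction m with
  | zero => simp
  | succ m ih =>
    rw [Finset.sum_range_succ, ih, slab_prod, ← setIntegral_union ?_ (measurableSet_slab d _ _)
      hg.integrableOn hg.integrableOn, ← union_prod]
    · congr 4
      push_cast
      exact Ioc_union_Ioc_eq_Ioc (by positivity) (by linarith)
    · refine Set.disjoint_prod.2 (Or.inl ?_)
      exact Ioc_disjoint_Ioc_of_le le_rfl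

lemma sum_integral_slab_le {T τ : ℝ} (hτ : 0 ≤ τ) {g : ℝ × Torus d → ℝ}
    (hg : Integrable g (spaceTimeMeasure d T)) (hg0 : ∀ z, 0 ≤ g z) (m : ℕ) :
    ∑ k ∈ Finset.range m, ∫ z, g z ∂((slab T τ k).prod volume) ≤ ∫ z, g z ∂(spaceTimeMeasure d T) := by
  rw [sum_integral_slab hτ hg]
  exact setIntegral_le_integral hg (Filter.Eventually.of_forall hg0)

/-- Absolute continuity of the integral: all slabs have measure at most `T / J`, so the smallness is
uniform in `k`. -/
lemma eventually_integral_slab_le {T : ℝ} {g : ℝ × Torus d → ℝ}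
    (hg : Integrable g (spaceTimeMeasure d T)) (hg0 : ∀ z, 0 ≤ g z) {ε : ℝ} (hε : 0 < ε) :
    ∀ᶠ J : ℕ in Filter.atTop, ∀ k, ∫ z, g z ∂((slab T (T / J) k).prod volume) ≤ ε := by
  have hfin : ∫⁻ z, ENNReal.ofReal (g z) ∂(spaceTimeMeasure d T) ≠ ⊤ := by
    have := hg.2.ne
    simp only [Real.enorm_of_nonneg (hg0 _)] at this
    exact this
  obtain ⟨δ, hδ, h⟩ := exists_pos_setLIntegral_lt_of_measure_lt hfin
    (ENNReal.ofReal_pos.2 hε).ne'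
  have ht : Filter.Tendsto (fun J : ℕ => ENNReal.ofReal (T / J)) Filter.atTop (nhds 0) := by
    rw [← ENNReal.ofReal_zero]
    exact ENNReal.tendsto_ofReal (tendsto_const_div_atTop_nhds_zero_nat T)
  filter_upwards [ht.eventually (gt_mem_nhds hδ)] with J hJ k
  have h1 := h _ ((spaceTime_slab_le (d := d) (T := T) (τ := T / J) k).trans_lt hJ)
  rw [slab_prod, integral_eq_lintegral_of_nonneg_ae (Filter.Eventually.of_forall hg0)
    hg.1.restrict]
  exact ENNReal.toReal_le_of_le_ofReal hε.le h1.le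

/-! ### Schemes -/

/-- A sequence of small displacements approximating the flow of a drift with time step `τ`, together
with bounds `a k` on the `k`-th displacement and `exp (lam k)` on its compressibility. -/
structure IsScheme (T τ β K L : ℝ) (V : ℕ → Torus d → Euc d) (a lam : ℕ → ℝ) : Prop where
  pos : 0 < τ
  field : ∀ k, FieldBound (V k) (a k)
  lam_nonneg : ∀ k, 0 ≤ lam k
  comp : ∀ k, ∀ F : Torus d → ENNReal, Measurable F →
    ∫⁻ x, F (displace (V k) x) ≤ ENNReal.ofReal (Real.exp (lam k)) * ∫⁻ x, F x
  sum_lam : ∀ k : ℕ, k * τ ≤ T → ∑ j ∈ Finset.range k, lam j ≤ L * (k * τ) + 1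
  exp_le : ∀ k, ∫⁻ x, ENNReal.ofReal (Real.exp (β / τ * frobNorm (jac (V k) x))) ≤ ENNReal.ofReal K

/-- The displacements of a drift at mollification parameter `n` for the time step `τ`. -/
noncomputable def driftSteps (T τ : ℝ) (n : ℕ) (b : ℝ → Torus d → Euc d) (k : ℕ) : Torus d → Euc d :=
  stepField (slab T τ k) n b

/-- The errors in the compression rates are quadratic in the steps. A sum of squares is at most the
largest term times the sum, and the largest term tends to zero, so the total error is made at most
one. -/
lemma exists_isScheme {T β K L : ℝ} {b : ℝ → Torus d → Euc d} {Db : ℝ → Torus d → Fin d → Euc d}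
    (h : IsDrift T β K L b Db) (hT : 0 < T) (hβ : 0 < β) (hL : 0 ≤ L) (n : ℕ) :
    ∃ C : ℝ, 0 ≤ C ∧ ∀ᶠ J : ℕ in Filter.atTop, ∃ lam : ℕ → ℝ,
      IsScheme T (T / J) β K L (driftSteps T (T / J) n b)
        (fun k => C * ∫ z, ‖b z.1 z.2‖ ∂((slab T (T / J) k).prod volume)) lam := by
  obtain ⟨C, hC, hF⟩ := exists_fieldBound_stepField d n
  obtain ⟨D, r, hD, hr, hcomp⟩ := exists_lintegral_comp_displace_le d
  refine ⟨C, hC, ?_⟩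
  set N := ∫ z, ‖b z.1 z.2‖ ∂(spaceTimeMeasure d T) with hN
  have hN0 : 0 ≤ N := integral_nonneg fun z => norm_nonneg _
  have hgb : Integrable (fun z : ℝ × Torus d => ‖b z.1 z.2‖) (spaceTimeMeasure d T) :=
    h.integrable_drift.norm
  -- smallness parameters
  have hε : 0 < min r (1 / (2 * (D * (C * N) + 1))) := by positivity
  set ε := min r (1 / (2 * (D * (C * N) + 1))) with hεdef
  have h1 := eventually_integral_slab_le hgb (fun z => norm_nonneg _)
    (ε := ε / (C + 1)) (by positivity)
  -- Makes `D m (L τ)² ≤ D L T · L τ ≤ 1/2` while `m τ ≤ T`; the squares of the field bounds take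
  -- the other half of the error budget.
  have h2 : ∀ᶠ J : ℕ in Filter.atTop, L * (T / J) < min r (1 / (2 * (D * L * T + 1))) := by
    have : Filter.Tendsto (fun J : ℕ => L * (T / J)) Filter.atTop (nhds (L * 0)) :=
      (tendsto_const_div_atTop_nhds_zero_nat T).const_mul L
    rw [mul_zero] at this
    exact this.eventually (gt_mem_nhds (by positivity))
  filter_upwards [h1, h2, Filter.eventually_gt_atTop 0] with J hJ1 hJ2 hJ0
  set τ := T / J with hτdef
  have hτ : 0 < τ := by positivity
  set α : ℕ → ℝ := fun k => ∫ z, ‖b z.1 z.2‖ ∂((slab T τ k).prod volume) with hα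
  have hα0 : ∀ k, 0 ≤ α k := fun k => integral_nonneg fun z => norm_nonneg _
  have hαε : ∀ k, C * α k ≤ ε := by
    intro k
    calc C * α k ≤ C * (ε / (C + 1)) := mul_le_mul_of_nonneg_left (hJ1 k) hC
      _ = ε * (C / (C + 1)) := by ring
      _ ≤ ε * 1 := by
          refine mul_le_mul_of_nonneg_left ?_ hε.le
          rw [div_le_one (by positivity)]; linarith
      _ = ε := mul_one _
  have hLτ0 : 0 ≤ L * τ := by positivity
  refine ⟨fun k => L * τ + D * ((C * α k) ^ 2 + (L * τ) ^ 2), hτ,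
    fun k => hF T β K L b Db _ h (slab_le T τ k), fun k => by positivity, fun k F hFm => ?_,
    fun m hm => ?_, fun k => ?_⟩
  · refine hcomp _ _ _ (hF T β K L b Db _ h (slab_le T τ k)) ((hαε k).trans (min_le_left _ _))
      hLτ0 (hJ2.le.trans (min_le_left _ _)) (fun x => ?_) F hFm
    refine (h.abs_rowTrace_jac_stepField_le (slab_le T τ k) n x).trans ?_
    exact mul_le_mul_of_nonneg_left (slab_univ_le hτ.le k) hL
  -- One factor of each square is bounded by the uniform `ε`; the other factors add up to the mass
  -- of the drift.
  · have hs1 : ∑ k ∈ Finset.range m, (C * α k) ^ 2 ≤ ε * (C * N) := by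
      calc ∑ k ∈ Finset.range m, (C * α k) ^ 2 ≤ ∑ k ∈ Finset.range m, ε * (C * α k) := by
            refine Finset.sum_le_sum fun k _ => ?_
            rw [sq]
            exact mul_le_mul_of_nonneg_right (hαε k) (mul_nonneg hC (hα0 k))
        _ = ε * (C * ∑ k ∈ Finset.range m, α k) := by rw [← Finset.mul_sum, ← Finset.mul_sum]
        _ ≤ ε * (C * N) := by
            have := sum_integral_slab_le hτ.le hgb (fun z => norm_nonneg _) m
            gcongr
    have hs2 : D * (ε * (C * N)) ≤ 1 / 2 := by
      have : ε ≤ 1 / (2 * (D * (C * N) + 1)) := min_le_right _ _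
      rw [le_div_iff₀ (by positivity)] at this
      nlinarith [hε.le]
    have hs3 : D * (m * (L * τ) ^ 2) ≤ 1 / 2 := by
      have h3 : L * τ ≤ 1 / (2 * (D * L * T + 1)) := hJ2.le.trans (min_le_right _ _)
      have h4 : D * (m * (L * τ) ^ 2) ≤ D * L * T * (L * τ) := by
        have : D * (m * (L * τ) ^ 2) = D * L * (m * τ) * (L * τ) := by ring
        rw [this]
        gcongr
      rw [le_div_iff₀ (by positivity)] at h3
      nlinarith
    calc ∑ k ∈ Finset.range m, (L * τ + D * ((C * α k) ^ 2 + (L * τ) ^ 2))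
        = L * (m * τ) + D * (∑ k ∈ Finset.range m, (C * α k) ^ 2) + D * (m * (L * τ) ^ 2) := by
          rw [Finset.sum_add_distrib, Finset.sum_const, ← Finset.mul_sum, Finset.sum_add_distrib,
            Finset.sum_const]
          simp only [Finset.card_range, nsmul_eq_mul]
          ring
      _ ≤ L * (m * τ) + D * (ε * (C * N)) + D * (m * (L * τ) ^ 2) := by gcongr
      _ ≤ _ := by linarith
  · exact h.lintegral_exp_frobNorm_jac_stepField_le (slab_le T τ k) hτ (slab_univ_le hτ.le k) hβ n

/-! ### Consistency of the scheme with the transport equation -/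

lemma HasC2Bound.abs_comp_displace_sub_le {V : Torus d → Euc d} {a Q : ℝ} (hu : IsSmoothOnTorus u)
    (h : HasC2Bound u Q Q) (hV : FieldBound V a) (x : Torus d) :
    |u (displace V x) - u x - ∑ i, V x i * torusPartial u i x| ≤ Q * a ^ 2 := by
  refine (h.taylor h.nonneg hu x (V x)).trans ?_
  have := hV.norm_le x
  exact mul_le_mul_of_nonneg_left (pow_le_pow_left₀ (norm_nonneg _) this 2) h.nonneg

lemma integral_field_mul_torusPartial {V : Torus d → Euc d} (hu : IsSmoothOnTorus u)
    (hφ : IsSmoothOnTorus φ) (hV : IsSmoothField V) :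
    ∫ x, (∑ i, V x i * torusPartial u i x) * φ x =
      - ∫ x, u x * ((∑ i, V x i * torusPartial φ i x) + rowTrace (jac V x) * φ x) := by
  have hc : ∀ i, Continuous fun x => V x i := fun i => (hV i).continuous
  have hcu := fun i => (hu.smooth_torusPartial i).continuous
  have hcφ := fun i => (hφ.smooth_torusPartial i).continuous
  have hcV := fun i => ((hV i).smooth_torusPartial i).continuous
  have h1 : ∀ x, (∑ i, V x i * torusPartial u i x) * φ x
      = ∑ i, torusPartial u i x * (V x i * φ x) := fun x => by
    rw [Finset.sum_mul]; exact Finset.sum_congr rfl fun i _ => by ring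
  have h2 : ∀ x, u x * ((∑ i, V x i * torusPartial φ i x) + rowTrace (jac V x) * φ x)
      = ∑ i, u x * torusPartial (fun x => V x i * φ x) i x := fun x => by
    rw [rowTrace, Finset.sum_mul, ← Finset.sum_add_distrib, Finset.mul_sum]
    refine Finset.sum_congr rfl fun i _ => ?_
    rw [torusPartial_mul (hV i) hφ]
    simp only [jac, grad_apply]
    ring
  have hsm := fun i => (hV i).mul hφ
  simp_rw [h1, h2]
  rw [integral_finsetSum _ fun i _ => ?_, integral_finsetSum _ fun i _ => ?_,
    ← Finset.sum_neg_distrib]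
  · refine Finset.sum_congr rfl fun i _ => ?_
    rw [integral_mul_torusPartial hu (hsm i), neg_neg]
  · exact integrable_of_continuous (hu.continuous.mul ((hsm i).smooth_torusPartial i).continuous)
  · exact integrable_of_continuous ((hcu i).mul ((hc i).mul hφ.continuous))

section Drift

variable {T β K L : ℝ} {b : ℝ → Torus d → Euc d} {Db : ℝ → Torus d → Fin d → Euc d}

/-- The integrand `b · ∇φ + (div b) φ` of the weak formulation. -/
noncomputable def weakIntegrand (b : ℝ → Torus d → Euc d) (Db : ℝ → Torus d → Fin d → Euc d)
    (φ : Torus d → ℝ) (z : ℝ × Torus d) : ℝ :=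
  (∑ i, b z.1 z.2 i * torusPartial φ i z.2) + rowTrace (Db z.1 z.2) * φ z.2

/-- The pointwise mollification error of the drift and of its divergence. -/
noncomputable def mollError (b : ℝ → Torus d → Euc d) (Db : ℝ → Torus d → Fin d → Euc d) (n : ℕ)
    (z : ℝ × Torus d) : ℝ :=
  (∑ i, |moll n (fun y => b z.1 y i) z.2 - b z.1 z.2 i|) +
    |moll n (fun y => rowTrace (Db z.1 y)) z.2 - rowTrace (Db z.1 z.2)|

lemma mollError_nonneg (n : ℕ) (z : ℝ × Torus d) : 0 ≤ mollError b Db n z :=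
  add_nonneg (Finset.sum_nonneg fun _ _ => abs_nonneg _) (abs_nonneg _)

section Measure

variable {ν : Measure ℝ} [IsFiniteMeasure ν]

lemma IsDrift.integrable_weakIntegrand (h : IsDrift T β K L b Db)
    (hν : ν ≤ volume.restrict (Icc 0 T)) (hφ : IsSmoothOnTorus φ) :
    Integrable (weakIntegrand b Db φ) (ν.prod volume) := by
  refine Integrable.add (integrable_finsetSum _ fun i _ => ?_) ?_
  · have := integrable_smul_of_continuous (hφ.smooth_torusPartial i).continuous
      (h.integrable_coord_prod hν i)
    simpa only [smul_eq_mul, mul_comm] using this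
  · have := integrable_smul_of_continuous hφ.continuous (h.integrable_div_prod hν)
    simpa only [smul_eq_mul, mul_comm] using this

lemma IsDrift.integrable_mollError (h : IsDrift T β K L b Db)
    (hν : ν ≤ volume.restrict (Icc 0 T)) (n : ℕ) :
    Integrable (mollError b Db n) (ν.prod volume) :=
  Integrable.add (integrable_finsetSum _ fun i _ =>
    ((integrable_moll_prod n (h.integrable_coord_prod hν i)).sub (h.integrable_coord_prod hν i)).abs)
    ((integrable_moll_prod n (h.integrable_div_prod hν)).sub (h.integrable_div_prod hν)).abs

lemma IsDrift.integral_mollError (h : IsDrift T β K L b Db)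
    (hν : ν ≤ volume.restrict (Icc 0 T)) (n : ℕ) :
    ∫ z, mollError b Db n z ∂(ν.prod volume) =
      (∑ i, ∫ z, |moll n (fun y => b z.1 y i) z.2 - b z.1 z.2 i| ∂(ν.prod volume)) +
      ∫ z, |moll n (fun y => rowTrace (Db z.1 y)) z.2 - rowTrace (Db z.1 z.2)|
        ∂(ν.prod volume) := by
  have hi : ∀ i, Integrable (fun z : ℝ × Torus d =>
      |moll n (fun y => b z.1 y i) z.2 - b z.1 z.2 i|) (ν.prod volume) := fun i =>
    ((integrable_moll_prod n (h.integrable_coord_prod hν i)).sub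
      (h.integrable_coord_prod hν i)).abs
  rw [← integral_finsetSum _ fun i _ => hi i]
  exact integral_add (integrable_finsetSum _ fun i _ => hi i)
    ((integrable_moll_prod n (h.integrable_div_prod hν)).sub (h.integrable_div_prod hν)).abs

lemma IsDrift.tendsto_integral_mollError (h : IsDrift T β K L b Db)
    (hν : ν ≤ volume.restrict (Icc 0 T)) :
    Filter.Tendsto (fun n => ∫ z, mollError b Db n z ∂(ν.prod volume)) Filter.atTop (nhds 0) := by
  simp_rw [h.integral_mollError hν]
  have h2 := (tendsto_finsetSum Finset.univ fun i _ =>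
    tendsto_integral_moll_sub_prod (h.integrable_coord_prod hν i)).add
    (tendsto_integral_moll_sub_prod (h.integrable_div_prod hν))
  simpa using h2

/-- Taylor expansion, then integration by parts moves the derivative onto `φ`, then the mollified
coefficients are compared with the true ones. The first error carries the second order bound `Q` but
is quadratic in the step; the second involves only the sup bound of `u`, so it survives the removal
of the mollification. -/
lemma IsDrift.abs_integral_comp_displace_sub_le (h : IsDrift T β K L b Db)
    (hν : ν ≤ volume.restrict (Icc 0 T)) {n : ℕ} {a Q M Φ : ℝ} (hu : IsSmoothOnTorus u)
    (hφ : IsSmoothOnTorus φ) (hQ : HasC2Bound u Q Q) (hV : FieldBound (stepField ν n b) a)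
    (hM : ∀ x, |u x| ≤ M) (hΦ : ∀ x, |φ x| ≤ Φ) (hΦ' : ∀ i x, |torusPartial φ i x| ≤ Φ) :
    |(∫ x, u (displace (stepField ν n b) x) * φ x) - (∫ x, u x * φ x) -
      ∫ z, u z.2 * weakIntegrand b Db φ z ∂(ν.prod volume)| ≤
      Q * a ^ 2 * Φ + M * Φ * ∫ z, mollError b Db n z ∂(ν.prod volume) := by
  set V := stepField ν n b with hVdef
  have hΦ0 : 0 ≤ Φ := (abs_nonneg _).trans (hΦ 0)
  have hM0 : 0 ≤ M := (abs_nonneg _).trans (hM 0)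
  have hcφ := fun i => (hφ.smooth_torusPartial i).continuous
  have hcu := fun i => (hu.smooth_torusPartial i).continuous
  have hcV : ∀ i, Continuous fun x => V x i := fun i => (hV.smooth i).continuous
  set B : Fin d → Torus d → ℝ := fun i => timeInt ν fun s y => b s y i with hB
  set D : Torus d → ℝ := timeInt ν fun s y => rowTrace (Db s y) with hD
  have hBi : ∀ i, Integrable (B i) := fun i => integrable_timeInt (h.integrable_coord_prod hν i)
  have hDi : Integrable D := integrable_timeInt (h.integrable_div_prod hν)
  have hmB := fun i => integrable_of_continuous (continuous_moll n (hBi i))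
  have hmD := integrable_of_continuous (continuous_moll n hDi)
  -- Taylor expansion
  have hcd : Continuous fun x => u (displace V x) := hu.continuous.comp
    (continuous_displace hV.smooth.continuous)
  have hcs : Continuous fun x => ∑ i, V x i * torusPartial u i x :=
    continuous_finsetSum _ fun i _ => (hcV i).mul (hcu i)
  have e1 : |(∫ x, u (displace V x) * φ x) - (∫ x, u x * φ x) -
      ∫ x, (∑ i, V x i * torusPartial u i x) * φ x| ≤ Q * a ^ 2 * Φ := by
    have i1 : Integrable fun x => u (displace V x) * φ x :=
      integrable_of_continuous (hcd.mul hφ.continuous)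
    have i2 : Integrable fun x => u x * φ x :=
      integrable_of_continuous (hu.continuous.mul hφ.continuous)
    have i3 : Integrable fun x => (∑ i, V x i * torusPartial u i x) * φ x :=
      integrable_of_continuous (hcs.mul hφ.continuous)
    have i4 : Integrable fun x => u (displace V x) * φ x - u x * φ x := i1.sub i2
    rw [← integral_sub i1 i2, ← integral_sub i4 i3]
    have := norm_integral_le_of_norm_le_const (μ := (volume : Measure (Torus d)))
      (f := fun x => u (displace V x) * φ x - u x * φ x -
        (∑ i, V x i * torusPartial u i x) * φ x) (C := Q * a ^ 2 * Φ)
      (Filter.Eventually.of_forall fun x => by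
        rw [← sub_mul, ← sub_mul, norm_mul]
        exact mul_le_mul (hQ.abs_comp_displace_sub_le hu hV x) (hΦ x) (abs_nonneg _)
          (mul_nonneg hQ.nonneg (sq_nonneg _)))
    simpa using this
  -- the time integral of the weak integrand
  have e2 : ∫ z, u z.2 * weakIntegrand b Db φ z ∂(ν.prod volume) =
      ∫ x, u x * ((∑ i, B i x * torusPartial φ i x) + D x * φ x) := by
    have hΨ := h.integrable_weakIntegrand hν hφ
    have := integral_smul_timeInt (F := fun s x => weakIntegrand b Db φ (s, x)) hu.continuous hΨ
    simp only [smul_eq_mul] at this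
    rw [← this]
    refine integral_congr_ae ?_
    have hb : ∀ᵐ y : Torus d, ∀ i, Integrable (fun s => b s y i) ν :=
      ae_all_iff.2 fun i => (h.integrable_coord_prod hν i).prod_left_ae
    have hd : ∀ᵐ y : Torus d, Integrable (fun s => rowTrace (Db s y)) ν :=
      (h.integrable_div_prod hν).prod_left_ae
    filter_upwards [hb, hd] with y hy hy'
    congr 1
    simp only [timeInt, weakIntegrand, hB, hD]
    rw [integral_add (integrable_finsetSum _ fun i _ => (hy i).mul_const _) (hy'.mul_const _),
      integral_finsetSum _ fun i _ => (hy i).mul_const _, integral_mul_const]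
    congr 1
    exact Finset.sum_congr rfl fun i _ => integral_mul_const _ _
  have e3 : ∫ x, (∑ i, V x i * torusPartial u i x) * φ x =
      ∫ x, u x * ((∑ i, moll n (B i) x * torusPartial φ i x) + moll n D x * φ x) := by
    rw [integral_field_mul_torusPartial hu hφ hV.smooth, ← integral_neg]
    refine integral_congr_ae (Filter.Eventually.of_forall fun x => ?_)
    simp only [hVdef, h.rowTrace_jac_stepField hν, stepField]
    rw [← mul_neg, neg_add, ← Finset.sum_neg_distrib]
    congr 2
    · exact Finset.sum_congr rfl fun i _ => by ring
    · ring
  have hw1 : Integrable fun x => u x * ((∑ i, moll n (B i) x * torusPartial φ i x) + moll n D x * φ x) :=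
    integrable_of_continuous (hu.continuous.mul ((continuous_finsetSum _ fun i _ =>
      (continuous_moll n (hBi i)).mul (hcφ i)).add ((continuous_moll n hDi).mul hφ.continuous)))
  have hw2 : Integrable fun x => u x * ((∑ i, B i x * torusPartial φ i x) + D x * φ x) := by
    have := TorusTransport.Continuous.integrable_mul (f := fun x => (∑ i, B i x * torusPartial φ i x) + D x * φ x)
      ((integrable_finsetSum _ fun i _ => Continuous.integrable_mul (hBi i) (hcφ i)).add
        (Continuous.integrable_mul hDi hφ.continuous)) hu.continuous
    simpa only [mul_comm] using this
  have e4 : |(∫ x, u x * ((∑ i, moll n (B i) x * torusPartial φ i x) + moll n D x * φ x)) -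
      ∫ x, u x * ((∑ i, B i x * torusPartial φ i x) + D x * φ x)| ≤
      M * Φ * ∫ z, mollError b Db n z ∂(ν.prod volume) := by
    rw [← integral_sub hw1 hw2]
    have hdi : ∀ i, Integrable fun x => |moll n (B i) x - B i x| := fun i => ((hmB i).sub (hBi i)).abs
    have hdd : Integrable fun x => |moll n D x - D x| := (hmD.sub hDi).abs
    have hpt : ∀ x, ‖u x * ((∑ i, moll n (B i) x * torusPartial φ i x) + moll n D x * φ x) -
        u x * ((∑ i, B i x * torusPartial φ i x) + D x * φ x)‖ ≤
        M * Φ * ((∑ i, |moll n (B i) x - B i x|) + |moll n D x - D x|) := by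
      intro x
      have : u x * ((∑ i, moll n (B i) x * torusPartial φ i x) + moll n D x * φ x) -
        u x * ((∑ i, B i x * torusPartial φ i x) + D x * φ x) =
        u x * ((∑ i, (moll n (B i) x - B i x) * torusPartial φ i x) + (moll n D x - D x) * φ x) := by
        simp only [sub_mul, Finset.sum_sub_distrib]; ring
      rw [this, norm_mul, mul_assoc]
      refine mul_le_mul (hM x) ?_ (norm_nonneg _) hM0
      rw [mul_add, Finset.mul_sum]
      refine (norm_add_le _ _).trans (add_le_add ((norm_sum_le _ _).trans
        (Finset.sum_le_sum fun i _ => ?_)) ?_)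
      · rw [norm_mul, mul_comm]
        exact mul_le_mul_of_nonneg_right (hΦ' i x) (abs_nonneg _)
      · rw [norm_mul, mul_comm]
        exact mul_le_mul_of_nonneg_right (hΦ x) (abs_nonneg _)
    refine (norm_integral_le_integral_norm _).trans ((integral_mono (hw1.sub hw2).norm
      (((integrable_finsetSum _ fun i _ => hdi i).add hdd).const_mul _) hpt).trans ?_)
    rw [integral_const_mul]
    refine mul_le_mul_of_nonneg_left ?_ (mul_nonneg hM0 hΦ0)
    have hsum : ∫ x, ((∑ i, |moll n (B i) x - B i x|) + |moll n D x - D x|) =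
        (∑ i, ∫ x, |moll n (B i) x - B i x|) + ∫ x, |moll n D x - D x| := by
      rw [← integral_finsetSum _ fun i _ => hdi i]
      exact integral_add (integrable_finsetSum _ fun i _ => hdi i) hdd
    refine hsum.trans_le ?_
    rw [h.integral_mollError hν]
    exact add_le_add (Finset.sum_le_sum fun i _ =>
      integral_abs_moll_timeInt_sub_le n (h.integrable_coord_prod hν i))
      (integral_abs_moll_timeInt_sub_le n (h.integrable_div_prod hν))
  rw [e3] at e1
  rw [e2]
  refine le_trans ?_ (add_le_add e1 e4)
  refine le_trans (le_of_eq ?_) (abs_add_le _ _)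
  congr 1
  ring

end Measure

end Drift

/-! ### Approximate solutions -/

/-- The number `k` of the interval `(kτ, (k+1)τ]` containing `t > 0`. -/
noncomputable def stepIndex (τ t : ℝ) : ℕ := ⌈t / τ⌉₊ - 1

lemma stepIndex_eq {τ t : ℝ} (hτ : 0 < τ) {k : ℕ} (ht : t ∈ Ioc (k * τ) ((k + 1) * τ)) :
    stepIndex τ t = k := by
  have h : ⌈t / τ⌉₊ = k + 1 := by
    rw [Nat.ceil_eq_iff (by lia)]
    constructor
    · rw [lt_div_iff₀ hτ]; simpa using ht.1
    · rw [div_le_iff₀ hτ]; simpa using ht.2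
  rw [stepIndex, h]; rfl

lemma stepIndex_mul_le {τ t : ℝ} (hτ : 0 < τ) (ht : 0 ≤ t) : stepIndex τ t * τ ≤ t := by
  rw [← le_div_iff₀ hτ]
  rcases Nat.eq_zero_or_pos ⌈t / τ⌉₊ with h | h
  -- At `t = 0` the truncated subtraction gives index `0`, as wanted: no displacement has been
  -- applied.
  · simp only [stepIndex, h, zero_tsub, Nat.cast_zero]; positivity
  · have h1 : ⌈t / τ⌉₊ - 1 < ⌈t / τ⌉₊ := by lia
    exact (Nat.lt_ceil.1 h1).le

lemma le_stepIndex_add_one_mul {τ t : ℝ} (hτ : 0 < τ) : t ≤ (stepIndex τ t + 1) * τ := by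
  rw [← div_le_iff₀ hτ]
  refine (Nat.le_ceil _).trans ?_
  have : ⌈t / τ⌉₊ ≤ stepIndex τ t + 1 := by rw [stepIndex]; lia
  exact_mod_cast this

lemma measurable_stepIndex (τ : ℝ) : Measurable (stepIndex τ) :=
  (measurable_from_nat (f := fun k => k - 1)).comp
    (Nat.measurable_ceil.comp (measurable_id.div_const τ))

/-- The approximate solution with initial datum `U` given by a sequence of displacements. -/
noncomputable def approx (V : ℕ → Torus d → Euc d) (τ : ℝ) (U : Torus d → ℝ) (t : ℝ) (x : Torus d) :
    ℝ := U (traj V (stepIndex τ t) x)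

lemma measurable_approx {V : ℕ → Torus d → Euc d} (hV : ∀ k, IsSmoothField (V k)) (τ : ℝ)
    (hu : Continuous u) : Measurable fun z : ℝ × Torus d => approx V τ u z.1 z.2 := by
  have h1 : Measurable fun z : ℕ × Torus d => u (traj V z.1 z.2) :=
    measurable_from_prod_countable_right fun k => (hu.comp (continuous_traj hV k)).measurable
  exact h1.comp (((measurable_stepIndex τ).comp measurable_fst).prodMk measurable_snd)

section Drift

variable {T β K L : ℝ} {b : ℝ → Torus d → Euc d} {Db : ℝ → Torus d → Fin d → Euc d}

lemma IsDrift.integrable_weakIntegrand_spaceTime (h : IsDrift T β K L b Db)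
    (hφ : IsSmoothOnTorus φ) : Integrable (weakIntegrand b Db φ) (spaceTimeMeasure d T) :=
  h.integrable_weakIntegrand le_rfl hφ

lemma IsDrift.integrable_mollError_spaceTime (h : IsDrift T β K L b Db) (n : ℕ) :
    Integrable (mollError b Db n) (spaceTimeMeasure d T) :=
  h.integrable_mollError le_rfl n

/-- On each slab the approximation is constant in time, so the one-step errors telescope; the
unfinished last slab contributes the term `M * ε`. -/
lemma IsDrift.abs_weak_eq_approx_le (h : IsDrift T β K L b Db) {τ : ℝ} {n : ℕ} {a lam : ℕ → ℝ}
    (hS : IsScheme T τ β K L (driftSteps T τ n b) a lam) {Q M Φ A ε : ℝ} (hu : IsSmoothOnTorus u)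
    (hφ : IsSmoothOnTorus φ) (hQ : HasC2Bound u Q Q) (hM : ∀ x, |u x| ≤ M) (hΦ : ∀ x, |φ x| ≤ Φ)
    (hΦ' : ∀ i x, |torusPartial φ i x| ≤ Φ) (hA : ∀ m, ∑ j ∈ Finset.range m, a j ≤ A)
    (haε : ∀ k, a k ≤ ε)
    (hε : ∀ k, ∫ z, |weakIntegrand b Db φ z| ∂((slab T τ k).prod volume) ≤ ε)
    {t : ℝ} (ht : 0 ≤ t) :
    |(∫ x, approx (driftSteps T τ n b) τ u t x * φ x) - (∫ x, u x * φ x) -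
      ∫ z in Ioc 0 t ×ˢ univ, approx (driftSteps T τ n b) τ u z.1 z.2 * weakIntegrand b Db φ z
        ∂(spaceTimeMeasure d T)| ≤
      Real.exp (3 * A) * Q * Φ * (ε * A) + M * Φ * (∫ z, mollError b Db n z ∂(spaceTimeMeasure d T))
        + M * ε := by
  set V := driftSteps T τ n b with hV
  have hΦ0 : 0 ≤ Φ := (abs_nonneg _).trans (hΦ 0)
  have hM0 : 0 ≤ M := (abs_nonneg _).trans (hM 0)
  have ha0 : ∀ k, 0 ≤ a k := fun k => (hS.field k).nonneg
  have hsm : ∀ k, IsSmoothField (V k) := fun k => (hS.field k).smooth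
  have hτ := hS.pos
  set k := stepIndex τ t with hk
  set w : ℕ → Torus d → ℝ := fun j x => u (traj V j x) with hw
  have hwsm : ∀ j, IsSmoothOnTorus (w j) := fun j => smooth_comp_traj hsm hu j
  have hwQ : ∀ j, HasC2Bound (w j) (Real.exp (3 * A) * Q) (Real.exp (3 * A) * Q) := fun j => by
    have h1 := hasC2Bound_comp_traj hS.field hu hQ j
    have h2 : Real.exp (3 * ∑ i ∈ Finset.range j, a i) * Q ≤ Real.exp (3 * A) * Q := by
      have := hA j
      have := hQ.nonneg
      gcongr
    exact h1.mono h2 h2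
  have hΨ := h.integrable_weakIntegrand_spaceTime hφ
  set G : ℝ × Torus d → ℝ := fun z => approx V τ u z.1 z.2 * weakIntegrand b Db φ z with hG
  have hGle : ∀ z, |G z| ≤ M * |weakIntegrand b Db φ z| := fun z => by
    simp only [hG, abs_mul]
    exact mul_le_mul_of_nonneg_right (hM _) (abs_nonneg _)
  have hGi : Integrable G (spaceTimeMeasure d T) :=
    hΨ.bdd_mul (c := M) (measurable_approx hsm τ hu.continuous).aestronglyMeasurable
      (Filter.Eventually.of_forall fun z => hM _)
  -- one step
  have hstep : ∀ j, |(∫ x, w (j + 1) x * φ x) - (∫ x, w j x * φ x) -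
      ∫ z, G z ∂((slab T τ j).prod volume)| ≤
      Real.exp (3 * A) * Q * Φ * (ε * a j) +
        M * Φ * ∫ z, mollError b Db n z ∂((slab T τ j).prod volume) := by
    intro j
    have h1 := h.abs_integral_comp_displace_sub_le (slab_le T τ j) (hwsm j) hφ (hwQ j) (hS.field j)
      (fun x => hM _) hΦ hΦ'
    have h2 : ∫ z, G z ∂((slab T τ j).prod volume) =
        ∫ z, w j z.2 * weakIntegrand b Db φ z ∂((slab T τ j).prod volume) := by
      rw [slab_prod]
      refine setIntegral_congr_fun (measurableSet_slab d _ _) fun z hz => ?_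
      simp only [hG, approx, stepIndex_eq hτ hz.1, hw]
    rw [h2]
    refine h1.trans (add_le_add_left ?_ _)
    have h3 : (a j) ^ 2 ≤ ε * a j := by
      rw [sq]; exact mul_le_mul_of_nonneg_right (haε j) (ha0 j)
    calc Real.exp (3 * A) * Q * a j ^ 2 * Φ ≤ Real.exp (3 * A) * Q * (ε * a j) * Φ :=
          mul_le_mul_of_nonneg_right (mul_le_mul_of_nonneg_left h3 (hwQ 0).nonneg) hΦ0
      _ = _ := by ring
  -- telescoping
  have hsplit : ∫ z in Ioc 0 t ×ˢ univ, G z ∂(spaceTimeMeasure d T) =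
      (∑ j ∈ Finset.range k, ∫ z, G z ∂((slab T τ j).prod volume)) +
      ∫ z in Ioc (k * τ) t ×ˢ univ, G z ∂(spaceTimeMeasure d T) := by
    rw [sum_integral_slab hτ.le hGi, ← setIntegral_union ?_ (measurableSet_slab d _ _)
      hGi.integrableOn hGi.integrableOn, ← union_prod,
      Ioc_union_Ioc_eq_Ioc (by positivity) (stepIndex_mul_le hτ ht)]
    exact Set.disjoint_prod.2 (Or.inl (Ioc_disjoint_Ioc_of_le le_rfl))
  have hlast : |∫ z in Ioc (k * τ) t ×ˢ univ, G z ∂(spaceTimeMeasure d T)| ≤ M * ε := by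
    calc |∫ z in Ioc (k * τ) t ×ˢ univ, G z ∂(spaceTimeMeasure d T)|
        ≤ ∫ z in Ioc (k * τ) t ×ˢ univ, |G z| ∂(spaceTimeMeasure d T) :=
          abs_integral_le_integral_abs
      _ ≤ ∫ z in Ioc (k * τ) ((k + 1) * τ) ×ˢ univ, |G z| ∂(spaceTimeMeasure d T) :=
          setIntegral_mono_set hGi.abs.integrableOn
            (Filter.Eventually.of_forall fun z => abs_nonneg _)
            (Filter.Eventually.of_forall
              (prod_mono (Ioc_subset_Ioc_right (le_stepIndex_add_one_mul hτ)) subset_rfl))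
      _ ≤ ∫ z in Ioc (k * τ) ((k + 1) * τ) ×ˢ univ, M * |weakIntegrand b Db φ z|
            ∂(spaceTimeMeasure d T) :=
          integral_mono hGi.abs.integrableOn (hΨ.abs.const_mul M).integrableOn hGle
      _ ≤ M * ε := by
          rw [integral_const_mul, ← slab_prod]
          exact mul_le_mul_of_nonneg_left (hε k) hM0
  have htel : (∫ x, w k x * φ x) - ∫ x, w 0 x * φ x =
      ∑ j ∈ Finset.range k, ((∫ x, w (j + 1) x * φ x) - ∫ x, w j x * φ x) :=
    (Finset.sum_range_sub (fun j => ∫ x, w j x * φ x) k).symm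
  have hmain : (∫ x, approx V τ u t x * φ x) - (∫ x, u x * φ x) -
      ∫ z in Ioc 0 t ×ˢ univ, G z ∂(spaceTimeMeasure d T) =
      (∑ j ∈ Finset.range k, ((∫ x, w (j + 1) x * φ x) - (∫ x, w j x * φ x) -
        ∫ z, G z ∂((slab T τ j).prod volume))) -
      ∫ z in Ioc (k * τ) t ×ˢ univ, G z ∂(spaceTimeMeasure d T) := by
    have e1 : (∫ x, approx V τ u t x * φ x) - (∫ x, u x * φ x)
      = (∫ x, w k x * φ x) - ∫ x, w 0 x * φ x := rfl
    rw [hsplit, Finset.sum_sub_distrib, e1, htel]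
    ring
  rw [hmain]
  refine (abs_sub _ _).trans (add_le_add ?_ hlast)
  refine (Finset.abs_sum_le_sum_abs _ _).trans ((Finset.sum_le_sum fun j _ => hstep j).trans ?_)
  rw [Finset.sum_add_distrib, ← Finset.mul_sum, ← Finset.mul_sum, ← Finset.mul_sum]
  have hε0 : 0 ≤ ε := (ha0 0).trans (haε 0)
  refine add_le_add ?_ ?_
  · refine mul_le_mul_of_nonneg_left ?_ (mul_nonneg (hwQ 0).nonneg hΦ0)
    exact mul_le_mul_of_nonneg_left (hA k) hε0
  · refine mul_le_mul_of_nonneg_left ?_ (mul_nonneg hM0 hΦ0)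
    exact sum_integral_slab_le hτ.le (h.integrable_mollError_spaceTime n) (mollError_nonneg n) k

end Drift

/-! ### Weak compactness -/

section WeakCompactness

variable {Ω : Type*} [MeasurableSpace Ω] {μ : Measure Ω} [IsFiniteMeasure μ]

lemma memLp_two_of_bound {f : Ω → ℝ} (hf : AEStronglyMeasurable f μ) {M : ℝ}
    (hM : ∀ᵐ x ∂μ, |f x| ≤ M) : MemLp f 2 μ := MemLp.of_bound hf M hM

/-- Weak convergence against a sequence of uniformly bounded functions may be tested with bounded
functions only. -/
lemma tendsto_integral_mul_of_bounded {f : ℕ → Ω → ℝ} {g : Ω → ℝ} {M : ℝ}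
    (hf : ∀ n, AEStronglyMeasurable (f n) μ) (hfM : ∀ n, ∀ᵐ x ∂μ, |f n x| ≤ M)
    (hg : AEStronglyMeasurable g μ) (hgM : ∀ᵐ x ∂μ, |g x| ≤ M)
    (h : ∀ ψ : Ω → ℝ, Integrable ψ μ → (∃ C, ∀ x, |ψ x| ≤ C) →
      Filter.Tendsto (fun n => ∫ x, f n x * ψ x ∂μ) Filter.atTop (nhds (∫ x, g x * ψ x ∂μ)))
    {ψ : Ω → ℝ} (hψ : Integrable ψ μ) :
    Filter.Tendsto (fun n => ∫ x, f n x * ψ x ∂μ) Filter.atTop (nhds (∫ x, g x * ψ x ∂μ)) := by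
  rcases eq_or_ne μ 0 with h0 | h0
  · subst h0; simp
  have hM0 : 0 ≤ M := by
    have : (ae μ).NeBot := ae_neBot.2 h0
    obtain ⟨x, hx⟩ := hgM.exists
    exact (abs_nonneg _).trans hx
  set ψ' := hψ.1.mk ψ with hψ'
  have hae : ψ =ᵐ[μ] ψ' := hψ.1.ae_eq_mk
  have hm : Measurable ψ' := hψ.1.stronglyMeasurable_mk.measurable
  have hi : Integrable ψ' μ := hψ.congr hae
  suffices H : Filter.Tendsto (fun n => ∫ x, f n x * ψ' x ∂μ) Filter.atTop
      (nhds (∫ x, g x * ψ' x ∂μ)) by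
    have e : ∀ F : Ω → ℝ, ∫ x, F x * ψ x ∂μ = ∫ x, F x * ψ' x ∂μ := fun F =>
      integral_congr_ae (hae.mono fun x hx => by simp only [hx])
    simp_rw [e]; exact H
  set t : ℕ → Ω → ℝ := fun k => {x | |ψ' x| ≤ k}.indicator ψ' with ht
  have hsm : ∀ k : ℕ, MeasurableSet {x | |ψ' x| ≤ k} := fun k =>
    measurableSet_le hm.abs measurable_const
  have hti : ∀ k, Integrable (t k) μ := fun k => hi.indicator (hsm k)
  have htle : ∀ k x, |ψ' x - t k x| ≤ |ψ' x| := fun k x => by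
    simp only [ht, indicator]; split_ifs <;> simp
  have htend : Filter.Tendsto (fun k => ∫ x, |ψ' x - t k x| ∂μ) Filter.atTop (nhds 0) := by
    have := tendsto_integral_of_dominated_convergence (μ := μ)
      (F := fun k x => |ψ' x - t k x|) (f := fun _ => 0) (fun x => |ψ' x|)
      (fun k => ((hi.sub (hti k)).abs).1) hi.abs
      (fun k => Filter.Eventually.of_forall fun x => by
        rw [Real.norm_of_nonneg (abs_nonneg _)]; exact htle k x)
      (Filter.Eventually.of_forall fun x => by
        refine tendsto_const_nhds.congr' ?_
        obtain ⟨N, hN⟩ := exists_nat_ge |ψ' x|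
        filter_upwards [Filter.eventually_ge_atTop N] with k hk
        have : x ∈ {x | |ψ' x| ≤ k} := hN.trans (by exact_mod_cast hk)
        simp [ht, indicator_of_mem this])
    simpa using this
  have herr : ∀ F : Ω → ℝ, AEStronglyMeasurable F μ → (∀ᵐ x ∂μ, |F x| ≤ M) → ∀ k,
      |(∫ x, F x * ψ' x ∂μ) - ∫ x, F x * t k x ∂μ| ≤ M * ∫ x, |ψ' x - t k x| ∂μ := by
    intro F hF hFM k
    have i1 : Integrable (fun x => F x * ψ' x) μ := hi.bdd_mul (c := M) hF hFM
    have i2 : Integrable (fun x => F x * t k x) μ := (hti k).bdd_mul (c := M) hF hFM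
    have i3 : Integrable (fun x => |ψ' x - t k x|) μ := (hi.sub (hti k)).abs
    rw [← integral_sub i1 i2, ← integral_const_mul]
    refine (abs_integral_le_integral_abs).trans
      (integral_mono_ae (i1.sub i2).abs (i3.const_mul M) ?_)
    filter_upwards [hFM] with x hx
    rw [← mul_sub, abs_mul]
    exact mul_le_mul_of_nonneg_right hx (abs_nonneg _)
  rw [Metric.tendsto_atTop]
  intro ε hε
  obtain ⟨k, hk⟩ := ((htend.const_mul M).eventually
    (gt_mem_nhds (show M * 0 < ε / 3 by simpa using by positivity))).exists
  obtain ⟨N, hN⟩ := (Metric.tendsto_atTop.1 (h (t k) (hti k) ⟨k, fun x => by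
    simp only [ht, indicator]
    split_ifs with hx
    · exact hx
    · simp⟩)) (ε / 3) (by positivity)
  refine ⟨N, fun n hn => ?_⟩
  have h1 := herr (f n) (hf n) (hfM n) k
  have h2 := herr g hg hgM k
  have h3 := hN n hn
  rw [Real.dist_eq] at h3 ⊢
  rw [abs_le] at h1 h2
  rw [abs_lt] at h3 ⊢
  constructor <;> linarith [h1.1, h1.2, h2.1, h2.2, h3.1, h3.2]

/-- Bounded functions form a bounded set of the separable Hilbert space `L²`, where sequential
Banach-Alaoglu and Riesz representation apply. The bound passes to the limit by testing with
indicators, and density extends the convergence to integrable test functions. -/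
lemma exists_weak_limit [MeasurableSpace.CountablyGenerated Ω] {f : ℕ → Ω → ℝ} {M : ℝ}
    (hM0 : 0 ≤ M)
    (hf : ∀ n, AEStronglyMeasurable (f n) μ) (hfM : ∀ n, ∀ᵐ x ∂μ, |f n x| ≤ M) :
    ∃ ns : ℕ → ℕ, StrictMono ns ∧ ∃ g : Ω → ℝ, Measurable g ∧ (∀ x, |g x| ≤ M) ∧
      ∀ ψ : Ω → ℝ, Integrable ψ μ →
        Filter.Tendsto (fun k => ∫ x, f (ns k) x * ψ x ∂μ) Filter.atTop
          (nhds (∫ x, g x * ψ x ∂μ)) := by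
  have : Fact ((1 : ENNReal) ≤ 2) := ⟨one_le_two⟩
  have : Fact ((2 : ENNReal) ≠ ⊤) := ⟨ENNReal.ofNat_ne_top⟩
  set H := Lp ℝ 2 μ
  have hmem := fun n => memLp_two_of_bound (hf n) (hfM n)
  set F : ℕ → H := fun n => (hmem n).toLp (f n)
  obtain ⟨R, hR⟩ : ∃ R : ℝ, ∀ n, ‖F n‖ ≤ R := by
    refine ⟨measureUnivNNReal μ ^ (ENNReal.toReal 2)⁻¹ * M, fun n => ?_⟩
    have h1 : ∀ᵐ x ∂μ, ‖F n x‖ ≤ M := by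
      filter_upwards [(hmem n).coeFn_toLp, hfM n] with x hx hx'
      rw [hx]; exact hx'
    exact Lp.norm_le_of_ae_bound hM0 h1
  have hcomp := WeakDual.isSeqCompact_closedBall ℝ H (0 : StrongDual ℝ H) R
  obtain ⟨ℓ, -, ns, hns, hlim⟩ := hcomp (x := fun n =>
    StrongDual.toWeakDual (InnerProductSpace.toDual ℝ H (F n))) (fun n => by
      simp only [mem_preimage, Metric.mem_closedBall, dist_zero_right]
      have : ‖InnerProductSpace.toDual ℝ H (F n)‖ ≤ R := by
        rw [LinearIsometryEquiv.norm_map]; exact hR n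
      exact this)
  set G : H := (InnerProductSpace.toDual ℝ H).symm (WeakDual.toStrongDual ℓ)
  have hinner : ∀ A B : H, inner ℝ A B = ∫ x, A x * B x ∂μ := fun A B => by
    rw [L2.inner_def]
    exact integral_congr_ae (Filter.Eventually.of_forall fun x => by simp [mul_comm])
  have hconv : ∀ ψ : Ω → ℝ, MemLp ψ 2 μ → Filter.Tendsto (fun k => ∫ x, f (ns k) x * ψ x ∂μ)
      Filter.atTop (nhds (∫ x, G x * ψ x ∂μ)) := by
    intro ψ hψ
    have h1 := ((WeakDual.eval_continuous (𝕜 := ℝ) (E := H) (hψ.toLp ψ)).tendsto ℓ).comp hlim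
    have h2 : ℓ (hψ.toLp ψ) = ∫ x, G x * ψ x ∂μ := by
      have : inner ℝ G (hψ.toLp ψ) = ℓ (hψ.toLp ψ) := InnerProductSpace.toDual_symm_apply
      rw [← this, hinner]
      exact integral_congr_ae (hψ.coeFn_toLp.mono fun x hx => by simp only [hx])
    rw [h2] at h1
    refine h1.congr fun k => ?_
    have : inner ℝ (F (ns k)) (hψ.toLp ψ) = ∫ x, f (ns k) x * ψ x ∂μ := by
      rw [hinner]
      refine integral_congr_ae ?_
      filter_upwards [hψ.coeFn_toLp, (hmem (ns k)).coeFn_toLp] with x hx hx'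
      rw [hx, hx']
    rw [← this]
    rfl
  have hGi : Integrable G μ := (Lp.memLp G).integrable one_le_two
  -- the weak limit satisfies the same bounds
  have hle : ∀ᵐ x ∂μ, G x ≤ M := by
    refine ae_le_of_forall_setIntegral_le hGi (integrable_const M) fun s hs _ => ?_
    have h1 := hconv (s.indicator fun _ => 1) (memLp_indicator_const 2 hs 1 (Or.inr (measure_ne_top _ _)))
    have e : ∀ q : Ω → ℝ, ∫ x, q x * s.indicator (fun _ => (1 : ℝ)) x ∂μ = ∫ x in s, q x ∂μ :=
      fun q => by
        rw [← integral_indicator hs]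
        refine integral_congr_ae (Filter.Eventually.of_forall fun x => ?_)
        by_cases hx : x ∈ s <;> simp [hx]
    simp_rw [e] at h1
    refine le_of_tendsto h1 (Filter.Eventually.of_forall fun k => ?_)
    refine integral_mono_ae ((hmem _).integrable one_le_two).integrableOn
      (integrable_const M) (ae_restrict_of_ae ((hfM (ns k)).mono fun x hx => (abs_le.1 hx).2))
  have hge : ∀ᵐ x ∂μ, -M ≤ G x := by
    refine ae_le_of_forall_setIntegral_le (integrable_const (-M)) hGi fun s hs _ => ?_
    have h1 := hconv (s.indicator fun _ => 1) (memLp_indicator_const 2 hs 1 (Or.inr (measure_ne_top _ _)))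
    have e : ∀ q : Ω → ℝ, ∫ x, q x * s.indicator (fun _ => (1 : ℝ)) x ∂μ = ∫ x in s, q x ∂μ :=
      fun q => by
        rw [← integral_indicator hs]
        refine integral_congr_ae (Filter.Eventually.of_forall fun x => ?_)
        by_cases hx : x ∈ s <;> simp [hx]
    simp_rw [e] at h1
    refine ge_of_tendsto h1 (Filter.Eventually.of_forall fun k => ?_)
    refine integral_mono_ae (integrable_const (-M))
      ((hmem _).integrable one_le_two).integrableOn
      (ae_restrict_of_ae ((hfM (ns k)).mono fun x hx => (abs_le.1 hx).1))
  set g0 := hGi.1.mk G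
  have hg0 : Measurable g0 := hGi.1.stronglyMeasurable_mk.measurable
  -- A representative which is measurable and bounded everywhere, so that slices of a space-time
  -- limit need no further null sets.
  set g : Ω → ℝ := fun x => max (-M) (min M (g0 x)) with hg
  have hgG : G =ᵐ[μ] g := by
    filter_upwards [hGi.1.ae_eq_mk, hle, hge] with x hx h1 h2
    have : g0 x = G x := hx.symm
    simp only [hg, this, min_eq_right h1, max_eq_right h2]
  have hgm : Measurable g := measurable_const.max (measurable_const.min hg0)
  have hgM : ∀ x, |g x| ≤ M := fun x => by
    rw [abs_le]
    exact ⟨le_max_left _ _, max_le (by linarith) (min_le_left _ _)⟩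
  refine ⟨ns, hns, g, hgm, hgM, fun ψ hψ => ?_⟩
  refine tendsto_integral_mul_of_bounded (fun n => hf (ns n)) (fun n => hfM (ns n))
    hgm.aestronglyMeasurable (Filter.Eventually.of_forall hgM) (fun χ hχ ⟨C, hC⟩ => ?_) hψ
  have h1 := hconv χ (memLp_two_of_bound hχ.1 (Filter.Eventually.of_forall hC))
  have h2 : ∫ x, G x * χ x ∂μ = ∫ x, g x * χ x ∂μ :=
    integral_congr_ae (hgG.mono fun x hx => by simp only [hx])
  rwa [h2] at h1

end WeakCompactness

/-! ### From space-time weak limits to solutions -/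

lemma setIntegral_spaceTime {T s t : ℝ} (hs : 0 ≤ s) (hst : s ≤ t) (htT : t ≤ T)
    {G : ℝ × Torus d → ℝ} (hG : Integrable G (spaceTimeMeasure d T)) :
    ∫ z in Ioc s t ×ˢ univ, G z ∂(spaceTimeMeasure d T) = ∫ r in s..t, ∫ x, G (r, x) := by
  have h1 : (spaceTimeMeasure d T).restrict (Ioc s t ×ˢ univ) =
      (volume.restrict (Ioc s t)).prod volume := by
    rw [spaceTimeMeasure, ← Measure.prod_restrict, Measure.restrict_univ,
      Measure.restrict_restrict measurableSet_Ioc,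
      inter_eq_self_of_subset_left
        (show Ioc s t ⊆ Icc 0 T from fun r hr => ⟨hs.trans hr.1.le, hr.2.trans htT⟩)]
  have h2 : Integrable G ((volume.restrict (Ioc s t)).prod volume) := h1 ▸ hG.restrict
  rw [h1, integral_prod _ h2, intervalIntegral.integral_of_le hst]

lemma continuousOn_setIntegral_spaceTime {T : ℝ} {G : ℝ × Torus d → ℝ}
    (hG : Integrable G (spaceTimeMeasure d T)) :
    ContinuousOn (fun t => ∫ z in Ioc 0 t ×ˢ univ, G z ∂(spaceTimeMeasure d T)) (Icc 0 T) := by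
  have h1 : IntegrableOn (fun r => ∫ x, G (r, x)) (Icc 0 T) := hG.integral_prod_left
  refine (intervalIntegral.continuousOn_primitive h1).congr fun t ht => ?_
  simp only
  rw [setIntegral_spaceTime le_rfl ht.1 ht.2 hG, intervalIntegral.integral_of_le ht.1]

lemma abs_integral_mul_le {M : ℝ} {f g : Torus d → ℝ} (hf : ∀ᵐ x, |f x| ≤ M) (hg : Integrable g) :
    |∫ x, f x * g x| ≤ M * ∫ x, |g x| := by
  rw [← integral_const_mul]
  refine norm_integral_le_of_norm_le (f := fun x => f x * g x) (hg.abs.const_mul M) ?_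
  filter_upwards [hf] with x hx
  rw [norm_mul]
  exact mul_le_mul_of_nonneg_right hx (abs_nonneg _)

lemma tendsto_integral_abs_moll_sub {f : Torus d → ℝ} (hf : Integrable f) :
    Filter.Tendsto (fun n => ∫ x, |moll n f x - f x|) Filter.atTop (nhds 0) := by
  have h2 := (ENNReal.tendsto_toReal ENNReal.zero_ne_top).comp (tendsto_lintegral_moll_sub hf)
  refine h2.congr fun n => ?_
  exact (integral_eq_lintegral_of_nonneg_ae (Filter.Eventually.of_forall fun _ => abs_nonneg _)
    (((continuous_moll n hf).aestronglyMeasurable.sub hf.1).norm)).symm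

/-- A countable family of smooth functions separating integrable functions. -/
lemma exists_countable_separating (d : ℕ) : ∃ (κ : Type) (_ : Countable κ) (H : κ → Torus d → ℝ),
    (∀ j, IsSmoothOnTorus (H j)) ∧
    ∀ f : Torus d → ℝ, Integrable f → (∀ j, ∫ x, f x * H j x = 0) → f =ᵐ[volume] 0 := by
  choose ι hι g h hg hh hk hm using exists_moll_eq_sum d
  refine ⟨Σ n, ι n, inferInstance, fun j => h j.1 j.2, fun j => hh j.1 j.2, fun f hf hz => ?_⟩
  have h0 : ∀ n x, moll n f x = 0 := by
    intro n x
    rw [hm n f hf]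
    refine Finset.sum_eq_zero fun j _ => ?_
    have := hz ⟨n, j⟩
    simp only [mul_comm (f _)] at this
    rw [this, zero_mul]
  have h1 := tendsto_integral_abs_moll_sub hf
  simp only [h0, zero_sub, abs_neg] at h1
  have h2 := tendsto_nhds_unique h1 tendsto_const_nhds
  have h3 := (integral_eq_zero_iff_of_nonneg (fun x => abs_nonneg (f x)) hf.abs).1 h2.symm
  filter_upwards [h3] with x hx
  simpa using hx

section Drift

variable {T β K L : ℝ} {b : ℝ → Torus d → Euc d} {Db : ℝ → Torus d → Fin d → Euc d}

/-- The second order bounds of datum and scheme may blow up with `n`, but the time step is chosen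
after `n` and absorbs them. The scheme is fixed before the test function, so one sequence of schemes
serves all of them. -/
lemma IsDrift.exists_scheme_weak_eq (h : IsDrift T β K L b Db) (hT : 0 < T) (hβ : 0 < β)
    (hL : 0 ≤ L) {M : ℝ} (n : ℕ) (hu : IsSmoothOnTorus u) (hM : ∀ x, |u x| ≤ M) :
    ∃ (τ : ℝ) (V : ℕ → Torus d → Euc d) (a lam : ℕ → ℝ), IsScheme T τ β K L V a lam ∧
      ∀ (φ : Torus d → ℝ) (Φ : ℝ), IsSmoothOnTorus φ → (∀ x, |φ x| ≤ Φ) →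
        (∀ i x, |torusPartial φ i x| ≤ Φ) → ∀ t, 0 ≤ t →
        |(∫ x, approx V τ u t x * φ x) - (∫ x, u x * φ x) -
          ∫ z in Ioc 0 t ×ˢ univ, approx V τ u z.1 z.2 * weakIntegrand b Db φ z
            ∂(spaceTimeMeasure d T)| ≤
        (Φ + M) * (1 + Φ) * (1 / (n + 1)) +
          M * Φ * ∫ z, mollError b Db n z ∂(spaceTimeMeasure d T) := by
  obtain ⟨C, hC, hS⟩ := exists_isScheme h hT hβ hL n
  obtain ⟨Q, hQ0, hQ⟩ : ∃ Q, 0 ≤ Q ∧ HasC2Bound u Q Q := by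
    obtain ⟨g, ℓ, hℓ, hgl⟩ := exists_hasC2Bound hu
    exact ⟨max g ℓ, hℓ.trans (le_max_right _ _), hgl.mono (le_max_left _ _) (le_max_right _ _)⟩
  have hM0 : 0 ≤ M := (abs_nonneg _).trans (hM 0)
  have hgb : Integrable (fun z : ℝ × Torus d => ‖b z.1 z.2‖) (spaceTimeMeasure d T) :=
    h.integrable_drift.norm
  have hgd : Integrable (fun z : ℝ × Torus d => (∑ i, |b z.1 z.2 i|) + |rowTrace (Db z.1 z.2)|)
      (spaceTimeMeasure d T) :=
    Integrable.add (integrable_finsetSum _ fun i _ => (h.integrable_coord_prod le_rfl i).abs)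
      (h.integrable_div_prod le_rfl).abs
  set N := ∫ z, ‖b z.1 z.2‖ ∂(spaceTimeMeasure d T) with hN
  have hN0 : 0 ≤ N := integral_nonneg fun z => norm_nonneg _
  set A := C * N with hA
  have hA0 : 0 ≤ A := mul_nonneg hC hN0
  -- Small enough to beat the second order bound `exp (3 A) Q` of the composed datum times the total
  -- displacement `A`.
  set ε : ℝ := 1 / (n + 1) / (Real.exp (3 * A) * Q * A + 1) with hε
  have hε0 : 0 < ε := by positivity
  have hε1 : ε ≤ 1 / (n + 1) := div_le_self (by positivity) (by
    have : 0 ≤ Real.exp (3 * A) * Q * A := by positivity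
    linarith)
  have hε2 : Real.exp (3 * A) * Q * A * ε ≤ 1 / (n + 1) := by
    rw [hε, ← mul_div_assoc, div_le_iff₀ (by positivity), mul_comm]
    have : (0 : ℝ) ≤ 1 / (n + 1) := by positivity
    nlinarith
  obtain ⟨J, ⟨lam, hlam⟩, hJ1, hJ2⟩ := (hS.and ((eventually_integral_slab_le hgb
    (fun z => norm_nonneg _) (ε := ε / (C + 1)) (by positivity)).and
    (eventually_integral_slab_le hgd (fun z => add_nonneg
      (Finset.sum_nonneg fun _ _ => abs_nonneg _) (abs_nonneg _)) hε0))).exists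
  refine ⟨_, _, _, lam, hlam, fun φ Φ hφ hΦ hΦ' t ht => ?_⟩
  have hΦ0 : 0 ≤ Φ := (abs_nonneg _).trans (hΦ 0)
  have hεΦ : ε ≤ (1 + Φ) * ε := by nlinarith
  -- Smallness on the slabs was imposed on a majorant free of `φ`, which dominates the weak
  -- integrand up to the factor `Φ`; hence `(1 + Φ) * ε`.
  refine (h.abs_weak_eq_approx_le hlam hu hφ hQ hM hΦ hΦ' (A := A) (ε := (1 + Φ) * ε)
    (fun m => ?_) (fun k => ?_) (fun k => ?_) ht).trans ?_
  · rw [← Finset.mul_sum]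
    exact mul_le_mul_of_nonneg_left (sum_integral_slab_le hlam.pos.le hgb (fun z => norm_nonneg _) m)
      hC
  · refine le_trans ?_ hεΦ
    calc _ ≤ C * (ε / (C + 1)) := mul_le_mul_of_nonneg_left (hJ1 k) hC
      _ = ε * (C / (C + 1)) := by ring
      _ ≤ ε * 1 := by
          refine mul_le_mul_of_nonneg_left ?_ hε0.le
          rw [div_le_one (by positivity)]; linarith
      _ = ε := mul_one _
  · have hpt : ∀ z, |weakIntegrand b Db φ z| ≤
        Φ * ((∑ i, |b z.1 z.2 i|) + |rowTrace (Db z.1 z.2)|) := fun z => by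
      rw [mul_add, Finset.mul_sum]
      refine (abs_add_le _ _).trans (add_le_add ((Finset.abs_sum_le_sum_abs _ _).trans
        (Finset.sum_le_sum fun i _ => ?_)) ?_)
      · rw [abs_mul, mul_comm]; exact mul_le_mul_of_nonneg_right (hΦ' i _) (abs_nonneg _)
      · rw [abs_mul, mul_comm]; exact mul_le_mul_of_nonneg_right (hΦ _) (abs_nonneg _)
    calc _ ≤ ∫ z, Φ * ((∑ i, |b z.1 z.2 i|) + |rowTrace (Db z.1 z.2)|)
          ∂((slab T (T / J) k).prod volume) := by
          refine integral_mono (h.integrable_weakIntegrand (slab_le _ _ _) hφ).abs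
            (Integrable.const_mul ?_ Φ) hpt
          rw [slab_prod]; exact hgd.restrict
      _ ≤ Φ * ε := by rw [integral_const_mul]; exact mul_le_mul_of_nonneg_left (hJ2 k) hΦ0
      _ ≤ _ := by nlinarith
  · have e1 : Real.exp (3 * A) * Q * Φ * ((1 + Φ) * ε * A) =
        Φ * (1 + Φ) * (Real.exp (3 * A) * Q * A * ε) := by ring
    have e2 : Φ * (1 + Φ) * (Real.exp (3 * A) * Q * A * ε) ≤ Φ * (1 + Φ) * (1 / (n + 1)) :=
      mul_le_mul_of_nonneg_left hε2 (by positivity)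
    have e3 : M * ((1 + Φ) * ε) ≤ M * (1 + Φ) * (1 / (n + 1)) := by
      rw [← mul_assoc]
      exact mul_le_mul_of_nonneg_left hε1 (by positivity)
    rw [e1]
    nlinarith

end Drift

lemma exists_test_bound (hφ : IsSmoothOnTorus φ) :
    ∃ Φ : ℝ, (∀ x, |φ x| ≤ Φ) ∧ ∀ i x, |torusPartial φ i x| ≤ Φ := by
  obtain ⟨A, -, hA⟩ := exists_bound_of_continuous hφ.continuous
  obtain ⟨g, ℓ, -, h⟩ := exists_hasC2Bound hφ
  exact ⟨max A g, fun x => (hA x).trans (le_max_left _ _), fun i x =>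
    (abs_torusPartial_le φ i x).trans ((h.grad_le x).trans (le_max_right _ _))⟩

/-- Slices of a space-time weak limit agree with the weak limits of the slices. -/
lemma ae_slice_eq_of_weak_limit {T M : ℝ} {U : ℕ → ℝ → Torus d → ℝ} {w : ℝ × Torus d → ℝ}
    (hU : ∀ n, Measurable fun z : ℝ × Torus d => U n z.1 z.2) (hUM : ∀ n t x, |U n t x| ≤ M)
    (hw : Measurable w) (hwM : ∀ z, |w z| ≤ M)
    (hlim : ∀ ψ : ℝ × Torus d → ℝ, Integrable ψ (spaceTimeMeasure d T) → Filter.Tendsto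
      (fun n => ∫ z, U n z.1 z.2 * ψ z ∂(spaceTimeMeasure d T)) Filter.atTop
      (nhds (∫ z, w z * ψ z ∂(spaceTimeMeasure d T))))
    {g : ℝ → Torus d → ℝ} (hg : ∀ t ∈ Icc 0 T, Measurable (g t))
    (hgM : ∀ t ∈ Icc 0 T, ∀ x, |g t x| ≤ M)
    (hgU : ∀ t ∈ Icc 0 T, ∀ φ, IsSmoothOnTorus φ → Filter.Tendsto (fun n => ∫ x, U n t x * φ x)
      Filter.atTop (nhds (∫ x, g t x * φ x))) :
    ∀ᵐ t ∂(volume.restrict (Icc 0 T)), (fun x => w (t, x)) =ᵐ[volume] g t := by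
  obtain ⟨κ, hκ, H, hH, hsep⟩ := exists_countable_separating d
  have key : ∀ j, ∀ᵐ t ∂(volume.restrict (Icc 0 T)),
      ∫ x, w (t, x) * H j x = ∫ x, g t x * H j x := by
    intro j
    obtain ⟨Φ, hΦ0, hΦ⟩ := exists_bound_of_continuous (hH j).continuous
    have hmH : Measurable (H j) := (hH j).continuous.measurable
    have hprod : ∀ n, Integrable (fun z : ℝ × Torus d => U n z.1 z.2 * H j z.2)
        (spaceTimeMeasure d T) := fun n =>
      Integrable.of_bound ((hU n).mul (hmH.comp measurable_snd)).aestronglyMeasurable (M * Φ)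
        (Filter.Eventually.of_forall fun z => by
          rw [norm_mul]
          exact mul_le_mul (hUM n _ _) (hΦ _) (norm_nonneg _) ((abs_nonneg _).trans (hUM n 0 0)))
    have hwprod : Integrable (fun z : ℝ × Torus d => w z * H j z.2) (spaceTimeMeasure d T) :=
      Integrable.of_bound (hw.mul (hmH.comp measurable_snd)).aestronglyMeasurable (M * Φ)
        (Filter.Eventually.of_forall fun z => by
          rw [norm_mul]
          exact mul_le_mul (hwM _) (hΦ _) (norm_nonneg _) ((abs_nonneg _).trans (hwM 0)))
    have hsl : ∀ n, Integrable (fun t => ∫ x, U n t x * H j x) (volume.restrict (Icc 0 T)) :=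
      fun n => (hprod n).integral_prod_left
    have hmem : ∀ᵐ t ∂(volume.restrict (Icc 0 T)), t ∈ Icc 0 T := ae_restrict_mem measurableSet_Icc
    have hbd : ∀ n t, ‖∫ x, U n t x * H j x‖ ≤ M * Φ := fun n t => by
      have := norm_integral_le_of_norm_le_const (μ := (volume : Measure (Torus d)))
        (f := fun x => U n t x * H j x) (C := M * Φ) (Filter.Eventually.of_forall fun x => by
          rw [norm_mul]
          exact mul_le_mul (hUM n _ _) (hΦ _) (norm_nonneg _) ((abs_nonneg _).trans (hUM n 0 0)))
      simpa using this
    have hgm : AEStronglyMeasurable (fun t => ∫ x, g t x * H j x) (volume.restrict (Icc 0 T)) :=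
      aestronglyMeasurable_of_tendsto_ae Filter.atTop (fun n => (hsl n).1)
        (hmem.mono fun t ht => hgU t ht _ (hH j))
    have hgi : Integrable (fun t => ∫ x, g t x * H j x) (volume.restrict (Icc 0 T)) := by
      refine Integrable.of_bound hgm (M * Φ) (hmem.mono fun t ht => ?_)
      exact le_of_tendsto (hgU t ht _ (hH j)).norm (Filter.Eventually.of_forall fun n => hbd n t)
    -- Two functions of time are compared by integrating over an arbitrary measurable set of times,
    -- where both limits of the same integrals are available.
    refine Integrable.ae_eq_of_forall_setIntegral_eq _ _ hwprod.integral_prod_left hgi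
      fun s hs _ => ?_
    have hms : MeasurableSet (s ×ˢ (univ : Set (Torus d))) := hs.prod .univ
    have hψ : Integrable ((s ×ˢ univ).indicator fun z : ℝ × Torus d => H j z.2)
        (spaceTimeMeasure d T) :=
      Integrable.indicator (Integrable.of_bound (hmH.comp measurable_snd).aestronglyMeasurable Φ
        (Filter.Eventually.of_forall fun z => hΦ _)) hms
    have h1 := hlim _ hψ
    have e : ∀ F : ℝ × Torus d → ℝ, Integrable (fun z => F z * H j z.2) (spaceTimeMeasure d T) →
        ∫ z, F z * (s ×ˢ univ).indicator (fun z : ℝ × Torus d => H j z.2) z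
          ∂(spaceTimeMeasure d T) = ∫ t in s, (∫ x, F (t, x) * H j x) ∂(volume.restrict (Icc 0 T)) := by
      intro F hF
      have e1 : ∀ z, F z * (s ×ˢ univ).indicator (fun z : ℝ × Torus d => H j z.2) z =
          (s ×ˢ univ).indicator (fun z => F z * H j z.2) z := fun z => by
        by_cases hz : z ∈ s ×ˢ (univ : Set (Torus d)) <;> simp [hz]
      simp_rw [e1]
      rw [integral_indicator hms, spaceTimeMeasure, setIntegral_prod _ hF.integrableOn]
      simp
    rw [e w hwprod] at h1
    simp_rw [fun n => e (fun z => U n z.1 z.2) (hprod n)] at h1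
    refine tendsto_nhds_unique h1 ?_
    refine tendsto_integral_of_dominated_convergence (fun _ => M * Φ)
      (fun n => (hsl n).1.restrict) (integrable_const _)
      (fun n => Filter.Eventually.of_forall fun t => hbd n t)
      (ae_restrict_of_ae (hmem.mono fun t ht => hgU t ht _ (hH j)))
  have hmem : ∀ᵐ t ∂(volume.restrict (Icc 0 T)), t ∈ Icc 0 T := ae_restrict_mem measurableSet_Icc
  filter_upwards [ae_all_iff.2 key, hmem] with t ht htT
  have i1 : Integrable fun x => w (t, x) :=
    Integrable.of_bound (hw.comp measurable_prodMk_left).aestronglyMeasurable M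
      (Filter.Eventually.of_forall fun x => hwM _)
  have i2 : Integrable (g t) := Integrable.of_bound (hg t htT).aestronglyMeasurable M
      (Filter.Eventually.of_forall fun x => hgM t htT _)
  have h0 := hsep (fun x => w (t, x) - g t x) (i1.sub i2) fun j => by
    simp_rw [sub_mul]
    rw [integral_sub (Continuous.integrable_mul i1 (hH j).continuous)
      (Continuous.integrable_mul i2 (hH j).continuous), ht j, sub_self]
  filter_upwards [h0] with x hx
  exact sub_eq_zero.1 hx

/-- A bounded curve that is weakly continuous against smooth functions is weakly continuous. -/
lemma continuousOn_integral_of_smooth {T M : ℝ} {u : ℝ → Torus d → ℝ}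
    (hm : ∀ t ∈ Icc 0 T, AEStronglyMeasurable (u t)) (hM : ∀ t ∈ Icc 0 T, ∀ᵐ x, |u t x| ≤ M)
    (h : ∀ φ, IsSmoothOnTorus φ → ContinuousOn (fun t => ∫ x, u t x * φ x) (Icc 0 T))
    {ψ : Torus d → ℝ} (hψ : Integrable ψ) :
    ContinuousOn (fun t => ∫ x, u t x * ψ x) (Icc 0 T) := by
  have hlim := (tendsto_integral_abs_moll_sub hψ).const_mul M
  rw [mul_zero] at hlim
  refine continuousOn_of_uniform_approx_of_continuousOn fun s hs => ?_
  obtain ⟨ε, hε, hεs⟩ := Metric.mem_uniformity_dist.1 hs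
  obtain ⟨n, hn⟩ := (hlim.eventually (gt_mem_nhds hε)).exists
  refine ⟨fun t => ∫ x, u t x * moll n ψ x, h _ (isSmooth_moll n hψ), fun t ht => hεs ?_⟩
  have hmi := integrable_of_continuous (continuous_moll n hψ)
  rw [dist_comm, Real.dist_eq, ← integral_sub (hmi.bdd_mul (hm t ht) (hM t ht))
    (hψ.bdd_mul (hm t ht) (hM t ht))]
  simp_rw [← mul_sub]
  exact (abs_integral_mul_le (hM t ht) (hmi.sub hψ)).trans_lt hn

section Drift

variable {T β K L : ℝ} {b : ℝ → Torus d → Euc d} {Db : ℝ → Torus d → Fin d → Euc d}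

/-- A space-time weak limit turns the approximate equation into an exact one, which determines the
limit of every time slice against smooth functions, at every time and not just almost every one. The
schemes are kept in the conclusion because the regularity estimates are proved on them and passed to
the slices. -/
lemma IsDrift.exists_solution (h : IsDrift T β K L b Db) (hT : 0 < T) (hβ : 0 < β) (hL : 0 ≤ L)
    {u₀ : Torus d → ℝ} {M : ℝ} (hM0 : 0 ≤ M) (hu₀ : AEStronglyMeasurable u₀)
    (hM : ∀ᵐ x, |u₀ x| ≤ M) :
    ∃ u : ℝ → Torus d → ℝ, IsBoundedTransportSolution T b Db u₀ u ∧
      (∀ t ∈ Icc 0 T, ∀ x, |u t x| ≤ M) ∧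
      ∃ (τ : ℕ → ℝ) (V : ℕ → ℕ → Torus d → Euc d) (a lam : ℕ → ℕ → ℝ),
        (∀ n, IsScheme T (τ n) β K L (V n) (a n) (lam n)) ∧
        ∀ t ∈ Icc 0 T, ∃ ks : ℕ → ℕ, ∀ ψ : Torus d → ℝ, Integrable ψ → Filter.Tendsto
          (fun j => ∫ x, approx (V (ks j)) (τ (ks j)) (moll (ks j) u₀) t x * ψ x) Filter.atTop
          (nhds (∫ x, u t x * ψ x)) := by
  have hu₀i : Integrable u₀ := Integrable.of_bound hu₀ M hM
  have hmM : ∀ n x, |moll n u₀ x| ≤ M := fun n x => norm_moll_le n (f := u₀) hM x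
  choose τ V a lam hS hweak using fun n =>
    h.exists_scheme_weak_eq hT hβ hL n (isSmooth_moll n hu₀i) (hmM n)
  set U : ℕ → ℝ → Torus d → ℝ := fun n => approx (V n) (τ n) (moll n u₀) with hU
  have hUm : ∀ n, Measurable fun z : ℝ × Torus d => U n z.1 z.2 := fun n =>
    measurable_approx (fun k => ((hS n).field k).smooth) _ (continuous_moll n hu₀i)
  have hUM : ∀ n t x, |U n t x| ≤ M := fun n t x => hmM n _
  obtain ⟨ns, hns, w, hw, hwM, hwlim⟩ := exists_weak_limit (μ := spaceTimeMeasure d T) hM0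
    (fun n => (hUm n).aestronglyMeasurable) (fun n => Filter.Eventually.of_forall fun z => hUM n _ _)
  -- limits of the slices against smooth functions
  set ℓ : ℝ → (Torus d → ℝ) → ℝ := fun t φ => (∫ x, u₀ x * φ x) +
    ∫ z in Ioc 0 t ×ˢ univ, w z * weakIntegrand b Db φ z ∂(spaceTimeMeasure d T) with hℓ
  have hslice : ∀ t ∈ Icc 0 T, ∀ φ, IsSmoothOnTorus φ →
      Filter.Tendsto (fun k => ∫ x, U (ns k) t x * φ x) Filter.atTop (nhds (ℓ t φ)) := by
    intro t ht φ hφ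
    obtain ⟨Φ, hΦ, hΦ'⟩ := exists_test_bound hφ
    have hΨ := h.integrable_weakIntegrand_spaceTime hφ
    have h1 : Filter.Tendsto (fun n => ∫ x, moll n u₀ x * φ x) Filter.atTop
        (nhds (∫ x, u₀ x * φ x)) := by
      rw [tendsto_iff_norm_sub_tendsto_zero]
      have h2 := (tendsto_integral_abs_moll_sub hu₀i).const_mul Φ
      rw [mul_zero] at h2
      refine squeeze_zero (fun n => norm_nonneg _) (fun n => ?_) h2
      have hmi := integrable_of_continuous (continuous_moll n hu₀i)
      rw [← integral_sub (Continuous.integrable_mul hmi hφ.continuous)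
        (Continuous.integrable_mul hu₀i hφ.continuous)]
      have := abs_integral_mul_le (f := φ) (Filter.Eventually.of_forall hΦ) (hmi.sub hu₀i)
      refine le_trans (le_of_eq ?_) this
      rw [Real.norm_eq_abs]
      congr 1
      exact integral_congr_ae (Filter.Eventually.of_forall fun x => by
        simp only [Pi.sub_apply]; ring)
    have e : ∀ F : ℝ × Torus d → ℝ, ∫ z, F z * (Ioc 0 t ×ˢ univ).indicator
        (weakIntegrand b Db φ) z ∂(spaceTimeMeasure d T) =
        ∫ z in Ioc 0 t ×ˢ univ, F z * weakIntegrand b Db φ z ∂(spaceTimeMeasure d T) := fun F => by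
      rw [← integral_indicator (measurableSet_slab d 0 t)]
      refine integral_congr_ae (Filter.Eventually.of_forall fun z => ?_)
      by_cases hz : z ∈ Ioc 0 t ×ˢ (univ : Set (Torus d)) <;> simp [hz]
    have h2 := hwlim _ (hΨ.indicator (measurableSet_slab d 0 t))
    rw [e w] at h2
    simp_rw [fun k => e (fun z => U (ns k) z.1 z.2)] at h2
    have h3 : Filter.Tendsto (fun n => (∫ x, U n t x * φ x) - (∫ x, moll n u₀ x * φ x) -
        ∫ z in Ioc 0 t ×ˢ univ, U n z.1 z.2 * weakIntegrand b Db φ z ∂(spaceTimeMeasure d T))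
        Filter.atTop (nhds 0) := by
      have hb := ((tendsto_one_div_add_atTop_nhds_zero_nat (𝕜 := ℝ)).const_mul
        ((Φ + M) * (1 + Φ))).add ((h.tendsto_integral_mollError le_rfl).const_mul (M * Φ))
      simp only [mul_zero, add_zero] at hb
      exact squeeze_zero_norm (fun n => hweak n φ Φ hφ hΦ hΦ' t ht.1) hb
    have h4 := ((h3.comp hns.tendsto_atTop).add (h1.comp hns.tendsto_atTop)).add h2
    rw [zero_add] at h4
    refine h4.congr fun k => ?_
    simp only [Function.comp_apply]
    ring
  -- weak limits of the slices
  have hex : ∀ t, ∃ ms : ℕ → ℕ, StrictMono ms ∧ ∃ g : Torus d → ℝ, Measurable g ∧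
      (∀ x, |g x| ≤ M) ∧ ∀ ψ : Torus d → ℝ, Integrable ψ → Filter.Tendsto
        (fun k => ∫ x, U (ns (ms k)) t x * ψ x) Filter.atTop (nhds (∫ x, g x * ψ x)) := fun t =>
    exists_weak_limit (f := fun k => U (ns k) t) hM0
      (fun k => ((hUm (ns k)).comp measurable_prodMk_left).aestronglyMeasurable)
      (fun k => Filter.Eventually.of_forall fun x => hUM _ _ _)
  choose ms hms g hgm hgM hglim using hex
  -- The extracted subsequence depends on `t`, but the equation fixes the limit, so no uniform
  -- choice is needed.
  have hgℓ : ∀ t ∈ Icc 0 T, ∀ φ, IsSmoothOnTorus φ → ∫ x, g t x * φ x = ℓ t φ :=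
    fun t ht φ hφ => tendsto_nhds_unique
      (hglim t φ (integrable_of_continuous hφ.continuous))
      ((hslice t ht φ hφ).comp (hms t).tendsto_atTop)
  have hwg := ae_slice_eq_of_weak_limit (fun n => hUm (ns n)) (fun n => hUM (ns n)) hw hwM hwlim
    (fun t _ => hgm t) (fun t _ => hgM t) (fun t ht φ hφ => by
      rw [hgℓ t ht φ hφ]; exact hslice t ht φ hφ)
  classical
  -- The slices `g t` are right at every time but not jointly measurable; `w` is jointly measurable
  -- but right at almost every time only. Using `w` wherever the two agree combines both properties.
  set u : ℝ → Torus d → ℝ := fun t => if (fun x => w (t, x)) =ᵐ[volume] g t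
    then fun x => w (t, x) else g t with hu
  have hug : ∀ t, u t =ᵐ[volume] g t := fun t => by
    simp only [hu]; split_ifs with hc
    · exact hc
    · exact Filter.EventuallyEq.rfl
  have hum : ∀ t, Measurable (u t) := fun t => by
    simp only [hu]; split_ifs
    · exact hw.comp measurable_prodMk_left
    · exact hgm t
  have huM : ∀ t x, |u t x| ≤ M := fun t x => by
    simp only [hu]; split_ifs
    · exact hwM _
    · exact hgM t x
  have huw : ∀ᵐ z ∂(spaceTimeMeasure d T), u z.1 z.2 = w z := by
    have := (Measure.quasiMeasurePreserving_fst (μ := volume.restrict (Icc 0 T))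
      (ν := (volume : Measure (Torus d)))).ae hwg
    filter_upwards [this] with z hz
    simp only [hu, if_pos hz]
  have hint : ∀ t (ψ : Torus d → ℝ), ∫ x, u t x * ψ x = ∫ x, g t x * ψ x := fun t ψ =>
    integral_congr_ae ((hug t).mono fun x hx => by simp only [hx])
  have huweak : ∀ t ∈ Icc 0 T, ∀ φ, IsSmoothOnTorus φ → ∫ x, u t x * φ x = ℓ t φ :=
    fun t ht φ hφ => by rw [hint, hgℓ t ht φ hφ]
  have hGi : ∀ φ, IsSmoothOnTorus φ →
      Integrable (fun z => w z * weakIntegrand b Db φ z) (spaceTimeMeasure d T) := fun φ hφ =>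
    (h.integrable_weakIntegrand_spaceTime hφ).bdd_mul (c := M) hw.aestronglyMeasurable
      (Filter.Eventually.of_forall hwM)
  refine ⟨u, ⟨?_, fun t _ => (hum t).aestronglyMeasurable,
    ⟨M, fun t _ => Filter.Eventually.of_forall (huM t)⟩, fun ψ hψ => ?_, fun t ht φ hφ => ?_⟩,
    fun t _ => huM t, τ, V, a, lam, hS, fun t _ => ⟨fun k => ns (ms t k), fun ψ hψ => ?_⟩⟩
  · exact hw.aestronglyMeasurable.congr (huw.mono fun z hz => hz.symm)
  · refine continuousOn_integral_of_smooth (fun t _ => (hum t).aestronglyMeasurable)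
      (fun t _ => Filter.Eventually.of_forall (huM t)) (fun φ hφ => ?_) hψ
    refine ContinuousOn.congr ?_ fun t ht => huweak t ht φ hφ
    exact continuousOn_const.add (continuousOn_setIntegral_spaceTime (hGi φ hφ))
  · rw [huweak t ht φ hφ, hℓ]
    simp only [add_sub_cancel_left]
    have e1 : ∫ z in Ioc 0 t ×ˢ univ, w z * weakIntegrand b Db φ z ∂(spaceTimeMeasure d T) =
        ∫ z in Ioc 0 t ×ˢ univ, u z.1 z.2 * weakIntegrand b Db φ z ∂(spaceTimeMeasure d T) :=
      integral_congr_ae (ae_restrict_of_ae (huw.mono fun z hz => by simp only [hz]))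
    have hGi' : Integrable (fun z : ℝ × Torus d => u z.1 z.2 * weakIntegrand b Db φ z)
        (spaceTimeMeasure d T) :=
      (hGi φ hφ).congr (huw.mono fun z hz => by simp only [hz])
    rw [e1, setIntegral_spaceTime le_rfl ht.1 ht.2 hGi']
    rfl
  · rw [hint]
    exact hglim t ψ hψ

end Drift

/-! ### Lower semicontinuity under weak convergence -/

lemma lintegral_le_of_tendsto {Ω : Type*} [MeasurableSpace Ω] {μ : Measure Ω} {F : ℕ → Ω → ENNReal}
    {G : Ω → ENNReal} {B : ENNReal} (hF : ∀ n, Measurable (F n)) (hB : ∀ n, ∫⁻ x, F n x ∂μ ≤ B)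
    (h : ∀ᵐ x ∂μ, Filter.Tendsto (fun n => F n x) Filter.atTop (nhds (G x))) :
    ∫⁻ x, G x ∂μ ≤ B := by
  calc ∫⁻ x, G x ∂μ = ∫⁻ x, Filter.liminf (fun n => F n x) Filter.atTop ∂μ :=
        lintegral_congr_ae (h.mono fun x hx => hx.liminf_eq.symm)
    _ ≤ Filter.liminf (fun n => ∫⁻ x, F n x ∂μ) Filter.atTop := lintegral_liminf_le hF
    _ ≤ B := Filter.liminf_le_of_le (by isBoundedDefault) fun b hb => by
        obtain ⟨n, hn⟩ := hb.exists
        exact hn.trans (hB n)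

/-- Weak convergence of a sequence of functions, tested against integrable functions. -/
def WeakLim (f : ℕ → Torus d → ℝ) (g : Torus d → ℝ) : Prop := ∀ ψ : Torus d → ℝ, Integrable ψ →
  Filter.Tendsto (fun j => ∫ x, f j x * ψ x) Filter.atTop (nhds (∫ x, g x * ψ x))

variable {f : ℕ → Torus d → ℝ} {g : Torus d → ℝ}

lemma WeakLim.tendsto_moll (h : WeakLim f g) (n : ℕ) (x : Torus d) :
    Filter.Tendsto (fun j => moll n (f j) x) Filter.atTop (nhds (moll n g x)) := by
  have := h _ (integrable_of_continuous (continuous_kernel_sub n x))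
  simpa only [moll, smul_eq_mul, mul_comm] using this

/-- Mollification turns weak convergence into pointwise convergence and, for `p ≥ 1`, does not
increase the bound; Fatou's lemma is used once for the sequence and once to remove the
mollification. -/
lemma WeakLim.lintegral_translate_le (h : WeakLim f g) (hf : ∀ j, Continuous (f j))
    (hg : Integrable g) {p : ℝ} (hp : 1 ≤ p) (a : Torus d) {B : ENNReal}
    (hB : ∀ j, ∫⁻ x, ENNReal.ofReal (|f j (x + a) - f j x| ^ p) ≤ B) :
    ∫⁻ x, ENNReal.ofReal (|g (x + a) - g x| ^ p) ≤ B := by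
  have hp0 : 0 ≤ p := zero_le_one.trans hp
  have hcts : Continuous fun r : ℝ => ENNReal.ofReal (|r| ^ p) :=
    ENNReal.continuous_ofReal.comp (continuous_abs.rpow_const fun _ => Or.inr hp0)
  have h1 : ∀ n, ∫⁻ x, ENNReal.ofReal (|moll n g (x + a) - moll n g x| ^ p) ≤ B := by
    intro n
    refine lintegral_le_of_tendsto
      (F := fun j x => ENNReal.ofReal (|moll n (f j) (x + a) - moll n (f j) x| ^ p))
      (fun j => ?_) (fun j => ?_) (Filter.Eventually.of_forall fun x => ?_)
    · have hc := continuous_moll n (integrable_of_continuous (hf j))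
      exact (hcts.comp ((hc.comp (continuous_id.add continuous_const)).sub hc)).measurable
    · have hi := integrable_of_continuous (hf j)
      have hi' : Integrable fun x => f j (x + a) :=
        integrable_of_continuous ((hf j).comp (continuous_id.add continuous_const))
      refine le_trans ?_ (hB j)
      have := lintegral_moll_rpow_le n (hi'.sub hi) hp
      refine le_trans (le_of_eq (lintegral_congr fun x => ?_)) this
      have e := moll_sub n hi' hi x
      rw [moll_comp_add] at e
      rw [← e]
      rfl
    · exact (hcts.tendsto _).comp ((h.tendsto_moll n (x + a)).sub (h.tendsto_moll n x))
  obtain ⟨ns, -, hns⟩ := exists_subseq_tendsto_moll hg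
  refine lintegral_le_of_tendsto
    (F := fun k x => ENNReal.ofReal (|moll (ns k) g (x + a) - moll (ns k) g x| ^ p))
    (fun k => ?_) (fun k => h1 (ns k)) ?_
  · have hc := continuous_moll (ns k) hg
    exact (hcts.comp ((hc.comp (continuous_id.add continuous_const)).sub hc)).measurable
  · filter_upwards [hns, (quasiMeasurePreserving_add a).ae hns] with x hx hx'
    exact (hcts.tendsto _).comp (hx'.sub hx)

lemma torusPartial_moll_eq_sum (d n : ℕ) : ∃ (ι : Type) (_ : Fintype ι) (g h : ι → Torus d → ℝ),
    (∀ j, IsSmoothOnTorus (h j)) ∧ ∀ f : Torus d → ℝ, Integrable f → ∀ i x,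
      torusPartial (moll n f) i x = ∑ j, (∫ y, f y * h j y) * torusPartial (g j) i x := by
  obtain ⟨ι, _, g, h, hg, hh, -, hm⟩ := exists_moll_eq_sum d n
  refine ⟨ι, inferInstance, g, h, hh, fun f hf i x => ?_⟩
  rw [hm f hf, torusPartial_sum Finset.univ (fun j _ => (hg j).const_mul _)]
  refine Finset.sum_congr rfl fun j _ => ?_
  rw [torusPartial_const_mul (hg j)]
  simp only [mul_comm (h j _)]

lemma WeakLim.tendsto_grad_moll (h : WeakLim f g) (hf : ∀ j, Integrable (f j)) (hg : Integrable g)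
    (n : ℕ) (x : Torus d) :
    Filter.Tendsto (fun j => grad (moll n (f j)) x) Filter.atTop (nhds (grad (moll n g) x)) := by
  obtain ⟨ι, _, G, H, hH, hm⟩ := torusPartial_moll_eq_sum d n
  have h1 : Filter.Tendsto (fun j => fun i => torusPartial (moll n (f j)) i x) Filter.atTop
      (nhds fun i => torusPartial (moll n g) i x) := by
    refine tendsto_pi_nhds.2 fun i => ?_
    simp_rw [fun j => hm (f j) (hf j) i x, hm g hg i x]
    exact tendsto_finsetSum _ fun l _ =>
      (h _ (integrable_of_continuous (hH l).continuous)).mul_const _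
  exact ((PiLp.continuous_toLp 2 fun _ : Fin d => ℝ).tendsto _).comp h1

/-- The bound stays at the level of mollifications, because the limit is not yet known to be weakly
differentiable. -/
lemma WeakLim.lintegral_grad_moll_le (h : WeakLim f g) (hf : ∀ j, IsSmoothOnTorus (f j))
    (hg : Integrable g) {r : ℝ} (hr : 1 ≤ r) {B : ENNReal}
    (hB : ∀ j, ∫⁻ x, ENNReal.ofReal (‖grad (f j) x‖ ^ r) ≤ B) (n : ℕ) :
    ∫⁻ x, ENNReal.ofReal (‖grad (moll n g) x‖ ^ r) ≤ B := by
  have hr0 : 0 ≤ r := zero_le_one.trans hr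
  have hcts : Continuous fun y : Euc d => ENNReal.ofReal (‖y‖ ^ r) :=
    ENNReal.continuous_ofReal.comp (continuous_norm.rpow_const fun _ => Or.inr hr0)
  have hi := fun j => integrable_of_continuous (hf j).continuous
  refine lintegral_le_of_tendsto
    (F := fun j x => ENNReal.ofReal (‖grad (moll n (f j)) x‖ ^ r)) (fun j => ?_) (fun j => ?_)
    (Filter.Eventually.of_forall fun x =>
      (hcts.tendsto _).comp (h.tendsto_grad_moll hi hg n x))
  · exact (hcts.comp (isSmoothField_grad (isSmooth_moll n (hi j))).continuous).measurable
  · refine le_trans (le_of_eq (lintegral_congr fun x => ?_))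
      ((lintegral_moll_rpow_le n (isWeakGrad_grad (hf j)).integrable_grad hr).trans (hB j))
    rw [grad_moll n (isWeakGrad_grad (hf j))]

lemma exists_subseq_tendsto_moll_euc {G : Torus d → Euc d} (hG : Integrable G) :
    ∃ ns : ℕ → ℕ, ∀ᵐ x, Filter.Tendsto (fun k => moll (ns k) G x) Filter.atTop (nhds (G x)) := by
  have hm : Filter.Tendsto (fun n => ∑ i, ∫⁻ x, ENNReal.ofReal |moll n (fun y => G y i) x - G x i|)
      Filter.atTop (nhds 0) := by
    have := tendsto_finsetSum Finset.univ fun i _ =>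
      tendsto_lintegral_moll_sub (integrable_coord hG i)
    simpa using this
  have h1 : Filter.Tendsto (fun n => eLpNorm (moll n G - G) 1 volume) Filter.atTop (nhds 0) := by
    refine tendsto_of_tendsto_of_tendsto_of_le_of_le tendsto_const_nhds hm (fun _ => zero_le)
      fun n => ?_
    rw [eLpNorm_one_eq_lintegral_enorm, ← lintegral_finsetSum' _ fun i _ => ?_]
    · refine lintegral_mono fun x => ?_
      rw [← ofReal_norm, ← ENNReal.ofReal_sum_of_nonneg fun i _ => abs_nonneg _]
      refine ENNReal.ofReal_le_ofReal ((norm_le_sum_abs _).trans (le_of_eq ?_))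
      refine Finset.sum_congr rfl fun i _ => ?_
      rw [Pi.sub_apply, PiLp.sub_apply, moll_apply_euc hG]
    · exact ((continuous_moll n (integrable_coord hG i)).aestronglyMeasurable.sub
        (integrable_coord hG i).1).norm.aemeasurable.ennreal_ofReal
  obtain ⟨ns, -, hns⟩ := (tendstoInMeasure_of_tendsto_eLpNorm one_ne_zero
    (fun n => (continuous_moll n hG).aestronglyMeasurable) hG.1 h1).exists_seq_tendsto_ae
  exact ⟨ns, hns⟩

lemma lintegral_weakGrad_le {G : Torus d → Euc d} (hG : IsWeakGrad g G) {r : ℝ} (hr : 1 ≤ r)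
    {B : ENNReal} (hB : ∀ n, ∫⁻ x, ENNReal.ofReal (‖grad (moll n g) x‖ ^ r) ≤ B) :
    ∫⁻ x, ENNReal.ofReal (‖G x‖ ^ r) ≤ B := by
  have hr0 : 0 ≤ r := zero_le_one.trans hr
  have hcts : Continuous fun y : Euc d => ENNReal.ofReal (‖y‖ ^ r) :=
    ENNReal.continuous_ofReal.comp (continuous_norm.rpow_const fun _ => Or.inr hr0)
  obtain ⟨ns, hns⟩ := exists_subseq_tendsto_moll_euc hG.integrable_grad
  refine lintegral_le_of_tendsto
    (F := fun k x => ENNReal.ofReal (‖moll (ns k) G x‖ ^ r)) (fun k => ?_) (fun k => ?_)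
    (hns.mono fun x hx => (hcts.tendsto _).comp hx)
  · exact (hcts.comp (continuous_moll _ hG.integrable_grad)).measurable
  · refine le_trans (le_of_eq (lintegral_congr fun x => ?_)) (hB (ns k))
    rw [grad_moll _ hG]

/-! ### Gagliardo seminorms from the decay of increments -/

/-- The surplus `γ - α` leaves the singularity `‖w‖ ^ (-(d - δ))` with `δ = p (γ - α) > 0`,
integrable near the origin in dimension `d`. -/
lemma gagliardoPow_lt_top_of_decay (hd : 1 ≤ d) {g : Torus d → ℝ} {α γ p C : ℝ} (hp : 0 < p)
    (hαγ : α < γ) (h : ∀ w : Euc d, ∫⁻ x, ENNReal.ofReal (|g (x + proj w) - g x| ^ p) ≤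
      ENNReal.ofReal (C * ‖w‖ ^ (γ * p))) : gagliardoPow α p g < ⊤ := by
  set δ := p * (γ - α) with hδ
  have hδ0 : 0 < δ := mul_pos hp (sub_pos.2 hαγ)
  have hpt : ∀ w : Euc d, ∫⁻ x, ENNReal.ofReal (|g (x + proj w) - g x| ^ p /
      ‖w‖ ^ ((d : ℝ) + p * α)) ≤ ENNReal.ofReal (C * ‖w‖ ^ (-((d : ℝ) - δ))) := by
    intro w
    rcases eq_or_ne w 0 with rfl | hw
    · simp [proj_zero, Real.zero_rpow hp.ne']
    have hw0 : 0 < ‖w‖ := norm_pos_iff.2 hw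
    have e : ∀ x, ENNReal.ofReal (|g (x + proj w) - g x| ^ p / ‖w‖ ^ ((d : ℝ) + p * α)) =
        ENNReal.ofReal (‖w‖ ^ ((d : ℝ) + p * α))⁻¹ *
          ENNReal.ofReal (|g (x + proj w) - g x| ^ p) := fun x => by
      rw [← ENNReal.ofReal_mul (by positivity)]; congr 1; ring
    simp_rw [e]
    rw [lintegral_const_mul' _ _ ENNReal.ofReal_ne_top]
    refine (mul_le_mul_right (h w) _).trans ?_
    rw [← ENNReal.ofReal_mul (by positivity)]
    refine ENNReal.ofReal_le_ofReal (le_of_eq ?_)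
    rw [← Real.rpow_neg hw0.le, mul_left_comm, ← Real.rpow_add hw0]
    congr 2
    rw [hδ]; ring
  have hfin : Module.finrank ℝ (Euc d) = d := by simp
  have hint : IntegrableOn (fun w : Euc d => C * ‖w‖ ^ (-((d : ℝ) - δ)))
      (Metric.ball 0 (√d + 1)) := by
    refine integrableOn_ball_of_norm_le_rpow (C := |C|) (α := (d : ℝ) - δ) (by rw [hfin]; exact hd)
      (by rw [hfin]; linarith) (Filter.Eventually.of_forall fun w => ?_) ?_
    · rw [norm_mul, Real.norm_eq_abs, Real.norm_of_nonneg (by positivity)]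
    · exact (measurable_const.mul (measurable_norm.pow_const _)).aestronglyMeasurable
  have hsub : cube d 1 ⊆ Metric.ball 0 (√d + 1) := fun w hw => by
    rw [mem_ball_zero_iff]
    have := norm_le_sqrt_of_mem_cube hw
    linarith
  calc gagliardoPow α p g ≤ ∫⁻ w in cube d 1, ENNReal.ofReal (C * ‖w‖ ^ (-((d : ℝ) - δ))) :=
        lintegral_mono fun w => hpt w
    _ < ⊤ := (hint.mono_set hsub).lintegral_lt_top

/-! ### Moment bounds along a scheme -/

lemma ennreal_add_rpow_le (a b : ENNReal) {s : ℝ} (hs : 0 ≤ s) :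
    (a + b) ^ s ≤ 2 ^ s * (a ^ s + b ^ s) := by
  have h1 : a + b ≤ 2 * max a b := by
    rw [two_mul]; exact add_le_add (le_max_left _ _) (le_max_right _ _)
  calc (a + b) ^ s ≤ (2 * max a b) ^ s := ENNReal.rpow_le_rpow h1 hs
    _ = 2 ^ s * max a b ^ s := ENNReal.mul_rpow_of_nonneg _ _ hs
    _ ≤ 2 ^ s * (a ^ s + b ^ s) := by
        gcongr
        rcases le_total a b with h | h
        · rw [max_eq_right h]; exact le_add_self
        · rw [max_eq_left h]; exact le_self_add

lemma lintegral_mul_rpow_le {Ω : Type*} [MeasurableSpace Ω] {μ : Measure Ω} {q s p : ℝ}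
    (hq : 0 < q) (hs : 0 < s) (hp : 0 < p) (h : 1 / q = 1 / s + 1 / p) {A G : Ω → ENNReal}
    (hA : AEMeasurable A μ) (hG : AEMeasurable G μ) :
    ∫⁻ x, (A x * G x) ^ q ∂μ ≤ ((∫⁻ x, A x ^ s ∂μ) ^ (1 / s) * (∫⁻ x, G x ^ p ∂μ) ^ (1 / p)) ^ q := by
  have hqs : q < s := by
    rw [← one_div_lt_one_div hs hq, h]
    have : 0 < 1 / p := by positivity
    linarith
  have h1 := ENNReal.lintegral_Lp_mul_le_Lq_mul_Lr hq hqs h μ hA hG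
  have h2 := ENNReal.rpow_le_rpow h1 hq.le
  rw [← ENNReal.rpow_mul, one_div_mul_cancel hq.ne', ENNReal.rpow_one] at h2
  exact h2

/-- The constant in `dist_displace_le`. -/
noncomputable def lipConst (d : ℕ) : ℝ := √d * 2 * 4 ^ d

section Scheme

variable {T τ β K L : ℝ} {V : ℕ → Torus d → Euc d} {a lam : ℕ → ℝ}

lemma IsScheme.smooth (hS : IsScheme T τ β K L V a lam) (k : ℕ) : IsSmoothField (V k) :=
  (hS.field k).smooth

lemma IsScheme.sum_lam_le (hS : IsScheme T τ β K L V a lam) (hL : 0 ≤ L) {t : ℝ}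
    (ht : t ∈ Icc 0 T) :
    ∑ j ∈ Finset.range (stepIndex τ t), lam j ≤ L * t + 1 := by
  have h1 := stepIndex_mul_le hS.pos ht.1
  refine (hS.sum_lam _ (h1.trans ht.2)).trans ?_
  gcongr

lemma IsScheme.lintegral_comp_traj_le (hS : IsScheme T τ β K L V a lam) (hL : 0 ≤ L) {t : ℝ}
    (ht : t ∈ Icc 0 T) {F : Torus d → ENNReal} (hF : Measurable F) :
    ∫⁻ x, F (traj V (stepIndex τ t) x) ≤ ENNReal.ofReal (Real.exp (L * t + 1)) * ∫⁻ x, F x :=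
  (TorusTransport.lintegral_comp_traj_le hS.smooth hS.comp _ hF).trans (by
    gcongr; exact hS.sum_lam_le hL ht)

/-- The number of steps up to time `t` is at most `t / τ`, so rates of order `θ / τ` per step become
the condition `s t ≤ θ`. -/
lemma IsScheme.lintegral_exp_accum_le (hS : IsScheme T τ β K L V a lam) (hL : 0 ≤ L) {t : ℝ}
    (ht : t ∈ Icc 0 T) {m : ℕ → Torus d → ℝ} (hm : ∀ k, Measurable (m k)) {θ Z : ℝ} (hZ : 1 ≤ Z)
    (hmZ : ∀ k, ∀ s, 0 ≤ s → s ≤ θ / τ → ∫⁻ x, ENNReal.ofReal (Real.exp (s * m k x)) ≤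
      ENNReal.ofReal Z) {s : ℝ} (hs : 0 ≤ s) (hst : s * t ≤ θ) :
    ∫⁻ x, ENNReal.ofReal (Real.exp (s * accum V m (stepIndex τ t) x)) ≤
      ENNReal.ofReal (Real.exp (L * t + 1) * Z) := by
  have h1 := stepIndex_mul_le hS.pos ht.1
  have hk : s * stepIndex τ t ≤ θ / τ := by
    rw [le_div_iff₀ hS.pos, mul_assoc]
    exact (mul_le_mul_of_nonneg_left h1 hs).trans hst
  refine (TorusTransport.lintegral_exp_accum_le hS.smooth hS.lam_nonneg hS.comp hm
    (ENNReal.one_le_ofReal.2 hZ) hmZ _ hs hk).trans ?_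
  rw [ENNReal.ofReal_mul (Real.exp_pos _).le]
  gcongr
  exact hS.sum_lam_le hL ht

lemma IsScheme.lintegral_exp_le (hS : IsScheme T τ β K L V a lam) (k : ℕ) {s : ℝ} (hs : s ≤ β / τ) :
    ∫⁻ x, ENNReal.ofReal (Real.exp (s * frobNorm (jac (V k) x))) ≤ ENNReal.ofReal K := by
  refine le_trans (lintegral_mono fun x => ENNReal.ofReal_le_ofReal (Real.exp_le_exp.2 ?_))
    (hS.exp_le k)
  exact mul_le_mul_of_nonneg_right hs (frobNorm_nonneg _)

lemma IsScheme.lintegral_exp_accum_frobNorm_le (hS : IsScheme T τ β K L V a lam) (hL : 0 ≤ L)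
    (hK : 1 ≤ K) {t : ℝ} (ht : t ∈ Icc 0 T) {s : ℝ} (hs : 0 ≤ s) (hst : s * t ≤ β) :
    ∫⁻ x, ENNReal.ofReal (Real.exp (s * accum V (fun k x => frobNorm (jac (V k) x))
      (stepIndex τ t) x)) ≤ ENNReal.ofReal (Real.exp (L * t + 1) * K) :=
  hS.lintegral_exp_accum_le hL ht (fun k => (continuous_frobNorm_jac (hS.smooth k)).measurable) hK
    (fun k _ _ hs => hS.lintegral_exp_le k hs) hs hst

/-- The factor `2` in the condition is the loss in passing to the maximal function, and `lipConst d`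
is the constant of the two-point estimate. -/
lemma IsScheme.lintegral_exp_accum_realMax_le (hS : IsScheme T τ β K L V a lam) (hL : 0 ≤ L)
    (hd : 1 ≤ d) (hβ : 0 < β) (hK : 1 ≤ K) {t : ℝ} (ht : t ∈ Icc 0 T) {s : ℝ} (hs : 0 ≤ s)
    (hst : 2 * lipConst d * s * t ≤ β) :
    ∫⁻ x, ENNReal.ofReal (Real.exp (s * accum V
      (fun k x => lipConst d * realMax (fun x => frobNorm (jac (V k) x)) x) (stepIndex τ t) x)) ≤
      ENNReal.ofReal (Real.exp (L * t + 1) * (1 + 10 ^ d * K)) := by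
  have hc : 0 < lipConst d := by
    have : (0 : ℝ) < d := by exact_mod_cast hd
    unfold lipConst; positivity
  refine hS.lintegral_exp_accum_le (θ := β / (2 * lipConst d)) hL ht
    (fun k => (measurable_realMax (continuous_frobNorm_jac (hS.smooth k))).const_mul _)
    (by nlinarith [show (0 : ℝ) < 10 ^ d by positivity]) (fun k s hs0 hsθ => ?_) hs ?_
  · have h1 := lintegral_exp_realMax_le (continuous_frobNorm_jac (hS.smooth k))
      (fun x => frobNorm_nonneg _) (θ := β / τ) (div_pos hβ hS.pos) (s := s * lipConst d) (by
        rw [div_div, le_div_iff₀ (by have := hS.pos; positivity)] at hsθ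
        rw [le_div_iff₀ hS.pos]
        linarith)
    simp_rw [← mul_assoc]
    refine h1.trans ?_
    rw [ENNReal.ofReal_add zero_le_one (by positivity), ENNReal.ofReal_one,
      ENNReal.ofReal_mul (by positivity), ENNReal.ofReal_pow (by positivity)]
    gcongr
    · simp
    · exact hS.exp_le k
  · rw [le_div_iff₀ (by positivity)]; linarith

/-- Hölder's inequality: the stretching factor is measured in `L^s` by its exponential moments, the
transported gradient in `L^p` by the compression bound. -/
lemma IsScheme.lintegral_grad_approx_le (hS : IsScheme T τ β K L V a lam) (hL : 0 ≤ L)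
    (hK : 1 ≤ K) {t : ℝ} (ht : t ∈ Icc 0 T) {r s p : ℝ} (hr : 0 < r) (hs : 0 < s) (hp : 0 < p)
    (h : 1 / r = 1 / s + 1 / p) (hst : s * t ≤ β) (hu : IsSmoothOnTorus u) :
    ∫⁻ x, ENNReal.ofReal (‖grad (approx V τ u t) x‖ ^ r) ≤
      (ENNReal.ofReal (Real.exp (L * t + 1) * K) ^ (1 / s) *
        (ENNReal.ofReal (Real.exp (L * t + 1)) *
          ∫⁻ x, ENNReal.ofReal (‖grad u x‖ ^ p)) ^ (1 / p)) ^ r := by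
  set k := stepIndex τ t with hk
  set E := accum V (fun k x => frobNorm (jac (V k) x)) k with hE
  have hEm : Measurable E := measurable_accum hS.smooth
    (fun k => (continuous_frobNorm_jac (hS.smooth k)).measurable) k
  have hgc : Continuous fun x => ‖grad u x‖ := (isSmoothField_grad hu).continuous.norm
  have hXc := continuous_traj hS.smooth k
  have h1 := lintegral_mul_rpow_le (μ := (volume : Measure (Torus d))) hr hs hp h
    (A := fun x => ENNReal.ofReal (Real.exp (E x)))
    (G := fun x => ENNReal.ofReal ‖grad u (traj V k x)‖)
    (Real.measurable_exp.comp hEm).ennreal_ofReal.aemeasurable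
    (hgc.comp hXc).measurable.ennreal_ofReal.aemeasurable
  calc ∫⁻ x, ENNReal.ofReal (‖grad (approx V τ u t) x‖ ^ r)
      ≤ ∫⁻ x, (ENNReal.ofReal (Real.exp (E x)) * ENNReal.ofReal ‖grad u (traj V k x)‖) ^ r := by
        refine lintegral_mono fun x => ?_
        rw [← ENNReal.ofReal_mul (Real.exp_pos _).le, ENNReal.ofReal_rpow_of_nonneg
          (mul_nonneg (Real.exp_pos _).le (norm_nonneg _)) hr.le]
        exact ENNReal.ofReal_le_ofReal (Real.rpow_le_rpow (norm_nonneg _)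
          (norm_grad_comp_traj_le hS.smooth hu k x) hr.le)
    _ ≤ _ := h1
    _ ≤ _ := by
        have e1 : ∀ x, ENNReal.ofReal (Real.exp (E x)) ^ s = ENNReal.ofReal (Real.exp (s * E x)) :=
          fun x => by
            rw [ENNReal.ofReal_rpow_of_nonneg (Real.exp_pos _).le hs.le, ← Real.exp_mul, mul_comm]
        have e2 : ∀ x, ENNReal.ofReal ‖grad u (traj V k x)‖ ^ p =
            ENNReal.ofReal (‖grad u (traj V k x)‖ ^ p) := fun x =>
          ENNReal.ofReal_rpow_of_nonneg (norm_nonneg _) hp.le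
        simp_rw [e1, e2]
        gcongr
        · exact hS.lintegral_exp_accum_frobNorm_le hL hK ht hs.le hst
        · exact hS.lintegral_comp_traj_le hL ht
            (F := fun x => ENNReal.ofReal (‖grad u x‖ ^ p))
            (hgc.rpow_const fun _ => Or.inr hp.le).measurable.ennreal_ofReal

/-- The Hajłasz inequality for `u` is evaluated at the two trajectories, whose distance is `‖w‖`
times the exponential of the sum of the accumulated maximal functions; Hölder's inequality then
separates stretching from the transported Gagliardo quotient. -/
lemma exists_lintegral_increment_approx_le (hd : 1 ≤ d) {α p : ℝ} (hα : 0 < α) (hp : 1 ≤ p) :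
    ∃ C : ℝ, 0 ≤ C ∧ ∀ (T τ β K L : ℝ) (V : ℕ → Torus d → Euc d) (a lam : ℕ → ℝ),
      IsScheme T τ β K L V a lam → 0 ≤ L → 0 < β → 1 ≤ K → ∀ t ∈ Icc 0 T, ∀ q s : ℝ, 0 < q → 0 < s →
      1 / q = 1 / s + 1 / p → 4 * lipConst d * α * s * t ≤ β → ∀ u : Torus d → ℝ, Continuous u →
      ∀ w : Euc d, ∫⁻ x, ENNReal.ofReal (|approx V τ u t (x + proj w) - approx V τ u t x| ^ q) ≤
        (ENNReal.ofReal (C * ‖w‖ ^ α) *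
        ((2 ^ s * (2 * ENNReal.ofReal (Real.exp (L * t + 1) * (1 + 10 ^ d * K)))) ^ (1 / s) *
          (2 ^ p * (2 * (ENNReal.ofReal (Real.exp (L * t + 1)) *
            gagliardoPow α p u))) ^ (1 / p))) ^ q := by
  obtain ⟨C, hC, hH⟩ := exists_abs_sub_le_gagliardoAt d hα hp
  refine ⟨C, hC, fun T τ β K L V a lam hS hL hβ hK t ht q s hq hs hqsp hst u hu w => ?_⟩
  have hp0 : 0 < p := by linarith
  set k := stepIndex τ t with hk
  set m : ℕ → Torus d → ℝ := fun k x => lipConst d * realMax (fun x => frobNorm (jac (V k) x)) x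
    with hm
  set E := accum V m k with hE
  have hEm : Measurable E := measurable_accum hS.smooth
    (fun k => (measurable_realMax (continuous_frobNorm_jac (hS.smooth k))).const_mul _) k
  have hXm : Measurable (traj V k) := (continuous_traj hS.smooth k).measurable
  set A : Torus d → ENNReal := fun x => ENNReal.ofReal (Real.exp (2 * α * E x)) with hA
  set G : Torus d → ENNReal := fun x => gagliardoAt α p u (traj V k x) ^ (1 / p) with hG
  have hAm : Measurable A := (Real.measurable_exp.comp (hEm.const_mul _)).ennreal_ofReal
  have hgm : Measurable (gagliardoAt α p u) := measurable_gagliardoAt α p hu.measurable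
  have hGm : Measurable G := (hgm.comp hXm).pow_const _
  have htr : Measurable fun x : Torus d => x + proj w := measurable_add_const _
  have hpt : ∀ x, ENNReal.ofReal |approx V τ u t (x + proj w) - approx V τ u t x| ≤
      ENNReal.ofReal (C * ‖w‖ ^ α) * ((A (x + proj w) + A x) * (G (x + proj w) + G x)) := by
    intro x
    set y := x + proj w with hy
    have h1 := hH u hu.measurable (traj V k y) (traj V k x)
    have h2 : dist (traj V k y) (traj V k x) ≤ Real.exp (E y + E x) * ‖w‖ :=
      (dist_traj_le (m := m) (fun j x y => dist_displace_le (hS.smooth j) x y) k y x).trans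
        (mul_le_mul_of_nonneg_left (dist_add_proj_le x w) (Real.exp_pos _).le)
    have h3 : C * dist (traj V k y) (traj V k x) ^ α ≤
        C * ‖w‖ ^ α * (Real.exp (2 * α * E y) + Real.exp (2 * α * E x)) := by
      rw [mul_assoc]
      refine mul_le_mul_of_nonneg_left ?_ hC
      calc dist (traj V k y) (traj V k x) ^ α ≤ (Real.exp (E y + E x) * ‖w‖) ^ α :=
            Real.rpow_le_rpow dist_nonneg h2 hα.le
        _ = ‖w‖ ^ α * Real.exp (α * (E y + E x)) := by
            rw [Real.mul_rpow (Real.exp_pos _).le (norm_nonneg _), ← Real.exp_mul, mul_comm,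
              mul_comm α]
        _ ≤ _ := by
            refine mul_le_mul_of_nonneg_left ?_ (by positivity)
            -- The exponential of a sum is bounded by the exponential of twice the larger term, so
            -- that no joint moment at two points is needed. This is the second factor `2` in `C₁`.
            rcases le_total (E y) (E x) with h | h
            · refine le_trans (Real.exp_le_exp.2 ?_) (le_add_of_nonneg_left (Real.exp_pos _).le)
              nlinarith
            · refine le_trans (Real.exp_le_exp.2 ?_) (le_add_of_nonneg_right (Real.exp_pos _).le)
              nlinarith
    refine h1.trans ?_
    calc _ ≤ ENNReal.ofReal (C * ‖w‖ ^ α * (Real.exp (2 * α * E y) + Real.exp (2 * α * E x))) *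
          (G y + G x) := by gcongr
      _ = _ := by
        rw [ENNReal.ofReal_mul (by positivity), ENNReal.ofReal_add (Real.exp_pos _).le
          (Real.exp_pos _).le, mul_assoc]
  have h1 := lintegral_mul_rpow_le (μ := (volume : Measure (Torus d))) hq hs hp0 hqsp
    (A := fun x => A (x + proj w) + A x) (G := fun x => G (x + proj w) + G x)
    ((hAm.comp htr).add hAm).aemeasurable ((hGm.comp htr).add hGm).aemeasurable
  have hsum : ∀ (F : Torus d → ENNReal), Measurable F → ∀ r : ℝ, 0 ≤ r →
      ∫⁻ x, (F (x + proj w) + F x) ^ r ≤ 2 ^ r * (2 * ∫⁻ x, F x ^ r) := by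
    intro F hF r hr
    calc ∫⁻ x, (F (x + proj w) + F x) ^ r ≤ ∫⁻ x, 2 ^ r * (F (x + proj w) ^ r + F x ^ r) :=
          lintegral_mono fun x => ennreal_add_rpow_le _ _ hr
      _ = 2 ^ r * ((∫⁻ x, F (x + proj w) ^ r) + ∫⁻ x, F x ^ r) := by
          rw [lintegral_const_mul' _ _ (ENNReal.rpow_ne_top_of_nonneg hr (by norm_num)),
            lintegral_add_right _ (hF.pow_const r)]
      _ = _ := by
          rw [lintegral_add_right_eq_self (fun x => F x ^ r) (proj w), two_mul]
  have hAs : ∫⁻ x, A x ^ s ≤ ENNReal.ofReal (Real.exp (L * t + 1) * (1 + 10 ^ d * K)) := by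
    have e1 : ∀ x, A x ^ s = ENNReal.ofReal (Real.exp (2 * α * s * E x)) := fun x => by
      rw [hA, ENNReal.ofReal_rpow_of_nonneg (Real.exp_pos _).le hs.le, ← Real.exp_mul]
      congr 2; ring
    simp_rw [e1]
    exact hS.lintegral_exp_accum_realMax_le hL hd hβ hK ht (by positivity) (by linarith)
  have hGs : ∫⁻ x, G x ^ p ≤ ENNReal.ofReal (Real.exp (L * t + 1)) * gagliardoPow α p u := by
    have e1 : ∀ x, G x ^ p = gagliardoAt α p u (traj V k x) := fun x => by
      rw [hG, ← ENNReal.rpow_mul, one_div_mul_cancel hp0.ne', ENNReal.rpow_one]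
    simp_rw [e1]
    rw [← lintegral_gagliardoAt α p hu.measurable]
    exact hS.lintegral_comp_traj_le hL ht hgm
  calc ∫⁻ x, ENNReal.ofReal (|approx V τ u t (x + proj w) - approx V τ u t x| ^ q)
      ≤ ∫⁻ x, ENNReal.ofReal (C * ‖w‖ ^ α) ^ q *
          ((A (x + proj w) + A x) * (G (x + proj w) + G x)) ^ q := by
        refine lintegral_mono fun x => ?_
        rw [← ENNReal.mul_rpow_of_nonneg _ _ hq.le, ← ENNReal.ofReal_rpow_of_nonneg (abs_nonneg _) hq.le]
        exact ENNReal.rpow_le_rpow (hpt x) hq.le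
    _ = ENNReal.ofReal (C * ‖w‖ ^ α) ^ q *
          ∫⁻ x, ((A (x + proj w) + A x) * (G (x + proj w) + G x)) ^ q :=
        lintegral_const_mul' _ _ (ENNReal.rpow_ne_top_of_nonneg hq.le ENNReal.ofReal_ne_top)
    _ ≤ ENNReal.ofReal (C * ‖w‖ ^ α) ^ q * _ := mul_le_mul_right h1 _
    _ ≤ _ := by
        rw [← ENNReal.mul_rpow_of_nonneg _ _ hq.le]
        have g1 := (hsum A hAm s hs.le).trans (mul_le_mul_right (mul_le_mul_right hAs 2) (2 ^ s))
        have g2 := (hsum G hGm p hp0.le).trans (mul_le_mul_right (mul_le_mul_right hGs 2) (2 ^ p))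
        gcongr

end Scheme

lemma gagliardoPow_moll_le (n : ℕ) {f : Torus d → ℝ} (hf : Integrable f) {α p : ℝ} (hp : 1 ≤ p) :
    gagliardoPow α p (moll n f) ≤ gagliardoPow α p f := by
  refine lintegral_mono fun w => ?_
  have e : ∀ (g : Torus d → ℝ) (x : Torus d),
      ENNReal.ofReal (|g (x + proj w) - g x| ^ p / ‖w‖ ^ ((d : ℝ) + p * α)) =
      ENNReal.ofReal (‖w‖ ^ ((d : ℝ) + p * α))⁻¹ *
        ENNReal.ofReal (|g (x + proj w) - g x| ^ p) := fun g x => by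
    rw [← ENNReal.ofReal_mul (by positivity)]; congr 1; ring
  change ∫⁻ x, ENNReal.ofReal (|moll n f (x + proj w) - moll n f x| ^ p / _) ≤
    ∫⁻ x, ENNReal.ofReal (|f (x + proj w) - f x| ^ p / _)
  simp_rw [e]
  rw [lintegral_const_mul' _ _ ENNReal.ofReal_ne_top, lintegral_const_mul' _ _ ENNReal.ofReal_ne_top]
  refine mul_le_mul_right ?_ _
  have hi' : Integrable fun x => f (x + proj w) := hf.comp_add_right (proj w)
  refine le_trans (le_of_eq (lintegral_congr fun x => ?_)) (lintegral_moll_rpow_le n (hi'.sub hf) hp)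
  have e := moll_sub n hi' hf x
  rw [moll_comp_add] at e
  rw [← e]
  rfl

/-! ### Weak compactness in `L^r` for `r > 1` -/

/-- Truncation of a real number at height `c`. -/
noncomputable def clip (c y : ℝ) : ℝ := max (-c) (min c y)

lemma continuous_clip (c : ℝ) : Continuous (clip c) :=
  continuous_const.max (continuous_const.min continuous_id)

lemma abs_clip_le {c : ℝ} (hc : 0 ≤ c) (y : ℝ) : |clip c y| ≤ c := by
  rw [abs_le]
  exact ⟨le_max_left _ _, max_le (by linarith) (min_le_left _ _)⟩

lemma clip_eq_self {c y : ℝ} (h : |y| ≤ c) : clip c y = y := by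
  rw [abs_le] at h
  rw [clip, min_eq_right h.2, max_eq_right h.1]

lemma abs_clip_le_abs {c : ℝ} (hc : 0 ≤ c) (y : ℝ) : |clip c y| ≤ |y| := by
  rcases le_total |y| c with h | h
  · rw [clip_eq_self h]
  · exact (abs_clip_le hc y).trans h

lemma abs_sub_clip_le {c : ℝ} (hc : 0 ≤ c) (y : ℝ) : |y - clip c y| ≤ |y| := by
  rcases le_or_gt y (-c) with h | h
  · rw [clip, min_eq_right (by linarith), max_eq_left h, abs_of_nonpos (by linarith),
      abs_of_nonpos (by linarith)]
    linarith
  · rcases le_or_gt y c with h' | h'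
    · rw [clip_eq_self (abs_le.2 ⟨h.le, h'⟩)]; simp
    · rw [clip, min_eq_left h'.le, max_eq_right (by linarith), abs_of_nonneg (by linarith),
        abs_of_nonneg (by linarith)]
      linarith

lemma abs_sub_clip_le_rpow {c r : ℝ} (hc : 0 < c) (hr : 1 < r) (y : ℝ) :
    |y - clip c y| ≤ c ^ (1 - r) * |y| ^ r := by
  rcases le_or_gt |y| c with h | h
  · rw [clip_eq_self h, sub_self, abs_zero]; positivity
  · refine (abs_sub_clip_le hc.le y).trans ?_
    have hy : 0 < |y| := hc.trans h
    calc |y| = |y| ^ (1 - r) * |y| ^ r := by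
          rw [← Real.rpow_add hy]; simp
      _ ≤ c ^ (1 - r) * |y| ^ r := by
          refine mul_le_mul_of_nonneg_right ?_ (by positivity)
          exact Real.rpow_le_rpow_of_nonpos hc h.le (by linarith)

lemma clip_clip {c e : ℝ} (hc : 0 ≤ c) (hce : c ≤ e) (y : ℝ) : clip c (clip e y) = clip c y := by
  rcases le_or_gt |y| e with h | h
  · rw [clip_eq_self h]
  · rcases le_total 0 y with hy | hy
    · rw [abs_of_nonneg hy] at h
      have h1 : clip e y = e := by rw [clip, min_eq_left h.le, max_eq_right (by linarith)]
      rw [h1, clip, clip, min_eq_left hce, min_eq_left (by linarith)]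
    · rw [abs_of_nonpos hy] at h
      have h1 : clip e y = -e := by rw [clip, min_eq_right (by linarith), max_eq_left (by linarith)]
      rw [h1, clip, clip, min_eq_right (by linarith), min_eq_right (by linarith),
        max_eq_left (by linarith), max_eq_left (by linarith)]

section Truncation

variable {Ω : Type*} [MeasurableSpace Ω] {μ : Measure Ω} [IsFiniteMeasure μ]

/-- All truncations of a sequence of functions converge weakly along a common subsequence. -/
lemma exists_weak_limit_clip [MeasurableSpace.CountablyGenerated Ω] {F : ℕ → Ω → ℝ}
    (hF : ∀ n, Measurable (F n)) : ∃ ns : ℕ → ℕ, StrictMono ns ∧ ∃ H : ℕ → Ω → ℝ,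
      (∀ N, Measurable (H N)) ∧ (∀ (N : ℕ) (x : Ω), |H N x| ≤ (N : ℝ) + 1) ∧
        ∀ (N : ℕ) (ψ : Ω → ℝ), Integrable ψ μ →
        Filter.Tendsto (fun k => ∫ x, clip ((N : ℝ) + 1) (F (ns k) x) * ψ x ∂μ) Filter.atTop
          (nhds (∫ x, H N x * ψ x ∂μ)) := by
  -- All truncation heights are handled at once on `Ω × ℕ` with geometric weights; a single
  -- extraction replaces a diagonal argument.
  set ρ : Measure ℕ := Measure.sum fun N : ℕ => ENNReal.ofReal ((1 / 2) ^ N) • Measure.dirac N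
  have hρ : IsFiniteMeasure ρ := by
    refine ⟨?_⟩
    rw [Measure.sum_apply _ .univ]
    simp only [Measure.smul_apply, measure_univ, smul_eq_mul, mul_one]
    rw [← ENNReal.ofReal_tsum_of_nonneg (fun N => by positivity) summable_geometric_two]
    exact ENNReal.ofReal_lt_top
  have hρN : ∀ N, ρ.real {N} ≠ 0 := by
    intro N
    have : ρ {N} = ENNReal.ofReal ((1 / 2) ^ N) := by
      rw [Measure.sum_apply _ (measurableSet_singleton N), tsum_eq_single N]
      · simp
      · intro M hM
        simp [hM]
    rw [measureReal_def, this, ENNReal.toReal_ofReal (by positivity)]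
    positivity
  set Φ : ℕ → Ω × ℕ → ℝ := fun n z => clip (z.2 + 1) (F n z.1) / (z.2 + 1) with hΦ
  have hΦm : ∀ n, Measurable (Φ n) := fun n => measurable_from_prod_countable_left fun N => by
    have h : Measurable fun x => clip ((N : ℝ) + 1) (F n x) / ((N : ℝ) + 1) :=
      ((continuous_clip _).measurable.comp (hF n)).div_const _
    exact h
  have hΦ1 : ∀ n z, |Φ n z| ≤ 1 := fun n z => by
    have hz : (0 : ℝ) < z.2 + 1 := by positivity
    rw [hΦ, abs_div, abs_of_pos hz, div_le_one hz]
    exact abs_clip_le hz.le _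
  obtain ⟨ns, hns, G, hG, hG1, hlim⟩ := exists_weak_limit (μ := μ.prod ρ) zero_le_one
    (fun n => (hΦm n).aestronglyMeasurable) (fun n => Filter.Eventually.of_forall (hΦ1 n))
  refine ⟨ns, hns, fun N x => (N + 1) * G (x, N), fun N => (hG.comp measurable_prodMk_right).const_mul _,
    fun N x => ?_, fun N ψ hψ => ?_⟩
  · have hN : (0 : ℝ) < N + 1 := by positivity
    rw [abs_mul, abs_of_pos hN]
    exact mul_le_of_le_one_right hN.le (hG1 _)
  · have hN : (0 : ℝ) < N + 1 := by positivity
    have hind : Integrable (fun M : ℕ => ({N} : Set ℕ).indicator (fun _ => (1 : ℝ)) M) ρ :=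
      (integrable_const 1).indicator (measurableSet_singleton N)
    have h1 := hlim _ (hψ.mul_prod hind)
    have e : ∀ A : Ω × ℕ → ℝ, Measurable A → (∀ z, |A z| ≤ 1) →
        ∫ z, A z * (ψ z.1 * ({N} : Set ℕ).indicator (fun _ => (1 : ℝ)) z.2) ∂(μ.prod ρ) =
        ρ.real {N} * ∫ x, A (x, N) * ψ x ∂μ := by
      intro A hA hA1
      have hi : Integrable (fun z : Ω × ℕ =>
          A z * (ψ z.1 * ({N} : Set ℕ).indicator (fun _ => (1 : ℝ)) z.2)) (μ.prod ρ) :=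
        (hψ.mul_prod hind).bdd_mul (c := 1) hA.aestronglyMeasurable (Filter.Eventually.of_forall hA1)
      rw [integral_prod _ hi, ← integral_const_mul]
      refine integral_congr_ae (Filter.Eventually.of_forall fun x => ?_)
      have e2 : ∀ M, A (x, M) * (ψ x * ({N} : Set ℕ).indicator (fun _ => (1 : ℝ)) M) =
          ({N} : Set ℕ).indicator (fun _ => A (x, N) * ψ x) M := fun M => by
        by_cases hM : M = N
        · subst hM; simp
        · simp [hM]
      simp only [e2]
      rw [integral_indicator_const _ (measurableSet_singleton N), smul_eq_mul]
    rw [e G hG hG1] at h1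
    simp_rw [fun k => e (Φ (ns k)) (hΦm _) (hΦ1 _)] at h1
    have h2 := h1.const_mul ((N + 1) * (ρ.real {N})⁻¹)
    have e3 : ∀ A : Ω → ℝ, (N + 1) * (ρ.real {N})⁻¹ * (ρ.real {N} * ∫ x, A x * ψ x ∂μ) =
        ∫ x, (N + 1) * A x * ψ x ∂μ := fun A => by
      simp_rw [mul_assoc (N + 1 : ℝ)]
      rw [integral_const_mul, inv_mul_cancel_left₀ (hρN N)]
    rw [e3 fun x => G (x, N)] at h2
    simp_rw [fun k => e3 fun x => Φ (ns k) (x, N)] at h2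
    refine h2.congr fun k => ?_
    refine integral_congr_ae (Filter.Eventually.of_forall fun x => ?_)
    simp only [hΦ]
    rw [mul_div_cancel₀ _ hN.ne']

/-- Weak limits of sequences bounded in `L^r`, `r > 1`, are represented by integrable functions. -/
lemma exists_integrable_of_rpow_bound [Nonempty Ω] [MeasurableSpace.CountablyGenerated Ω] {F : ℕ → Ω → ℝ}
    (hF : ∀ n, Measurable (F n)) {r : ℝ} (hr : 1 < r) {B : ENNReal} (hB : B ≠ ⊤)
    (hFB : ∀ n, ∫⁻ x, ENNReal.ofReal (|F n x| ^ r) ∂μ ≤ B) :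
    ∃ G : Ω → ℝ, Integrable G μ ∧ ∀ (ψ : Ω → ℝ) (C ℓ : ℝ), Measurable ψ → (∀ x, |ψ x| ≤ C) →
      Filter.Tendsto (fun n => ∫ x, F n x * ψ x ∂μ) Filter.atTop (nhds ℓ) →
      ℓ = ∫ x, G x * ψ x ∂μ := by
  obtain ⟨ns, hns, H, hHm, hHle, hH⟩ := exists_weak_limit_clip (μ := μ) hF
  have hpm : ∀ n, Measurable fun x => |F n x| ^ r := fun n => (hF n).abs.pow_const r
  have hpi : ∀ n, Integrable (fun x => |F n x| ^ r) μ := fun n => by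
    refine ⟨(hpm n).aestronglyMeasurable, ?_⟩
    rw [hasFiniteIntegral_iff_ofReal (Filter.Eventually.of_forall fun x => by positivity)]
    exact (hFB n).trans_lt hB.lt_top
  have hpB : ∀ n, ∫ x, |F n x| ^ r ∂μ ≤ B.toReal := fun n => by
    rw [integral_eq_lintegral_of_nonneg_ae (Filter.Eventually.of_forall fun x => by positivity)
      (hpm n).aestronglyMeasurable]
    exact ENNReal.toReal_mono hB (hFB n)
  have hFi : ∀ n, Integrable (F n) μ := fun n => by
    refine Integrable.mono' ((integrable_const (1 : ℝ)).add (hpi n)) (hF n).aestronglyMeasurable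
      (Filter.Eventually.of_forall fun x => ?_)
    simp only [Pi.add_apply]
    rcases le_total |F n x| 1 with h | h
    · exact h.trans (le_add_of_nonneg_right (by positivity))
    · exact (Real.self_le_rpow_of_one_le h hr.le).trans (le_add_of_nonneg_left zero_le_one)
  -- Uniform bound on the `L¹` mass lost by truncation at height `N + 1`. It tends to zero because
  -- `r > 1`.
  set e : ℕ → ℝ := fun N => ((N : ℝ) + 1) ^ (1 - r) * B.toReal with he
  have he0 : Filter.Tendsto e Filter.atTop (nhds 0) := by
    have h1 : Filter.Tendsto (fun x : ℝ => x ^ (-(r - 1))) Filter.atTop (nhds 0) :=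
      tendsto_rpow_neg_atTop (by linarith)
    have h2 := (h1.comp (Filter.tendsto_atTop_add_const_right _ 1
      (tendsto_natCast_atTop_atTop (R := ℝ)))).mul_const B.toReal
    rw [zero_mul] at h2
    refine h2.congr fun N => ?_
    simp [he]
  have hci : ∀ N n, Integrable (fun x => clip ((N : ℕ) + 1) (F n x)) μ := fun N n =>
    Integrable.of_bound ((continuous_clip _).measurable.comp (hF n)).aestronglyMeasurable (N + 1)
      (Filter.Eventually.of_forall fun x => abs_clip_le (by positivity) _)
  have htail : ∀ N n, ∫ x, |F n x - clip ((N : ℕ) + 1) (F n x)| ∂μ ≤ e N := fun N n => by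
    calc _ ≤ ∫ x, ((N : ℝ) + 1) ^ (1 - r) * |F n x| ^ r ∂μ :=
          integral_mono ((hFi n).sub (hci N n)).abs ((hpi n).const_mul _)
            fun x => abs_sub_clip_le_rpow (by positivity) hr _
      _ ≤ _ := by
          rw [integral_const_mul]
          exact mul_le_mul_of_nonneg_left (hpB n) (by positivity)
  have hHi : ∀ N, Integrable (H N) μ := fun N =>
    Integrable.of_bound (hHm N).aestronglyMeasurable (N + 1) (Filter.Eventually.of_forall (hHle N))
  have hmulbd : ∀ {A ψ : Ω → ℝ} {C : ℝ}, Integrable A μ → Measurable ψ → (∀ x, |ψ x| ≤ C) →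
      |∫ x, A x * ψ x ∂μ| ≤ (∫ x, |A x| ∂μ) * C := by
    intro A ψ C hA hψ hC
    rw [← integral_mul_const]
    refine norm_integral_le_of_norm_le (f := fun x => A x * ψ x) (hA.abs.mul_const C)
      (Filter.Eventually.of_forall fun x => ?_)
    rw [norm_mul]
    exact mul_le_mul_of_nonneg_left (hC x) (abs_nonneg _)
  have hmuli : ∀ {A ψ : Ω → ℝ} {C : ℝ}, Integrable A μ → Measurable ψ → (∀ x, |ψ x| ≤ C) →
      Integrable (fun x => A x * ψ x) μ := fun hA hψ hC =>
    hA.mul_bdd (c := _) hψ.aestronglyMeasurable (Filter.Eventually.of_forall hC)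
  -- the truncated limits form a Cauchy sequence
  have hcauchy : ∀ N M, N ≤ M → ∫ x, |H N x - H M x| ∂μ ≤ e N := by
    intro N M hNM
    -- Testing with the sign of the difference recovers its `L¹` norm from weak convergence.
    set ψ : Ω → ℝ := fun x => SignType.sign (H N x - H M x) with hψ
    have hψm : Measurable ψ := by
      have : ψ = fun x => if 0 < H N x - H M x then 1 else if H N x - H M x < 0 then -1 else 0 := by
        funext x; simp only [hψ, sign_apply]; split_ifs <;> simp
      rw [this]
      exact Measurable.ite (measurableSet_lt measurable_const ((hHm N).sub (hHm M))) measurable_const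
        (Measurable.ite (measurableSet_lt ((hHm N).sub (hHm M)) measurable_const) measurable_const
          measurable_const)
    have hψ1 : ∀ x, |ψ x| ≤ 1 := fun x => by
      simp only [hψ, sign_apply]; split_ifs <;> simp
    have hψi : Integrable ψ μ := Integrable.of_bound hψm.aestronglyMeasurable 1
      (Filter.Eventually.of_forall hψ1)
    have h1 := (hH N ψ hψi).sub (hH M ψ hψi)
    have h2 : (∫ x, H N x * ψ x ∂μ) - ∫ x, H M x * ψ x ∂μ = ∫ x, |H N x - H M x| ∂μ := by
      rw [← integral_sub (hmuli (hHi N) hψm hψ1) (hmuli (hHi M) hψm hψ1)]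
      refine integral_congr_ae (Filter.Eventually.of_forall fun x => ?_)
      simp only [hψ]
      rw [← sub_mul, self_mul_sign]
    rw [h2] at h1
    refine le_of_tendsto h1 (Filter.Eventually.of_forall fun k => ?_)
    rw [← integral_sub (hmuli (hci N _) hψm hψ1) (hmuli (hci M _) hψm hψ1)]
    simp_rw [← sub_mul]
    refine (le_abs_self _).trans ((hmulbd ((hci N _).sub (hci M _)) hψm hψ1).trans ?_)
    rw [mul_one]
    refine le_trans (integral_mono ((hci N _).sub (hci M _)).abs ((hpi (ns k)).const_mul
      (((N : ℝ) + 1) ^ (1 - r))) fun x => ?_) (le_trans (le_of_eq (integral_const_mul _ _))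
        (mul_le_mul_of_nonneg_left (hpB (ns k)) (by positivity)))
    have h3 := abs_sub_clip_le_rpow (c := N + 1) (by positivity) hr (clip (M + 1) (F (ns k) x))
    rw [clip_clip (by positivity) (by exact_mod_cast Nat.succ_le_succ hNM)] at h3
    simp only [Pi.sub_apply]
    rw [abs_sub_comm]
    refine h3.trans (mul_le_mul_of_nonneg_left ?_ (by positivity))
    exact Real.rpow_le_rpow (abs_nonneg _) (abs_clip_le_abs (by positivity) _) (by linarith)
  have hdist : ∀ N M, dist ((hHi N).toL1 (H N)) ((hHi M).toL1 (H M)) = ∫ x, |H N x - H M x| ∂μ := by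
    intro N M
    rw [dist_eq_norm, ← Integrable.toL1_sub, L1.norm_eq_integral_norm]
    refine integral_congr_ae ?_
    filter_upwards [((hHi N).sub (hHi M)).coeFn_toL1] with x hx
    rw [hx]; rfl
  have hmono : ∀ N M, N ≤ M → e M ≤ e N := fun N M h => by
    refine mul_le_mul_of_nonneg_right ?_ ENNReal.toReal_nonneg
    exact Real.rpow_le_rpow_of_nonpos (by positivity) (by gcongr) (by linarith)
  have hC : CauchySeq fun N => (hHi N).toL1 (H N) := by
    refine cauchySeq_of_le_tendsto_0 e (fun N M P hN hM => ?_) he0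
    rcases le_total N M with h | h
    · rw [hdist]; exact (hcauchy N M h).trans (hmono P N hN)
    · rw [dist_comm, hdist]; exact (hcauchy M N h).trans (hmono P M hM)
  obtain ⟨G, hG⟩ := cauchySeq_tendsto_of_complete hC
  refine ⟨G, L1.integrable_coeFn G, fun ψ C ℓ hψ hψC hlim => ?_⟩
  have hGH : Filter.Tendsto (fun N => ∫ x, |H N x - G x| ∂μ) Filter.atTop (nhds 0) := by
    rw [tendsto_iff_dist_tendsto_zero] at hG
    refine hG.congr fun N => ?_
    rw [dist_eq_norm, L1.norm_eq_integral_norm]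
    refine integral_congr_ae ?_
    filter_upwards [Lp.coeFn_sub ((hHi N).toL1 (H N)) G, (hHi N).coeFn_toL1] with x hx hx'
    rw [hx, Pi.sub_apply, hx', Real.norm_eq_abs]
  have h1 : ∀ N, |ℓ - ∫ x, H N x * ψ x ∂μ| ≤ e N * C := by
    intro N
    have hψi : Integrable ψ μ := Integrable.of_bound hψ.aestronglyMeasurable C
      (Filter.Eventually.of_forall hψC)
    have h2 := ((hlim.comp hns.tendsto_atTop).sub (hH N ψ hψi)).abs
    refine le_of_tendsto h2 (Filter.Eventually.of_forall fun k => ?_)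
    simp only [Function.comp_apply]
    rw [← integral_sub (hmuli (hFi _) hψ hψC) (hmuli (hci N _) hψ hψC)]
    simp_rw [← sub_mul]
    refine (hmulbd ((hFi _).sub (hci N _)) hψ hψC).trans ?_
    obtain ⟨x0⟩ := ‹Nonempty Ω›
    exact mul_le_mul_of_nonneg_right (htail N _) ((abs_nonneg _).trans (hψC x0))
  have h3 : Filter.Tendsto (fun N => ∫ x, H N x * ψ x ∂μ) Filter.atTop (nhds (∫ x, G x * ψ x ∂μ)) := by
    rw [tendsto_iff_norm_sub_tendsto_zero]
    have h4 := hGH.mul_const C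
    rw [zero_mul] at h4
    refine squeeze_zero (fun _ => norm_nonneg _) (fun N => ?_) h4
    rw [← integral_sub (hmuli (hHi N) hψ hψC) (hmuli (L1.integrable_coeFn G) hψ hψC)]
    simp_rw [← sub_mul]
    exact hmulbd ((hHi N).sub (L1.integrable_coeFn G)) hψ hψC
  have h5 : Filter.Tendsto (fun N => ∫ x, H N x * ψ x ∂μ) Filter.atTop (nhds ℓ) := by
    rw [tendsto_iff_norm_sub_tendsto_zero]
    have h4 := he0.mul_const C
    rw [zero_mul] at h4
    refine squeeze_zero (fun _ => norm_nonneg _) (fun N => ?_) h4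
    rw [norm_sub_rev]
    exact h1 N
  exact tendsto_nhds_unique h5 h3

end Truncation

/-- The gradients of the mollifications converge against smooth functions, and the bound with `r >
1` ensures that the limit is a function; for `r = 1` it could be a measure. -/
lemma exists_isWeakGrad_of_bound {f : Torus d → ℝ} (hf : Integrable f) {r : ℝ} (hr : 1 < r)
    {B : ENNReal} (hB : B ≠ ⊤)
    (h : ∀ n, ∫⁻ x, ENNReal.ofReal (‖grad (moll n f) x‖ ^ r) ≤ B) :
    ∃ G, IsWeakGrad f G := by
  have hsm := fun n => isSmooth_moll n hf
  have hex : ∀ i, ∃ G : Torus d → ℝ, Integrable G ∧ ∀ φ, IsSmoothOnTorus φ →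
      ∫ x, f x * torusPartial φ i x = - ∫ x, G x * φ x := by
    intro i
    obtain ⟨G, hG, hGφ⟩ := exists_integrable_of_rpow_bound (μ := (volume : Measure (Torus d)))
      (F := fun n x => torusPartial (moll n f) i x)
      (fun n => ((hsm n).smooth_torusPartial i).continuous.measurable) hr hB (fun n =>
        le_trans (lintegral_mono fun x => ENNReal.ofReal_le_ofReal (Real.rpow_le_rpow (abs_nonneg _)
          (abs_torusPartial_le _ i x) (by linarith))) (h n))
    refine ⟨G, hG, fun φ hφ => ?_⟩
    obtain ⟨Φ, hΦ, hΦ'⟩ := exists_test_bound hφ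
    have hlim : Filter.Tendsto (fun n => ∫ x, torusPartial (moll n f) i x * φ x) Filter.atTop
        (nhds (- ∫ x, f x * torusPartial φ i x)) := by
      have e : ∀ n, ∫ x, torusPartial (moll n f) i x * φ x =
          - ∫ x, moll n f x * torusPartial φ i x := fun n => by
        rw [integral_mul_torusPartial (hsm n) hφ, neg_neg]
      simp_rw [e]
      refine Filter.Tendsto.neg ?_
      rw [tendsto_iff_norm_sub_tendsto_zero]
      have h2 := (tendsto_integral_abs_moll_sub hf).const_mul Φ
      rw [mul_zero] at h2
      refine squeeze_zero (fun n => norm_nonneg _) (fun n => ?_) h2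
      have hmi := integrable_of_continuous (continuous_moll n hf)
      have hc := (hφ.smooth_torusPartial i).continuous
      rw [← integral_sub (Continuous.integrable_mul hmi hc) (Continuous.integrable_mul hf hc)]
      have := abs_integral_mul_le (f := torusPartial φ i)
        (Filter.Eventually.of_forall (hΦ' i)) (hmi.sub hf)
      refine le_trans (le_of_eq ?_) this
      rw [Real.norm_eq_abs]
      congr 1
      exact integral_congr_ae (Filter.Eventually.of_forall fun x => by
        simp only [Pi.sub_apply]; ring)
    rw [← hGφ φ Φ _ hφ.continuous.measurable hΦ hlim, neg_neg]
  choose G hG hGφ using hex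
  refine ⟨fun x => WithLp.toLp 2 fun i => G i x, hf, ?_, fun φ hφ i => hGφ i φ hφ⟩
  have hm : AEStronglyMeasurable (fun x => (WithLp.toLp 2 fun i => G i x : Euc d)) volume :=
    (PiLp.continuous_toLp 2 fun _ : Fin d => ℝ).comp_aestronglyMeasurable
      (aemeasurable_pi_iff.2 fun i => (hG i).1.aemeasurable).aestronglyMeasurable
  refine Integrable.mono' (integrable_finsetSum Finset.univ fun i _ => (hG i).abs) hm
    (Filter.Eventually.of_forall fun x => norm_le_sum_abs _)

/-! ### Sobolev regularity of limits of schemes -/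

variable {T β K L t : ℝ}

/-- `f` is a weak limit, at time `t`, of numerical transport schemes started from mollifications
of `u₀`. -/
def HasSchemeLimit (T β K L : ℝ) (u₀ : Torus d → ℝ) (t : ℝ) (f : Torus d → ℝ) : Prop :=
  ∃ (τ : ℕ → ℝ) (V : ℕ → ℕ → Torus d → Euc d) (a lam : ℕ → ℕ → ℝ) (ms : ℕ → ℕ),
    (∀ j, IsScheme T (τ j) β K L (V j) (a j) (lam j)) ∧
    WeakLim (fun j => approx (V j) (τ j) (moll (ms j) u₀) t) f

lemma lintegral_rpow_lt_top {X : Type*} [NormedAddCommGroup X] {g : Torus d → X} {p : ℝ}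
    (hp : 0 < p) (h : MemLp g (ENNReal.ofReal p) volume) :
    ∫⁻ x, ENNReal.ofReal (‖g x‖ ^ p) < ⊤ := by
  have h1 := lintegral_rpow_enorm_lt_top_of_eLpNorm_lt_top (by simpa using hp) ENNReal.ofReal_ne_top
    h.eLpNorm_lt_top
  rw [ENNReal.toReal_ofReal hp.le] at h1
  refine lt_of_le_of_lt (le_of_eq (lintegral_congr fun x => ?_)) h1
  rw [← ENNReal.ofReal_rpow_of_nonneg (norm_nonneg _) hp.le, ofReal_norm]

lemma eLpNorm_eq_lintegral_ofReal {X : Type*} [NormedAddCommGroup X] (g : Torus d → X) {p : ℝ}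
    (hp : 0 < p) :
    eLpNorm g (ENNReal.ofReal p) volume = (∫⁻ x, ENNReal.ofReal (‖g x‖ ^ p)) ^ (1 / p) := by
  rw [eLpNorm_eq_lintegral_rpow_enorm_toReal (by simpa using hp) ENNReal.ofReal_ne_top,
    ENNReal.toReal_ofReal hp.le]
  congr 1
  refine lintegral_congr fun x => ?_
  rw [← ENNReal.ofReal_rpow_of_nonneg (norm_nonneg _) hp.le, ofReal_norm]

lemma _root_.IsWeakGrad.congr_ae {f g : Torus d → ℝ} {G : Torus d → Euc d} (h : IsWeakGrad f G)
    (hfg : f =ᵐ[volume] g) : IsWeakGrad g G := by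
  refine ⟨h.integrable_fun.congr hfg, h.integrable_grad, fun φ hφ i => ?_⟩
  rw [← h.integral_eq φ hφ i]
  refine integral_congr_ae ?_
  filter_upwards [hfg] with x hx
  rw [hx]

lemma gagliardoPow_congr_ae {f g : Torus d → ℝ} (hfg : f =ᵐ[volume] g) (α p : ℝ) :
    gagliardoPow α p f = gagliardoPow α p g := by
  unfold gagliardoPow
  refine lintegral_congr fun h => lintegral_congr_ae ?_
  filter_upwards [hfg, (quasiMeasurePreserving_add (proj h)).ae hfg] with x hx hx'
  rw [hx]
  have : f (x + fun i => (h i : UnitAddCircle)) = g (x + fun i => (h i : UnitAddCircle)) := hx'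
  rw [this]

lemma _root_.MemSobolev.congr_ae {f g : Torus d → ℝ} {α p : ℝ} (h : MemSobolev α p f)
    (hfg : f =ᵐ[volume] g) : MemSobolev α p g := by
  refine ⟨(memLp_congr_ae hfg).1 h.1, h.2.imp (fun h => ⟨h.1, ?_⟩) fun ⟨h, G, hG, hG'⟩ =>
    ⟨h, G, hG.congr_ae hfg, hG'⟩⟩
  rw [← gagliardoPow_congr_ae hfg]
  exact h.2

/-- A Sobolev function has finite Gagliardo seminorms of orders arbitrarily close to its own. -/
lemma _root_.MemSobolev.exists_gagliardoPow_lt_top (hd : 1 ≤ d) {f : Torus d → ℝ} {α p η : ℝ}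
    (hα : 0 < α) (hp : 1 ≤ p) (h : MemSobolev α p f) (hη : η < α) :
    ∃ θ, η < θ ∧ θ ≤ α ∧ 0 < θ ∧ θ < 1 ∧ gagliardoPow θ p f < ⊤ := by
  rcases h.2 with ⟨h1, h2⟩ | ⟨rfl, G, hG, hGp⟩
  · exact ⟨α, hη, le_rfl, hα, h1, h2⟩
  · have hfin := lintegral_rpow_lt_top (by linarith) hGp
    refine ⟨(max η 0 + 1) / 2, ?_, ?_, ?_, ?_, gagliardoPow_lt_top_of_decay hd (γ := 1)
      (C := (∫⁻ x, ENNReal.ofReal (‖G x‖ ^ p)).toReal) (by linarith) ?_ fun w => ?_⟩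
    · have := le_max_left η 0; linarith
    · have := max_lt hη one_pos; linarith
    · have := le_max_right η 0; linarith
    · have := max_lt hη one_pos; linarith
    · have := max_lt hη one_pos; linarith
    · refine (lintegral_translate_le hG hp w).trans (le_of_eq ?_)
      rw [ENNReal.ofReal_mul ENNReal.toReal_nonneg, ENNReal.ofReal_toReal hfin.ne, one_mul, mul_comm]

/-- Hölder's inequality may force `q` below one, where lower semicontinuity fails. Interpolation
with the sup bound, `|r| ^ P ≤ (2M) ^ (P - q) |r| ^ q`, restores a power `P ≥ 1` before passing to
the limit, while the decay exponent stays `θ q`. -/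
lemma HasSchemeLimit.exists_increment_decay (hd : 1 ≤ d) (hL : 0 ≤ L) (hβ : 0 < β) (hK : 1 ≤ K)
    (ht : t ∈ Icc 0 T) {f u₀ : Torus d → ℝ} (h : HasSchemeLimit T β K L u₀ t f) (hf : Integrable f)
    {M : ℝ} (hM0 : 0 ≤ M) (hu₀ : Integrable u₀) (hM : ∀ᵐ x, |u₀ x| ≤ M) {θ p q s P : ℝ}
    (hθ : 0 < θ) (hp : 1 ≤ p) (hq : 0 < q) (hs : 0 < s) (hqsp : 1 / q = 1 / s + 1 / p)
    (hst : 4 * lipConst d * θ * s * t ≤ β) (hP : 1 ≤ P) (hqP : q ≤ P)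
    (hg : gagliardoPow θ p u₀ < ⊤) :
    ∃ D : ℝ, ∀ w : Euc d, ∫⁻ x, ENNReal.ofReal (|f (x + proj w) - f x| ^ P) ≤
      ENNReal.ofReal (D * ‖w‖ ^ (θ * q)) := by
  obtain ⟨τ, V, a, lam, ms, hS, hlim⟩ := h
  obtain ⟨C, hC, hinc⟩ := exists_lintegral_increment_approx_le hd hθ hp
  set A : ENNReal := (2 ^ s * (2 * ENNReal.ofReal (Real.exp (L * t + 1) * (1 + 10 ^ d * K)))) ^ (1 / s) *
    (2 ^ p * (2 * (ENNReal.ofReal (Real.exp (L * t + 1)) * gagliardoPow θ p u₀))) ^ (1 / p) with hA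
  have h2 : ∀ r : ℝ, 0 ≤ r → (2 : ENNReal) ^ r ≠ ⊤ := fun r hr =>
    ENNReal.rpow_ne_top_of_nonneg hr (by norm_num)
  have hAt : A ≠ ⊤ := by
    refine ENNReal.mul_ne_top (ENNReal.rpow_ne_top_of_nonneg (by positivity) ?_)
      (ENNReal.rpow_ne_top_of_nonneg (by positivity) ?_)
    · exact ENNReal.mul_ne_top (h2 s hs.le) (ENNReal.mul_ne_top (by norm_num) ENNReal.ofReal_ne_top)
    · exact ENNReal.mul_ne_top (h2 p (by linarith)) (ENNReal.mul_ne_top (by norm_num)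
        (ENNReal.mul_ne_top ENNReal.ofReal_ne_top hg.ne))
  refine ⟨(2 * M) ^ (P - q) * (C * A.toReal) ^ q, fun w => ?_⟩
  have hcont : ∀ j, Continuous (approx (V j) (τ j) (moll (ms j) u₀) t) := fun j =>
    (continuous_moll _ hu₀).comp (continuous_traj (hS j).smooth _)
  refine hlim.lintegral_translate_le hcont hf hP (proj w) fun j => ?_
  have hb : ∀ x, |approx (V j) (τ j) (moll (ms j) u₀) t x| ≤ M := fun x => by
    exact norm_moll_le (ms j) (f := u₀) hM _
  calc _ ≤ ∫⁻ x, ENNReal.ofReal ((2 * M) ^ (P - q)) * ENNReal.ofReal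
        (|approx (V j) (τ j) (moll (ms j) u₀) t (x + proj w) -
          approx (V j) (τ j) (moll (ms j) u₀) t x| ^ q) := by
        refine lintegral_mono fun x => ?_
        rw [← ENNReal.ofReal_mul (by positivity)]
        refine ENNReal.ofReal_le_ofReal ?_
        have h1 := abs_sub (approx (V j) (τ j) (moll (ms j) u₀) t (x + proj w))
          (approx (V j) (τ j) (moll (ms j) u₀) t x)
        have h3 := hb x
        have h4 := hb (x + proj w)
        rw [← sub_add_cancel P q, Real.rpow_add_of_nonneg (abs_nonneg _) (by linarith) hq.le,
          sub_add_cancel]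
        exact mul_le_mul_of_nonneg_right (Real.rpow_le_rpow (abs_nonneg _) (by linarith)
          (by linarith)) (by positivity)
    _ = ENNReal.ofReal ((2 * M) ^ (P - q)) * ∫⁻ x, ENNReal.ofReal
        (|approx (V j) (τ j) (moll (ms j) u₀) t (x + proj w) -
          approx (V j) (τ j) (moll (ms j) u₀) t x| ^ q) := by
        rw [lintegral_const_mul' _ _ ENNReal.ofReal_ne_top]
    _ ≤ ENNReal.ofReal ((2 * M) ^ (P - q)) * (ENNReal.ofReal (C * ‖w‖ ^ θ) * A) ^ q := by
        gcongr
        refine (hinc T (τ j) β K L (V j) (a j) (lam j) (hS j) hL hβ hK t ht q s hq hs hqsp hst _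
          (continuous_moll (ms j) hu₀) w).trans ?_
        have := gagliardoPow_moll_le (ms j) hu₀ (α := θ) hp
        rw [hA]
        gcongr
    _ = _ := by
        rw [← ENNReal.ofReal_toReal hAt, ← ENNReal.ofReal_mul (by positivity),
          ENNReal.ofReal_rpow_of_nonneg (by positivity) hq.le, ← ENNReal.ofReal_mul (by positivity),
          ENNReal.toReal_ofReal ENNReal.toReal_nonneg]
        congr 1
        rw [mul_right_comm C, Real.mul_rpow (x := C * A.toReal) (by positivity) (by positivity),
          ← Real.rpow_mul (norm_nonneg _), mul_assoc]

lemma HasSchemeLimit.memSobolev (hd : 1 ≤ d) (hL : 0 ≤ L) (hβ : 0 < β) (hK : 1 ≤ K)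
    (ht : t ∈ Icc 0 T) {f u₀ : Torus d → ℝ} (h : HasSchemeLimit T β K L u₀ t f) 
    {M : ℝ} (hM0 : 0 ≤ M) (hfm : AEStronglyMeasurable f) (hfM : ∀ x, |f x| ≤ M)
    (hu₀ : Integrable u₀) (hM : ∀ᵐ x, |u₀ x| ≤ M) {θ p q s P α : ℝ}
    (hθ : 0 < θ) (hp : 1 ≤ p) (hq : 0 < q) (hs : 0 < s) (hqsp : 1 / q = 1 / s + 1 / p)
    (hst : 4 * lipConst d * θ * s * t ≤ β) (hP : 1 ≤ P) (hqP : q ≤ P)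
    (hg : gagliardoPow θ p u₀ < ⊤) (hα : α < 1) (hαP : α * P < θ * q) :
    MemSobolev α P f := by
  have hm : ∀ r, MemLp f r volume := fun r =>
    MemLp.of_bound hfm M (Filter.Eventually.of_forall hfM)
  obtain ⟨D, hD⟩ := h.exists_increment_decay hd hL hβ hK ht (memLp_one_iff_integrable.1 (hm 1)) hM0
    hu₀ hM hθ hp hq hs hqsp hst hP hqP hg
  refine ⟨hm _, Or.inl ⟨hα, ?_⟩⟩
  refine gagliardoPow_lt_top_of_decay hd (γ := θ * q / P) (C := D) (by linarith)
    ((lt_div_iff₀ (by linarith)).2 hαP) fun w => ?_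
  rw [div_mul_cancel₀ _ (by linarith)]
  exact hD w

lemma lipConst_pos (hd : 1 ≤ d) : 0 < lipConst d := by
  unfold lipConst
  have : (0 : ℝ) < d := by exact_mod_cast hd
  positivity

/-- Fractional regularity with the exponent of integrability kept. -/
lemma HasSchemeLimit.memSobolev_loss_order (hd : 1 ≤ d) (hL : 0 ≤ L) (hβ : 0 < β) (hK : 1 ≤ K)
    (ht : t ∈ Icc 0 T) (ht0 : 0 < t) {f u₀ : Torus d → ℝ} (h : HasSchemeLimit T β K L u₀ t f)
    {M : ℝ} (hM0 : 0 ≤ M) (hfm : AEStronglyMeasurable f) (hfM : ∀ x, |f x| ≤ M)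
    (hu₀ : Integrable u₀) (hM : ∀ᵐ x, |u₀ x| ≤ M) {α p : ℝ} (hα : 0 < α) (hα1 : α ≤ 1)
    (hp : 1 ≤ p) (hu : MemSobolev α p u₀) :
    MemSobolev (α * (1 / (1 + 2 * β⁻¹ * α * p * (4 * lipConst d) * t))) p f := by
  have hc := lipConst_pos hd
  have hp0 : 0 < p := by linarith
  set A : ℝ := β⁻¹ * p * (4 * lipConst d) * t with hA
  have hA0 : 0 < A := by positivity
  have e : 2 * β⁻¹ * α * p * (4 * lipConst d) * t = 2 * A * α := by rw [hA]; ring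
  rw [e]
  have hη : α / (1 + A * α) < α := (div_lt_self hα (by nlinarith [mul_pos hA0 hα]))
  obtain ⟨θ, hθ, hθα, hθ0, hθ1, hg⟩ := hu.exists_gagliardoPow_lt_top hd hα hp hη
  have hlt : α * (1 / (1 + 2 * A * α)) < 1 := by
    rw [mul_one_div, div_lt_one (by positivity)]
    nlinarith [mul_pos hA0 hα]
  -- `s` saturates the moment condition `4 * lipConst d * θ * s * t ≤ β`, and `q` is then dictated
  -- by `1/q = 1/s + 1/p`. The resulting order `θ q / p` is `θ / (1 + A θ)`.
  refine h.memSobolev hd hL hβ hK ht hM0 hfm hfM hu₀ hM (θ := θ) (q := p / (1 + A * θ))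
    (s := p / (A * θ)) hθ0 hp (by positivity) (by positivity) ?_ ?_ hp ?_ hg hlt ?_
  · field_simp
    ring
  · rw [hA]
    apply le_of_eq
    field_simp
  · exact div_le_self hp0.le (by nlinarith [mul_pos hA0 hθ0])
  · rw [div_lt_iff₀ (by positivity)] at hθ
    -- Equivalent to `θ > α / (1 + A α)`. The factor `2` in the claimed order leaves room for `θ <
    -- 1` when `α = 1`, and for the strict gain needed by the Gagliardo integral.
    have h1 : α * (1 / (1 + 2 * A * α)) < θ / (1 + A * θ) := by
      rw [mul_one_div, div_lt_div_iff₀ (by positivity) (by positivity)]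
      nlinarith
    calc _ < θ / (1 + A * θ) * p := mul_lt_mul_of_pos_right h1 hp0
      _ = _ := by ring

/-- Fractional regularity with the order of differentiability almost kept. -/
lemma HasSchemeLimit.memSobolev_loss_integrability (hd : 1 ≤ d) (hL : 0 ≤ L) (hβ : 0 < β)
    (hK : 1 ≤ K)
    (ht : t ∈ Icc 0 T) {f u₀ : Torus d → ℝ} (h : HasSchemeLimit T β K L u₀ t f)
    {M : ℝ} (hM0 : 0 ≤ M) (hfm : AEStronglyMeasurable f) (hfM : ∀ x, |f x| ≤ M)
    (hu₀ : Integrable u₀) (hM : ∀ᵐ x, |u₀ x| ≤ M) {α p α' p' : ℝ} (hα1 : α ≤ 1)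
    (hp' : 1 ≤ p') (hpp : p' < p) (hα' : 0 < α') (hαα : α' < α)
    (htt : t < (1 / p' - 1 / p) * (β / (α * (4 * lipConst d)))) (hu : MemSobolev α p u₀) :
    MemSobolev α' p' f := by
  have hc := lipConst_pos hd
  have hp : 0 < p := by linarith
  have hα : 0 < α := by linarith
  have hs : 0 < 1 / p' - 1 / p := sub_pos.2 (one_div_lt_one_div_of_lt (by linarith) hpp)
  obtain ⟨θ, hθ, hθα, hθ0, hθ1, hg⟩ := hu.exists_gagliardoPow_lt_top hd hα (by linarith) hαα
  -- No interpolation here: the integrability is lowered to `p'`, `s` is the Hölder complement of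
  -- `p` to `p'`, and the moment condition becomes the bound on `t`.
  refine h.memSobolev hd hL hβ hK ht hM0 hfm hfM hu₀ hM (θ := θ) (q := p')
    (s := 1 / (1 / p' - 1 / p)) hθ0 (by linarith) (by linarith) (by positivity) ?_ ?_ hp' le_rfl hg
    (by linarith) (mul_lt_mul_of_pos_right hθ (by linarith))
  · rw [one_div_one_div]; ring
  · rw [← mul_div_assoc, lt_div_iff₀ (by positivity)] at htt
    have ht0 := ht.1
    rw [mul_one_div, div_mul_eq_mul_div, div_le_iff₀ hs]
    have : 4 * lipConst d * θ * t ≤ t * (α * (4 * lipConst d)) := by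
      have := mul_le_mul_of_nonneg_left hθα (mul_nonneg ht0 (mul_nonneg zero_le_four hc.le))
      nlinarith
    nlinarith

/-- Uniform bound on the gradients of the mollifications of a limit of schemes. -/
lemma HasSchemeLimit.lintegral_grad_moll_le (hL : 0 ≤ L) (hK : 1 ≤ K)
    (ht : t ∈ Icc 0 T) {f u₀ : Torus d → ℝ} (h : HasSchemeLimit T β K L u₀ t f) (hf : Integrable f)
    {g₀ : Torus d → Euc d} (hg₀ : IsWeakGrad u₀ g₀) {r s p : ℝ} (hr : 1 ≤ r) (hs : 0 < s)
    (hp : 1 ≤ p) (hrsp : 1 / r = 1 / s + 1 / p) (hst : s * t ≤ β) (n : ℕ) :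
    ∫⁻ x, ENNReal.ofReal (‖grad (moll n f) x‖ ^ r) ≤
      (ENNReal.ofReal (Real.exp (L * t + 1) * K) ^ (1 / s) *
        (ENNReal.ofReal (Real.exp (L * t + 1)) * ∫⁻ x, ENNReal.ofReal (‖g₀ x‖ ^ p)) ^ (1 / p)) ^ r := by
  obtain ⟨τ, V, a, lam, ms, hS, hlim⟩ := h
  have hsm := fun j => isSmooth_moll (ms j) hg₀.integrable_fun
  refine hlim.lintegral_grad_moll_le (fun j => smooth_comp_traj (hS j).smooth (hsm j) _) hf hr
    (fun j => ?_) n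
  refine ((hS j).lintegral_grad_approx_le hL hK ht (by linarith) hs (by linarith) hrsp hst
    (hsm j)).trans ?_
  have : ∫⁻ x, ENNReal.ofReal (‖grad (moll (ms j) u₀) x‖ ^ p) ≤ ∫⁻ x, ENNReal.ofReal (‖g₀ x‖ ^ p) := by
    simp_rw [grad_moll (ms j) hg₀]
    exact lintegral_moll_rpow_le (ms j) hg₀.integrable_grad hp
  gcongr

/-- The gradient is found in `L^r` with `r > 1` strictly, even when `p' = 1`, and then lowered to
`L^{p'}` on the probability space. -/
lemma memSobolev_one_of_grad_moll_le {f u₀ : Torus d → ℝ} (hf : ∀ r, MemLp f r volume)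
    {p p' r : ℝ} (hp : 1 ≤ p) (hp' : 0 < p') (hpr : p' ≤ r) (hr : 1 < r) {c : ENNReal} (hc : c ≠ ⊤)
    (h : ∀ g₀, IsWeakGrad u₀ g₀ → ∀ n, ∫⁻ x, ENNReal.ofReal (‖grad (moll n f) x‖ ^ r) ≤
      (c * (∫⁻ x, ENNReal.ofReal (‖g₀ x‖ ^ p)) ^ (1 / p)) ^ r)
    (hu₀ : ∃ g₀, IsWeakGrad u₀ g₀ ∧ MemLp g₀ (ENNReal.ofReal p) volume) :
    MemSobolev 1 p' f ∧ ∀ g₀ g, IsWeakGrad u₀ g₀ → IsWeakGrad f g →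
      eLpNorm g (ENNReal.ofReal p') volume ≤ c * eLpNorm g₀ (ENNReal.ofReal p) volume := by
  have key : ∀ g₀ g, IsWeakGrad u₀ g₀ → IsWeakGrad f g →
      eLpNorm g (ENNReal.ofReal p') volume ≤ c * eLpNorm g₀ (ENNReal.ofReal p) volume := by
    intro g₀ g hg₀ hg
    refine (eLpNorm_le_eLpNorm_of_exponent_le (ENNReal.ofReal_le_ofReal hpr) hg.integrable_grad.1).trans
      ?_
    rw [eLpNorm_eq_lintegral_ofReal g (hp'.trans_le hpr), eLpNorm_eq_lintegral_ofReal g₀ (by linarith)]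
    refine (ENNReal.rpow_le_rpow (lintegral_weakGrad_le hg hr.le (h g₀ hg₀)) (by positivity)).trans
      (le_of_eq ?_)
    rw [← ENNReal.rpow_mul, mul_one_div_cancel (by linarith), ENNReal.rpow_one]
  refine ⟨⟨hf _, Or.inr ⟨rfl, ?_⟩⟩, key⟩
  obtain ⟨g₀, hg₀, hg₀p⟩ := hu₀
  have hfin := (lintegral_rpow_lt_top (by linarith) hg₀p).ne
  have hB : (c * (∫⁻ x, ENNReal.ofReal (‖g₀ x‖ ^ p)) ^ (1 / p)) ^ r ≠ ⊤ :=
    ENNReal.rpow_ne_top_of_nonneg (by linarith) (ENNReal.mul_ne_top hc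
      (ENNReal.rpow_ne_top_of_nonneg (by positivity) hfin))
  obtain ⟨G, hG⟩ := exists_isWeakGrad_of_bound (memLp_one_iff_integrable.1 (hf 1)) hr hB (h g₀ hg₀)
  exact ⟨G, hG, hG.integrable_grad.1, (key g₀ G hg₀ hG).trans_lt
    (ENNReal.mul_lt_top hc.lt_top hg₀p.eLpNorm_lt_top)⟩

lemma one_le_lipConst (hd : 1 ≤ d) : 1 ≤ lipConst d := by
  unfold lipConst
  have h1 : (1 : ℝ) ≤ √d := Real.one_le_sqrt.2 (by exact_mod_cast hd)
  have h2 : (1 : ℝ) ≤ 4 ^ d := one_le_pow₀ (by norm_num)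
  nlinarith

/-- First order regularity, with loss of integrability. -/
lemma HasSchemeLimit.memSobolev_one (hd : 1 ≤ d) (hL : 0 ≤ L) (hβ : 0 < β) (hK : 1 ≤ K)
    (ht : t ∈ Icc 0 T) {f u₀ : Torus d → ℝ} (h : HasSchemeLimit T β K L u₀ t f)
    (h0 : t = 0 → u₀ =ᵐ[volume] f) (hf : ∀ r, MemLp f r volume)
    {p p' : ℝ} (hp' : 1 ≤ p') (hpp : p' < p)
    (htt : t < (1 / p' - 1 / p) * (β / (4 * lipConst d)))
    (hu₀ : ∃ g₀, IsWeakGrad u₀ g₀ ∧ MemLp g₀ (ENNReal.ofReal p) volume) :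
    MemSobolev 1 p' f ∧ ∀ g₀ g, IsWeakGrad u₀ g₀ → IsWeakGrad f g →
      eLpNorm g (ENNReal.ofReal p') volume ≤
        ENNReal.ofReal ((Real.exp (L * t) * Real.exp 1 * K) ^
          ((1 + β⁻¹ * p * (4 * lipConst d) * t) / p)) * eLpNorm g₀ (ENNReal.ofReal p) volume := by
  have hc := lipConst_pos hd
  have hp : 0 < p := by linarith
  have hK0 : 0 < K := by linarith
  have hE : 1 ≤ Real.exp (L * t) * Real.exp 1 * K := by
    have h1 := Real.one_le_exp (mul_nonneg hL ht.1)
    have h2 := Real.one_le_exp zero_le_one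
    calc (1 : ℝ) = 1 * 1 * 1 := by norm_num
      _ ≤ _ := by gcongr
  -- At time zero the Hölder exponent `s` would be infinite; there the datum itself gives the bound
  -- with `r = p`.
  rcases ht.1.eq_or_lt with h00 | ht0
  · subst h00
    refine memSobolev_one_of_grad_moll_le hf (r := p) (by linarith) (by linarith) hpp.le (by linarith)
      ENNReal.ofReal_ne_top (fun g₀ hg₀ n => ?_) hu₀
    have h1 : ∫⁻ x, ENNReal.ofReal (‖grad (moll n f) x‖ ^ p) ≤
        ∫⁻ x, ENNReal.ofReal (‖g₀ x‖ ^ p) := by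
      simp_rw [grad_moll n (hg₀.congr_ae (h0 rfl))]
      exact lintegral_moll_rpow_le n hg₀.integrable_grad (by linarith)
    rw [ENNReal.mul_rpow_of_nonneg _ _ hp.le, ← ENNReal.rpow_mul, one_div_mul_cancel hp.ne',
      ENNReal.rpow_one]
    refine h1.trans (le_mul_of_one_le_left' (ENNReal.one_le_rpow ?_ hp))
    rw [ENNReal.one_le_ofReal]
    exact Real.one_le_rpow hE (by positivity)
  · set C := 4 * lipConst d with hC
    have hC1 : 1 ≤ C := by have := one_le_lipConst hd; linarith
    have hC0 : 0 < C := by linarith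
    rw [← mul_div_assoc, lt_div_iff₀ hC0] at htt
    have h1 : t * C / β < 1 / p' - 1 / p := (div_lt_iff₀ hβ).2 htt
    have hr0 : 0 < 1 / p + t * C / β := by positivity
    have hpr : p' < 1 / (1 / p + t * C / β) := by
      rw [lt_one_div (by linarith) hr0]; linarith
    -- With `s = β / (t C)` the exponent `1/s + 1/p` is the one in the claimed constant, and the
    -- restriction on `t` says exactly `r > p'`.
    refine memSobolev_one_of_grad_moll_le hf (r := 1 / (1 / p + t * C / β)) (by linarith) (by linarith) hpr.le
      (by linarith) ENNReal.ofReal_ne_top (fun g₀ hg₀ n => ?_) hu₀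
    refine (h.lintegral_grad_moll_le hL hK ht (memLp_one_iff_integrable.1 (hf 1)) hg₀
      (s := β / (t * C)) (p := p) (by linarith) (by positivity) (by linarith) ?_ ?_ n).trans ?_
    · rw [one_div_one_div, one_div_div, add_comm]
    -- Here `s t = β / C` is below the allowed `β`: gradients need no maximal function, so the
    -- constant `C ≥ 1` of the fractional estimates is more than enough.
    · rw [div_mul_eq_mul_div, div_le_iff₀ (by positivity)]
      nlinarith [mul_le_mul_of_nonneg_left hC1 (mul_pos hβ ht0).le]
    · refine ENNReal.rpow_le_rpow ?_ (by positivity)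
      rw [Real.exp_add, ENNReal.mul_rpow_of_nonneg (ENNReal.ofReal (Real.exp (L * t) * Real.exp 1)) _
        (by positivity : 0 ≤ 1 / p), ← mul_assoc]
      refine mul_le_mul_left ?_ _
      have e : (1 + β⁻¹ * p * C * t) / p = 1 / (β / (t * C)) + 1 / p := by
        field_simp
        ring
      rw [e, ← ENNReal.ofReal_rpow_of_pos (by positivity),
        ENNReal.rpow_add_of_nonneg _ _ (by positivity) (by positivity)]
      refine mul_le_mul_right (ENNReal.rpow_le_rpow (ENNReal.ofReal_le_ofReal ?_) (by positivity)) _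
      exact le_mul_of_one_le_right (by positivity) hK

/-! ### Square integrable gradients and products with the drift -/

lemma tendsto_integral_moll_mul {f g : Torus d → ℝ} {M : ℝ} (hf : AEStronglyMeasurable f)
    (hM : ∀ᵐ x, |f x| ≤ M) (hg : Integrable g) :
    Filter.Tendsto (fun n => ∫ x, moll n f x * g x) Filter.atTop (nhds (∫ x, f x * g x)) := by
  have hfi : Integrable f := Integrable.of_bound hf M hM
  have hmi := fun n => integrable_of_continuous (continuous_moll n hfi)
  refine tendsto_integral_mul_of_bounded (fun n => (continuous_moll n hfi).aestronglyMeasurable)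
    (fun n => Filter.Eventually.of_forall fun x => norm_moll_le n (f := f) hM x) hf hM (fun ψ hψ ⟨C, hC⟩ => ?_) hg
  rw [tendsto_iff_norm_sub_tendsto_zero]
  have h2 := (tendsto_integral_abs_moll_sub hfi).const_mul C
  rw [mul_zero] at h2
  refine squeeze_zero (fun n => norm_nonneg _) (fun n => ?_) h2
  have hb := Filter.Eventually.of_forall (f := ae (volume : Measure (Torus d))) hC
  rw [← integral_sub ((hmi n).mul_bdd hψ.1 hb) (hfi.mul_bdd hψ.1 hb)]
  refine le_trans (le_of_eq ?_) (abs_integral_mul_le (f := ψ) hb ((hmi n).sub hfi))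
  rw [Real.norm_eq_abs]
  congr 1
  exact integral_congr_ae (Filter.Eventually.of_forall fun x => by ring)

lemma memLp_two_of_lintegral_le {F : Torus d → ℝ} (hF : AEStronglyMeasurable F) {B : ℝ}
    (hB : 0 ≤ B) (h : ∫⁻ x, ENNReal.ofReal (|F x| ^ (2 : ℝ)) ≤ ENNReal.ofReal B) :
    MemLp F 2 volume ∧ ∫ x, F x ^ 2 ≤ B := by
  have h1 : ∫⁻ x, ENNReal.ofReal (F x ^ 2) ≤ ENNReal.ofReal B := by
    refine le_trans (le_of_eq (lintegral_congr fun x => ?_)) h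
    rw [Real.rpow_two, sq_abs]
  have h2 : Integrable fun x => F x ^ 2 := by
    refine ⟨hF.pow 2, ?_⟩
    rw [hasFiniteIntegral_iff_ofReal (Filter.Eventually.of_forall fun x => sq_nonneg _)]
    exact h1.trans_lt ENNReal.ofReal_lt_top
  refine ⟨(memLp_two_iff_integrable_sq hF).2 h2, ?_⟩
  rw [integral_eq_lintegral_of_nonneg_ae (Filter.Eventually.of_forall fun x => sq_nonneg _) h2.1]
  exact ENNReal.toReal_le_of_le_ofReal hB h1

/-- The oscillation of a function with square integrable weak gradient at the mollification
scale. -/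
lemma integral_moll_sub_sq_le (n : ℕ) {f : Torus d → ℝ} {D : Torus d → Euc d} (hfD : IsWeakGrad f D)
    {E : ℝ} (hE : 0 ≤ E) (hD : ∫⁻ x, ENNReal.ofReal (‖D x‖ ^ (2 : ℝ)) ≤ ENNReal.ofReal E) :
    MemLp (fun x => moll n f x - f x) 2 volume ∧
      ∫ x, (moll n f x - f x) ^ 2 ≤ √d ^ (2 : ℝ) * kernelMoment d n 2 * E := by
  have hk := kernelMoment_nonneg d n 2
  refine memLp_two_of_lintegral_le
    ((continuous_moll n hfD.integrable_fun).aestronglyMeasurable.sub hfD.integrable_fun.1)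
    (by positivity) ((lintegral_moll_sub_rpow_le n hfD one_le_two).trans ?_)
  rw [ENNReal.ofReal_mul (p := √d ^ (2 : ℝ) * kernelMoment d n 2) (by positivity)]
  exact mul_le_mul_right hD _

/-- A substitute for the Poincaré inequality: a fixed mollification is bounded, and the difference
from it is controlled in `L²` by the gradient. -/
lemma memLp_two_of_isWeakGrad {f : Torus d → ℝ} {D : Torus d → Euc d} (hfD : IsWeakGrad f D)
    {E : ℝ} (hE : 0 ≤ E) (hD : ∫⁻ x, ENNReal.ofReal (‖D x‖ ^ (2 : ℝ)) ≤ ENNReal.ofReal E) :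
    MemLp f 2 volume := by
  obtain ⟨C, hC, hC'⟩ := exists_bound_of_continuous (continuous_moll 0 hfD.integrable_fun)
  have h1 : MemLp (moll 0 f) 2 volume := MemLp.of_bound
    (continuous_moll 0 hfD.integrable_fun).aestronglyMeasurable C (Filter.Eventually.of_forall hC')
  have h2 := h1.sub (integral_moll_sub_sq_le 0 hfD hE hD).1
  refine (memLp_congr_ae (Filter.Eventually.of_forall fun x => ?_)).1 h2
  simp

lemma integral_abs_mul_le_sq {f F : Torus d → ℝ} (hf : MemLp f 2 volume) (hF : MemLp F 2 volume)
    {c : ℝ} (hc : 0 < c) :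
    ∫ x, |f x * F x| ≤ c * (∫ x, f x ^ 2) + c⁻¹ * ∫ x, F x ^ 2 := by
  have h1 := hf.integrable_sq
  have h2 := hF.integrable_sq
  rw [← integral_const_mul, ← integral_const_mul, ← integral_add (h1.const_mul c) (h2.const_mul c⁻¹)]
  refine integral_mono (hf.integrable_mul hF).abs ((h1.const_mul c).add (h2.const_mul c⁻¹))
    fun x => ?_
  simp only []
  rw [abs_mul, ← sq_abs (f x), ← sq_abs (F x)]
  have h3 : 0 ≤ c * (|f x| - c⁻¹ * |F x|) ^ 2 := by positivity
  have h4 : c * (|f x| - c⁻¹ * |F x|) ^ 2 = c * |f x| ^ 2 - 2 * (|f x| * |F x|) + c⁻¹ * |F x| ^ 2 := by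
    field_simp
    ring
  have h5 : 0 ≤ |f x| * |F x| := by positivity
  linarith

/-- Applied to the drift at a fixed time, whose oscillation is controlled in `L²` uniformly in time
but whose mean is only integrable in time. The bound is therefore made linear in the `L¹` norm, to
serve as a dominating function in time. -/
lemma exists_integral_abs_mul_le (d : ℕ) {E B : ℝ} (hE : 0 ≤ E) (hB : 0 ≤ B) : ∃ C : ℝ, 0 ≤ C ∧
    ∀ (f : Torus d → ℝ) (D : Torus d → Euc d) (F : Torus d → ℝ), IsWeakGrad f D →
      ∫⁻ x, ENNReal.ofReal (‖D x‖ ^ (2 : ℝ)) ≤ ENNReal.ofReal E → MemLp F 2 volume →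
      ∫ x, F x ^ 2 ≤ B → ∫ x, |f x * F x| ≤ C * (1 + ∫ x, |f x|) := by
  obtain ⟨C, hC, hC'⟩ := exists_moll_bound d 0
  have hk := kernelMoment_nonneg d 0 2
  set A := √d ^ (2 : ℝ) * kernelMoment d 0 2 * E with hA
  have hA0 : 0 ≤ A := by positivity
  refine ⟨A + B + C * (1 + B), by positivity, fun f D F hfD hD hF hFB => ?_⟩
  obtain ⟨h1, h2⟩ := integral_moll_sub_sq_le 0 hfD hE hD
  have hf2 := memLp_two_of_isWeakGrad hfD hE hD
  have hI : 0 ≤ ∫ x, |f x| := integral_nonneg fun x => abs_nonneg _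
  have h3 := integral_abs_mul_le_sq h1 hF one_pos
  have hF1 : ∫ x, |F x| ≤ 1 + B := by
    calc _ ≤ ∫ x, (1 + F x ^ 2) := by
          refine integral_mono (hF.integrable one_le_two).abs ((integrable_const _).add hF.integrable_sq)
            fun x => ?_
          simp only []
          rw [← sq_abs]
          nlinarith [sq_nonneg (|F x| - 1), abs_nonneg (F x)]
      _ ≤ _ := by
          rw [integral_add (integrable_const _) hF.integrable_sq]
          simpa using hFB
  have h4 : ∫ x, |f x * F x| ≤ ∫ x, (|(moll 0 f x - f x) * F x| + C * (∫ y, |f y|) * |F x|) := by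
    refine integral_mono (hf2.integrable_mul hF).abs ((h1.integrable_mul hF).abs.add
      ((hF.integrable one_le_two).abs.const_mul _)) fun x => ?_
    have h5 := (hC' f hfD.integrable_fun).1 x
    simp only [abs_mul]
    rw [← add_mul]
    refine mul_le_mul_of_nonneg_right ?_ (abs_nonneg _)
    have := abs_sub_abs_le_abs_sub (f x) (moll 0 f x)
    rw [abs_sub_comm] at this
    linarith
  have h9 : Integrable fun x => |(moll 0 f x - f x) * F x| := (h1.integrable_mul hF).abs
  rw [integral_add h9 ((hF.integrable one_le_two).abs.const_mul _),
    integral_const_mul] at h4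
  have h6 : C * (∫ y, |f y|) * ∫ x, |F x| ≤ C * (∫ y, |f y|) * (1 + B) := by gcongr
  simp only [one_mul, inv_one] at h3
  have h7 : 0 ≤ (A + B) * ∫ x, |f x| := by positivity
  have h8 : 0 ≤ C * (1 + B) := by positivity
  nlinarith

/-- `f` is split into a bounded mollification, against which `L¹` convergence suffices, and a
remainder small in `L²`, against which the bound on the differences suffices. -/
lemma tendsto_integral_abs_mul_moll_sub {f : Torus d → ℝ} {D : Torus d → Euc d}
    (hfD : IsWeakGrad f D) {E : ℝ} (hE : 0 ≤ E)
    (hD : ∫⁻ x, ENNReal.ofReal (‖D x‖ ^ (2 : ℝ)) ≤ ENNReal.ofReal E) {F : Torus d → ℝ} {B : ℝ}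
    (hB : 0 ≤ B) (hF : MemLp F 2 volume) (hFB : ∀ n, ∫ x, (moll n F x - F x) ^ 2 ≤ B) :
    Filter.Tendsto (fun n => ∫ x, |f x * (moll n F x - F x)|) Filter.atTop (nhds 0) := by
  have hFi := hF.integrable one_le_two
  have hm2 : ∀ n, MemLp (moll n F) 2 volume := fun n => by
    obtain ⟨C, hC, hC'⟩ := exists_bound_of_continuous (continuous_moll n hFi)
    exact MemLp.of_bound (continuous_moll n hFi).aestronglyMeasurable C (Filter.Eventually.of_forall hC')
  have hH : ∀ n, MemLp (fun x => moll n F x - F x) 2 volume := fun n => (hm2 n).sub hF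
  have hf2 := memLp_two_of_isWeakGrad hfD hE hD
  have hk : Filter.Tendsto (fun m => √d ^ (2 : ℝ) * kernelMoment d m 2 * E) Filter.atTop (nhds 0) := by
    have := ((tendsto_kernelMoment d two_pos).const_mul (√d ^ (2 : ℝ))).mul_const E
    simpa using this
  rw [Metric.tendsto_atTop]
  intro ε hε
  -- This weight makes the term with `B` at most `ε / 3`; the mollification scale `m` is chosen
  -- afterwards to beat the factor `c` on the other term.
  set c : ℝ := 3 * (B + 1) / ε with hc
  have hc0 : 0 < c := by positivity
  obtain ⟨m, hm⟩ := (hk.eventually (gt_mem_nhds (show 0 < ε / (3 * c) by positivity))).exists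
  obtain ⟨h1, h2⟩ := integral_moll_sub_sq_le m hfD hE hD
  obtain ⟨C, hC, hC'⟩ := exists_bound_of_continuous (continuous_moll m hfD.integrable_fun)
  have h3 := (tendsto_integral_abs_moll_sub hFi).const_mul C
  rw [mul_zero] at h3
  obtain ⟨N, hN⟩ := (h3.eventually (gt_mem_nhds (show 0 < ε / 3 by positivity))).exists_forall_of_atTop
  refine ⟨N, fun n hn => ?_⟩
  rw [dist_zero_right, Real.norm_of_nonneg (integral_nonneg fun x => abs_nonneg _)]
  have h4 : ∫ x, |f x * (moll n F x - F x)| ≤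
      ∫ x, (|(moll m f x - f x) * (moll n F x - F x)| + C * |moll n F x - F x|) := by
    refine integral_mono (hf2.integrable_mul (hH n)).abs ((h1.integrable_mul (hH n)).abs.add
      (((hH n).integrable one_le_two).abs.const_mul _)) fun x => ?_
    simp only [abs_mul]
    rw [← add_mul]
    refine mul_le_mul_of_nonneg_right ?_ (abs_nonneg _)
    have := abs_sub_abs_le_abs_sub (f x) (moll m f x)
    rw [abs_sub_comm] at this
    have h5 := hC' x
    rw [Real.norm_eq_abs] at h5
    linarith
  have h9 : Integrable fun x => |(moll m f x - f x) * (moll n F x - F x)| :=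
    (h1.integrable_mul (hH n)).abs
  rw [integral_add h9 (((hH n).integrable one_le_two).abs.const_mul _),
    integral_const_mul] at h4
  have h6 := integral_abs_mul_le_sq h1 (hH n) hc0
  have h7 : c * ∫ x, (moll m f x - f x) ^ 2 < ε / 3 := by
    have := mul_lt_mul_of_pos_left (h2.trans_lt hm) hc0
    refine this.trans_le (le_of_eq ?_)
    field_simp
  have h8 : c⁻¹ * ∫ x, (moll n F x - F x) ^ 2 ≤ ε / 3 := by
    calc _ ≤ c⁻¹ * (B + 1) := by gcongr; linarith [hFB n]
      _ = _ := by rw [hc]; field_simp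
  linarith [hN n hn]

/-! ### The pairing of two solutions at a fixed time -/

section Slice

variable {b : ℝ → Torus d → Euc d} {Db : ℝ → Torus d → Fin d → Euc d}

lemma IsDrift.lintegral_sq_row_le (h : IsDrift T β K L b Db) (hβ : 0 < β) (ht : t ∈ Icc 0 T)
    (i : Fin d) :
    ∫⁻ x, ENNReal.ofReal (‖Db t x i‖ ^ (2 : ℝ)) ≤ ENNReal.ofReal (2 / β ^ 2 * K) := by
  calc _ ≤ ∫⁻ x, ENNReal.ofReal (2 / β ^ 2) *
        ENNReal.ofReal (Real.exp (β * frobNorm (Db t x))) := by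
        refine lintegral_mono fun x => ?_
        rw [← ENNReal.ofReal_mul (by positivity), Real.rpow_two]
        refine ENNReal.ofReal_le_ofReal ?_
        have h1 := norm_row_le_frobNorm (Db t x) i
        have h2 := frobNorm_nonneg (Db t x)
        have h3 := Real.quadratic_le_exp_of_nonneg (mul_nonneg hβ.le h2)
        have h4 : ‖Db t x i‖ ^ 2 ≤ frobNorm (Db t x) ^ 2 := by gcongr
        rw [div_mul_eq_mul_div, le_div_iff₀ (by positivity)]
        nlinarith [mul_nonneg hβ.le h2, mul_le_mul_of_nonneg_right h4 (sq_nonneg β)]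
    _ ≤ _ := by
        rw [lintegral_const_mul' _ _ ENNReal.ofReal_ne_top, ENNReal.ofReal_mul (by positivity)]
        exact mul_le_mul_right (h.exp_le t ht) _

lemma IsDrift.integrable_weakIntegrand_slice (h : IsDrift T β K L b Db) (ht : t ∈ Icc 0 T)
    (hφ : IsSmoothOnTorus φ) : Integrable fun x => weakIntegrand b Db φ (t, x) := by
  refine (integrable_finsetSum Finset.univ fun i _ => Continuous.integrable_mul
    (h.isWeakGrad t ht i).integrable_fun (hφ.smooth_torusPartial i).continuous).add
    (Continuous.integrable_mul ?_ hφ.continuous)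
  exact integrable_finsetSum Finset.univ fun i _ =>
    integrable_coord (h.isWeakGrad t ht i).integrable_grad i

/-- Integration by parts against a Sobolev drift. -/
lemma IsDrift.integral_mul_weakIntegrand_of_smooth (h : IsDrift T β K L b Db) (ht : t ∈ Icc 0 T)
    (hu : IsSmoothOnTorus u) (hφ : IsSmoothOnTorus φ) :
    ∫ x, u x * weakIntegrand b Db φ (t, x) = - ∑ i, ∫ x, φ x * (b t x i * torusPartial u i x) := by
  have hbi := fun i => (h.isWeakGrad t ht i).integrable_fun
  have hDi := fun i => integrable_coord (h.isWeakGrad t ht i).integrable_grad i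
  have hcu := fun i => (hu.smooth_torusPartial i).continuous
  have hcφ := fun i => (hφ.smooth_torusPartial i).continuous
  have h1 : ∀ i, Integrable fun x => φ x * (b t x i * torusPartial u i x) := fun i =>
    (Continuous.integrable_mul (hbi i) ((hcu i).mul hφ.continuous)).congr
      (Filter.Eventually.of_forall fun x => by simp only [Pi.mul_apply]; ring)
  have h2 : ∀ i, Integrable fun x => u x * (b t x i * torusPartial φ i x) := fun i =>
    (Continuous.integrable_mul (hbi i) ((hcφ i).mul hu.continuous)).congr
      (Filter.Eventually.of_forall fun x => by simp only [Pi.mul_apply]; ring)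
  have h3 : ∀ i, Integrable fun x => Db t x i i * (u x * φ x) := fun i =>
    Continuous.integrable_mul (hDi i) (hu.continuous.mul hφ.continuous)
  have key : ∀ i, (∫ x, u x * (b t x i * torusPartial φ i x)) + ∫ x, Db t x i i * (u x * φ x) =
      - ∫ x, φ x * (b t x i * torusPartial u i x) := by
    intro i
    have h4 := (h.isWeakGrad t ht i).integral_eq _ (hu.mul hφ) i
    have h5 : ∫ x, b t x i * torusPartial (fun x => u x * φ x) i x =
        (∫ x, u x * (b t x i * torusPartial φ i x)) + ∫ x, φ x * (b t x i * torusPartial u i x) := by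
      rw [← integral_add (h2 i) (h1 i)]
      refine integral_congr_ae (Filter.Eventually.of_forall fun x => ?_)
      simp only []
      rw [torusPartial_mul hu hφ]
      ring
    rw [h5] at h4
    linarith
  rw [← Finset.sum_neg_distrib]
  simp_rw [← key]
  rw [Finset.sum_add_distrib, ← integral_finsetSum _ fun i _ => h2 i,
    ← integral_finsetSum _ fun i _ => h3 i, ← integral_add (integrable_finsetSum _ fun i _ => h2 i)
      (integrable_finsetSum _ fun i _ => h3 i)]
  refine integral_congr_ae (Filter.Eventually.of_forall fun x => ?_)
  simp only [weakIntegrand, rowTrace]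
  rw [mul_add, Finset.mul_sum, Finset.sum_mul, Finset.mul_sum]
  congr 1
  exact Finset.sum_congr rfl fun i _ => by ring

variable {w : Torus d → ℝ} {G : Torus d → Euc d} {B : ℝ}

lemma memLp_two_coord (hG : Integrable G) (hB : 0 ≤ B)
    (hGB : ∫⁻ x, ENNReal.ofReal (‖G x‖ ^ (2 : ℝ)) ≤ ENNReal.ofReal B) (i : Fin d) :
    MemLp (fun x => G x i) 2 volume ∧ ∫ x, G x i ^ 2 ≤ B := by
  refine memLp_two_of_lintegral_le (integrable_coord hG i).1 hB (le_trans (lintegral_mono fun x => ?_)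
    hGB)
  exact ENNReal.ofReal_le_ofReal (Real.rpow_le_rpow (abs_nonneg _)
    (PiLp.norm_apply_le (G x) i) zero_le_two)

lemma memLp_two_moll_coord (hG : Integrable G) (hB : 0 ≤ B)
    (hGB : ∫⁻ x, ENNReal.ofReal (‖G x‖ ^ (2 : ℝ)) ≤ ENNReal.ofReal B) (n : ℕ) (i : Fin d) :
    MemLp (moll n fun x => G x i) 2 volume ∧ ∫ x, (moll n (fun x => G x i) x) ^ 2 ≤ B := by
  have h1 := memLp_two_coord (integrable_of_continuous (continuous_moll n hG)) hB
    ((lintegral_moll_rpow_le n hG one_le_two).trans hGB) i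
  have e : (fun x => moll n G x i) = moll n fun x => G x i := funext fun x => moll_apply_euc hG x i
  rw [e] at h1
  exact ⟨h1.1, by simpa only [← moll_apply_euc hG] using h1.2⟩

lemma IsDrift.tendsto_integral_mul_drift_grad (h : IsDrift T β K L b Db) (hβ : 0 < β)
    (ht : t ∈ Icc 0 T) (hG : IsWeakGrad w G) (hB : 0 ≤ B)
    (hGB : ∫⁻ x, ENNReal.ofReal (‖G x‖ ^ (2 : ℝ)) ≤ ENNReal.ofReal B) {M : ℝ}
    (hv : AEStronglyMeasurable v) (hM : ∀ᵐ x, |v x| ≤ M) (i : Fin d) :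
    Filter.Tendsto (fun n => ∫ x, v x * (b t x i * torusPartial (moll n w) i x)) Filter.atTop
      (nhds (∫ x, v x * (b t x i * G x i))) := by
  have hE : 0 ≤ 2 / β ^ 2 * K := mul_nonneg (by positivity) (zero_le_one.trans h.one_le)
  have hD := h.lintegral_sq_row_le hβ ht i
  have hb2 := memLp_two_of_isWeakGrad (h.isWeakGrad t ht i) hE hD
  obtain ⟨hG2, hG2B⟩ := memLp_two_coord hG.integrable_grad hB hGB i
  have hm := fun n => memLp_two_moll_coord hG.integrable_grad hB hGB n i
  have hbd : ∀ n, ∫ x, (moll n (fun x => G x i) x - G x i) ^ 2 ≤ 4 * B := by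
    intro n
    calc _ ≤ ∫ x, (2 * (moll n (fun x => G x i) x) ^ 2 + 2 * G x i ^ 2) := by
          refine integral_mono ((hm n).1.sub hG2).integrable_sq
            (((hm n).1.integrable_sq.const_mul 2).add (hG2.integrable_sq.const_mul 2)) fun x => ?_
          simp only []
          nlinarith [sq_nonneg (moll n (fun x => G x i) x + G x i)]
      _ ≤ _ := by
          rw [integral_add ((hm n).1.integrable_sq.const_mul 2) (hG2.integrable_sq.const_mul 2),
            integral_const_mul, integral_const_mul]
          linarith [(hm n).2]
  have h1 := (tendsto_integral_abs_mul_moll_sub (h.isWeakGrad t ht i) hE hD (by positivity) hG2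
    hbd).const_mul M
  rw [mul_zero] at h1
  rw [tendsto_iff_norm_sub_tendsto_zero]
  refine squeeze_zero (fun n => norm_nonneg _) (fun n => ?_) h1
  simp_rw [fun x => torusPartial_moll n hG i x]
  have h2 : Integrable fun x => b t x i * moll n (fun x => G x i) x := hb2.integrable_mul (hm n).1
  have h3 : Integrable fun x => b t x i * G x i := hb2.integrable_mul hG2
  have h4 : Integrable fun x => b t x i * (moll n (fun x => G x i) x - G x i) :=
    hb2.integrable_mul ((hm n).1.sub hG2)
  rw [← integral_sub (h2.bdd_mul (c := M) hv hM) (h3.bdd_mul (c := M) hv hM)]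
  refine le_trans (le_of_eq ?_) (abs_integral_mul_le hM h4)
  rw [Real.norm_eq_abs]
  congr 1
  exact integral_congr_ae (Filter.Eventually.of_forall fun x => by ring)

lemma IsDrift.integral_mul_weakIntegrand (h : IsDrift T β K L b Db) (hβ : 0 < β)
    (ht : t ∈ Icc 0 T) (hG : IsWeakGrad w G) (hB : 0 ≤ B)
    (hGB : ∫⁻ x, ENNReal.ofReal (‖G x‖ ^ (2 : ℝ)) ≤ ENNReal.ofReal B) {Φ : ℝ}
    (hw : ∀ᵐ x, |w x| ≤ Φ) (hφ : IsSmoothOnTorus φ) :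
    ∫ x, w x * weakIntegrand b Db φ (t, x) = - ∑ i, ∫ x, φ x * (b t x i * G x i) := by
  obtain ⟨C, hC, hC'⟩ := exists_bound_of_continuous hφ.continuous
  have h1 := tendsto_integral_moll_mul hG.integrable_fun.1 hw
    (h.integrable_weakIntegrand_slice ht hφ)
  have h2 := (tendsto_finsetSum Finset.univ fun i _ => h.tendsto_integral_mul_drift_grad hβ ht hG hB
    hGB hφ.continuous.aestronglyMeasurable (Filter.Eventually.of_forall hC') i).neg
  refine tendsto_nhds_unique h1 (h2.congr fun n => ?_)
  exact (h.integral_mul_weakIntegrand_of_smooth ht (isSmooth_moll n hG.integrable_fun) hφ).symm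

/-- The weak time derivative of the pairing of a mollified pair of solutions. -/
noncomputable def pairing (b : ℝ → Torus d → Euc d) (Db : ℝ → Torus d → Fin d → Euc d) (n : ℕ)
    (v w : Torus d → ℝ) (t : ℝ) : ℝ :=
  (∫ x, v x * weakIntegrand b Db (moll n w) (t, x)) +
    ∫ x, w x * weakIntegrand b Db (moll n v) (t, x)

/-- In the first term the derivative falls on the mollified `w`; in the second, integration by parts
moves it from the mollified `v` onto the weak gradient of `w`. No derivative of `v` is left, which
is why `v` may be merely bounded. -/
lemma IsDrift.pairing_eq (h : IsDrift T β K L b Db) (hβ : 0 < β)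
    (ht : t ∈ Icc 0 T) (hG : IsWeakGrad w G) (hB : 0 ≤ B)
    (hGB : ∫⁻ x, ENNReal.ofReal (‖G x‖ ^ (2 : ℝ)) ≤ ENNReal.ofReal B) {M Φ : ℝ}
    (hv : AEStronglyMeasurable v) (hM : ∀ᵐ x, |v x| ≤ M) (hw : ∀ᵐ x, |w x| ≤ Φ) (n : ℕ) :
    pairing b Db n v w t = (∑ i, ∫ x, v x * (b t x i * torusPartial (moll n w) i x)) +
      (∫ x, moll n w x * (v x * rowTrace (Db t x))) - ∑ i, ∫ x, moll n v x * (b t x i * G x i) := by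
  have hvi : Integrable v := Integrable.of_bound hv M hM
  have hsm := isSmooth_moll n hG.integrable_fun
  rw [pairing, h.integral_mul_weakIntegrand hβ ht hG hB hGB hw (isSmooth_moll n hvi), sub_eq_add_neg]
  congr 1
  have h1 : ∀ i, Integrable fun x => v x * (b t x i * torusPartial (moll n w) i x) := fun i =>
    (Continuous.integrable_mul (h.isWeakGrad t ht i).integrable_fun
      (hsm.smooth_torusPartial i).continuous).bdd_mul (c := M) hv hM
  have h2 : Integrable fun x => rowTrace (Db t x) := integrable_finsetSum Finset.univ fun i _ =>
    integrable_coord (h.isWeakGrad t ht i).integrable_grad i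
  have h3 : Integrable fun x => moll n w x * (v x * rowTrace (Db t x)) :=
    (Continuous.integrable_mul (h2.bdd_mul (c := M) hv hM) hsm.continuous).congr
      (Filter.Eventually.of_forall fun x => by ring)
  rw [← integral_finsetSum _ fun i _ => h1 i, ← integral_add (integrable_finsetSum _ fun i _ => h1 i)
    h3]
  refine integral_congr_ae (Filter.Eventually.of_forall fun x => ?_)
  simp only [weakIntegrand]
  rw [mul_add, Finset.mul_sum]
  ring

/-- The two terms with gradients have the same limit and opposite signs, so only the divergence
survives. -/
lemma IsDrift.tendsto_pairing (h : IsDrift T β K L b Db) (hβ : 0 < β)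
    (ht : t ∈ Icc 0 T) (hG : IsWeakGrad w G) (hB : 0 ≤ B)
    (hGB : ∫⁻ x, ENNReal.ofReal (‖G x‖ ^ (2 : ℝ)) ≤ ENNReal.ofReal B) {M Φ : ℝ}
    (hv : AEStronglyMeasurable v) (hM : ∀ᵐ x, |v x| ≤ M) (hw : ∀ᵐ x, |w x| ≤ Φ) :
    Filter.Tendsto (fun n => pairing b Db n v w t) Filter.atTop
      (nhds (∫ x, w x * (v x * rowTrace (Db t x)))) := by
  have hE : 0 ≤ 2 / β ^ 2 * K := mul_nonneg (by positivity) (zero_le_one.trans h.one_le)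
  have h1 := tendsto_finsetSum Finset.univ fun i _ => h.tendsto_integral_mul_drift_grad hβ ht hG hB
    hGB hv hM i
  have h2 : Integrable fun x => rowTrace (Db t x) := integrable_finsetSum Finset.univ fun i _ =>
    integrable_coord (h.isWeakGrad t ht i).integrable_grad i
  have h3 := tendsto_integral_moll_mul hG.integrable_fun.1 hw (h2.bdd_mul (c := M) hv hM)
  have h4 := tendsto_finsetSum Finset.univ fun i (_ : i ∈ Finset.univ) =>
    tendsto_integral_moll_mul hv hM (g := fun x => b t x i * G x i)
      ((memLp_two_of_isWeakGrad (h.isWeakGrad t ht i) hE (h.lintegral_sq_row_le hβ ht i)).integrable_mul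
        (memLp_two_coord hG.integrable_grad hB hGB i).1)
  have h5 := (h1.add h3).sub h4
  rw [add_sub_cancel_left] at h5
  exact h5.congr fun n => (h.pairing_eq hβ ht hG hB hGB hv hM hw n).symm

/-- Provides the domination in time, uniform in the mollification parameter, under which the limit
passes through the time integral. -/
lemma exists_abs_pairing_le (d : ℕ) {β K B M Φ L : ℝ} (hβ : 0 < β) (hK : 1 ≤ K) (hB : 0 ≤ B)
    (hM0 : 0 ≤ M) (hΦ0 : 0 ≤ Φ) : ∃ C : ℝ,
    ∀ (T : ℝ) (b : ℝ → Torus d → Euc d) (Db : ℝ → Torus d → Fin d → Euc d),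
      IsDrift T β K L b Db → ∀ t ∈ Icc 0 T, (∀ᵐ x, |rowTrace (Db t x)| ≤ L) →
      ∀ (v w : Torus d → ℝ) (G : Torus d → Euc d), IsWeakGrad w G →
        ∫⁻ x, ENNReal.ofReal (‖G x‖ ^ (2 : ℝ)) ≤ ENNReal.ofReal B → AEStronglyMeasurable v →
        (∀ᵐ x, |v x| ≤ M) → (∀ᵐ x, |w x| ≤ Φ) → ∀ n,
        |pairing b Db n v w t| ≤ C * (1 + ∑ i, ∫ x, |b t x i|) := by
  have hE : 0 ≤ 2 / β ^ 2 * K := mul_nonneg (by positivity) (zero_le_one.trans hK)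
  obtain ⟨C, hC, hC'⟩ := exists_integral_abs_mul_le d hE hB
  refine ⟨M * (2 * C * (d + 1)) + Φ * (M * |L|), fun T b Db h t ht hdiv v w G hG hGB hv hM hw n => ?_⟩
  rw [h.pairing_eq hβ ht hG hB hGB hv hM hw n]
  have hvi : Integrable v := Integrable.of_bound hv M hM
  have hI : ∀ i, 0 ≤ ∫ x, |b t x i| := fun i => integral_nonneg fun x => abs_nonneg _
  have hIs : 0 ≤ ∑ i, ∫ x, |b t x i| := Finset.sum_nonneg fun i _ => hI i
  have hb2 := fun i => memLp_two_of_isWeakGrad (h.isWeakGrad t ht i) hE (h.lintegral_sq_row_le hβ ht i)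
  have hsum : ∀ (z : Torus d → ℝ) (F : Fin d → Torus d → ℝ), (∀ᵐ x, |z x| ≤ M) →
      (∀ i, MemLp (F i) 2 volume ∧ ∫ x, F i x ^ 2 ≤ B) →
      |∑ i, ∫ x, z x * (b t x i * F i x)| ≤ M * (C * (d + ∑ i, ∫ x, |b t x i|)) := by
    intro z F hz hF
    calc _ ≤ ∑ i, |∫ x, z x * (b t x i * F i x)| := Finset.abs_sum_le_sum_abs _ _
      _ ≤ ∑ i, M * (C * (1 + ∫ x, |b t x i|)) := by
          refine Finset.sum_le_sum fun i _ => (abs_integral_mul_le hz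
            ((hb2 i).integrable_mul (hF i).1)).trans (mul_le_mul_of_nonneg_left ?_ hM0)
          exact hC' _ _ (F i) (h.isWeakGrad t ht i) (h.lintegral_sq_row_le hβ ht i) (hF i).1 (hF i).2
      _ = _ := by
          rw [← Finset.mul_sum, ← Finset.mul_sum, Finset.sum_add_distrib]
          simp
  have h1 := hsum v (fun i x => torusPartial (moll n w) i x) hM fun i => by
    have := memLp_two_moll_coord hG.integrable_grad hB hGB n i
    simp_rw [fun x => torusPartial_moll n hG i x]
    exact this
  have h2 := hsum (moll n v) (fun i x => G x i)
    (Filter.Eventually.of_forall fun x => norm_moll_le n (f := v) hM x) fun i =>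
      memLp_two_coord hG.integrable_grad hB hGB i
  have h3 : |∫ x, moll n w x * (v x * rowTrace (Db t x))| ≤ Φ * (M * |L|) := by
    have hd : Integrable fun x => rowTrace (Db t x) := integrable_finsetSum Finset.univ fun i _ =>
      integrable_coord (h.isWeakGrad t ht i).integrable_grad i
    have hvd : Integrable fun x => v x * rowTrace (Db t x) := hd.bdd_mul (c := M) hv hM
    refine (abs_integral_mul_le (M := Φ)
      (Filter.Eventually.of_forall fun x => norm_moll_le n (f := w) hw x) hvd).trans
      (mul_le_mul_of_nonneg_left ?_ hΦ0)
    calc _ ≤ ∫ x : Torus d, M * |L| := by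
          refine integral_mono_ae hvd.abs (integrable_const _) ?_
          filter_upwards [hM, hdiv] with x hx hx'
          rw [abs_mul]
          exact mul_le_mul hx (hx'.trans (le_abs_self L)) (abs_nonneg _) hM0
      _ = _ := by simp
  refine (abs_sub _ _).trans ((add_le_add (abs_add_le _ _) le_rfl).trans ?_)
  have hd0 : (0 : ℝ) ≤ d := Nat.cast_nonneg d
  have h4 : M * (C * (d + ∑ i, ∫ x, |b t x i|)) ≤ M * (C * ((d + 1) * (1 + ∑ i, ∫ x, |b t x i|))) := by
    gcongr
    nlinarith
  have h5 : 0 ≤ Φ * (M * |L|) * ∑ i, ∫ x, |b t x i| := by positivity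
  nlinarith

end Slice

/-! ### Weak solutions, time reversal and the product rule -/

lemma mul_sub_mul_eq_integral {f g f' g' : ℝ → ℝ} {δ : ℝ} (hδ : 0 ≤ δ)
    (hf' : IntervalIntegrable f' volume 0 δ) (hg' : IntervalIntegrable g' volume 0 δ)
    (hf : ∀ t ∈ Icc 0 δ, f t = f 0 + ∫ s in (0 : ℝ)..t, f' s)
    (hg : ∀ t ∈ Icc 0 δ, g t = g 0 + ∫ s in (0 : ℝ)..t, g' s) :
    IntervalIntegrable (fun s => f' s * g s + f s * g' s) volume 0 δ ∧
      f δ * g δ - f 0 * g 0 = ∫ s in (0 : ℝ)..δ, (f' s * g s + f s * g' s) := by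
  have hac : ∀ {f' : ℝ → ℝ} (c : ℝ), IntervalIntegrable f' volume 0 δ →
      AbsolutelyContinuousOnInterval (fun t => c + ∫ s in (0 : ℝ)..t, f' s) 0 δ := fun c h =>
    (LipschitzOnWith.absolutelyContinuousOnInterval (f := fun _ : ℝ => c) (K := 0)
      (LipschitzWith.const c).lipschitzOnWith).add
      (h.absolutelyContinuousOnInterval_intervalIntegral left_mem_uIcc)
  have hF := hac (f 0) hf'
  have hG := hac (g 0) hg'
  have hFf : ∀ t ∈ uIcc 0 δ, f 0 + ∫ s in (0 : ℝ)..t, f' s = f t := fun t ht =>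
    (hf t (by rwa [uIcc_of_le hδ] at ht)).symm
  have hGg : ∀ t ∈ uIcc 0 δ, g 0 + ∫ s in (0 : ℝ)..t, g' s = g t := fun t ht =>
    (hg t (by rwa [uIcc_of_le hδ] at ht)).symm
  have hcf : ContinuousOn f (uIcc 0 δ) := hF.continuousOn.congr fun t ht => (hFf t ht).symm
  have hcg : ContinuousOn g (uIcc 0 δ) := hG.continuousOn.congr fun t ht => (hGg t ht).symm
  refine ⟨(hf'.mul_continuousOn hcg).add (hg'.continuousOn_mul hcf), ?_⟩
  have h1 := hF.integral_deriv_mul_eq_sub hG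
  simp only [hFf _ right_mem_uIcc, hGg _ right_mem_uIcc, hFf _ left_mem_uIcc,
    hGg _ left_mem_uIcc] at h1
  rw [← h1]
  refine intervalIntegral.integral_congr_ae ?_
  filter_upwards [hf'.ae_hasDerivAt_integral, hg'.ae_hasDerivAt_integral] with t h2 h3 ht
  have ht' := uIoc_subset_uIcc ht
  rw [((h2 ht' 0 left_mem_uIcc).const_add (f 0)).deriv, ((h3 ht' 0 left_mem_uIcc).const_add (g 0)).deriv,
    hFf t ht', hGg t ht']

lemma kernel_sub_comm (n : ℕ) (x y : Torus d) : kernel n (x - y) = kernel n (y - x) := by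
  simp only [kernel, bump, Pi.sub_apply, circleCos_sub, mul_comm]

/-- A bounded curve of functions solving the transport equation weakly, without reference to the
initial datum. -/
structure IsWeakSolution (T M : ℝ) (b : ℝ → Torus d → Euc d) (Db : ℝ → Torus d → Fin d → Euc d)
    (u : ℝ → Torus d → ℝ) : Prop where
  aestronglyMeasurable : AEStronglyMeasurable (Function.uncurry u) (spaceTimeMeasure d T)
  aestronglyMeasurable_slice : ∀ t ∈ Icc 0 T, AEStronglyMeasurable (u t)
  bounded : ∀ t ∈ Icc 0 T, ∀ᵐ x, |u t x| ≤ M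
  eq_add : ∀ t ∈ Icc 0 T, ∀ φ, IsSmoothOnTorus φ → ∫ x, u t x * φ x =
    (∫ x, u 0 x * φ x) + ∫ s in (0 : ℝ)..t, ∫ x, u s x * weakIntegrand b Db φ (s, x)

variable {b : ℝ → Torus d → Euc d} {Db : ℝ → Torus d → Fin d → Euc d} {M : ℝ}

/-- Fubini for null sets needs a measurable set, so the bound is first established for a measurable
representative. -/
lemma ae_spaceTime_of_slices {U : ℝ → Torus d → ℝ}
    (hU : AEStronglyMeasurable (Function.uncurry U) (spaceTimeMeasure d T))
    (hM : ∀ t ∈ Icc 0 T, ∀ᵐ x, |U t x| ≤ M) : ∀ᵐ z ∂(spaceTimeMeasure d T), |U z.1 z.2| ≤ M := by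
  obtain ⟨g, hg, hUg⟩ := hU
  have h1 : ∀ᵐ z ∂(spaceTimeMeasure d T), |g z| ≤ M := by
    rw [spaceTimeMeasure, Measure.ae_prod_iff_ae_ae
      (measurableSet_le hg.measurable.abs measurable_const)]
    filter_upwards [Measure.ae_ae_of_ae_prod hUg, ae_restrict_mem measurableSet_Icc] with t ht htT
    filter_upwards [ht, hM t htT] with x hx hx'
    rw [← hx]
    exact hx'
  filter_upwards [h1, hUg] with z hz hz'
  rw [← hz'] at hz
  exact hz

lemma IsWeakSolution.integrable_slice {U : ℝ → Torus d → ℝ} (hU : IsWeakSolution T M b Db U)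
    (ht : t ∈ Icc 0 T) : Integrable (U t) :=
  Integrable.of_bound (hU.aestronglyMeasurable_slice t ht) M (hU.bounded t ht)

lemma IsWeakSolution.integrable_mul {U : ℝ → Torus d → ℝ} (hU : IsWeakSolution T M b Db U)
    {F : ℝ × Torus d → ℝ} (hF : Integrable F (spaceTimeMeasure d T)) :
    Integrable (fun z => U z.1 z.2 * F z) (spaceTimeMeasure d T) :=
  hF.bdd_mul (c := M) hU.aestronglyMeasurable
    (ae_spaceTime_of_slices hU.aestronglyMeasurable hU.bounded)

lemma intervalIntegrable_of_spaceTime (hT : 0 ≤ T) {F : ℝ × Torus d → ℝ}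
    (hF : Integrable F (spaceTimeMeasure d T)) :
    IntervalIntegrable (fun s => ∫ x, F (s, x)) volume 0 T := by
  rw [intervalIntegrable_iff_integrableOn_Icc_of_le hT]
  exact hF.integral_prod_left

lemma IsWeakSolution.intervalIntegrable {U : ℝ → Torus d → ℝ} (hU : IsWeakSolution T M b Db U)
    (h : IsDrift T β K L b Db) (hT : 0 ≤ T) (hφ : IsSmoothOnTorus φ) :
    IntervalIntegrable (fun s => ∫ x, U s x * weakIntegrand b Db φ (s, x)) volume 0 T :=
  intervalIntegrable_of_spaceTime hT (hU.integrable_mul (h.integrable_weakIntegrand_spaceTime hφ))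

lemma _root_.IsBoundedTransportSolution.isWeakSolution {u₀ : Torus d → ℝ} {U : ℝ → Torus d → ℝ}
    (hU : IsBoundedTransportSolution T b Db u₀ U) (hT : 0 ≤ T)
    (hM : ∀ t ∈ Icc 0 T, ∀ᵐ x, |U t x| ≤ M) :
    IsWeakSolution T M b Db U := by
  refine ⟨hU.aestronglyMeasurable, hU.aestronglyMeasurable_slice, hM, fun t ht φ hφ => ?_⟩
  have h0 := hU.weak_eq 0 ⟨le_rfl, hT⟩ φ hφ
  have h1 := hU.weak_eq t ht φ hφ
  rw [intervalIntegral.integral_same, sub_eq_zero] at h0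
  rw [h0, ← sub_eq_iff_eq_add']
  exact h1

lemma IsWeakSolution.sub {M' : ℝ} {U W : ℝ → Torus d → ℝ} (hU : IsWeakSolution T M b Db U)
    (hW : IsWeakSolution T M' b Db W) (h : IsDrift T β K L b Db) :
    IsWeakSolution T (M + M') b Db fun t x => U t x - W t x := by
  refine ⟨hU.aestronglyMeasurable.sub hW.aestronglyMeasurable, fun t ht =>
    (hU.aestronglyMeasurable_slice t ht).sub (hW.aestronglyMeasurable_slice t ht), fun t ht => ?_,
    fun t ht φ hφ => ?_⟩
  · filter_upwards [hU.bounded t ht, hW.bounded t ht] with x hx hx'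
    exact (abs_sub _ _).trans (add_le_add hx hx')
  · have hT : 0 ≤ T := ht.1.trans ht.2
    have e1 : ∀ s ∈ Icc 0 T, ∫ x, (U s x - W s x) * φ x = (∫ x, U s x * φ x) - ∫ x, W s x * φ x := by
      intro s hs
      simp_rw [sub_mul]
      exact integral_sub (Continuous.integrable_mul (hU.integrable_slice hs) hφ.continuous)
        (Continuous.integrable_mul (hW.integrable_slice hs) hφ.continuous)
    have e2 : ∀ s ∈ Icc 0 T, ∫ x, (U s x - W s x) * weakIntegrand b Db φ (s, x) =
        (∫ x, U s x * weakIntegrand b Db φ (s, x)) - ∫ x, W s x * weakIntegrand b Db φ (s, x) := by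
      intro s hs
      have h1 := h.integrable_weakIntegrand_slice hs hφ
      simp_rw [sub_mul]
      exact integral_sub (h1.bdd_mul (c := M) (hU.aestronglyMeasurable_slice s hs) (hU.bounded s hs))
        (h1.bdd_mul (c := M') (hW.aestronglyMeasurable_slice s hs) (hW.bounded s hs))
    have e3 : ∫ s in (0 : ℝ)..t, ∫ x, (U s x - W s x) * weakIntegrand b Db φ (s, x) =
        ∫ s in (0 : ℝ)..t, ((∫ x, U s x * weakIntegrand b Db φ (s, x)) -
          ∫ x, W s x * weakIntegrand b Db φ (s, x)) := by
      refine intervalIntegral.integral_congr fun s hs => ?_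
      rw [uIcc_of_le ht.1] at hs
      exact e2 s ⟨hs.1, hs.2.trans ht.2⟩
    have hsub : uIcc 0 t ⊆ uIcc 0 T := by
      rw [uIcc_of_le ht.1, uIcc_of_le hT]
      exact Icc_subset_Icc_right ht.2
    rw [e1 t ht, e1 0 ⟨le_rfl, hT⟩, e3, intervalIntegral.integral_sub
      ((hU.intervalIntegrable h hT hφ).mono_set hsub) ((hW.intervalIntegrable h hT hφ).mono_set hsub),
      hU.eq_add t ht φ hφ, hW.eq_add t ht φ hφ]
    ring

lemma weakIntegrand_reverse (φ : Torus d → ℝ) (r : ℝ) (x : Torus d) :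
    weakIntegrand (fun s x => - b (t - s) x) (fun s x i => - Db (t - s) x i) φ (r, x) =
      - weakIntegrand b Db φ (t - r, x) := by
  simp only [weakIntegrand, rowTrace, PiLp.neg_apply, neg_mul, Finset.sum_neg_distrib]
  ring

lemma IsWeakSolution.reverse {U : ℝ → Torus d → ℝ} (hU : IsWeakSolution T M b Db U)
    (h : IsDrift T β K L b Db) {δ : ℝ} (hδ0 : 0 ≤ δ) (htT : t ≤ T) (hδt : δ ≤ t) :
    IsWeakSolution δ M (fun s x => - b (t - s) x) (fun s x i => - Db (t - s) x i)
      fun s => U (t - s) := by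
  have hmem : ∀ s ∈ Icc 0 δ, t - s ∈ Icc 0 T := fun s hs =>
    ⟨by linarith [hs.2], by linarith [hs.1]⟩
  refine ⟨?_, fun s hs => hU.aestronglyMeasurable_slice _ (hmem s hs), fun s hs =>
    hU.bounded _ (hmem s hs), fun r hr φ hφ => ?_⟩
  · exact (hU.aestronglyMeasurable.mono_measure (restrict_prod_le_spaceTime
      (Icc_subset_Icc (by linarith) htT))).comp_measurePreserving measurePreserving_reverse
  · have hT : 0 ≤ T := by linarith
    have ht : t ∈ Icc 0 T := ⟨by linarith, htT⟩
    have hi := hU.intervalIntegrable h hT hφ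
    have hsub : ∀ s ∈ Icc 0 T, uIcc 0 s ⊆ uIcc 0 T := fun s hs => by
      rw [uIcc_of_le hs.1, uIcc_of_le hT]
      exact Icc_subset_Icc_right hs.2
    simp_rw [weakIntegrand_reverse, mul_neg, integral_neg]
    rw [intervalIntegral.integral_neg, intervalIntegral.integral_comp_sub_left
      (fun s => ∫ x, U s x * weakIntegrand b Db φ (s, x)) t, sub_zero,
      ← intervalIntegral.integral_interval_sub_left (hi.mono_set (hsub t ht))
        (hi.mono_set (hsub _ (hmem r hr))), hU.eq_add t ht φ hφ, hU.eq_add _ (hmem r hr) φ hφ]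
    ring

lemma weakIntegrand_sum {ι : Type*} [Fintype ι] {g : ι → Torus d → ℝ}
    (hg : ∀ j, IsSmoothOnTorus (g j)) (c : ι → ℝ) (z : ℝ × Torus d) :
    weakIntegrand b Db (fun x => ∑ j, c j * g j x) z = ∑ j, c j * weakIntegrand b Db (g j) z := by
  simp only [weakIntegrand]
  simp_rw [torusPartial_sum Finset.univ (fun j _ => (hg j).const_mul (c j)),
    torusPartial_const_mul (hg _), mul_add, Finset.sum_add_distrib, Finset.mul_sum]
  rw [Finset.sum_comm]
  congr 1
  · exact Finset.sum_congr rfl fun j _ => Finset.sum_congr rfl fun i _ => by ring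
  · exact Finset.sum_congr rfl fun j _ => by ring

/-- The product rule for the mollified pairing of two solutions. -/
lemma IsWeakSolution.integral_mul_moll_sub {M' : ℝ} {U W : ℝ → Torus d → ℝ}
    (hU : IsWeakSolution T M b Db U) (hW : IsWeakSolution T M' b Db W)
    (h : IsDrift T β K L b Db) (hT : 0 ≤ T) (n : ℕ) :
    IntervalIntegrable (fun s => pairing b Db n (U s) (W s) s) volume 0 T ∧
    (∫ x, U T x * moll n (W T) x) - ∫ x, U 0 x * moll n (W 0) x =
      ∫ s in (0 : ℝ)..T, pairing b Db n (U s) (W s) s := by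
  obtain ⟨ι, _, g, k, hg, hk, hgk, hmoll⟩ := exists_moll_eq_sum d n
  -- Since the kernel is even, mollification can be expanded with the two families of factors in
  -- either role. The mollified pairing becomes a finite sum of products of scalar functions of
  -- time, to which the product rule applies.
  have hmoll' : ∀ f : Torus d → ℝ, Integrable f → moll n f = fun x => ∑ j, (∫ y, f y * g j y) * k j x := by
    intro f hf
    funext x
    have e : ∀ y, kernel n (x - y) • f y = ∑ j, f y * g j y * k j x := fun y => by
      rw [kernel_sub_comm, hgk, smul_eq_mul, Finset.sum_mul]
      exact Finset.sum_congr rfl fun j _ => by ring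
    rw [moll]
    simp_rw [e]
    rw [integral_finsetSum _ fun j _ => (Continuous.integrable_mul hf (hg j).continuous).mul_const _]
    simp_rw [integral_mul_const]
  have hmoll'' : ∀ f : Torus d → ℝ, Integrable f → moll n f = fun x => ∑ j, (∫ y, f y * k j y) * g j x := by
    intro f hf
    rw [hmoll f hf]
    simp_rw [mul_comm]
  have hprod := fun j => mul_sub_mul_eq_integral hT (hU.intervalIntegrable h hT (hg j))
    (hW.intervalIntegrable h hT (hk j)) (f := fun s => ∫ x, U s x * g j x)
    (g := fun s => ∫ x, W s x * k j x) (fun t ht => hU.eq_add t ht _ (hg j))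
    (fun t ht => hW.eq_add t ht _ (hk j))
  have e1 : ∀ s ∈ Icc 0 T, ∫ x, U s x * moll n (W s) x =
      ∑ j, (∫ x, U s x * g j x) * ∫ x, W s x * k j x := by
    intro s hs
    rw [hmoll'' _ (hW.integrable_slice hs)]
    simp_rw [Finset.mul_sum]
    have hi : ∀ j, Integrable fun x => U s x * ((∫ y, W s y * k j y) * g j x) := fun j =>
      Continuous.integrable_mul (hU.integrable_slice hs) (continuous_const.mul (hg j).continuous)
    rw [integral_finsetSum _ fun j _ => hi j]
    refine Finset.sum_congr rfl fun j _ => ?_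
    rw [← integral_mul_const]
    exact integral_congr_ae (Filter.Eventually.of_forall fun x => by ring)
  have e2 : ∀ s ∈ Icc 0 T, pairing b Db n (U s) (W s) s =
      ∑ j, ((∫ x, U s x * weakIntegrand b Db (g j) (s, x)) * (∫ x, W s x * k j x) +
        (∫ x, U s x * g j x) * ∫ x, W s x * weakIntegrand b Db (k j) (s, x)) := by
    intro s hs
    rw [pairing, hmoll'' _ (hW.integrable_slice hs), hmoll' _ (hU.integrable_slice hs)]
    simp_rw [weakIntegrand_sum hg, weakIntegrand_sum hk, Finset.mul_sum]
    rw [integral_finsetSum, integral_finsetSum, ← Finset.sum_add_distrib]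
    · refine Finset.sum_congr rfl fun j _ => ?_
      rw [← integral_mul_const, ← integral_const_mul]
      congr 1
      · exact integral_congr_ae (Filter.Eventually.of_forall fun x => by ring)
      · exact integral_congr_ae (Filter.Eventually.of_forall fun x => by ring)
    · exact fun j _ => ((h.integrable_weakIntegrand_slice hs (hk j)).const_mul _).bdd_mul (c := M')
        (hW.aestronglyMeasurable_slice s hs) (hW.bounded s hs)
    · exact fun j _ => ((h.integrable_weakIntegrand_slice hs (hg j)).const_mul _).bdd_mul (c := M)
        (hU.aestronglyMeasurable_slice s hs) (hU.bounded s hs)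
  have e3 : EqOn (fun s => ∑ j, ((∫ x, U s x * weakIntegrand b Db (g j) (s, x)) *
      (∫ x, W s x * k j x) + (∫ x, U s x * g j x) * ∫ x, W s x * weakIntegrand b Db (k j) (s, x)))
      (fun s => pairing b Db n (U s) (W s) s) (uIcc 0 T) := fun s hs => by
    rw [uIcc_of_le hT] at hs
    exact (e2 s hs).symm
  constructor
  · refine IntervalIntegrable.congr (fun s hs => e3 (uIoc_subset_uIcc hs)) ?_
    have := IntervalIntegrable.sum Finset.univ fun j _ => (hprod j).1
    simpa only [Finset.sum_fn] using this
  · rw [← intervalIntegral.integral_congr e3, intervalIntegral.integral_finsetSum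
      fun j _ => (hprod j).1, e1 T ⟨hT, le_rfl⟩, e1 0 ⟨le_rfl, hT⟩, ← Finset.sum_sub_distrib]
    exact Finset.sum_congr rfl fun j _ => (hprod j).2

lemma _root_.IsBoundedTransportSolution.ae_eq_initial {u₀ : Torus d → ℝ} {U : ℝ → Torus d → ℝ}
    (hU : IsBoundedTransportSolution T b Db u₀ U) (hT : 0 ≤ T) (hu₀ : Integrable u₀) :
    U 0 =ᵐ[volume] u₀ := by
  obtain ⟨κ, _, H, hH, hsep⟩ := exists_countable_separating d
  have h0 : (0 : ℝ) ∈ Icc 0 T := ⟨le_rfl, hT⟩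
  obtain ⟨M, hM⟩ := hU.bounded
  have hi : Integrable (U 0) := Integrable.of_bound (hU.aestronglyMeasurable_slice 0 h0) M (hM 0 h0)
  have h1 := hsep _ (hi.sub hu₀) fun j => by
    have h2 := hU.weak_eq 0 h0 _ (hH j)
    rw [intervalIntegral.integral_same] at h2
    simp_rw [Pi.sub_apply, sub_mul]
    rw [integral_sub (Continuous.integrable_mul hi (hH j).continuous)
      (Continuous.integrable_mul hu₀ (hH j).continuous), h2]
  filter_upwards [h1] with x hx
  exact sub_eq_zero.1 hx

/-- Duality: a solution vanishing at the final time pairs with solutions which are Sobolev functions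
of the space variable. -/
lemma IsWeakSolution.abs_integral_mul_le {δ M' B c : ℝ} {U W : ℝ → Torus d → ℝ}
    (hU : IsWeakSolution δ M b Db U) (hW : IsWeakSolution δ M' b Db W)
    (h : IsDrift δ β K L b Db) (hβ : 0 < β) (hL : 0 ≤ L) (hδ : 0 ≤ δ) (hM0 : 0 ≤ M) (hM'0 : 0 ≤ M')
    (hB : 0 ≤ B)
    (hG : ∀ s ∈ Icc 0 δ, ∃ G, IsWeakGrad (W s) G ∧
      ∫⁻ x, ENNReal.ofReal (‖G x‖ ^ (2 : ℝ)) ≤ ENNReal.ofReal B)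
    (hc : ∀ s ∈ Icc 0 δ, ∫ x, |U s x| ≤ c) (hend : U δ =ᵐ[volume] 0) :
    |∫ x, U 0 x * W 0 x| ≤ M' * (L * c) * δ := by
  have hprod := hU.integral_mul_moll_sub hW h hδ
  have h0 : (0 : ℝ) ∈ Icc 0 δ := ⟨le_rfl, hδ⟩
  have hdiv : ∀ᵐ s ∂(volume : Measure ℝ), s ∈ Icc 0 δ → ∀ᵐ x, |rowTrace (Db s x)| ≤ L := by
    have := Measure.ae_ae_of_ae_prod h.div_le
    rwa [ae_restrict_iff' measurableSet_Icc] at this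
  have hIoc : ∀ {s : ℝ}, s ∈ uIoc 0 δ → s ∈ Icc 0 δ := fun hs => by
    rw [uIoc_of_le hδ] at hs
    exact ⟨hs.1.le, hs.2⟩
  obtain ⟨C, hC⟩ := exists_abs_pairing_le d (M := M) (Φ := M') (L := L) hβ h.one_le hB hM0 hM'0
  -- The same sequence is evaluated twice: by dominated convergence in time it tends to the
  -- divergence term, and by the product rule to minus the initial pairing.
  have hlim : Filter.Tendsto (fun n => ∫ s in (0 : ℝ)..δ, pairing b Db n (U s) (W s) s) Filter.atTop
      (nhds (∫ s in (0 : ℝ)..δ, ∫ x, W s x * (U s x * rowTrace (Db s x)))) := by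
    refine intervalIntegral.tendsto_integral_filter_of_dominated_convergence
      (fun s => C * (1 + ∑ i, ∫ x, |b s x i|))
      (Filter.Eventually.of_forall fun n => (hprod n).1.def'.1) (Filter.Eventually.of_forall fun n => ?_)
      ?_ ?_
    · filter_upwards [hdiv] with s hs hsδ
      obtain ⟨G, hG1, hG2⟩ := hG s (hIoc hsδ)
      exact hC δ b Db h s (hIoc hsδ) (hs (hIoc hsδ)) _ _ G hG1 hG2
        (hU.aestronglyMeasurable_slice s (hIoc hsδ)) (hU.bounded s (hIoc hsδ))
        (hW.bounded s (hIoc hsδ)) n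
    · have hi : ∀ i, IntervalIntegrable (fun s => ∫ x, |b s x i|) volume 0 δ := fun i =>
        intervalIntegrable_of_spaceTime hδ (F := fun z => |b z.1 z.2 i|)
          (h.integrable_coord_prod le_rfl i).abs
      have := IntervalIntegrable.sum Finset.univ fun i (_ : i ∈ Finset.univ) => hi i
      rw [Finset.sum_fn] at this
      exact (intervalIntegrable_const.add this).const_mul C
    · refine Filter.Eventually.of_forall fun s hs => ?_
      obtain ⟨G, hG1, hG2⟩ := hG s (hIoc hs)
      exact h.tendsto_pairing hβ (hIoc hs) hG1 hB hG2 (hU.aestronglyMeasurable_slice s (hIoc hs))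
        (hU.bounded s (hIoc hs)) (hW.bounded s (hIoc hs))
  have hlim' : Filter.Tendsto (fun n => ∫ s in (0 : ℝ)..δ, pairing b Db n (U s) (W s) s) Filter.atTop
      (nhds (-∫ x, W 0 x * U 0 x)) := by
    refine (tendsto_integral_moll_mul (hW.aestronglyMeasurable_slice 0 h0) (hW.bounded 0 h0)
      (hU.integrable_slice h0)).neg.congr fun n => ?_
    rw [← (hprod n).2]
    have e : ∫ x, U δ x * moll n (W δ) x = 0 := by
      refine integral_eq_zero_of_ae ?_
      filter_upwards [hend] with x hx
      rw [hx, Pi.zero_apply, zero_mul]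
    simp_rw [e, zero_sub, mul_comm]
  have e := tendsto_nhds_unique hlim' hlim
  simp_rw [mul_comm (U 0 _)]
  rw [← abs_neg, e]
  have := intervalIntegral.norm_integral_le_of_norm_le_const_ae (a := 0) (b := δ) (C := M' * (L * c))
    (f := fun s => ∫ x, W s x * (U s x * rowTrace (Db s x))) ?_
  · rwa [sub_zero, abs_of_nonneg hδ] at this
  filter_upwards [hdiv] with s hs hsδ
  have hsδ := hIoc hsδ
  have hUd : Integrable fun x => U s x * rowTrace (Db s x) :=
    Integrable.bdd_mul (c := M) (integrable_finsetSum Finset.univ fun i _ =>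
      integrable_coord (h.isWeakGrad s hsδ i).integrable_grad i)
      (hU.aestronglyMeasurable_slice s hsδ) (hU.bounded s hsδ)
  refine (TorusTransport.abs_integral_mul_le (hW.bounded s hsδ) hUd).trans
    (mul_le_mul_of_nonneg_left ?_ hM'0)
  calc _ ≤ ∫ x, L * |U s x| := by
        refine integral_mono_ae hUd.abs ((hU.integrable_slice hsδ).abs.const_mul L) ?_
        filter_upwards [hs hsδ] with x hx
        rw [abs_mul, mul_comm]
        exact mul_le_mul_of_nonneg_right hx (abs_nonneg _)
    _ ≤ _ := by
        rw [integral_const_mul]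
        exact mul_le_mul_of_nonneg_left (hc s hsδ) hL

/-- For smooth data and short times, solutions with square integrable gradients exist. -/
lemma IsDrift.exists_sobolev_solution {δ Φ : ℝ} (h : IsDrift δ β K L b Db) (hβ : 0 < β) (hL : 0 ≤ L)
    (hδ : 0 < δ) (hδβ : 4 * δ ≤ β) (hφ : IsSmoothOnTorus φ) (hΦ0 : 0 ≤ Φ) (hΦ : ∀ x, |φ x| ≤ Φ) :
    ∃ W : ℝ → Torus d → ℝ, IsWeakSolution δ Φ b Db W ∧ W 0 =ᵐ[volume] φ ∧ ∃ B : ℝ, 0 ≤ B ∧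
      ∀ s ∈ Icc 0 δ, ∃ G, IsWeakGrad (W s) G ∧
        ∫⁻ x, ENNReal.ofReal (‖G x‖ ^ (2 : ℝ)) ≤ ENNReal.ofReal B := by
  obtain ⟨W, hW, hWΦ, τ, V, a, lam, hS, hlim⟩ := h.exists_solution hδ hβ hL hΦ0
    hφ.continuous.aestronglyMeasurable (Filter.Eventually.of_forall hΦ)
  have hWs := hW.isWeakSolution hδ.le fun t ht => Filter.Eventually.of_forall (hWΦ t ht)
  obtain ⟨C, hC, hC'⟩ := exists_bound_of_continuous (isSmoothField_grad hφ).continuous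
  -- Hölder's inequality with `1/2 = 1/4 + 1/4`: the fourth moment of the stretching factor requires
  -- `4 δ ≤ β`, and the gradient of a smooth datum is bounded.
  have h4 : ∫⁻ x, ENNReal.ofReal (‖grad φ x‖ ^ (4 : ℝ)) ≤ ENNReal.ofReal (C ^ (4 : ℝ)) := by
    calc _ ≤ ∫⁻ x : Torus d, ENNReal.ofReal (C ^ (4 : ℝ)) := lintegral_mono fun x =>
          ENNReal.ofReal_le_ofReal (Real.rpow_le_rpow (norm_nonneg _) (hC' x) (by norm_num))
      _ = _ := by simp
  set B : ENNReal := (ENNReal.ofReal (Real.exp (L * δ + 1) * K) ^ (1 / 4 : ℝ) *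
    (ENNReal.ofReal (Real.exp (L * δ + 1)) * ENNReal.ofReal (C ^ (4 : ℝ))) ^ (1 / 4 : ℝ)) ^ (2 : ℝ)
    with hB
  have hBt : B ≠ ⊤ := by
    refine ENNReal.rpow_ne_top_of_nonneg zero_le_two (ENNReal.mul_ne_top ?_ ?_)
    · exact ENNReal.rpow_ne_top_of_nonneg (by norm_num) ENNReal.ofReal_ne_top
    · exact ENNReal.rpow_ne_top_of_nonneg (by norm_num)
        (ENNReal.mul_ne_top ENNReal.ofReal_ne_top ENNReal.ofReal_ne_top)
  refine ⟨W, hWs, hW.ae_eq_initial hδ.le (integrable_of_continuous hφ.continuous), B.toReal,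
    ENNReal.toReal_nonneg, fun s hs => ?_⟩
  obtain ⟨ks, hks⟩ := hlim s hs
  have hK0 : 0 ≤ K := zero_le_one.trans h.one_le
  have hb : ∀ n, ∫⁻ x, ENNReal.ofReal (‖grad (moll n (W s)) x‖ ^ (2 : ℝ)) ≤ B := fun n => by
    refine (HasSchemeLimit.lintegral_grad_moll_le (β := β) (s := 4) (p := 4) hL h.one_le hs
      ⟨_, _, _, _, ks, fun j => hS (ks j), hks⟩ (hWs.integrable_slice hs) (isWeakGrad_grad hφ)
      one_le_two (by norm_num) (by norm_num) (by norm_num) (by linarith [hs.2]) n).trans ?_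
    have hs2 := hs.2
    rw [hB]
    gcongr
  obtain ⟨G, hG⟩ := exists_isWeakGrad_of_bound (hWs.integrable_slice hs) one_lt_two hBt hb
  refine ⟨G, hG, ?_⟩
  rw [ENNReal.ofReal_toReal hBt]
  exact lintegral_weakGrad_le hG one_le_two hb

/-- Duality with a mollified sign of the initial slice as datum of `W`: its sup norm is at most one,
and removing the mollification recovers the `L¹` norm. -/
lemma IsWeakSolution.integral_abs_le {δ c : ℝ} {U : ℝ → Torus d → ℝ}
    (hU : IsWeakSolution δ M b Db U) (h : IsDrift δ β K L b Db) (hβ : 0 < β) (hL : 0 ≤ L)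
    (hδ : 0 < δ) (hδβ : 4 * δ ≤ β) (hM0 : 0 ≤ M)
    (hc : ∀ s ∈ Icc 0 δ, ∫ x, |U s x| ≤ c) (hend : U δ =ᵐ[volume] 0) :
    ∫ x, |U 0 x| ≤ L * c * δ := by
  have h0 : (0 : ℝ) ∈ Icc 0 δ := ⟨le_rfl, hδ.le⟩
  have hUi := hU.integrable_slice h0
  set σ : Torus d → ℝ := fun x => SignType.sign (U 0 x) with hσ
  have hσm : AEStronglyMeasurable σ := by
    obtain ⟨g, hg, hUg⟩ := hU.aestronglyMeasurable_slice 0 h0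
    have e : (fun x => (SignType.sign (g x) : ℝ)) =
        fun x => if 0 < g x then 1 else if g x < 0 then -1 else 0 := by
      funext x; simp only [sign_apply]; split_ifs <;> simp
    have hm : Measurable fun x => (SignType.sign (g x) : ℝ) := by
      rw [e]
      exact Measurable.ite (measurableSet_lt measurable_const hg.measurable) measurable_const
        (Measurable.ite (measurableSet_lt hg.measurable measurable_const) measurable_const
          measurable_const)
    refine ⟨_, hm.stronglyMeasurable, ?_⟩
    filter_upwards [hUg] with x hx
    simp only [hσ, hx]
  have hσ1 : ∀ x, |σ x| ≤ 1 := fun x => by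
    simp only [hσ, sign_apply]; split_ifs <;> simp
  have hσi : Integrable σ := Integrable.of_bound hσm 1 (Filter.Eventually.of_forall hσ1)
  have hlim := tendsto_integral_moll_mul hσm (Filter.Eventually.of_forall hσ1) hUi
  have e : ∫ x, σ x * U 0 x = ∫ x, |U 0 x| :=
    integral_congr_ae (Filter.Eventually.of_forall fun x => sign_mul_self _)
  rw [e] at hlim
  refine le_of_tendsto hlim (Filter.Eventually.of_forall fun n => ?_)
  obtain ⟨W, hW, hW0, B, hB, hG⟩ := h.exists_sobolev_solution hβ hL hδ hδβ (isSmooth_moll n hσi)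
    zero_le_one fun x => norm_moll_le n (f := σ) (Filter.Eventually.of_forall hσ1) x
  have h1 := hU.abs_integral_mul_le hW h hβ hL hδ.le hM0 zero_le_one hB hG hc hend
  rw [one_mul] at h1
  refine le_trans (le_of_eq ?_) ((le_abs_self _).trans h1)
  refine integral_congr_ae ?_
  filter_upwards [hW0] with x hx
  rw [hx, mul_comm]

/-- Uniqueness on a short time interval. -/
lemma IsWeakSolution.ae_eq_zero_of_short {U : ℝ → Torus d → ℝ} (hU : IsWeakSolution T M b Db U)
    (h : IsDrift T β K L b Db) (hβ : 0 < β) (hL : 0 ≤ L) (hM0 : 0 ≤ M) {t₀ t₁ : ℝ} (ht₀ : 0 ≤ t₀)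
    (ht₁ : t₁ ≤ T) (hβt : 4 * (t₁ - t₀) ≤ β) (hLt : L * (t₁ - t₀) ≤ 1 / 2)
    (h0 : U t₀ =ᵐ[volume] 0) : ∀ t ∈ Icc t₀ t₁, U t =ᵐ[volume] 0 := by
  -- Time reversal at `t` turns vanishing at `t₀` into vanishing at the final time. Each use of the
  -- duality bound multiplies the supremum over the interval by at most `L (t₁ - t₀) ≤ 1/2`.
  have key : ∀ k : ℕ, ∀ t ∈ Icc t₀ t₁, ∫ x, |U t x| ≤ M * (1 / 2) ^ k := by
    intro k
    induction k with
    | zero =>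
      intro t ht
      have ht' : t ∈ Icc 0 T := ⟨ht₀.trans ht.1, ht.2.trans ht₁⟩
      calc _ ≤ ∫ x : Torus d, M := integral_mono_ae (hU.integrable_slice ht').abs
            (integrable_const _) (hU.bounded t ht')
        _ = _ := by simp
    | succ k ih =>
      intro t ht
      rcases ht.1.eq_or_lt with rfl | htt
      · have : ∫ x, |U t₀ x| = 0 := by
          refine integral_eq_zero_of_ae ?_
          filter_upwards [h0] with x hx
          rw [hx, Pi.zero_apply, abs_zero]
        rw [this]
        positivity
      · have ht2 := ht.2
        have htT : t ≤ T := ht2.trans ht₁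
        have h1 := (hU.reverse h (δ := t - t₀) (by linarith) htT (by linarith)).integral_abs_le
          (h.reverse htT (by linarith)) hβ hL (by linarith) (by linarith) hM0
          (c := M * (1 / 2) ^ k) (fun s hs => ih _ ⟨by linarith [hs.2], by linarith [hs.1]⟩)
          (by simpa using h0)
        simp only [sub_zero] at h1
        refine h1.trans ?_
        have h2 : L * (t - t₀) ≤ 1 / 2 :=
          (mul_le_mul_of_nonneg_left (by linarith) hL).trans hLt
        have h3 : 0 ≤ M * (1 / 2) ^ k := by positivity
        rw [pow_succ]
        nlinarith
  intro t ht
  have ht' : t ∈ Icc 0 T := ⟨ht₀.trans ht.1, ht.2.trans ht₁⟩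
  have h1 : ∫ x, |U t x| ≤ 0 := by
    have h2 := (tendsto_pow_atTop_nhds_zero_of_lt_one (r := (1 / 2 : ℝ)) (by norm_num)
      (by norm_num)).const_mul M
    rw [mul_zero] at h2
    exact ge_of_tendsto h2 (Filter.Eventually.of_forall fun k => key k t ht)
  have h2 := (integral_eq_zero_iff_of_nonneg (fun x => abs_nonneg _) (hU.integrable_slice ht').abs).1
    (le_antisymm h1 (integral_nonneg fun x => abs_nonneg _))
  filter_upwards [h2] with x hx
  exact abs_eq_zero.1 hx

lemma IsWeakSolution.ae_eq_zero {U : ℝ → Torus d → ℝ} (hU : IsWeakSolution T M b Db U)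
    (h : IsDrift T β K L b Db) (hβ : 0 < β) (hL : 0 ≤ L) (hM0 : 0 ≤ M)
    (h0 : U 0 =ᵐ[volume] 0) : ∀ t ∈ Icc 0 T, U t =ᵐ[volume] 0 := by
  -- A step length depending only on `β` and `L`, so finitely many short intervals reach any time.
  set δ : ℝ := min (β / 4) (1 / (2 * (L + 1))) with hδ
  have hδ0 : 0 < δ := lt_min (by positivity) (by positivity)
  have hδ1 : 4 * δ ≤ β := by have := min_le_left (β / 4) (1 / (2 * (L + 1))); linarith
  have hδ2 : L * δ ≤ 1 / 2 := by
    have h1 := min_le_right (β / 4) (1 / (2 * (L + 1)))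
    calc L * δ ≤ (L + 1) * (1 / (2 * (L + 1))) :=
          mul_le_mul (by linarith) h1 hδ0.le (by linarith)
      _ = 1 / 2 := by field_simp
  have key : ∀ k : ℕ, ∀ t ∈ Icc 0 T, t ≤ k * δ → U t =ᵐ[volume] 0 := by
    intro k
    induction k with
    | zero =>
      intro t ht htk
      have : t = 0 := le_antisymm (by simpa using htk) ht.1
      rw [this]; exact h0
    | succ k ih =>
      intro t ht htk
      rcases le_total t (k * δ) with h1 | h1
      · exact ih t ht h1
      · push_cast at htk
        have hle : t - k * δ ≤ δ := by linarith
        have hk0 : 0 ≤ k * δ := by positivity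
        exact hU.ae_eq_zero_of_short h hβ hL hM0 (t₀ := k * δ) (t₁ := t) hk0 ht.2 (by linarith)
          ((mul_le_mul_of_nonneg_left hle hL).trans hδ2)
          (ih _ ⟨hk0, h1.trans ht.2⟩ le_rfl) t ⟨h1, le_rfl⟩
  intro t ht
  obtain ⟨k, hk⟩ := exists_nat_ge (t / δ)
  exact key k t ht ((div_le_iff₀ hδ0).1 hk)

/-- Bounded solutions of the transport equation are determined by their initial datum. -/
lemma IsDrift.solution_unique {u₀ : Torus d → ℝ} {U W : ℝ → Torus d → ℝ}
    (h : IsDrift T β K L b Db) (hT : 0 ≤ T) (hβ : 0 < β) (hL : 0 ≤ L) (hu₀ : Integrable u₀)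
    (hU : IsBoundedTransportSolution T b Db u₀ U) (hW : IsBoundedTransportSolution T b Db u₀ W) :
    ∀ t ∈ Icc 0 T, U t =ᵐ[volume] W t := by
  obtain ⟨M, hM⟩ := hU.bounded
  obtain ⟨M', hM'⟩ := hW.bounded
  have h1 := hU.isWeakSolution (M := max M 0) hT fun t ht => by
    filter_upwards [hM t ht] with x hx
    exact hx.trans (le_max_left _ _)
  have h2 := hW.isWeakSolution (M := max M' 0) hT fun t ht => by
    filter_upwards [hM' t ht] with x hx
    exact hx.trans (le_max_left _ _)
  have h3 := (h1.sub h2 h).ae_eq_zero h hβ hL (by positivity) (by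
    filter_upwards [hU.ae_eq_initial hT hu₀, hW.ae_eq_initial hT hu₀] with x hx hx'
    simp [hx, hx'])
  intro t ht
  filter_upwards [h3 t ht] with x hx
  exact sub_eq_zero.1 hx

end TorusTransport

/-! ### The regularity and well-posedness statement -/

theorem corollary1p3 (d : ℕ) (hd : 1 ≤ d) :
    ∃ C₁ : ℝ, 0 < C₁ ∧ ∃ C₂ : ℝ, 2 < C₂ ∧ ∃ M : ℝ → ℝ,
      ∀ (T β K L : ℝ), 0 < T → 0 < β → 0 ≤ L →
      ∀ (b : ℝ → UnitAddTorus (Fin d) → EuclideanSpace ℝ (Fin d))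
        (Db : ℝ → UnitAddTorus (Fin d) → Fin d → EuclideanSpace ℝ (Fin d)),
      IsExpDrift T β K L b Db →
      ∀ (α p : ℝ), 0 < α → α ≤ 1 → 1 ≤ p →
      ∀ u₀ : UnitAddTorus (Fin d) → ℝ, MemLp u₀ ⊤ volume → MemSobolev α p u₀ →
      ∃ u : ℝ → UnitAddTorus (Fin d) → ℝ,
        IsBoundedTransportSolution T b Db u₀ u ∧
        (∀ v : ℝ → UnitAddTorus (Fin d) → ℝ, IsBoundedTransportSolution T b Db u₀ v →
          ∀ t ∈ Icc 0 T, v t =ᵐ[volume] u t) ∧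
        (∀ t ∈ Icc 0 T, MemSobolev (α * (1 / (1 + 2 * β⁻¹ * α * p * C₁ * t))) p (u t)) ∧
        (∀ p' α' : ℝ, 1 ≤ p' → p' < p → 0 < α' → α' < α →
          ∀ t ∈ Icc 0 T, t < (1 / p' - 1 / p) * (β / (α * C₁)) → MemSobolev α' p' (u t)) ∧
        (α = 1 → ∀ p' : ℝ, 1 ≤ p' → p' < p →
          ∀ t ∈ Icc 0 T, t < (1 / p' - 1 / p) * (β / C₁) →
            MemSobolev 1 p' (u t) ∧
            ∀ g₀ g : UnitAddTorus (Fin d) → EuclideanSpace ℝ (Fin d),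
              IsWeakGrad u₀ g₀ → IsWeakGrad (u t) g →
              eLpNorm g (ENNReal.ofReal p') volume ≤
                ENNReal.ofReal
                    (M p * (Real.exp (L * t) * C₂ * K) ^ ((1 + β⁻¹ * p * C₁ * t) / p)) *
                  eLpNorm g₀ (ENNReal.ofReal p) volume) := by
  have hc := TorusTransport.lipConst_pos hd
  -- The `4` collects the loss to the maximal function and the splitting of two-point exponentials.
  -- `C₂ = e` pays for the total discretisation error of the compression rates, kept at most one,
  -- and no further constant is needed, so `C_{d,p}` is `1`.
  refine ⟨4 * TorusTransport.lipConst d, by positivity, Real.exp 1,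
    by linarith [Real.exp_one_gt_d9], fun _ => 1, ?_⟩
  intro T β K L hT hβ hL b Db hexp α p hα hα1 hp u₀ hu₀ hS₀
  have h := hexp.isDrift hT hβ hL
  have hK := h.one_le
  have hu₀i : Integrable u₀ := memLp_one_iff_integrable.1 (hu₀.mono_exponent le_top)
  obtain ⟨M, hM0, hM⟩ : ∃ M : ℝ, 0 ≤ M ∧ ∀ᵐ x, |u₀ x| ≤ M := by
    refine ⟨(eLpNorm u₀ ⊤ volume).toReal, ENNReal.toReal_nonneg, ?_⟩
    filter_upwards [ae_le_eLpNormEssSup (f := u₀) (μ := volume)] with x hx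
    rw [← eLpNorm_exponent_top] at hx
    have := ENNReal.toReal_mono hu₀.eLpNorm_ne_top hx
    rwa [toReal_enorm, Real.norm_eq_abs] at this
  obtain ⟨u, hu, huM, τ, V, a, lam, hS, hlim⟩ := h.exists_solution hT hβ hL hM0 hu₀.1 hM
  have hlim' : ∀ t ∈ Icc 0 T, TorusTransport.HasSchemeLimit T β K L u₀ t (u t) := fun t ht => by
    obtain ⟨ks, hks⟩ := hlim t ht
    exact ⟨_, _, _, _, ks, fun j => hS (ks j), hks⟩
  have h0 : u₀ =ᵐ[volume] u 0 := (hu.ae_eq_initial hT.le hu₀i).symm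
  have hum := hu.aestronglyMeasurable_slice
  refine ⟨u, hu, fun v hv t ht => h.solution_unique hT.le hβ hL hu₀i hv hu t ht, fun t ht => ?_,
    fun p' α' hp' hpp hα' hαα t ht htt => ?_, fun hα1' p' hp' hpp t ht htt => ?_⟩
  · rcases ht.1.eq_or_lt with rfl | ht0
    · have e : α * (1 / (1 + 2 * β⁻¹ * α * p * (4 * TorusTransport.lipConst d) * 0)) = α := by simp
      rw [e]
      exact hS₀.congr_ae h0
    · exact (hlim' t ht).memSobolev_loss_order hd hL hβ hK ht ht0 hM0 (hum t ht) (huM t ht) hu₀i hM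
        hα hα1 hp hS₀
  · exact (hlim' t ht).memSobolev_loss_integrability hd hL hβ hK ht hM0 (hum t ht) (huM t ht) hu₀i hM
      hα1 hp' hpp hα' hαα htt hS₀
  · subst hα1'
    simp only [one_mul]
    refine (hlim' t ht).memSobolev_one hd hL hβ hK ht (fun h => h ▸ h0) (fun r =>
      MemLp.of_bound (hum t ht) M (Filter.Eventually.of_forall (huM t ht))) hp' hpp htt ?_
    rcases hS₀.2 with h1 | h1
    · exact absurd h1.1 (lt_irrefl 1)
    · exact h1.2
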